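/- **Setting.** A group generator samples, for a security parameter $\lambda$, a cyclic group $\mathbb G=\langle G\rangle$ whose order is a $\lambda$-bit prime $p$, with efficiently computable addition. $\mathsf{Hash}$ is a random oracle with values in $\{0,1\}^\lambda$; $\mathsf{PRF}_s(j)\in\mathbb Z_p$ is instantiated by a second random oracle, evaluated at $(s,j)$. Algorithms are probabilistic polynomial-time (PPT) in $\lambda$. **Scheme.** There are $n\ge 1$ cards $IC_1,\dots,IC_n$. Card $IC_i$ holds a uniform secret key $x_i\in\mathbb Z_p$ and a uniform key $s_i\in\{0,1\}^\lambda$; the shared public key is $Y=\sum_i Y_i$ with $Y_i=x_i\cdot G$. *Caching phase:* on index $j$, $IC_i$ returns $R_{i,j}=r_{i,j}\cdot G$, where $r_{i,j}=\mathsf{PRF}_{s_i}(j)$; the host adds these up to $R_j$. *Signing phase:* on a request $(R_j,\mathsf{Hash}(m),j)$ of the host with an index $j$ not used before, $IC_i$ returns $\epsilon_j=\mathsf{Hash}(R_j\|\mathsf{Hash}(m)\|j)$ and $\sigma_{i,j}=r_{i,j}-x_i\epsilon_j \bmod p$; the signature on $m$ is $(j,\sigma_j,\epsilon_j)$ with $\sigma_j=\sum_i\sigma_{i,j}$.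 A signature $(j,\sigma,\epsilon)$ on $m$ is valid if $\epsilon=\mathsf{Hash}(R\|\mathsf{Hash}(m)\|j)$, where $R=\sigma\cdot G+\epsilon\cdot Y$. **Forger.** A forger $\mathcal F$ is a PPT algorithm that receives the group, $Y$, $Y_1,\dots,Y_n$ and the keys $x_2,\dots,x_n$ of the corrupted cards, has access to the random oracles, and acts as the host towards the honest card $IC_1$: adaptively and in any order it makes caching requests for the indices $1,\dots,q_S$ and signing requests, at most one accepted per index, with arbitrary $R$ and arbitrary digests. It wins if it outputs a message $m$ and a valid signature on $m$ such that $m$ was not used in a signing session. (The host announces a message in each session; if the digest sent is not the hash of the announced message, then all messages with that digest also count as used.) $\mathcal F$ is a $(q_S,q_H,\epsilon)$-forger if it makes at most $q_H=q_H(\lambda)$ queries to $\mathsf{Hash}$ and wins with probability at least $\epsilon=\epsilon(\lambda)\ge 0$. **One-more discrete logarithms.** In the $N$-DL problem, an algorithm gets $(p,G)$ and the group, an oracle $O_{ch}$ returning uniformly random challenges in $\mathbb G$, and an oracle $O_{dlog}$ returning the discrete logarithm to the base $G$ of any group element. It wins if it obtains $N$ challenges $C_1,\dots,C_N$ and outputs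 $c_1,\dots,c_N$ with $C_l=c_l\cdot G$ for all $l$, after strictly fewer than $N$ queries to $O_{dlog}$. **Theorem.** Let $n\ge 1$ and let $q_S$ be a constant. If there is a $(q_S,q_H,\epsilon)$-forger for the multi-signature scheme above, then there are a PPT algorithm $\mathcal A$ and a negligible function $\mathrm{negl}$ such that $\mathcal A$ solves the $(q_S+1)$-DL problem, for each security parameter $\lambda\ge 2$, with probability at least $$\frac{\epsilon(\lambda)^2}{q_H(\lambda)^{\,q_S+1}}-\mathrm{negl}(\lambda).$$ (The bound has content only where $q_H(\lambda)\ge 1$.) -/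

import Mathlib

/-! ## Probabilistic oracle algorithms with a step count -/

/-- The data of the machine model: binary trees whose leaves are natural numbers. -/
inductive Val : Type
  | num (n : ℕ)
  | pair (a b : Val)
  deriving DecidableEq

namespace Val

/-- Length of a description of a value (numbers are written in binary). -/
def size : Val → ℕ
  | num n => 1 + Nat.size n
  | pair a b => 1 + a.size + b.size

/-- A list of values as one value. -/
def ofList : List Val → Val
  | [] => num 0
  | a :: l => pair a (ofList l)

end Val

/-- Arithmetic operations of the machine (truncated subtraction, rounded division). -/
inductive ArithOp : Type
  | add | sub | mul | div | mod

/-- Meaning of the arithmetic operations. -/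
def ArithOp.eval : ArithOp → ℕ → ℕ → ℕ
  | add, a, b => a + b
  | sub, a, b => a - b
  | mul, a, b => a * b
  | div, a, b => a / b
  | mod, a, b => a % b

/-- Programs with oracles named by `O`. A program takes a value and produces a value. -/
inductive Code (O : Type) : Type
  | skip
  | const (n : ℕ)
  | fst
  | snd
  | isPair
  | equal
  | arith (o : ArithOp)
  | rand
  | call (o : O)
  | pair (f g : Code O)
  /-- first `f`, then `g` -/
  | seq (f g : Code O)
  /-- test whether the value of `c` differs from the number `0` -/
  | ite (c f g : Code O)
  /-- while the value of `c` differs from the number `0`, apply `f` -/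
  | loop (c f : Code O)

/-- Interaction trees: a computation returns a result, asks an oracle, or draws a uniform
number below `n`. -/
inductive Comp (O : Type) (α : Type) : Type
  | ret (a : α)
  | query (o : O) (v : Val) (k : Val → Comp O α)
  | draw (n : ℕ) (k : ℕ → Comp O α)

namespace Comp

/-- Sequential composition. -/
def bind {O α β : Type} : Comp O α → (α → Comp O β) → Comp O β
  | ret a, f => f a
  | query o v k, f => query o v fun w => (k w).bind f
  | draw n k, f => draw n fun c => (k c).bind f

/-- `P` holds for every result that can occur, whatever is drawn and answered. -/
def Always {O α : Type} (P : α → Prop) : Comp O α → Prop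
  | ret a => P a
  | query _ _ k => ∀ w, (k w).Always P
  | draw n k => ∀ c < max n 1, (k c).Always P

/-- At most `N` rounds of a while loop. The second components are numbers of steps. -/
def whileLoop {O : Type} (c f : Val → Comp O (Val × ℕ)) : ℕ → Val → Comp O (Val × ℕ)
  | 0, v => ret (v, 1)
  | N + 1, v => (c v).bind fun b =>
      if b.1 = Val.num 0 then ret (v, b.2 + 1)
      else (f v).bind fun w => (whileLoop c f N w.1).bind fun u =>
        ret (u.1, b.2 + w.2 + u.2 + 1)

end Comp

/-- Execution of a program: the result together with the number of steps. An elementary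
instruction costs one step plus the length of its argument, and an oracle call costs the length
of the answer in addition. Loops are cut off after `N` rounds; a cut-off costs more than `N`
steps, so a run which takes at most `N` steps is a genuine, complete run of the program. -/
def Code.run {O : Type} (N : ℕ) : Code O → Val → Comp O (Val × ℕ)
  | .skip, v => .ret (v, 1 + v.size)
  | .const n, v => .ret (.num n, 1 + v.size)
  | .fst, v => .ret (match v with | .pair a _ => a | .num _ => .num 0, 1 + v.size)
  | .snd, v => .ret (match v with | .pair _ b => b | .num _ => .num 0, 1 + v.size)
  | .isPair, v => .ret (match v with | .pair _ _ => .num 1 | .num _ => .num 0, 1 + v.size)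
  | .equal, v => .ret (match v with
      | .pair a b => if a = b then .num 1 else .num 0
      | .num _ => .num 0, 1 + v.size)
  | .arith o, v => .ret (match v with
      | .pair (.num a) (.num b) => .num (o.eval a b)
      | _ => .num 0, 1 + v.size)
  | .rand, v => match v with
      | .num n => .draw n fun c => .ret (.num c, 1 + v.size)
      | .pair _ _ => .ret (.num 0, 1 + v.size)
  | .call o, v => .query o v fun w => .ret (w, 1 + v.size + w.size)
  | .pair f g, v => (f.run N v).bind fun a => (g.run N v).bind fun b =>
      .ret (.pair a.1 b.1, a.2 + b.2 + 1)
  | .seq f g, v => (f.run N v).bind fun a => (g.run N a.1).bind fun b =>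
      .ret (b.1, a.2 + b.2 + 1)
  | .ite c f g, v => (c.run N v).bind fun b =>
      (if b.1 = .num 0 then g.run N v else f.run N v).bind fun a => .ret (a.1, b.2 + a.2 + 1)
  | .loop c f, v => Comp.whileLoop (c.run N) (f.run N) N v

noncomputable section

/-- The uniform distribution on `{0, …, n - 1}` (and the constant `0` if `n = 0`). -/
def unif (n : ℕ) : PMF ℕ :=
  if h : 0 < n then PMF.uniformOfFinset (Finset.range n) (Finset.nonempty_range_iff.mpr h.ne')
  else PMF.pure 0

/-- `k` independent uniform numbers below `n`. -/
def unifList (n : ℕ) : ℕ → PMF (List ℕ)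
  | 0 => PMF.pure []
  | k + 1 => (unif n).bind fun a => (unifList n k).bind fun l => PMF.pure (a :: l)

/-- Run a computation against oracles that share a state of type `σ`. -/
def Comp.exec {O α σ : Type} (h : O → σ → Val → PMF (Val × σ)) : Comp O α → σ → PMF (α × σ)
  | .ret a, s => PMF.pure (a, s)
  | .query o v k, s => (h o s v).bind fun r => (k r.1).exec h r.2
  | .draw n k, s => (unif n).bind fun c => (k c).exec h s

/-- A random function into `{0, …, n - 1}`, sampled lazily: `tbl` holds the values fixed so far. -/
def askRandom (n : ℕ) (tbl : Val → Option ℕ) (v : Val) : PMF (ℕ × (Val → Option ℕ)) :=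
  match tbl v with
  | some c => PMF.pure (c, tbl)
  | none => (unif n).bind fun c => PMF.pure (c, Function.update tbl v (some c))

/-! ## Group generators -/

/-- A group generator: for every security parameter `k ≥ 2` (there is no `k`-bit prime for
smaller `k`) a distribution on instances. An instance is a cyclic group of `k`-bit prime order
with a generator `base`. Group elements and the group have descriptions of polynomial length, and
group elements are added by a polynomial-time program. No use is made of how instances are
sampled, so `gen` may be any distribution. -/
structure GroupGen where
  Inst : Type
  El : Inst → Type
  [grp : ∀ i, AddCommGroup (El i)]
  order : Inst → ℕ
  base : ∀ i, El i
  descr : Inst → Val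
  enc : ∀ i, El i → Val
  gen : ℕ → PMF Inst
  addCode : Code Empty
  bound : Polynomial ℕ
  order_prime : ∀ k, 2 ≤ k → ∀ i ∈ (gen k).support, (order i).Prime
  order_size : ∀ k, 2 ≤ k → ∀ i ∈ (gen k).support, Nat.size (order i) = k
  card_eq : ∀ k, 2 ≤ k → ∀ i ∈ (gen k).support, Nat.card (El i) = order i
  base_generates : ∀ k, 2 ≤ k → ∀ i ∈ (gen k).support, ∀ x : El i, ∃ c : ℕ, x = c • base i
  enc_injective : ∀ k, 2 ≤ k → ∀ i ∈ (gen k).support, Function.Injective (enc i)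
  descr_size : ∀ k, 2 ≤ k → ∀ i ∈ (gen k).support, (descr i).size ≤ bound.eval k
  enc_size : ∀ k, 2 ≤ k → ∀ i ∈ (gen k).support, ∀ x, (enc i x).size ≤ bound.eval k
  addCode_spec : ∀ k, 2 ≤ k → ∀ i ∈ (gen k).support, ∀ x y : El i,
    (addCode.run (bound.eval k) (.pair (descr i) (.pair (enc i x) (enc i y)))).Always
      fun r => r.1 = enc i (x + y) ∧ r.2 ≤ bound.eval k

attribute [instance] GroupGen.grp

namespace GroupGen

variable (𝒢 : GroupGen)

/-- The public description `(k, p, group, G)` of an instance. -/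
def inst (k : ℕ) (i : 𝒢.Inst) : Val :=
  .pair (.num k) (.pair (.num (𝒢.order i)) (.pair (𝒢.descr i) (𝒢.enc i (𝒢.base i))))

/-- The encoding of `c • G`. -/
def point (i : 𝒢.Inst) (c : ℕ) : Val := 𝒢.enc i (c • 𝒢.base i)

open Classical in
/-- The discrete logarithm of an encoded group element, in `{0, …, p - 1}` (and `0` if the value
is not the encoding of a group element). -/
def dlog (i : 𝒢.Inst) (v : Val) : ℕ :=
  if h : ∃ c, c < 𝒢.order i ∧ 𝒢.point i c = v then h.choose else 0

end GroupGen

/-! ## The one-more discrete logarithm problem -/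

/-- The challenge oracle and the discrete logarithm oracle. -/
inductive DLOracle : Type
  | challenge
  | dlog

/-- State of the experiment: the logarithms of the challenges returned so far, in the order in
which they were returned, and the number of queries to the discrete logarithm oracle. -/
structure DLState where
  challenges : List ℕ
  dlogQueries : ℕ

/-- The oracles of the one-more discrete logarithm problem. -/
def dlOracle (𝒢 : GroupGen) (i : 𝒢.Inst) :
    DLOracle → DLState → Val → PMF (Val × DLState)
  | .challenge, st, _ => (unif (𝒢.order i)).bind fun c =>
      PMF.pure (𝒢.point i c, { st with challenges := st.challenges ++ [c] })
  | .dlog, st, v =>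
      PMF.pure (.num (𝒢.dlog i v), { st with dlogQueries := st.dlogQueries + 1 })

/-- `out` is a list of numbers `c₁, …, c_N` with `cₗ • G` the `l`-th challenge. -/
def SolvesDL (𝒢 : GroupGen) (i : 𝒢.Inst) (challenges : List ℕ) (out : Val) : Prop :=
  ∃ cs : List ℕ, out = Val.ofList (cs.map Val.num) ∧
    cs.map (𝒢.point i) = challenges.map (𝒢.point i)

open Classical in
/-- The `N`-DL experiment for `A` (loops cut off after `T` rounds): whether `A` wins, and how many
steps it takes. It wins if it obtains `N` challenges, returns all their discrete logarithms, and
makes fewer than `N` queries to the discrete logarithm oracle. -/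
def dlGame (𝒢 : GroupGen) (N : ℕ) (A : Code DLOracle) (T k : ℕ) : PMF (Bool × ℕ) :=
  (𝒢.gen k).bind fun i =>
    ((A.run T (𝒢.inst k i)).exec (dlOracle 𝒢 i) ⟨[], 0⟩).bind fun r =>
      PMF.pure (decide (r.2.challenges.length = N ∧ r.2.dlogQueries < N ∧
        SolvesDL 𝒢 i r.2.challenges r.1.1), r.1.2)

/-- `A` solves the `N`-DL problem in probabilistic polynomial time, with probability at least
`δ k` for each security parameter `k`. -/
def SolvesOneMoreDL (𝒢 : GroupGen) (N : ℕ) (A : Code DLOracle) (δ : ℕ → ℝ) : Prop :=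
  ∃ T : Polynomial ℕ, ∀ k, 2 ≤ k →
    (∀ o ∈ (dlGame 𝒢 N A (T.eval k) k).support, o.2 ≤ T.eval k) ∧
    δ k ≤ (((dlGame 𝒢 N A (T.eval k) k).map Prod.fst) true).toReal

/-! ## The multi-signature scheme and its security experiment -/

/-- What the forger may call: the random oracle `hash`, the random oracle `prf` that instantiates
the pseudorandom function, and the caching and the signing phase of the honest card. -/
inductive ForgerOracle : Type
  | hash
  | prf
  | cache
  | sign

/-- An accepted signing session: the round index, the message announced by the host, and the
digest that the host sent. -/
structure Session where
  index : ℕ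
  msg : Val
  digest : Val

/-- State of the experiment. -/
structure ForgerState where
  hashTbl : Val → Option ℕ
  prfTbl : Val → Option ℕ
  sessions : List Session
  /-- number of hash queries made by the forger -/
  hashQueries : ℕ

/-- The input `R || h || j` of the hash function. -/
def hashInput (R h j : Val) : Val := .pair R (.pair h j)

/-- The honest card's nonce `r_j = PRF_s(j)`, an element of `ℤ_p`. -/
def nonce (p s j : ℕ) (st : ForgerState) : PMF (ℕ × ForgerState) :=
  (askRandom p st.prfTbl (.pair (.num s) (.num j))).bind fun r =>
    PMF.pure (r.1, { st with prfTbl := r.2 })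

/-- The hash function, with values in `{0,1}^k` read as numbers. -/
def hashOf (k : ℕ) (v : Val) (st : ForgerState) : PMF (ℕ × ForgerState) :=
  (askRandom (2 ^ k) st.hashTbl v).bind fun r => PMF.pure (r.1, { st with hashTbl := r.2 })

/-- The signature share `(σ, ε)` of the card with secret key `x` and PRF key `s`:
`ε = Hash(R || h || j)` and `σ = r_j - x ε mod p`. -/
def sigShare (k p x s : ℕ) (R h : Val) (j : ℕ) (st : ForgerState) :
    PMF ((ℕ × ℕ) × ForgerState) :=
  (hashOf k (hashInput R h (.num j)) st).bind fun e =>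
    (nonce p s j e.2).bind fun r =>
      PMF.pure ((((r.1 : ZMod p) - (x : ZMod p) * (e.1 : ZMod p)).val, e.1), r.2)

/-- The oracles of the forger. The honest card has secret key `x` and PRF key `s`. Round indices
are `1, …, qS`.
* `cache` on `j` returns `R_j = r_j • G`.
* `sign` on `(m, R, h, j)`: the card receives `(R, h, j)` from the host, checks that `j` has not
  been used, and returns its signature share. The message `m` that the host announces (with
  `h = Hash(m)` if the host is honest) is only recorded.
Requests that are not accepted are answered by the number `0`. -/
def forgerOracle (𝒢 : GroupGen) (k : ℕ) (i : 𝒢.Inst) (qS x s : ℕ) :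
    ForgerOracle → ForgerState → Val → PMF (Val × ForgerState)
  | .hash, st, v => (hashOf k v st).bind fun e =>
      PMF.pure (.num e.1, { e.2 with hashQueries := e.2.hashQueries + 1 })
  | .prf, st, v => (askRandom (𝒢.order i) st.prfTbl v).bind fun r =>
      PMF.pure (.num r.1, { st with prfTbl := r.2 })
  | .cache, st, v => match v with
      | .num j =>
          if 1 ≤ j ∧ j ≤ qS then
            (nonce (𝒢.order i) s j st).bind fun r => PMF.pure (𝒢.point i r.1, r.2)
          else PMF.pure (.num 0, st)
      | _ => PMF.pure (.num 0, st)
  | .sign, st, v => match v with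
      | .pair m (.pair R (.pair h (.num j))) =>
          if 1 ≤ j ∧ j ≤ qS ∧ j ∉ st.sessions.map Session.index then
            (sigShare k (𝒢.order i) x s R h j st).bind fun r =>
              PMF.pure (.pair (.num r.1.1) (.num r.1.2),
                { r.2 with sessions := ⟨j, m, h⟩ :: r.2.sessions })
          else PMF.pure (.num 0, st)
      | _ => PMF.pure (.num 0, st)

/-- Verification of the signature `(j, σ, ε)` on `m` under the shared key `Y`:
`ε = Hash(R || Hash(m) || j)` where `R = σ • G + ε • Y`. -/
def verify (𝒢 : GroupGen) (k : ℕ) (i : 𝒢.Inst) (Y : 𝒢.El i) (m j : Val) (σ ε : ℕ)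
    (st : ForgerState) : PMF (Bool × ForgerState) :=
  (hashOf k m st).bind fun h =>
    (hashOf k (hashInput (𝒢.enc i (σ • 𝒢.base i + ε • Y)) (.num h.1) j) h.2).bind fun e =>
      PMF.pure (decide (ε = e.1), e.2)

/-- Whether `m` is not the message of any of the given sessions. The message of a session is the
announced one if the digest sent was its hash; otherwise all preimages of the digest (and the
announced message) count as signed. -/
def isNew (k : ℕ) (m : Val) : List Session → ForgerState → PMF (Bool × ForgerState)
  | [], st => PMF.pure (true, st)
  | t :: l, st =>
      (hashOf k m st).bind fun h => (hashOf k t.msg h.2).bind fun h' =>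
        if m = t.msg ∨ (.num h'.1 ≠ t.digest ∧ .num h.1 = t.digest) then
          PMF.pure (false, h'.2)
        else isNew k m l h'.2

/-- Whether the output `(m, (j, (σ, ε)))` of the forger is a forgery. -/
def isForgery (𝒢 : GroupGen) (k : ℕ) (i : 𝒢.Inst) (Y : 𝒢.El i) (out : Val)
    (st : ForgerState) : PMF Bool :=
  match out with
  | .pair m (.pair j (.pair (.num σ) (.num ε))) =>
      (verify 𝒢 k i Y m j σ ε st).bind fun a =>
        (isNew k m st.sessions a.2).bind fun b => PMF.pure (a.1 && b.1)
  | _ => PMF.pure false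

/-- Result of the security experiment. -/
structure Outcome where
  win : Bool
  time : ℕ
  hashQueries : ℕ

/-- The input of the forger: the instance, the shared public key `Y`, the shares `Y_1, …, Y_n`
of it, and the secret keys `x_2, …, x_n` of the corrupted cards. -/
def forgerInput (𝒢 : GroupGen) (k : ℕ) (i : 𝒢.Inst) (x : ℕ) (xs : List ℕ) : Val :=
  .pair (𝒢.inst k i) (.pair (𝒢.enc i ((x :: xs).map fun c => c • 𝒢.base i).sum)
    (.pair (Val.ofList ((x :: xs).map (𝒢.point i))) (Val.ofList (xs.map .num))))

/-- The security experiment of the multi-signature scheme with `n` cards, of which all but the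
first are corrupted, for the forger `F` (loops cut off after `T` rounds). -/
def forgeryGame (𝒢 : GroupGen) (n qS : ℕ) (F : Code ForgerOracle) (T k : ℕ) : PMF Outcome :=
  (𝒢.gen k).bind fun i =>
    (unif (𝒢.order i)).bind fun x =>
      (unifList (𝒢.order i) (n - 1)).bind fun xs =>
        (unif (2 ^ k)).bind fun s =>
          ((F.run T (forgerInput 𝒢 k i x xs)).exec (forgerOracle 𝒢 k i qS x s)
            ⟨fun _ => none, fun _ => none, [], 0⟩).bind fun r =>
              (isForgery 𝒢 k i ((x :: xs).map fun c => c • 𝒢.base i).sum r.1.1 r.2).bind fun b =>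
                PMF.pure ⟨b, r.1.2, r.2.hashQueries⟩

/-- `F` runs in probabilistic polynomial time and `(qS, qH, ε)`-breaks the multi-signature scheme:
it takes part in at most `qS` signing sessions with the honest card, makes at most `qH` hash
queries, and wins with probability at least `ε`. -/
def Breaks (𝒢 : GroupGen) (n : ℕ) (F : Code ForgerOracle) (qS : ℕ) (qH : ℕ → ℕ) (ε : ℕ → ℝ) :
    Prop :=
  ∃ T : Polynomial ℕ, ∀ k, 2 ≤ k →
    (∀ o ∈ (forgeryGame 𝒢 n qS F (T.eval k) k).support,
      o.time ≤ T.eval k ∧ o.hashQueries ≤ qH k) ∧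
    ε k ≤ (((forgeryGame 𝒢 n qS F (T.eval k) k).map Outcome.win) true).toReal

/-- Negligible functions of the security parameter. -/
def Negligible (ν : ℕ → ℝ) : Prop :=
  Asymptotics.SuperpolynomialDecay Filter.atTop (fun k : ℕ => (k : ℝ)) ν

end

set_option linter.unusedSimpArgs false

/-! ## Execution of computations -/

namespace Comp

/-! The adversary asks for `qS + 1` challenges. One serves as the public key `Y₁ = x • G` of the
honest card, the others as its nonce points `R_1, …, R_qS`; everything else it draws itself, and it
runs the forger. A signing request with hash value `ε` costs one discrete logarithm, that of `R_j -
ε • Y₁`, which is the share `r_j - x ε`. Up to the bias of the coins the forger sees what it sees in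
the experiment (`map_det_tapesLaw`, `Comp.mean_execCoin`). If it wins, then outside of unlikely
events (repeated hash values, guessed hash values, a guess of the key `s`) it has itself hashed the
point `σ • G + ε • Y` of its forgery, in some slot `i` of the tape of hash values, and no signing
session used slot `i` (`mean_isForgery_le`, `Trial.isGood_of_claims`, `mean_hit_le`). Such a run is
called good.

The forger is then run a second time with the same random values, except that the hash values from
slot `i` on are redrawn unless a session of the first run used their slot. Suppose that the second
run is good as well and has the same shape: the same slot for the forgery and, for each index, the
same slot for the session. Up to slot `i` both runs are identical, so the same point is hashed there
(`World.exists_slot_point`), with different values; two representations of one point give `x`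
(`Trial.cast_key`). A session with index `j` has the same `ε` in both runs, because its slot was
kept or its value is the fresh one reserved for `j`. Hence its share is bought only once, and
together with `x` it reveals the nonce. The nonces without a share are bought at the end. In total
`qS` logarithms solve `qS + 1` challenges (`Trial.queries_le`, `Trial.wins`).

For the probability, fix a shape `g`. The kept slots are then a fixed set, the two tapes share the
entries in it and are independent elsewhere, and Jensen's inequality shows that both runs have shape
`g` with probability at least the square of that for one run (`sq_mean_le_merge`). A good run with
at most `H` hash queries has one of `H ^ (qS + 1)` shapes (`Trial.card_shapes`), so Cauchy–Schwarz
(`sq_sum_le`) yields the claimed loss (`Trial.sq_mean_good_le`).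

It remains to exhibit the adversary as a program with a polynomial number of steps. `Fn`, `Act` and
`Samples` form a calculus of deterministic and randomized polynomial-time programs, closed under
composition, branching and bounded loops; `Simulator.exists_simulates` compiles the forger, with its
oracles replaced by programs, into the language of the adversary; `exists_adversary` assembles the
result. -/

theorem exec_bind {O α β σ : Type} (h : O → σ → Val → PMF (Val × σ)) (m : Comp O α)
    (f : α → Comp O β) (s : σ) :
    (m.bind f).exec h s = (m.exec h s).bind fun r => (f r.1).exec h r.2 := by
  induction m generalizing s with
  | ret a => simp [bind, exec]
  | query o v k ih => simp [bind, exec, ih, PMF.bind_bind]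
  | draw n k ih => simp [bind, exec, ih, PMF.bind_bind]

/-- Rename the oracles of a computation. -/
def lift {O α : Type} : Comp Empty α → Comp O α
  | ret a => ret a
  | draw n k => draw n fun c => (k c).lift

theorem lift_bind {O α β : Type} (m : Comp Empty α) (f : α → Comp Empty β) :
    ((m.bind f).lift : Comp O β) = m.lift.bind fun a => (f a).lift := by
  induction m with
  | ret a => rfl
  | query o => exact o.elim
  | draw n k ih => simp [bind, lift, ih]

end Comp

/-- A program without oracles as a program with oracles. -/
def Code.lift {O : Type} : Code Empty → Code O
  | .skip => .skip
  | .const n => .const n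
  | .fst => .fst
  | .snd => .snd
  | .isPair => .isPair
  | .equal => .equal
  | .arith o => .arith o
  | .rand => .rand
  | .pair f g => .pair f.lift g.lift
  | .seq f g => .seq f.lift g.lift
  | .ite c f g => .ite c.lift f.lift g.lift
  | .loop c f => .loop c.lift f.lift

theorem Comp.lift_whileLoop {O : Type} (c f : Val → Comp Empty (Val × ℕ)) (N : ℕ) (v : Val) :
    (Comp.whileLoop c f N v).lift =
      Comp.whileLoop (O := O) (fun v => (c v).lift) (fun v => (f v).lift) N v := by
  induction N generalizing v with
  | zero => rfl
  | succ N ih =>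
    simp only [Comp.whileLoop, Comp.lift_bind]
    congr 1; funext b
    split
    · rfl
    · simp only [Comp.lift_bind, ih]; rfl

theorem Code.run_lift {O : Type} (N : ℕ) (c : Code Empty) (v : Val) :
    (c.lift : Code O).run N v = (c.run N v).lift := by
  induction c generalizing v with
  | call o => exact o.elim
  | rand => cases v <;> rfl
  | pair f g ihf ihg => simp only [Code.lift, Code.run, Comp.lift_bind, ihf, ihg]; rfl
  | seq f g ihf ihg => simp only [Code.lift, Code.run, Comp.lift_bind, ihf, ihg]; rfl
  | ite c f g ihc ihf ihg =>
    simp only [Code.lift, Code.run, Comp.lift_bind, ihc, ihf, ihg]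
    congr 1; funext b
    split <;> rfl
  | loop c f ihc ihf =>
    simp only [Code.lift, Code.run, Comp.lift_whileLoop]
    congr 1 <;> funext v <;> simp [ihc, ihf]
  | _ => rfl

/-- The bound is `max n 1` since `unif 0` is the point mass at `0`; this is also the range of draws
in `Comp.Always`. -/
theorem unif_support (n : ℕ) {c : ℕ} (hc : c ∈ (unif n).support) : c < max n 1 := by
  unfold unif at hc
  split at hc
  · rw [PMF.mem_support_uniformOfFinset_iff, Finset.mem_range] at hc; omega
  · simp at hc; omega

/-- The group addition is specified as an oracle-free program, for all its branches. This carries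
the specification over to runs inside the adversary, where such a program cannot touch the oracle
state. -/
theorem Comp.exec_lift_support {O α σ : Type} (h : O → σ → Val → PMF (Val × σ))
    (m : Comp Empty α) (P : α → Prop) (hm : m.Always P) (s : σ) :
    ∀ r ∈ ((m.lift : Comp O α).exec h s).support, P r.1 ∧ r.2 = s := by
  induction m with
  | ret a => intro r hr; simp [Comp.lift, Comp.exec] at hr; subst hr; exact ⟨hm, rfl⟩
  | query o => exact o.elim
  | draw n k ih =>
    intro r hr
    simp only [Comp.lift, Comp.exec, PMF.mem_support_bind_iff] at hr
    obtain ⟨c, hc, hr⟩ := hr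
    exact ih c (hm c (unif_support n hc)) r hr

/-! ## Polynomial-time functions -/

theorem Polynomial.monotone_eval_nat (P : Polynomial ℕ) : Monotone fun x => P.eval x := by
  intro a b hab
  induction P using Polynomial.induction_on' with
  | add p q hp hq => simp only [Polynomial.eval_add]; exact add_le_add hp hq
  | monomial n c => simp only [Polynomial.eval_monomial]; gcongr

/-- A security parameter together with an instance of the group. -/
structure Env (𝒢 : GroupGen) where
  k : ℕ
  i : 𝒢.Inst
  two_le : 2 ≤ k
  mem : i ∈ (𝒢.gen k).support

variable {𝒢 : GroupGen}

/-- Run from the oracle state `s`, the computation returns `z` within `B` steps and leaves the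
oracle state `s'`. -/
def Yields (e : Env 𝒢) (m : Comp DLOracle (Val × ℕ)) (s : DLState) (z : Val) (s' : DLState)
    (B : ℕ) : Prop :=
  ∀ r ∈ (m.exec (dlOracle 𝒢 e.i) s).support, r.1.1 = z ∧ r.1.2 ≤ B ∧ r.2 = s'

theorem Yields.ret {e : Env 𝒢} {s : DLState} {z : Val} {t B : ℕ} (h : t ≤ B) :
    Yields e (.ret (z, t)) s z s B := by
  intro r hr; simp [Comp.exec] at hr; subst hr; exact ⟨rfl, h, rfl⟩

theorem Yields.bind {e : Env 𝒢} {m : Comp DLOracle (Val × ℕ)}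
    {f : Val × ℕ → Comp DLOracle (Val × ℕ)} {s s' s'' : DLState} {z z' : Val} {B B' : ℕ}
    (hm : Yields e m s z s' B) (hf : ∀ t ≤ B, Yields e (f (z, t)) s' z' s'' B') :
    Yields e (m.bind f) s z' s'' B' := by
  intro r hr
  rw [Comp.exec_bind, PMF.mem_support_bind_iff] at hr
  obtain ⟨q, hq, hr⟩ := hr
  obtain ⟨h1, h2, h3⟩ := hm q hq
  obtain ⟨⟨q1, q2⟩, q3⟩ := q
  simp only at h1 h2 h3 hr
  subst h1 h3
  exact hf _ h2 _ hr

theorem Yields.mono {e : Env 𝒢} {m : Comp DLOracle (Val × ℕ)} {s s' : DLState} {z : Val}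
    {B B' : ℕ} (hm : Yields e m s z s' B) (h : B ≤ B') : Yields e m s z s' B' :=
  fun r hr => ⟨(hm r hr).1, (hm r hr).2.1.trans h, (hm r hr).2.2⟩

/-- The code `c` takes `φ x` to `ψ x` and the oracle state `s x` to `s' x`, in time `P`. -/
def Performs {X : Type} (e : X → Env 𝒢) (c : Code DLOracle) (P : Polynomial ℕ) (φ : X → Val)
    (s : X → DLState) (ψ : X → Val) (s' : X → DLState) : Prop :=
  ∀ x, (∀ N, P.eval ((e x).k + (φ x).size) ≤ N →
    Yields (e x) (c.run N (φ x)) (s x) (ψ x) (s' x) (P.eval ((e x).k + (φ x).size))) ∧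
    (ψ x).size ≤ P.eval ((e x).k + (φ x).size)

/-- A polynomial-time program takes `φ x` to `ψ x` and the oracle state `s x` to `s' x`. -/
def Act {X : Type} (e : X → Env 𝒢) (φ : X → Val) (s : X → DLState) (ψ : X → Val)
    (s' : X → DLState) : Prop :=
  ∃ c P, Performs e c P φ s ψ s'

/-- A polynomial-time program computes `ψ x` from `φ x`. -/
def Fn {X : Type} (e : X → Env 𝒢) (φ ψ : X → Val) : Prop :=
  Act (fun y : X × DLState => e y.1) (fun y => φ y.1) (fun y => y.2) (fun y => ψ y.1)
    (fun y => y.2)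

section closure

variable {X : Type} {e : X → Env 𝒢} {φ ψ χ : X → Val} {s s' s'' : X → DLState}

theorem Act.reindex {Y : Type} (g : Y → X) (h : Act e φ s ψ s') :
    Act (fun y => e (g y)) (fun y => φ (g y)) (fun y => s (g y)) (fun y => ψ (g y))
      (fun y => s' (g y)) := by
  obtain ⟨c, P, h⟩ := h
  exact ⟨c, P, fun y => h (g y)⟩

theorem Fn.reindex {Y : Type} (g : Y → X) (h : Fn e φ ψ) :
    Fn (fun y => e (g y)) (fun y => φ (g y)) (fun y => ψ (g y)) :=
  Act.reindex (fun y : Y × DLState => (g y.1, y.2)) h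

/-- `Fn` quantifies over all oracle states, so any family of states can be inserted. -/
theorem Fn.act (h : Fn e φ ψ) (s : X → DLState) : Act e φ s ψ s :=
  Act.reindex (fun x => (x, s x)) h

/-- The bound for the size of the output is part of `Performs` for the sake of this lemma: the time
of the second program is polynomial in the size of its own input, which must be polynomial in the
size of the first input. -/
theorem Act.seq (h : Act e φ s ψ s') (h' : Act e ψ s' χ s'') : Act e φ s χ s'' := by
  obtain ⟨c, P, h⟩ := h
  obtain ⟨d, Q, h'⟩ := h'
  refine ⟨.seq c d, P + Q.comp (.X + P) + 1, fun x => ?_⟩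
  obtain ⟨h1, h2⟩ := h x
  obtain ⟨h3, h4⟩ := h' x
  set y := (e x).k + (φ x).size with hy
  have hle : Q.eval ((e x).k + (ψ x).size) ≤ Q.eval (y + P.eval y) :=
    Q.monotone_eval_nat (by omega)
  simp only [Polynomial.eval_add, Polynomial.eval_comp, Polynomial.eval_X, Polynomial.eval_one]
  refine ⟨fun N hN => ?_, by omega⟩
  refine (h1 N (by omega)).bind fun t ht => ?_
  refine (h3 N (by omega)).bind fun t' ht' => ?_
  exact Yields.ret (by simp only; omega)

theorem Fn.trans (h : Fn e φ ψ) (h' : Fn e ψ χ) : Fn e φ χ := Act.seq h h'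

theorem Fn.pair (h : Fn e φ ψ) (h' : Fn e φ χ) : Fn e φ fun x => .pair (ψ x) (χ x) := by
  obtain ⟨c, P, h⟩ := h
  obtain ⟨d, Q, h'⟩ := h'
  refine ⟨.pair c d, P + Q + 1, fun x => ?_⟩
  obtain ⟨h1, h2⟩ := h x
  obtain ⟨h3, h4⟩ := h' x
  simp only [Polynomial.eval_add, Polynomial.eval_one] at *
  refine ⟨fun N hN => ?_, by simp only [Val.size]; omega⟩
  refine (h1 N (by omega)).bind fun t ht => ?_
  refine (h3 N (by omega)).bind fun t' ht' => ?_
  exact Yields.ret (by simp only; omega)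

/-- Programs that answer at once. -/
theorem Fn.of_ret (c : Code DLOracle) (hc : ∀ x N, c.run N (φ x) = .ret (ψ x, 1 + (φ x).size))
    (D : ℕ) (hs : ∀ x, (ψ x).size ≤ D + (φ x).size) : Fn e φ ψ := by
  refine ⟨c, .X + .C (D + 1), fun x => ⟨fun N _ => ?_, ?_⟩⟩
  · rw [hc]; exact Yields.ret (by simp; omega)
  · have := hs x.1
    simp only [Polynomial.eval_add, Polynomial.eval_X, Polynomial.eval_C]; omega

theorem Fn.id : Fn e φ φ := Fn.of_ret .skip (fun _ _ => rfl) 0 fun x => by omega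

theorem Fn.const (n : ℕ) : Fn e φ fun _ => .num n :=
  Fn.of_ret (.const n) (fun _ _ => rfl) (1 + Nat.size n) fun x => by simp [Val.size]

namespace Val

/-- First component (`0` for numbers). -/
def fst : Val → Val
  | pair a _ => a
  | num _ => num 0

/-- Second component (`0` for numbers). -/
def snd : Val → Val
  | pair _ b => b
  | num _ => num 0

/-- Whether a value is a pair. -/
def isPair : Val → Bool
  | pair _ _ => true
  | num _ => false

/-- The number (`0` for pairs). -/
def toNat : Val → ℕ
  | pair _ _ => 0
  | num n => n

/-- A truth value as a value. -/
def bit (b : Bool) : Val := num (if b then 1 else 0)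

@[simp] theorem bit_eq_zero (b : Bool) : bit b = num 0 ↔ b = false := by cases b <;> simp [bit]

end Val

/-- A polynomial-time program decides `b x` from `φ x`. -/
def FnB (e : X → Env 𝒢) (φ : X → Val) (b : X → Bool) : Prop := Fn e φ fun x => .bit (b x)

theorem Fn.fst (h : Fn e φ ψ) : Fn e φ fun x => (ψ x).fst :=
  h.trans (Fn.of_ret .fst (fun x N => by cases ψ x <;> rfl) 1 fun x => by
    cases ψ x <;> simp [Val.fst, Val.size]; omega)

theorem Fn.snd (h : Fn e φ ψ) : Fn e φ fun x => (ψ x).snd :=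
  h.trans (Fn.of_ret .snd (fun x N => by cases ψ x <;> rfl) 1 fun x => by
    cases ψ x <;> simp [Val.snd, Val.size]; omega)

theorem Fn.left (h : Fn e φ fun x => .pair (ψ x) (χ x)) : Fn e φ ψ := h.fst

theorem Fn.right (h : Fn e φ fun x => .pair (ψ x) (χ x)) : Fn e φ χ := h.snd

theorem FnB.isPair (h : Fn e φ ψ) : FnB e φ fun x => (ψ x).isPair :=
  h.trans (Fn.of_ret .isPair (fun x N => by dsimp only; cases ψ x <;> rfl) 2 fun x => by
    dsimp only; cases ψ x <;> simp [Val.isPair, Val.bit, Val.size]; omega)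

theorem FnB.eq (h : Fn e φ ψ) (h' : Fn e φ χ) : FnB e φ fun x => decide (ψ x = χ x) :=
  (h.pair h').trans (Fn.of_ret .equal (fun x N => by
    by_cases hx : ψ x = χ x <;> simp [Code.run, Val.bit, hx]) 2 fun x => by
    by_cases hx : ψ x = χ x <;> simp [Val.bit, Val.size, hx]; omega)

/-- Lengths add up under multiplication, an addition may produce one carry bit, and the other
operations do not exceed their first argument. -/
theorem ArithOp.size_eval (o : ArithOp) (a b : ℕ) :
    Nat.size (o.eval a b) ≤ Nat.size a + Nat.size b + 1 := by
  have ha := Nat.lt_size_self a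
  have hb := Nat.lt_size_self b
  rw [Nat.size_le]
  have h1 : 2 ^ Nat.size a ≤ 2 ^ (Nat.size a + Nat.size b) :=
    Nat.pow_le_pow_right (by norm_num) (by omega)
  have h2 : 2 ^ Nat.size b ≤ 2 ^ (Nat.size a + Nat.size b) :=
    Nat.pow_le_pow_right (by norm_num) (by omega)
  have h3 := pow_succ 2 (Nat.size a + Nat.size b)
  have hd := Nat.div_le_self a b
  have hm := Nat.mod_le a b
  cases o <;> simp only [ArithOp.eval] <;> try omega
  have := Nat.mul_lt_mul'' ha hb
  rw [← pow_add] at this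
  omega

theorem Fn.arith (o : ArithOp) {a b : X → ℕ} (h : Fn e φ fun x => .num (a x))
    (h' : Fn e φ fun x => .num (b x)) : Fn e φ fun x => .num (o.eval (a x) (b x)) :=
  (h.pair h').trans (Fn.of_ret (.arith o) (fun x N => by simp [Code.run]) 1 fun x => by
    have := o.size_eval (a x) (b x)
    simp only [Val.size]; omega)

variable {a b : X → ℕ}

theorem Fn.add (h : Fn e φ fun x => .num (a x)) (h' : Fn e φ fun x => .num (b x)) :
    Fn e φ fun x => .num (a x + b x) := h.arith .add h'

theorem Fn.sub (h : Fn e φ fun x => .num (a x)) (h' : Fn e φ fun x => .num (b x)) :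
    Fn e φ fun x => .num (a x - b x) := h.arith .sub h'

theorem Fn.mul (h : Fn e φ fun x => .num (a x)) (h' : Fn e φ fun x => .num (b x)) :
    Fn e φ fun x => .num (a x * b x) := h.arith .mul h'

theorem Fn.div (h : Fn e φ fun x => .num (a x)) (h' : Fn e φ fun x => .num (b x)) :
    Fn e φ fun x => .num (a x / b x) := h.arith .div h'

theorem Fn.mod (h : Fn e φ fun x => .num (a x)) (h' : Fn e φ fun x => .num (b x)) :
    Fn e φ fun x => .num (a x % b x) := h.arith .mod h'

theorem Act.ite {c : X → Prop} [∀ x, Decidable (c x)] (hc : FnB e φ fun x => decide (c x))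
    {s₁ s₂ : X → DLState} (h : Act e φ s ψ s₁) (h' : Act e φ s χ s₂) :
    Act e φ s (fun x => if c x then ψ x else χ x) (fun x => if c x then s₁ x else s₂ x) := by
  obtain ⟨cc, R, hc⟩ := hc.act s
  obtain ⟨c1, P, h⟩ := h
  obtain ⟨c2, Q, h'⟩ := h'
  refine ⟨.ite cc c1 c2, R + P + Q + 1, fun x => ?_⟩
  obtain ⟨h1, h2⟩ := h x
  obtain ⟨h3, h4⟩ := h' x
  obtain ⟨h5, h6⟩ := hc x
  simp only [Polynomial.eval_add, Polynomial.eval_one]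
  refine ⟨fun N hN => ?_, by split <;> omega⟩
  refine (h5 N (by omega)).bind fun t ht => ?_
  by_cases hx : c x
  · simp only [hx, decide_true, Val.bit_eq_zero, Bool.true_eq_false, if_false, if_true]
    refine (h1 N (by omega)).bind fun t' ht' => ?_
    exact Yields.ret (by simp only; omega)
  · simp only [hx, decide_false, Val.bit_eq_zero, if_true, if_false]
    refine (h3 N (by omega)).bind fun t' ht' => ?_
    exact Yields.ret (by simp only; omega)

theorem Fn.ite {c : X → Prop} [∀ x, Decidable (c x)] (hc : FnB e φ fun x => decide (c x))
    (h : Fn e φ ψ) (h' : Fn e φ χ) : Fn e φ fun x => if c x then ψ x else χ x := by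
  have := Act.ite (e := fun y : X × DLState => e y.1) (φ := fun y => φ y.1)
    (c := fun y : X × DLState => c y.1) (s := fun y => y.2)
    (Fn.reindex (fun y : X × DLState => y.1) hc) h h'
  simp only [ite_self] at this
  exact this

theorem Fn.congr (h : Fn e φ ψ) (hx : ∀ x, ψ x = χ x) : Fn e φ χ := by
  rwa [← show ψ = χ from funext hx]

theorem FnB.congr {b b' : X → Bool} (h : FnB e φ b) (hx : ∀ x, b x = b' x) : FnB e φ b' := by
  rwa [← show b = b' from funext hx]

theorem FnB.const (b : Bool) : FnB e φ fun _ => b := Fn.const (if b then 1 else 0)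

theorem FnB.and {c d : X → Prop} [∀ x, Decidable (c x)] [∀ x, Decidable (d x)]
    (hc : FnB e φ fun x => decide (c x)) (hd : FnB e φ fun x => decide (d x)) :
    FnB e φ fun x => decide (c x ∧ d x) :=
  Fn.congr (Fn.ite hc hd (FnB.const false)) fun x => by
    by_cases h : c x <;> by_cases h' : d x <;> simp [h, h']

theorem FnB.not {c : X → Prop} [∀ x, Decidable (c x)]
    (hc : FnB e φ fun x => decide (c x)) : FnB e φ fun x => decide (¬ c x) :=
  Fn.congr (Fn.ite hc (FnB.const false) (FnB.const true)) fun x => by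
    by_cases h : c x <;> simp [h]

theorem FnB.or {c d : X → Prop} [∀ x, Decidable (c x)] [∀ x, Decidable (d x)]
    (hc : FnB e φ fun x => decide (c x)) (hd : FnB e φ fun x => decide (d x)) :
    FnB e φ fun x => decide (c x ∨ d x) :=
  Fn.congr (Fn.ite hc (FnB.const true) hd) fun x => by
    by_cases h : c x <;> by_cases h' : d x <;> simp [h, h']

theorem FnB.le (h : Fn e φ fun x => .num (a x)) (h' : Fn e φ fun x => .num (b x)) :
    FnB e φ fun x => decide (a x ≤ b x) :=
  (FnB.eq (h.sub h') (Fn.const 0)).congr fun x => by simp [Nat.sub_eq_zero_iff_le]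

theorem FnB.lt (h : Fn e φ fun x => .num (a x)) (h' : Fn e φ fun x => .num (b x)) :
    FnB e φ fun x => decide (a x < b x) :=
  (FnB.le (h.add (Fn.const 1)) h').congr fun x => by simp

theorem FnB.eq_num (h : Fn e φ fun x => .num (a x)) (h' : Fn e φ fun x => .num (b x)) :
    FnB e φ fun x => decide (a x = b x) :=
  (FnB.eq h h').congr fun x => by simp

theorem Fn.toNat (h : Fn e φ ψ) : Fn e φ fun x => .num (ψ x).toNat :=
  Fn.congr (Fn.ite (c := fun x => (ψ x).isPair = true) ((FnB.isPair h).congr fun x => by simp)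
    (Fn.const 0) h) fun x => by cases h : ψ x <;> simp [Val.isPair, Val.toNat]

/-- A polynomial-time body may double the size of its input in each round, so iteration alone does
not stay polynomial. The loop is therefore described by its trajectory `L x 0, L x 1, …`, and a
polynomial `Q` of the initial size has to bound the number of rounds and every state on the
trajectory. Each round then costs at most a fixed polynomial of the initial size. -/
theorem Act.loop (n : X → ℕ) (L : X → ℕ → Val) (s : X → ℕ → DLState) (b : X → ℕ → Val)
    (hc : Act (fun y : {y : X × ℕ // y.2 ≤ n y.1} => e y.1.1) (fun y => L y.1.1 y.1.2)
      (fun y => s y.1.1 y.1.2) (fun y => b y.1.1 y.1.2) (fun y => s y.1.1 y.1.2))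
    (hb : ∀ x j, j ≤ n x → (b x j = .num 0 ↔ j = n x))
    (hf : Act (fun y : {y : X × ℕ // y.2 < n y.1} => e y.1.1) (fun y => L y.1.1 y.1.2)
      (fun y => s y.1.1 y.1.2) (fun y => L y.1.1 (y.1.2 + 1)) (fun y => s y.1.1 (y.1.2 + 1)))
    (Q : Polynomial ℕ) (hn : ∀ x, n x ≤ Q.eval ((e x).k + (L x 0).size))
    (hL : ∀ x j, j ≤ n x → (L x j).size ≤ Q.eval ((e x).k + (L x 0).size)) :
    Act e (fun x => L x 0) (fun x => s x 0) (fun x => L x (n x)) (fun x => s x (n x)) := by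
  obtain ⟨cc, Pc, hc⟩ := hc
  obtain ⟨cf, Pf, hf⟩ := hf
  -- At most `Q` rounds and a last test, each within `(Pc + Pf) (y + Q y) + 1` steps; the last
  -- summand `Q` bounds the size of the final state.
  refine ⟨.loop cc cf, (Q + 1) * ((Pc + Pf).comp (.X + Q) + 1) + Q, fun x => ?_⟩
  simp only [Polynomial.eval_add, Polynomial.eval_mul, Polynomial.eval_comp, Polynomial.eval_X,
    Polynomial.eval_one]
  set y := (e x).k + (L x 0).size with hy
  set q := Q.eval y with hq
  set D := Polynomial.eval (y + q) Pc + Polynomial.eval (y + q) Pf + 1 with hD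
  have hnx : n x ≤ q := hn x
  refine ⟨fun N hN => ?_, le_add_left (hL x _ le_rfl)⟩
  have hDN : (q + 1) * D ≤ N := by omega
  have hDN' : D ≤ N := le_trans (Nat.le_mul_of_pos_left _ (by omega)) hDN
  have hPc : ∀ j, j ≤ n x → Pc.eval ((e x).k + (L x j).size) ≤ Pc.eval (y + q) := fun j hj =>
    Pc.monotone_eval_nat (by have := hL x j hj; rw [← hy] at this; omega)
  have hPf : ∀ j, j ≤ n x → Pf.eval ((e x).k + (L x j).size) ≤ Pf.eval (y + q) := fun j hj =>
    Pf.monotone_eval_nat (by have := hL x j hj; rw [← hy] at this; omega)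
  -- Induction on the number `m` of rounds still to be done; the remaining cut-off `N'` has to
  -- exceed it because of the final test.
  have key : ∀ m j N', j + m = n x → m < N' →
      Yields (e x) (Comp.whileLoop (cc.run N) (cf.run N) N' (L x j)) (s x j) (L x (n x))
        (s x (n x)) ((m + 1) * D) := by
    intro m
    induction m with
    | zero =>
      intro j N' hj hN'
      obtain ⟨N', rfl⟩ : ∃ N'', N' = N'' + 1 := ⟨N' - 1, by omega⟩
      have hj' : j = n x := by omega
      obtain ⟨h1, -⟩ := hc ⟨(x, j), by simp; omega⟩
      have hj'' := hPc j (by omega)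
      refine (h1 N (by simp only; omega)).bind fun t ht => ?_
      simp only at ht ⊢
      rw [if_pos ((hb x j (by omega)).2 hj'), ← hj']
      exact Yields.ret (by omega)
    | succ m ih =>
      intro j N' hj hN'
      obtain ⟨N', rfl⟩ : ∃ N'', N' = N'' + 1 := ⟨N' - 1, by omega⟩
      obtain ⟨h1, -⟩ := hc ⟨(x, j), by simp; omega⟩
      obtain ⟨h2, -⟩ := hf ⟨(x, j), by simp; omega⟩
      have hj1 := hPc j (by omega)
      have hj2 := hPf j (by omega)
      refine (h1 N (by simp only; omega)).bind fun t ht => ?_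
      simp only at ht ⊢
      rw [if_neg (by rw [hb x j (by omega)]; omega)]
      refine (h2 N (by simp only; omega)).bind fun t' ht' => ?_
      refine (ih (j + 1) N' (by omega) (by omega)).bind fun t'' ht'' => ?_
      refine Yields.ret ?_
      simp only at ht' ⊢
      rw [add_mul (m + 1) 1 D]
      omega
  refine (key (n x) 0 N (by omega) ?_).mono ?_
  · calc n x < (q + 1) * 1 := by omega
      _ ≤ (q + 1) * D := Nat.mul_le_mul_left _ (by omega)
      _ ≤ N := hDN
  · exact le_trans (Nat.mul_le_mul_right _ (by omega)) (Nat.le_add_right _ _)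

theorem Fn.loop (n : X → ℕ) (L : X → ℕ → Val) (b : X → ℕ → Val)
    (hc : Fn (fun y : {y : X × ℕ // y.2 ≤ n y.1} => e y.1.1) (fun y => L y.1.1 y.1.2)
      (fun y => b y.1.1 y.1.2))
    (hb : ∀ x j, j ≤ n x → (b x j = .num 0 ↔ j = n x))
    (hf : Fn (fun y : {y : X × ℕ // y.2 < n y.1} => e y.1.1) (fun y => L y.1.1 y.1.2)
      (fun y => L y.1.1 (y.1.2 + 1)))
    (Q : Polynomial ℕ) (hn : ∀ x, n x ≤ Q.eval ((e x).k + (L x 0).size))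
    (hL : ∀ x j, j ≤ n x → (L x j).size ≤ Q.eval ((e x).k + (L x 0).size)) :
    Fn e (fun x => L x 0) (fun x => L x (n x)) :=
  Act.loop (X := X × DLState) (e := fun y => e y.1) (fun y => n y.1) (fun y => L y.1)
    (fun y _ => y.2) (fun y => b y.1)
    (Act.reindex (fun y : {y : (X × DLState) × ℕ // y.2 ≤ n y.1.1} =>
      ((⟨(y.1.1.1, y.1.2), y.2⟩ : {y : X × ℕ // y.2 ≤ n y.1}), y.1.1.2)) hc)
    (fun x => hb x.1)
    (Act.reindex (fun y : {y : (X × DLState) × ℕ // y.2 < n y.1.1} =>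
      ((⟨(y.1.1.1, y.1.2), y.2⟩ : {y : X × ℕ // y.2 < n y.1}), y.1.1.2)) hf)
    Q (fun x => hn x.1) (fun x => hL x.1)

end closure

/-! ## Loops over lists -/

section lists

variable {𝒢 : GroupGen} {X : Type} {e : X → Env 𝒢} {φ ψ χ : X → Val}

theorem Fn.size_le (h : Fn e φ ψ) :
    ∃ P : Polynomial ℕ, ∀ x, (ψ x).size ≤ P.eval ((e x).k + (φ x).size) := by
  obtain ⟨c, P, h⟩ := h
  exact ⟨P, fun x => (h (x, ⟨[], 0⟩)).2⟩

theorem Fn.arg₁ : Fn e (fun x => .pair (φ x) (ψ x)) φ := Fn.left Fn.id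

theorem Fn.arg₂ : Fn e (fun x => .pair (φ x) (.pair (ψ x) (χ x))) ψ := Fn.left (Fn.right Fn.id)

theorem Fn.arg₃ : Fn e (fun x => .pair (φ x) (.pair (ψ x) (χ x))) χ := Fn.right (Fn.right Fn.id)

/-- What can be computed before entering a larger context can be computed afterwards. -/
theorem Fn.inner {Y : Type} {g : Y → X} {ρ : Y → Val} (h : Fn e φ ψ) :
    Fn (fun y => e (g y)) (fun y => .pair (φ (g y)) (ρ y)) (fun y => ψ (g y)) :=
  Fn.arg₁.trans (h.reindex g)

namespace Val

@[simp] theorem ofList_nil : ofList [] = num 0 := rfl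

@[simp] theorem ofList_cons (a : Val) (l : List Val) : ofList (a :: l) = pair a (ofList l) := rfl

theorem size_ofList (l : List Val) : (ofList l).size = 1 + (l.map fun v => 1 + v.size).sum := by
  induction l with
  | nil => simp [size]
  | cons a l ih => simp only [ofList_cons, size, ih, List.map_cons, List.sum_cons]; omega

theorem size_ofList_sublist {l l' : List Val} (h : l.Sublist l') :
    (ofList l).size ≤ (ofList l').size := by
  simp only [size_ofList]
  exact Nat.add_le_add_left ((h.map _).sum_le_sum (by simp)) 1

theorem size_le_of_mem {a : Val} {l : List Val} (h : a ∈ l) : a.size ≤ (ofList l).size := by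
  rw [size_ofList]
  have := List.single_le_sum (l := l.map fun v => 1 + v.size) (by simp) (1 + a.size)
    (List.mem_map.2 ⟨a, h, rfl⟩)
  omega

theorem length_lt_size (l : List Val) : l.length < (ofList l).size := by
  induction l with
  | nil => simp [size]
  | cons a l ih => simp only [ofList_cons, size, List.length_cons]; omega

theorem size_ofList_le (l : List Val) (B : ℕ) (h : ∀ v ∈ l, v.size ≤ B) :
    (ofList l).size ≤ 1 + l.length * (1 + B) := by
  rw [size_ofList]
  have := List.sum_le_card_nsmul (l.map fun v => 1 + v.size) (1 + B) (by
    intro x hx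
    obtain ⟨v, hv, rfl⟩ := List.mem_map.1 hx
    exact Nat.add_le_add_left (h v hv) 1)
  simpa using this

/-- Optional values. -/
def ofOption {α : Type} (f : α → Val) : Option α → Val
  | none => num 0
  | some a => pair (num 1) (f a)

/-- A table with keys. -/
def ofTable {α : Type} (f : α → Val) (l : List (Val × α)) : Val :=
  ofList (l.map fun t => pair t.1 (f t.2))

end Val

open Val

/-- The loop state consists of the context `φ x`, the rest of the list and the accumulator, so that
`step` can use everything computable from `φ x`. The accumulator has to stay polynomial throughout,
hence a bound for all prefixes. -/
theorem Fn.foldl {α β : X → Type} (encα : ∀ x, α x → Val) (encβ : ∀ x, β x → Val)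
    (step : ∀ x, β x → α x → β x) {l : ∀ x, List (α x)} {b₀ : ∀ x, β x}
    (hl : Fn e φ fun x => ofList ((l x).map (encα x))) (h₀ : Fn e φ fun x => encβ x (b₀ x))
    (hstep : Fn (fun y : Σ x, α x × β x => e y.1)
      (fun y => .pair (φ y.1) (.pair (encα y.1 y.2.1) (encβ y.1 y.2.2)))
      (fun y => encβ y.1 (step y.1 y.2.2 y.2.1)))
    (Q : Polynomial ℕ) (hQ : ∀ x j, (encβ x (((l x).take j).foldl (step x) (b₀ x))).size ≤
      Q.eval ((e x).k + (φ x).size)) :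
    Fn e φ fun x => encβ x ((l x).foldl (step x) (b₀ x)) := by
  let L : X → ℕ → Val := fun x j => .pair (φ x) (.pair (ofList (((l x).drop j).map (encα x)))
    (encβ x (((l x).take j).foldl (step x) (b₀ x))))
  have key : Fn e (fun x => L x 0) (fun x => L x (l x).length) := by
    refine Fn.loop (fun x => (l x).length) L
      (fun x j => .bit (ofList (((l x).drop j).map (encα x))).isPair) ?_ ?_ ?_ (Q + .X + 1) ?_ ?_
    · exact FnB.isPair (Fn.arg₂)
    · intro x j hj
      rw [bit_eq_zero]
      rcases hj.lt_or_eq with h | h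
      · rw [List.drop_eq_getElem_cons h, List.map_cons, ofList_cons]
        simp [Val.isPair, h.ne]
      · simp [h, Val.isPair]
    · have h1 : Fn (fun y : {y : X × ℕ // y.2 < (l y.1).length} => e y.1.1)
          (fun y => L y.1.1 y.1.2) (fun y => ofList (((l y.1.1).drop y.1.2).map (encα y.1.1))) :=
        Fn.arg₂
      have h2 : Fn (fun y : {y : X × ℕ // y.2 < (l y.1).length} => e y.1.1)
          (fun y => L y.1.1 y.1.2) (fun y => φ y.1.1) := Fn.left Fn.id
      have h3 : Fn (fun y : {y : X × ℕ // y.2 < (l y.1).length} => e y.1.1)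
          (fun y => L y.1.1 y.1.2)
          (fun y => encβ y.1.1 (((l y.1.1).take y.1.2).foldl (step y.1.1) (b₀ y.1.1))) :=
        Fn.arg₃
      have h4 : ∀ y : {y : X × ℕ // y.2 < (l y.1).length},
          ofList (((l y.1.1).drop y.1.2).map (encα y.1.1)) =
          .pair (encα y.1.1 ((l y.1.1)[y.1.2]'y.2))
            (ofList (((l y.1.1).drop (y.1.2 + 1)).map (encα y.1.1))) := fun y => by
        rw [List.drop_eq_getElem_cons y.2]; rfl
      have h5 := h1.congr h4
      refine h2.pair (h5.right.pair ?_)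
      have h6 := (h2.pair (h5.left.pair h3)).trans (hstep.reindex
        fun y : {y : X × ℕ // y.2 < (l y.1).length} =>
          ⟨y.1.1, (l y.1.1)[y.1.2]'y.2, ((l y.1.1).take y.1.2).foldl (step y.1.1) (b₀ y.1.1)⟩)
      refine h6.congr fun y => ?_
      simp only
      rw [List.take_add_one, List.getElem?_eq_getElem y.2, List.foldl_append]
      rfl
    · intro x
      have := length_lt_size ((l x).map (encα x))
      simp only [List.length_map] at this
      simp only [Polynomial.eval_add, Polynomial.eval_X, L, List.drop_zero, Val.size]
      omega
    · intro x j _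
      have h1 := hQ x j
      have h2 := size_ofList_sublist (((l x).drop_sublist j).map (encα x))
      have h3 : Q.eval ((e x).k + (φ x).size) ≤ Q.eval ((e x).k + (L x 0).size) :=
        Q.monotone_eval_nat (by simp only [L, Val.size]; omega)
      simp only [Polynomial.eval_add, Polynomial.eval_X, Polynomial.eval_one]
      refine le_trans ?_ (Nat.add_le_add_right (Nat.add_le_add_right h3 _) 1)
      simp only [L, List.drop_zero, Val.size]
      omega
  have hin : Fn e φ fun x => L x 0 := by
    refine Fn.id.pair (Fn.pair ?_ ?_)
    · simpa using hl
    · simpa using h₀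
  exact (hin.trans key).right.right.congr fun x => by simp

theorem Fn.findSome? {α β : X → Type} (encα : ∀ x, α x → Val) (encβ : ∀ x, β x → Val)
    (f : ∀ x, α x → Option (β x)) {l : ∀ x, List (α x)}
    (hl : Fn e φ fun x => ofList ((l x).map (encα x)))
    (hf : Fn (fun y : Σ x, α x => e y.1) (fun y => .pair (φ y.1) (encα y.1 y.2))
      (fun y => ofOption (encβ y.1) (f y.1 y.2))) :
    Fn e φ fun x => ofOption (encβ x) ((l x).findSome? (f x)) := by
  -- The search is a fold of `Option.or`: once a value is found, the remaining entries do not change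
  -- it.
  have hfold : ∀ x (l : List (α x)) (o : Option (β x)),
      l.foldl (fun o a => o.or (f x a)) o = o.or (l.findSome? (f x)) := by
    intro x l
    induction l with
    | nil => intro o; simp
    | cons a l ih =>
      intro o
      rw [List.foldl_cons, ih, List.findSome?_cons]
      cases o <;> simp
      cases f x a <;> simp
  obtain ⟨P, hP⟩ := hf.size_le
  obtain ⟨R, hR⟩ := hl.size_le
  refine (Fn.foldl encα (fun x => ofOption (encβ x)) (fun x o a => o.or (f x a)) (b₀ := fun _ => none)
    hl (Fn.const 0) ?_ (P.comp (.X + 1 + R) + 1) ?_).congr fun x => by rw [hfold]; simp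
  · have h1 : Fn (fun y : Σ x, α x × Option (β x) => e y.1)
        (fun y => .pair (φ y.1) (.pair (encα y.1 y.2.1) (ofOption (encβ y.1) y.2.2)))
        (fun y => ofOption (encβ y.1) y.2.2) := Fn.arg₃
    have h2 : Fn (fun y : Σ x, α x × Option (β x) => e y.1)
        (fun y => .pair (φ y.1) (.pair (encα y.1 y.2.1) (ofOption (encβ y.1) y.2.2)))
        (fun y => ofOption (encβ y.1) (f y.1 y.2.1)) :=
      (Fn.arg₁.pair Fn.arg₂).trans
        (hf.reindex fun y : Σ x, α x × Option (β x) => ⟨y.1, y.2.1⟩)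
    have h3 := Fn.ite (c := fun y => (ofOption (encβ y.1) y.2.2).isPair = true)
      ((FnB.isPair h1).congr fun y => by simp) h1 h2
    refine h3.congr fun y => ?_
    rcases y.2.2 with _ | b <;> simp [ofOption, Val.isPair]
  · intro x j
    rw [hfold, Option.none_or]
    simp only [Polynomial.eval_add, Polynomial.eval_comp, Polynomial.eval_X, Polynomial.eval_one]
    rcases h : ((l x).take j).findSome? (f x) with _ | b
    · simp [ofOption, Val.size]
    · obtain ⟨a, ha, hab⟩ := List.exists_of_findSome?_eq_some h
      have h1 := hP ⟨x, a⟩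
      rw [hab] at h1
      refine le_trans h1 (le_trans (P.monotone_eval_nat ?_) (Nat.le_add_right _ _))
      have h2 := size_le_of_mem (List.mem_map_of_mem (f := encα x) (List.mem_of_mem_take ha))
      have h3 := hR x
      simp only [Val.size]
      omega

theorem FnB.any {α : X → Type} (encα : ∀ x, α x → Val) (p : ∀ x, α x → Bool)
    {l : ∀ x, List (α x)} (hl : Fn e φ fun x => ofList ((l x).map (encα x)))
    (hp : FnB (fun y : Σ x, α x => e y.1) (fun y => .pair (φ y.1) (encα y.1 y.2))
      (fun y => p y.1 y.2)) :
    FnB e φ fun x => (l x).any (p x) := by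
  have h := Fn.findSome? (β := fun _ => Unit) encα (fun _ _ => .num 0)
    (fun x a => if p x a then some () else none) hl
    ((Fn.ite (c := fun y : Σ x, α x => p y.1 y.2 = true) (by simpa using hp)
      ((Fn.const 1).pair (Fn.const 0)) (Fn.const 0)).congr fun y => by
        split <;> simp [ofOption, *])
  refine (FnB.isPair h).congr fun x => ?_
  induction l x with
  | nil => simp [ofOption, Val.isPair]
  | cons a t ih =>
    rw [List.findSome?_cons, List.any_cons, ← ih]
    by_cases hpa : p x a <;> simp [hpa, ofOption, Val.isPair]

theorem Fn.lookup {β : X → Type} (encβ : ∀ x, β x → Val) {l : ∀ x, List (Val × β x)}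
    {q : X → Val} (hl : Fn e φ fun x => ofTable (encβ x) (l x)) (hq : Fn e φ q) :
    Fn e φ fun x => ofOption (encβ x) ((l x).lookup (q x)) := by
  refine (Fn.findSome? (α := fun x => Val × β x) (fun x t => .pair t.1 (encβ x t.2)) encβ
    (fun x t => if q x = t.1 then some t.2 else none) hl ?_).congr fun x => ?_
  · have h1 : Fn (fun y : Σ x, Val × β x => e y.1)
      (fun y => .pair (φ y.1) (.pair y.2.1 (encβ y.1 y.2.2))) (fun y => y.2.1) :=
      Fn.arg₂
    have h2 : Fn (fun y : Σ x, Val × β x => e y.1)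
      (fun y => .pair (φ y.1) (.pair y.2.1 (encβ y.1 y.2.2))) (fun y => encβ y.1 y.2.2) :=
      Fn.arg₃
    refine (Fn.ite (c := fun y : Σ x, Val × β x => q y.1 = y.2.1) (FnB.eq hq.inner h1)
      ((Fn.const 1).pair h2) (Fn.const 0)).congr fun y => ?_
    split <;> simp [ofOption]
  · congr 1
    induction l x with
    | nil => simp
    | cons t r ih =>
      rw [List.findSome?_cons, List.lookup_cons, ih]
      by_cases h : q x = t.1 <;> simp [h, beq_eq_false_iff_ne.2]

theorem Fn.reverse {α : X → Type} (encα : ∀ x, α x → Val) {l : ∀ x, List (α x)}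
    (hl : Fn e φ fun x => ofList ((l x).map (encα x))) :
    Fn e φ fun x => ofList ((l x).reverse.map (encα x)) := by
  have hfold : ∀ x (l r : List (α x)), l.foldl (fun r a => a :: r) r = l.reverse ++ r := by
    intro x l
    induction l with
    | nil => simp
    | cons a l ih => intro r; simp [ih]
  obtain ⟨R, hR⟩ := hl.size_le
  refine (Fn.foldl encα (fun x r => ofList (r.map (encα x))) (fun x r a => a :: r)
    (b₀ := fun _ => []) hl (Fn.const 0) ?_ R ?_).congr fun x => by rw [hfold]; simp
  · exact (Fn.arg₂).pair (Fn.arg₃)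
  · intro x j
    rw [hfold, List.append_nil]
    refine le_trans (le_of_eq ?_) (le_trans
      (size_ofList_sublist (((l x).take_sublist j).map (encα x))) (hR x))
    rw [size_ofList, size_ofList, List.map_reverse, List.map_reverse, List.sum_reverse]

/-- A fold can only put new entries in front, so the image is built in reversed order and reversed
at the end. -/
theorem Fn.map {α β : X → Type} (encα : ∀ x, α x → Val) (encβ : ∀ x, β x → Val)
    (f : ∀ x, α x → β x) {l : ∀ x, List (α x)}
    (hl : Fn e φ fun x => ofList ((l x).map (encα x)))
    (hf : Fn (fun y : Σ x, α x => e y.1) (fun y => .pair (φ y.1) (encα y.1 y.2))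
      (fun y => encβ y.1 (f y.1 y.2))) :
    Fn e φ fun x => ofList (((l x).map (f x)).map (encβ x)) := by
  have hfold : ∀ x (l : List (α x)) (r : List (β x)),
      l.foldl (fun r a => f x a :: r) r = (l.map (f x)).reverse ++ r := by
    intro x l
    induction l with
    | nil => simp
    | cons a l ih => intro r; simp [ih]
  obtain ⟨P, hP⟩ := hf.size_le
  obtain ⟨R, hR⟩ := hl.size_le
  have h1 : Fn e φ fun x => ofList (((l x).map (f x)).reverse.map (encβ x)) := by
    refine (Fn.foldl encα (fun x r => ofList (r.map (encβ x))) (fun x r a => f x a :: r)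
      (b₀ := fun _ => []) hl (Fn.const 0) ?_ (1 + R * (1 + P.comp (.X + 1 + R))) ?_).congr
        fun x => by rw [hfold]; simp
    · exact ((Fn.arg₁.pair (Fn.arg₂)).trans
        (hf.reindex fun y : Σ x, α x × List (β x) => ⟨y.1, y.2.1⟩)).pair
          (Fn.arg₃)
    · intro x j
      rw [hfold, List.append_nil]
      simp only [Polynomial.eval_add, Polynomial.eval_comp, Polynomial.eval_X,
        Polynomial.eval_one, Polynomial.eval_mul]
      refine le_trans (size_ofList_le _ (P.eval ((e x).k + (φ x).size + 1 +
        R.eval ((e x).k + (φ x).size))) ?_) ?_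
      · intro v hv
        simp only [List.map_reverse, List.mem_reverse, List.mem_map] at hv
        obtain ⟨_, ⟨a, ha, rfl⟩, rfl⟩ := hv
        refine le_trans (hP ⟨x, a⟩) (P.monotone_eval_nat ?_)
        have h2 := size_le_of_mem (List.mem_map_of_mem (f := encα x) (List.mem_of_mem_take ha))
        have h3 := hR x
        simp only [Val.size]
        omega
      · have h2 := length_lt_size ((l x).map (encα x))
        have h3 := hR x
        simp only [List.length_map, List.length_reverse, List.length_take] at h2 ⊢
        exact Nat.add_le_add_left (Nat.mul_le_mul_right _ (by omega)) 1
  exact (Fn.reverse encβ h1).congr fun x => by simp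

/-! ## Counted loops -/

/-- A list of length `m x` turns counted loops into folds. The polynomial bound for `m x` is
indispensable: a number written in binary may be exponential in its size. -/
theorem Fn.replicate {m : X → ℕ} (hm : Fn e φ fun x => .num (m x)) (Q : Polynomial ℕ)
    (hQ : ∀ x, m x ≤ Q.eval ((e x).k + (φ x).size)) :
    Fn e φ fun x => ofList (List.replicate (m x) (.num 0)) := by
  obtain ⟨R, hR⟩ := hm.size_le
  let L : X → ℕ → Val := fun x j => .pair (φ x)
    (.pair (.num (m x - j)) (ofList (List.replicate j (.num 0))))
  have key : Fn e (fun x => L x 0) (fun x => L x (m x)) := by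
    refine Fn.loop m L (fun x j => .num (m x - j)) ?_ ?_ ?_ (.X + Q + Q + R + 5) ?_ ?_
    · exact Fn.arg₂
    · intro x j hj; simp; omega
    · refine Fn.arg₁.pair (Fn.pair ?_ ?_)
      · exact ((Fn.arg₂).sub (Fn.const 1)).congr fun x => by simp; omega
      · exact ((Fn.const 0).pair (Fn.arg₃)).congr fun x => by
          rw [List.replicate_succ]; rfl
    · intro x
      have h3 : Q.eval ((e x).k + (φ x).size) ≤ Q.eval ((e x).k + (L x 0).size) :=
        Q.monotone_eval_nat (by simp only [L, Val.size]; omega)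
      have := hQ x
      simp only [Polynomial.eval_add]
      omega
    · intro x j hj
      have h3 : Q.eval ((e x).k + (φ x).size) ≤ Q.eval ((e x).k + (L x 0).size) :=
        Q.monotone_eval_nat (by simp only [L, Val.size]; omega)
      have h4 : R.eval ((e x).k + (φ x).size) ≤ R.eval ((e x).k + (L x 0).size) :=
        R.monotone_eval_nat (by simp only [L, Val.size]; omega)
      have h5 := hQ x
      have h6 := hR x
      have h7 : (ofList (List.replicate j (Val.num 0))).size = 1 + j * 2 := by
        rw [size_ofList]; simp [Val.size]
      have h8 : Nat.size (m x - j) ≤ Nat.size (m x) := Nat.size_le_size (Nat.sub_le _ _)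
      have h9 : (φ x).size ≤ (L x 0).size := by simp only [L, Val.size]; omega
      simp only [Polynomial.eval_add, Polynomial.eval_X, Polynomial.eval_ofNat]
      simp only [Val.size] at h6
      have h10 : (L x j).size = 1 + (φ x).size + (1 + (1 + Nat.size (m x - j)) + (1 + j * 2)) := by
        simp only [L, Val.size, h7]
      omega
  have hin : Fn e φ fun x => L x 0 := Fn.id.pair (hm.pair (Fn.const 0))
  exact (hin.trans key).right.right

theorem Fn.iterate {β : X → Type} (encβ : ∀ x, β x → Val) (step : ∀ x, β x → β x)
    {b₀ : ∀ x, β x} {m : X → ℕ} (hm : Fn e φ fun x => .num (m x)) (Q : Polynomial ℕ)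
    (hQ : ∀ x, m x ≤ Q.eval ((e x).k + (φ x).size)) (h₀ : Fn e φ fun x => encβ x (b₀ x))
    (hstep : Fn (fun y : Σ x, β x => e y.1) (fun y => .pair (φ y.1) (encβ y.1 y.2))
      (fun y => encβ y.1 (step y.1 y.2)))
    (R : Polynomial ℕ) (hR : ∀ x j, j ≤ m x → (encβ x ((step x)^[j] (b₀ x))).size ≤
      R.eval ((e x).k + (φ x).size)) :
    Fn e φ fun x => encβ x ((step x)^[m x] (b₀ x)) := by
  have hfold : ∀ x (l : List Val) (b : β x), l.foldl (fun b _ => step x b) b =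
      (step x)^[l.length] b := fun x l b => List.foldl_const _ _ _
  refine (Fn.foldl (α := fun _ => Val) (fun _ v => v) encβ (fun x b _ => step x b)
    (l := fun x => List.replicate (m x) (.num 0)) (b₀ := b₀) ?_ h₀ ?_ R ?_).congr fun x => ?_
  · simpa using Fn.replicate hm Q hQ
  · exact (Fn.arg₁.pair (Fn.arg₃)).trans
      (hstep.reindex fun y : Σ x, Val × β x => ⟨y.1, y.2.2⟩)
  · intro x j
    rw [hfold]
    exact hR x _ (by simp)
  · rw [hfold]; simp

theorem Fn.eval {a : X → ℕ} (P : Polynomial ℕ) (h : Fn e φ fun x => .num (a x)) :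
    Fn e φ fun x => .num (P.eval (a x)) := by
  induction P using Polynomial.induction_on' with
  | add p q hp hq => exact (hp.add hq).congr fun x => by simp
  | monomial n c =>
    induction n with
    | zero => exact (Fn.const c).congr fun x => by simp
    | succ n ih =>
      exact (ih.mul h).congr fun x => by simp [Polynomial.eval_monomial, pow_succ, mul_assoc]

theorem Fn.two_pow {m : X → ℕ} (hm : Fn e φ fun x => .num (m x)) (Q : Polynomial ℕ)
    (hQ : ∀ x, m x ≤ Q.eval ((e x).k + (φ x).size)) :
    Fn e φ fun x => .num (2 ^ m x) := by
  have hit : ∀ j : ℕ, (fun b : ℕ => b * 2)^[j] 1 = 2 ^ j := by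
    intro j
    induction j with
    | zero => rfl
    | succ j ih => rw [Function.iterate_succ_apply', ih, pow_succ]
  refine (Fn.iterate (β := fun _ => ℕ) (fun _ b => .num b) (fun _ b => b * 2) hm Q hQ
    (Fn.const 1) ((Fn.right Fn.id).mul (Fn.const 2)) (Q + 2) ?_).congr fun x => by rw [hit]
  intro x j hj
  rw [hit]
  have := hQ x
  simp only [Val.size, Nat.size_pow, Polynomial.eval_add, Polynomial.eval_ofNat]
  omega

/-- The binary digits of a number, padded to length `k`, most significant first. -/
def binary (k n : ℕ) : List ℕ := ((fun b : ℕ × List ℕ => (b.1 / 2, (b.1 % 2) :: b.2))^[k] (n, [])).2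

theorem iterate_binary (k n : ℕ) (l : List ℕ) :
    (fun b : ℕ × List ℕ => (b.1 / 2, (b.1 % 2) :: b.2))^[k] (n, l) =
      (n / 2 ^ k, binary k n ++ l) := by
  have : ∀ k n l, (fun b : ℕ × List ℕ => (b.1 / 2, (b.1 % 2) :: b.2))^[k] (n, l) =
      (n / 2 ^ k, (((fun b : ℕ × List ℕ => (b.1 / 2, (b.1 % 2) :: b.2))^[k] (n, [])).2) ++ l) := by
    intro k
    induction k with
    | zero => simp
    | succ k ih =>
      intro n l
      rw [Function.iterate_succ_apply, Function.iterate_succ_apply, ih (n / 2) (n % 2 :: l),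
        ih (n / 2) [n % 2]]
      simp [Nat.div_div_eq_div_mul, pow_succ']
  exact this k n l

theorem binary_succ (k n : ℕ) : binary (k + 1) n = binary k (n / 2) ++ [n % 2] := by
  simp only [binary, Function.iterate_succ_apply]
  rw [iterate_binary]; rfl

theorem length_binary (k n : ℕ) : (binary k n).length = k := by
  induction k generalizing n with
  | zero => rfl
  | succ k ih => rw [binary_succ]; simp [ih]

/-- Horner's scheme. Only `k` digits are present, whence the remainder; the start value `a` is
doubled `k` times, which `Fn.groupSmul` has to compensate. -/
theorem foldl_binary (k n a : ℕ) :
    (binary k n).foldl (fun a b => 2 * a + b) a = 2 ^ k * a + n % 2 ^ k := by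
  induction k generalizing n with
  | zero => simp [binary, Nat.mod_one]
  | succ k ih =>
    rw [binary_succ, List.foldl_append, ih, List.foldl_cons, List.foldl_nil, pow_succ',
      Nat.mod_mul]
    ring

theorem Fn.binaryDigits {n : X → ℕ} (hk : Fn e φ fun x => .num (e x).k)
    (hn : Fn e φ fun x => .num (n x)) :
    Fn e φ fun x => ofList ((binary (e x).k (n x)).map .num) := by
  obtain ⟨R, hR⟩ := hn.size_le
  have h := Fn.iterate (β := fun _ => ℕ × List ℕ)
    (fun _ b => .pair (.num b.1) (ofList (b.2.map .num)))
    (fun _ b => (b.1 / 2, (b.1 % 2) :: b.2)) (b₀ := fun x => (n x, [])) hk .X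
    (fun x => by simp) (hn.pair (Fn.const 0)) ?_ (R + .X * 3 + 2) ?_
  · exact h.right
  · have h1 : Fn (fun y : (_ : X) × ℕ × List ℕ => e y.1)
      (fun y => .pair (φ y.1) (.pair (.num y.2.1) (ofList (y.2.2.map .num))))
      (fun y => .num y.2.1) := Fn.arg₂
    exact (h1.div (Fn.const 2)).pair ((h1.mod (Fn.const 2)).pair (Fn.arg₃))
  · intro x j hj
    rw [iterate_binary]
    have h1 := hR x
    have h2 : Nat.size (n x / 2 ^ j) ≤ Nat.size (n x) := Nat.size_le_size (Nat.div_le_self _ _)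
    have h3 : (ofList ((binary j (n x) ++ []).map .num)).size ≤ 1 + j * (1 + 2) := by
      refine le_trans (size_ofList_le _ 2 ?_) (by simp [length_binary])
      have : ∀ k n, ∀ b ∈ binary k n, b < 2 := by
        intro k
        induction k with
        | zero => simp [binary]
        | succ k ih =>
          intro n b hb
          rw [binary_succ, List.mem_append, List.mem_singleton] at hb
          rcases hb with hb | hb
          · exact ih _ b hb
          · omega
      intro v hv
      simp only [List.append_nil, List.mem_map] at hv
      obtain ⟨b, hb, rfl⟩ := hv
      have := Nat.size_le_size (show b ≤ 1 by have := this _ _ b hb; omega)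
      simp only [Val.size]
      simp at this
      omega
    simp only [Val.size] at h1 ⊢
    simp only [Polynomial.eval_add, Polynomial.eval_X, Polynomial.eval_mul, Polynomial.eval_ofNat]
    omega

end lists

/-! ## Group operations -/

namespace Comp

theorem Always.mono {O α : Type} {P Q : α → Prop} {m : Comp O α} (h : m.Always P)
    (hPQ : ∀ a, P a → Q a) : m.Always Q := by
  induction m with
  | ret a => exact hPQ a h
  | query o v k ih => exact fun w => ih w (h w)
  | draw n k ih => exact fun c hc => ih c (h c hc)

theorem always_bind {O α β : Type} {P : β → Prop} {m : Comp O α} {f : α → Comp O β} :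
    (m.bind f).Always P ↔ m.Always fun a => (f a).Always P := by
  induction m with
  | ret a => rfl
  | query o v k ih => exact forall_congr' ih
  | draw n k ih => exact forall₂_congr fun c _ => ih c

/-- Every computation has at least one branch. In the lemmas below this turns a step bound for
complete runs into one for their initial segments. -/
theorem Always.const {O α : Type} {p : Prop} {m : Comp O α} (h : m.Always fun _ => p) : p := by
  induction m with
  | ret a => exact h
  | query o v k ih => exact ih (.num 0) (h _)
  | draw n k ih => exact ih 0 (h 0 (by omega))

/-- Every round costs a step, so a loop that is cut off after `n` rounds costs more than `n` steps.
A loop known to stay within `B ≤ n` steps has thus ended by itself, and a larger cut-off `m` changes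
nothing. The predicate `P` carries along what is known about the result. -/
theorem always_whileLoop_of_le {O : Type} {c f c' f' : Val → Comp O (Val × ℕ)} {T : ℕ}
    (hc : ∀ v (P : Val × ℕ → Prop), (c v).Always (fun r => r.2 ≤ T ∧ P r) → (c' v).Always fun r => r.2 ≤ T ∧ P r)
    (hf : ∀ v (P : Val × ℕ → Prop), (f v).Always (fun r => r.2 ≤ T ∧ P r) → (f' v).Always fun r => r.2 ≤ T ∧ P r)
    (n m B : ℕ) (hB : B ≤ n) (hm : n ≤ m) (hT : B ≤ T) (v : Val) (P : Val × ℕ → Prop)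
    (h : (whileLoop c f n v).Always fun r => r.2 ≤ B ∧ P r) :
    (whileLoop c' f' m v).Always fun r => r.2 ≤ B ∧ P r := by
  induction n generalizing m B v P with
  | zero => exact absurd h.1 (by omega)
  | succ n ih =>
    obtain ⟨m, rfl⟩ : ∃ m', m = m' + 1 := ⟨m - 1, by omega⟩
    simp only [whileLoop, always_bind] at h ⊢
    refine (hc v _ (h.mono fun b hb => ⟨?_, hb⟩)).mono fun b hb => ?_
    · split at hb
      · have := hb.1; simp only at this; omega
      · rw [always_bind] at hb
        exact Always.const (hb.mono fun w hw => by
          rw [always_bind] at hw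
          exact Always.const (hw.mono fun u hu => by have := hu.1; simp only at this; omega))
    · obtain ⟨-, hb⟩ := hb
      split at hb
      · rw [if_pos ‹_›]; exact hb
      · rw [if_neg ‹_›, always_bind]
        rw [always_bind] at hb
        have hb' : (f v).Always fun w => w.2 ≤ T ∧ b.2 + w.2 + 1 ≤ B ∧
            (whileLoop c f n w.1).Always fun u => u.2 ≤ B - (b.2 + w.2 + 1) ∧
              (b.2 + w.2 + u.2 + 1 ≤ B ∧ P (u.1, b.2 + w.2 + u.2 + 1)) := hb.mono fun w hw => by
          rw [always_bind] at hw
          have hw2 : b.2 + w.2 + 1 ≤ B := Always.const (hw.mono fun u hu => by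
            have := hu.1; simp only at this; omega)
          refine ⟨by omega, hw2, hw.mono fun u hu => ?_⟩
          have := hu.1
          simp only at this
          exact ⟨by omega, this, hu.2⟩
        refine (hf v _ hb').mono fun w hw => ?_
        rw [always_bind]
        exact (ih m _ (by omega) (by omega) (by omega) _ _ hw.2.2).mono fun u hu => hu.2

end Comp

/-- Needed because the addition of group elements is specified for one particular cut-off, whereas
the adversary runs it with its own, larger one. -/
theorem Code.always_run_of_le {O : Type} {T N : ℕ} (hN : T ≤ N) (c : Code O) (v : Val)
    (P : Val × ℕ → Prop) (h : (c.run T v).Always fun r => r.2 ≤ T ∧ P r) :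
    (c.run N v).Always fun r => r.2 ≤ T ∧ P r := by
  induction c generalizing v P with
  | pair f g ihf ihg =>
    simp only [Code.run, Comp.always_bind] at h ⊢
    refine (ihf v _ (h.mono fun a ha => ⟨?_, ha⟩)).mono fun a ha => ?_
    · exact Comp.Always.const (ha.mono fun b hb => by have := hb.1; simp only at this; omega)
    · refine (ihg v _ (ha.2.mono fun b hb => ⟨?_, hb⟩)).mono fun b hb => hb.2
      have := hb.1; simp only at this; omega
  | seq f g ihf ihg =>
    simp only [Code.run, Comp.always_bind] at h ⊢
    refine (ihf v _ (h.mono fun a ha => ⟨?_, ha⟩)).mono fun a ha => ?_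
    · exact Comp.Always.const (ha.mono fun b hb => by have := hb.1; simp only at this; omega)
    · refine (ihg a.1 _ (ha.2.mono fun b hb => ⟨?_, hb⟩)).mono fun b hb => hb.2
      have := hb.1; simp only at this; omega
  | ite c f g ihc ihf ihg =>
    simp only [Code.run, Comp.always_bind] at h ⊢
    refine (ihc v _ (h.mono fun a ha => ⟨?_, ha⟩)).mono fun a ha => ?_
    · exact Comp.Always.const (ha.mono fun b hb => by have := hb.1; simp only at this; omega)
    · obtain ⟨-, ha⟩ := ha
      split at ha
      · rw [if_pos ‹_›]
        refine (ihg v _ (ha.mono fun b hb => ⟨?_, hb⟩)).mono fun b hb => hb.2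
        have := hb.1; simp only at this; omega
      · rw [if_neg ‹_›]
        refine (ihf v _ (ha.mono fun b hb => ⟨?_, hb⟩)).mono fun b hb => hb.2
        have := hb.1; simp only at this; omega
  | loop c f ihc ihf =>
    exact Comp.always_whileLoop_of_le ihc ihf T N T le_rfl hN le_rfl v P h
  | _ => exact h

section group

variable {𝒢 : GroupGen}

namespace Env

variable (e : Env 𝒢)

/-- The order of the group. -/
abbrev p : ℕ := 𝒢.order e.i

/-- The description of the instance. -/
abbrev inst : Val := 𝒢.inst e.k e.i

theorem prime : e.p.Prime := 𝒢.order_prime e.k e.two_le e.i e.mem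

theorem lt_two_pow : e.p < 2 ^ e.k := by
  have := 𝒢.order_size e.k e.two_le e.i e.mem
  rw [← this]; exact Nat.lt_size_self _

theorem two_pow_le : 2 ^ (e.k - 1) ≤ e.p := by
  have h := 𝒢.order_size e.k e.two_le e.i e.mem
  have := e.two_le
  exact Nat.lt_size.1 (by rw [h]; omega)

theorem order_smul (x : 𝒢.El e.i) : e.p • x = 0 := by
  have := 𝒢.card_eq e.k e.two_le e.i e.mem
  rw [Env.p, ← this, card_nsmul_eq_zero']

theorem mod_smul (c : ℕ) (x : 𝒢.El e.i) : (c % e.p) • x = c • x := by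
  conv_rhs => rw [← Nat.mod_add_div c e.p, add_smul, mul_comm, mul_smul, e.order_smul, smul_zero,
    add_zero]

/-- Otherwise `c` is coprime to the prime `p`, the order of the base point divides both, the base
point is `0`, and the group it generates would be trivial instead of having `p` elements. -/
theorem smul_base_eq_zero {c : ℕ} (h : c • 𝒢.base e.i = 0) : e.p ∣ c := by
  by_contra hc
  have hcop : Nat.Coprime c e.p := ((Nat.Prime.coprime_iff_not_dvd e.prime).2 hc).symm
  have h0 : ∀ x : 𝒢.El e.i, x = 0 := by
    have h1 : addOrderOf (𝒢.base e.i) ∣ 1 := by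
      rw [← hcop]
      exact Nat.dvd_gcd (addOrderOf_dvd_of_nsmul_eq_zero h)
        (addOrderOf_dvd_of_nsmul_eq_zero (e.order_smul _))
    rw [Nat.dvd_one, AddMonoid.addOrderOf_eq_one_iff] at h1
    intro x
    obtain ⟨c, rfl⟩ := 𝒢.base_generates e.k e.two_le e.i e.mem x
    rw [h1, smul_zero]
  have h1 := 𝒢.card_eq e.k e.two_le e.i e.mem
  have : Subsingleton (𝒢.El e.i) := ⟨fun a b => by rw [h0 a, h0 b]⟩
  rw [Nat.card_of_subsingleton (0 : 𝒢.El e.i)] at h1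
  exact e.prime.one_lt.ne h1

theorem smul_base_inj {a b : ℕ} (h : a • 𝒢.base e.i = b • 𝒢.base e.i) :
    (a : ZMod e.p) = (b : ZMod e.p) := by
  rw [ZMod.natCast_eq_natCast_iff]
  wlog hab : a ≤ b generalizing a b
  · exact (this h.symm (by omega)).symm
  rw [Nat.modEq_iff_dvd' hab]
  apply e.smul_base_eq_zero
  have : a • 𝒢.base e.i + (b - a) • 𝒢.base e.i = a • 𝒢.base e.i := by
    rw [← add_smul, Nat.add_sub_cancel' hab, h]
  simpa using this

theorem smul_base_congr {a b : ℕ} (h : (a : ZMod e.p) = (b : ZMod e.p)) :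
    a • 𝒢.base e.i = b • 𝒢.base e.i := by
  rw [ZMod.natCast_eq_natCast_iff] at h
  rw [← e.mod_smul a, ← e.mod_smul b, h]

theorem enc_inj : Function.Injective (𝒢.enc e.i) := 𝒢.enc_injective e.k e.two_le e.i e.mem

theorem dlog_point (c : ℕ) : 𝒢.dlog e.i (𝒢.point e.i c) = c % e.p := by
  have h : ∃ c', c' < 𝒢.order e.i ∧ 𝒢.point e.i c' = 𝒢.point e.i c :=
    ⟨c % e.p, Nat.mod_lt _ e.prime.pos, congrArg (𝒢.enc e.i) (e.mod_smul c _)⟩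
  rw [GroupGen.dlog, dif_pos h]
  have h1 := h.choose_spec
  have h2 := e.smul_base_inj (e.enc_inj h1.2)
  rw [ZMod.natCast_eq_natCast_iff] at h2
  rw [← h2]
  exact (Nat.mod_eq_of_lt h1.1).symm

end Env

variable {X : Type} {e : X → Env 𝒢} {φ ψ χ : X → Val}

theorem Fn.inst_k (h : Fn e φ fun x => (e x).inst) : Fn e φ fun x => .num (e x).k := h.left

theorem Fn.inst_p (h : Fn e φ fun x => (e x).inst) : Fn e φ fun x => .num (e x).p := h.right.left

theorem Fn.inst_base (h : Fn e φ fun x => (e x).inst) :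
    Fn e φ fun x => 𝒢.enc (e x).i (𝒢.base (e x).i) := h.right.right.right

theorem Fn.groupAdd {P Q : ∀ x, 𝒢.El (e x).i} (hI : Fn e φ fun x => (e x).inst)
    (hP : Fn e φ fun x => 𝒢.enc _ (P x)) (hQ : Fn e φ fun x => 𝒢.enc _ (Q x)) :
    Fn e φ fun x => 𝒢.enc _ (P x + Q x) := by
  refine (hI.right.right.left.pair (hP.pair hQ)).trans ⟨𝒢.addCode.lift, 𝒢.bound, fun x => ?_⟩
  have hk : 𝒢.bound.eval (e x.1).k ≤ 𝒢.bound.eval ((e x.1).k + ((𝒢.descr (e x.1).i).pair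
      ((𝒢.enc (e x.1).i (P x.1)).pair (𝒢.enc (e x.1).i (Q x.1)))).size) :=
    𝒢.bound.monotone_eval_nat (Nat.le_add_right _ _)
  refine ⟨fun N hN r hr => ?_, (𝒢.enc_size _ (e x.1).two_le _ (e x.1).mem _).trans hk⟩
  have h := 𝒢.addCode_spec _ (e x.1).two_le _ (e x.1).mem (P x.1) (Q x.1)
  have h' := Code.always_run_of_le (hk.trans hN) 𝒢.addCode _
    (fun r => r.1 = 𝒢.enc _ (P x.1 + Q x.1)) (h.mono fun r hr => ⟨hr.2, hr.1⟩)
  rw [Code.run_lift] at hr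
  obtain ⟨h1, h2⟩ := Comp.exec_lift_support _ _ _ h' _ r hr
  exact ⟨h1.2, h1.1.trans hk, h2⟩

theorem binary_lt_two (k n b : ℕ) (hb : b ∈ binary k n) : b < 2 := by
  induction k generalizing n with
  | zero => simp [binary] at hb
  | succ k ih =>
    rw [binary_succ, List.mem_append, List.mem_singleton] at hb
    rcases hb with hb | hb
    · exact ih _ hb
    · omega

/-- Double-and-add, started at `P` because no encoding of the neutral element is at hand. On the `k`
digits of `d` it yields `(2 ^ k + d) • P`, so `d` is taken to be `c - 2 ^ k` modulo `p`; as `d < p <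
2 ^ k`, no digit is lost. -/
theorem Fn.groupSmul {P : ∀ x, 𝒢.El (e x).i} {c : X → ℕ} (hI : Fn e φ fun x => (e x).inst)
    (hP : Fn e φ fun x => 𝒢.enc _ (P x)) (hc : Fn e φ fun x => .num (c x)) :
    Fn e φ fun x => 𝒢.enc _ (c x • P x) := by
  have hk := hI.inst_k
  have hp := hI.inst_p
  have h2k : Fn e φ fun x => .num (2 ^ (e x).k % (e x).p) :=
    (Fn.two_pow hk .X fun x => by simp).mod hp
  have hd := ((hc.add (hp.sub h2k)).mod hp)
  have hfold := Fn.foldl (α := fun _ => ℕ) (β := fun x => 𝒢.El (e x).i) (fun _ b => .num b)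
    (fun x A => 𝒢.enc (e x).i A) (fun x A b => if b = 1 then A + A + P x else A + A) (b₀ := P)
    (Fn.binaryDigits hk hd) hP ?_ 𝒢.bound ?_
  · refine hfold.congr fun x => ?_
    congr 1
    have h1 : ∀ (l : List ℕ) (a : ℕ), (∀ b ∈ l, b < 2) →
        l.foldl (fun (A : 𝒢.El (e x).i) b => if b = 1 then A + A + P x else A + A) (a • P x) =
          (l.foldl (fun a b => 2 * a + b) a) • P x := by
      intro l
      induction l with
      | nil => simp
      | cons b l ih =>
        intro a hl
        have hb := hl b (by simp)
        rw [List.foldl_cons, List.foldl_cons, ← ih _ fun b hb => hl b (by simp [hb])]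
        congr 1
        interval_cases b
        · simp [two_mul, add_smul]
        · simp [two_mul, add_smul]
    have h2 := h1 (binary (e x).k ((c x + ((e x).p - 2 ^ (e x).k % (e x).p)) % (e x).p)) 1
      (binary_lt_two _ _)
    rw [one_smul] at h2
    rw [h2, foldl_binary, ← (e x).mod_smul, mul_one]
    conv_rhs => rw [← (e x).mod_smul]
    congr 1
    have hpos := (e x).prime.pos
    have h3 : (c x + ((e x).p - 2 ^ (e x).k % (e x).p)) % (e x).p % 2 ^ (e x).k =
        (c x + ((e x).p - 2 ^ (e x).k % (e x).p)) % (e x).p :=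
      Nat.mod_eq_of_lt ((Nat.mod_lt _ hpos).trans (e x).lt_two_pow)
    rw [h3, Nat.add_mod_mod]
    have h4 := Nat.mod_lt (2 ^ (e x).k) hpos
    rw [Nat.add_mod, ← Nat.mod_mod (2 ^ (e x).k) (e x).p, ← Nat.add_mod, Nat.mod_mod,
      show 2 ^ (e x).k % (e x).p + (c x + ((e x).p - 2 ^ (e x).k % (e x).p)) = c x + (e x).p by
        omega]
    simp
  · have h1 : Fn (fun y : (x : X) × ℕ × 𝒢.El (e x).i => e y.1)
        (fun y => .pair (φ y.1) (.pair (.num y.2.1) (𝒢.enc (e y.1).i y.2.2)))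
        (fun y => 𝒢.enc (e y.1).i y.2.2) := Fn.arg₃
    have h2 := Fn.groupAdd hI.inner h1 h1
    refine (Fn.ite (c := fun y : (x : X) × ℕ × 𝒢.El (e x).i => y.2.1 = 1)
      (FnB.eq_num Fn.arg₂ (Fn.const 1)) (Fn.groupAdd hI.inner h2 hP.inner) h2).congr fun y => ?_
    split <;> rfl
  · intro x j
    exact (𝒢.enc_size _ (e x).two_le _ (e x).mem _).trans
      (𝒢.bound.monotone_eval_nat (Nat.le_add_right _ _))

/-- Square-and-multiply on the `k` digits of the exponent. With exponent `p - 2` it supplies the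
modular inverse in the extraction of the key. -/
theorem Fn.powMod {a n : X → ℕ} (hI : Fn e φ fun x => (e x).inst)
    (ha : Fn e φ fun x => .num (a x)) (hn : Fn e φ fun x => .num (n x))
    (hlt : ∀ x, n x < (e x).p) :
    Fn e φ fun x => .num (a x ^ n x % (e x).p) := by
  have hk := hI.inst_k
  have hp := hI.inst_p
  have hfold := Fn.foldl (α := fun _ => ℕ) (β := fun x => ℕ) (fun _ b => .num b)
    (fun x A => .num A) (fun x A b => if b = 1 then A * A * a x % (e x).p else A * A % (e x).p)
    (b₀ := fun x => 1 % (e x).p)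
    (Fn.binaryDigits hk hn) ((Fn.const 1).mod hp) ?_ (.X + 1) ?_
  · refine hfold.congr fun x => ?_
    congr 1
    have h1 : ∀ (l : List ℕ) (m : ℕ), (∀ b ∈ l, b < 2) →
        l.foldl (fun A b => if b = 1 then A * A * a x % (e x).p else A * A % (e x).p)
          (a x ^ m % (e x).p) = a x ^ (l.foldl (fun a b => 2 * a + b) m) % (e x).p := by
      intro l
      induction l with
      | nil => simp
      | cons b l ih =>
        intro m hl
        have hb := hl b (by simp)
        rw [List.foldl_cons, List.foldl_cons, ← ih _ fun b hb => hl b (by simp [hb])]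
        congr 1
        interval_cases b
        · simp [two_mul, pow_add, Nat.mul_mod]
        · simp [two_mul, pow_add, Nat.mul_mod]
    have h2 := h1 (binary (e x).k (n x)) 0 (binary_lt_two _ _)
    rw [pow_zero] at h2
    rw [h2, foldl_binary, mul_zero, zero_add, Nat.mod_eq_of_lt ((hlt x).trans (e x).lt_two_pow)]
  · have h1 : Fn (fun y : (_ : X) × ℕ × ℕ => e y.1)
        (fun y => .pair (φ y.1) (.pair (.num y.2.1) (.num y.2.2)))
        (fun y => .num y.2.2) := Fn.arg₃
    refine (Fn.ite (c := fun y : (_ : X) × ℕ × ℕ => y.2.1 = 1)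
      (FnB.eq_num Fn.arg₂ (Fn.const 1)) (((h1.mul h1).mul ha.inner).mod hp.inner)
        ((h1.mul h1).mod hp.inner)).congr fun y => ?_
    split <;> rfl
  · intro x j
    have : ∀ (l : List ℕ) (m : ℕ), m < (e x).p →
        l.foldl (fun A b => if b = 1 then A * A * a x % (e x).p else A * A % (e x).p) m <
          (e x).p := by
      intro l
      induction l with
      | nil => simp
      | cons b l ih =>
        intro m hm
        rw [List.foldl_cons]
        apply ih
        split <;> exact Nat.mod_lt _ (e x).prime.pos
    have h1 := Nat.size_le_size
      (this ((binary (e x).k (n x)).take j) (1 % (e x).p) (Nat.mod_lt _ (e x).prime.pos)).le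
    rw [𝒢.order_size _ (e x).two_le _ (e x).mem] at h1
    simp only [Val.size, Polynomial.eval_add, Polynomial.eval_X, Polynomial.eval_one]
    omega

/-- One more query to the discrete logarithm oracle. -/
def DLState.tick (s : DLState) : DLState := { s with dlogQueries := s.dlogQueries + 1 }

/-- The continuation sees the answer next to the old context `φ x`, so that a query can be placed
anywhere in a longer action while its counter is tracked. The answer is below `p` even for a value
that encodes no group element, which bounds its size. -/
theorem Act.dlog {q : X → Val} {s s' : X → DLState} (hq : Fn e φ q)
    (h : Act e (fun x => .pair (φ x) (.num (𝒢.dlog (e x).i (q x)))) (fun x => (s x).tick) ψ s') :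
    Act e φ s ψ s' := by
  have h1 : Act e (fun x => .pair (φ x) (q x)) s
      (fun x => .pair (φ x) (.num (𝒢.dlog (e x).i (q x)))) (fun x => (s x).tick) := by
    refine ⟨.pair .fst (.seq .snd (.call .dlog)), .X + .X + .X + .X + 10, fun x => ?_⟩
    have h2 : 𝒢.dlog (e x).i (q x) < 2 ^ (e x).k := by
      refine lt_of_lt_of_le ?_ (e x).lt_two_pow.le
      unfold GroupGen.dlog
      split
      · rename_i h; exact h.choose_spec.1
      · exact (e x).prime.pos
    rw [← Nat.size_le] at h2
    refine ⟨fun N _ r hr => ?_, ?_⟩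
    · simp only [Code.run, Comp.bind, Comp.exec, dlOracle, PMF.pure_bind, PMF.mem_support_pure_iff]
        at hr
      subst hr
      refine ⟨rfl, ?_, rfl⟩
      simp only [Val.size, Polynomial.eval_add, Polynomial.eval_X, Polynomial.eval_ofNat]
      omega
    · simp only [Val.size, Polynomial.eval_add, Polynomial.eval_X, Polynomial.eval_ofNat]
      omega
  exact ((Fn.id.pair hq).act s).seq (h1.seq h)

end group

/-! ## Simulation of programs -/

namespace Comp

/-- Run a computation against deterministic oracles and coins. -/
def det {O α S : Type} (D : O → S → Val → Val × S) (R : ℕ → S → ℕ × S) : Comp O α → S → α × S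
  | ret a, s => (a, s)
  | query o v k, s => (k (D o s v).1).det D R (D o s v).2
  | draw n k, s => (k (R n s).1).det D R (R n s).2

theorem det_bind {O α β S : Type} (D : O → S → Val → Val × S) (R : ℕ → S → ℕ × S)
    (m : Comp O α) (f : α → Comp O β) (s : S) :
    (m.bind f).det D R s = (f (m.det D R s).1).det D R (m.det D R s).2 := by
  induction m generalizing s with
  | ret a => rfl
  | query o v k ih => exact ih _ _
  | draw n k ih => exact ih _ _

end Comp

/-- What the instruction `rand` does with deterministic coins. -/
def drawVal {S : Type} (R : ℕ → S → ℕ × S) (s : S) : Val → Val × S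
  | .num n => (.num (R n s).1, (R n s).2)
  | .pair _ _ => (.num 0, s)

/-- Deterministic oracles for programs with oracles in `O`, with states in `S`, that are
implemented by polynomial-time programs with access to the discrete logarithm oracle. -/
structure Simulator {𝒢 : GroupGen} {X : Type} (e : X → Env 𝒢) (O S : Type) where
  answer : X → O → S → Val → Val × S
  coin : X → ℕ → S → ℕ × S
  enc : X → S → Val
  dl : X → S → DLState
  Valid : X → S → Prop
  growth : Polynomial ℕ
  answer_act : ∀ o, Act (fun y : {y : X × S × Val // Valid y.1 y.2.1} => e y.1.1)
    (fun y => .pair y.1.2.2 (enc y.1.1 y.1.2.1)) (fun y => dl y.1.1 y.1.2.1)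
    (fun y => .pair (answer y.1.1 o y.1.2.1 y.1.2.2).1
      (enc y.1.1 (answer y.1.1 o y.1.2.1 y.1.2.2).2))
    (fun y => dl y.1.1 (answer y.1.1 o y.1.2.1 y.1.2.2).2)
  coin_act : Act (fun y : {y : X × S × Val // Valid y.1 y.2.1} => e y.1.1)
    (fun y => .pair y.1.2.2 (enc y.1.1 y.1.2.1)) (fun y => dl y.1.1 y.1.2.1)
    (fun y => .pair (drawVal (coin y.1.1) y.1.2.1 y.1.2.2).1
      (enc y.1.1 (drawVal (coin y.1.1) y.1.2.1 y.1.2.2).2))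
    (fun y => dl y.1.1 (drawVal (coin y.1.1) y.1.2.1 y.1.2.2).2)
  answer_valid : ∀ x o s v, Valid x s → Valid x (answer x o s v).2
  coin_valid : ∀ x n s, Valid x s → Valid x (coin x n s).2
  coin_le : ∀ x n s, (coin x n s).1 ≤ n
  answer_size : ∀ x o s v, Valid x s → (enc x (answer x o s v).2).size ≤
    (enc x s).size + growth.eval (e x).k * (1 + v.size)
  coin_size : ∀ x n s, Valid x s → (enc x (coin x n s).2).size ≤
    (enc x s).size + growth.eval (e x).k

namespace Simulator

variable {𝒢 : GroupGen} {X : Type} {e : X → Env 𝒢} {O S : Type} (M : Simulator e O S)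

/-- A bound for the number of steps that simulate one step. -/
def slowdown (P : Polynomial ℕ) (x : X) (B : ℕ) : ℕ := P.eval ((e x).k + (2 * B + 1)) + B + 1

/-- The program `c'` simulates `c`. -/
def Simulates (P : Polynomial ℕ) (c : Code O) (c' : Code DLOracle) (C : ℕ) : Prop :=
  ∀ x N N' B G W v s a t s', G = M.growth.eval (e x).k → W = slowdown (e := e) P x B →
    M.Valid x s → (c.run N v).det (M.answer x) (M.coin x) s = ((a, t), s') → t ≤ N →
    (M.enc x s).size + G * t ≤ B → t ≤ B → C * t * W ≤ N' →
    Yields (e x) (c'.run N' (.pair v (M.enc x s))) (M.dl x s) (.pair a (M.enc x s')) (M.dl x s')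
      (C * t * W) ∧
    M.Valid x s' ∧ a.size ≤ C * t ∧ 1 + v.size ≤ t ∧
    (M.enc x s').size ≤ (M.enc x s).size + G * t

variable {M} {P : Polynomial ℕ}

theorem lt_slowdown (x : X) (B : ℕ) : B + 1 ≤ slowdown (e := e) P x B := by
  unfold slowdown; omega

/-- This is `(t - 1) * (W - 1) ≥ 0`. -/
theorem add_le_mul_add_one {t W : ℕ} (ht : 1 ≤ t) (hW : 1 ≤ W) : t + W ≤ t * W + 1 := by
  obtain ⟨t, rfl⟩ := Nat.exists_eq_add_of_le ht
  obtain ⟨W, rfl⟩ := Nat.exists_eq_add_of_le hW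
  nlinarith [Nat.zero_le (t * W)]

theorem simulates_atomic {c : Code O} {d : Code DLOracle} {f : Val → Val} (D : ℕ)
    (hc : ∀ N v, c.run N v = .ret (f v, 1 + v.size))
    (hd : ∀ N v, d.run N v = .ret (f v, 1 + v.size))
    (hf : ∀ v, (f v).size ≤ D + v.size) :
    M.Simulates P c (.pair (.seq .fst d) .snd) (10 + D) := by
  intro x N N' B G W v s a t s' hG hW hV hr htN hB htB hN'
  rw [hc] at hr
  simp only [Comp.det, Prod.mk.injEq] at hr
  obtain ⟨⟨rfl, rfl⟩, rfl⟩ := hr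
  have hW' : B + 1 ≤ W := hW ▸ lt_slowdown (P := P) (e := e) x B
  have htW := add_le_mul_add_one (t := 1 + v.size) (by omega) (show 1 ≤ W by omega)
  refine ⟨?_, hV, ?_, le_rfl, by omega⟩
  · simp only [Code.run, Comp.bind, hd]
    refine Yields.ret ?_
    simp only [Val.size]
    rw [mul_assoc]
    have : 10 * ((1 + v.size) * W) ≤ (10 + D) * ((1 + v.size) * W) :=
      Nat.mul_le_mul_right _ (by omega)
    omega
  · have := hf v
    nlinarith [Nat.zero_le (D * v.size)]

theorem simulates_seq {f g : Code O} {f' g' : Code DLOracle} {C C' : ℕ}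
    (hf : M.Simulates P f f' C) (hg : M.Simulates P g g' C') :
    M.Simulates P (.seq f g) (.seq f' g') (C + C' + 1) := by
  intro x N N' B G W v s a t s' hG hW hV hr htN hB htB hN'
  rcases h1 : (f.run N v).det (M.answer x) (M.coin x) s with ⟨⟨a1, t1⟩, s1⟩
  rcases h2 : (g.run N a1).det (M.answer x) (M.coin x) s1 with ⟨⟨a2, t2⟩, s2⟩
  simp only [Code.run, Comp.det_bind, h1, h2, Comp.det, Prod.mk.injEq] at hr
  obtain ⟨⟨rfl, rfl⟩, rfl⟩ := hr
  have e1 : (C + C' + 1) * (t1 + t2 + 1) * W = C * t1 * W + C' * t2 * W + (C * t2 * W +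
    C' * t1 * W + t1 * W + t2 * W + C * W + C' * W + W) := by ring
  have e2 : G * (t1 + t2 + 1) = G * t1 + G * t2 + G := by ring
  have hW' : B + 1 ≤ W := hW ▸ lt_slowdown (P := P) (e := e) x B
  obtain ⟨y1, V1, z1, l1, q1⟩ := hf x N N' B G W v s a1 t1 s1 hG hW hV h1 (by omega) (by omega) (by omega)
    (by omega)
  obtain ⟨y2, V2, z2, l2, q2⟩ := hg x N N' B G W a1 s1 a2 t2 s2 hG hW V1 h2 (by omega) (by omega) (by omega)
    (by omega)
  refine ⟨?_, V2, ?_, by omega, by omega⟩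
  · refine y1.bind fun t ht => y2.bind fun t' ht' => Yields.ret ?_
    simp only
    omega
  · refine z2.trans ?_
    exact Nat.mul_le_mul (by omega) (by omega)

/-- The encoded oracle state is threaded through both components: `(v, E)` becomes `(v, (a₁, E₁))`,
then `(a₁, (a₂, E₂))`, then `((a₁, a₂), E₂)`. The large constants pay for this rearranging. -/
theorem simulates_pair {f g : Code O} {f' g' : Code DLOracle} {C C' : ℕ}
    (hf : M.Simulates P f f' C) (hg : M.Simulates P g g' C') :
    M.Simulates P (.pair f g) (.seq (.pair .fst f') (.seq (.pair (.seq .snd .fst)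
      (.seq (.pair .fst (.seq .snd .snd)) g')) (.pair (.pair .fst (.seq .snd .fst))
        (.seq .snd .snd)))) (20 * (C + C') + 200) := by
  intro x N N' B G W v s a t s' hG hW hV hr htN hB htB hN'
  rcases h1 : (f.run N v).det (M.answer x) (M.coin x) s with ⟨⟨a1, t1⟩, s1⟩
  rcases h2 : (g.run N v).det (M.answer x) (M.coin x) s1 with ⟨⟨a2, t2⟩, s2⟩
  simp only [Code.run, Comp.det_bind, h1, h2, Comp.det, Prod.mk.injEq] at hr
  obtain ⟨⟨rfl, rfl⟩, rfl⟩ := hr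
  have e1 : (20 * (C + C') + 200) * (t1 + t2 + 1) * W = 20 * (C * t1 * W) + 20 * (C' * t2 * W) +
    200 * (t1 * W) + 200 * (t2 * W) + 200 * W + 20 * (C * t2 * W +
    C' * t1 * W + C * W + C' * W) := by ring
  have e2 : G * (t1 + t2 + 1) = G * t1 + G * t2 + G := by ring
  have hW' : B + 1 ≤ W := hW ▸ lt_slowdown (P := P) (e := e) x B
  obtain ⟨y1, V1, z1, l1, q1⟩ := hf x N N' B G W v s a1 t1 s1 hG hW hV h1 (by omega) (by omega) (by omega)
    (by omega)
  obtain ⟨y2, V2, z2, l2, q2⟩ := hg x N N' B G W v s1 a2 t2 s2 hG hW V1 h2 (by omega) (by omega) (by omega)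
    (by omega)
  have z1' : C * t1 ≤ C * t1 * W := Nat.le_mul_of_pos_right _ (by omega)
  have z2' : C' * t2 ≤ C' * t2 * W := Nat.le_mul_of_pos_right _ (by omega)
  refine ⟨?_, V2, ?_, by omega, by omega⟩
  · simp only [Code.run, Comp.bind]
    refine Yields.bind (z := .pair v (.pair a1 (M.enc x s1))) (s' := M.dl x s1)
      (B := C * t1 * W + 1 + (1 + (1 + v.size + (M.enc x s).size))) ?_ fun r hr => ?_
    · refine y1.bind fun t ht => Yields.ret ?_
      simp only [Val.size]; omega
    refine Yields.bind (z := .pair (.pair a1 a2) (M.enc x s2)) (s' := M.dl x s2)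
      (B := C' * t2 * W + 60 + 12 * (v.size + a1.size + a2.size + (M.enc x s1).size +
        (M.enc x s2).size)) ?_ fun r' hr' => ?_
    · refine Yields.bind (z := .pair a1 (.pair a2 (M.enc x s2))) (s' := M.dl x s2)
        (B := C' * t2 * W + 40 + 6 * (v.size + a1.size + (M.enc x s1).size))
        ?_ fun r' hr' => ?_
      · refine Yields.bind (z := .pair a2 (M.enc x s2)) (s' := M.dl x s2)
          (B := C' * t2 * W + 20 + 4 * (v.size + a1.size + (M.enc x s1).size))
          ?_ fun r' hr' => ?_
        · refine y2.bind fun t ht => Yields.ret ?_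
          simp only [Val.size]; omega
        · refine Yields.ret ?_
          simp only [Val.size]; omega
      · refine Yields.ret ?_
        simp only [Val.size]; omega
    · refine Yields.ret ?_
      simp only; omega
  · simp only [Val.size]
    have e3 : (20 * (C + C') + 200) * (t1 + t2 + 1) = C * t1 + C' * t2 + (19 * (C * t1) +
      19 * (C' * t2) + 200 * t1 + 200 * t2 + 200 + 20 * (C * t2 + C' * t1 + C + C')) := by ring
    omega

theorem simulates_ite {c f g : Code O} {c' f' g' : Code DLOracle} {C₀ C C' : ℕ}
    (hc : M.Simulates P c c' C₀) (hf : M.Simulates P f f' C) (hg : M.Simulates P g g' C') :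
    M.Simulates P (.ite c f g) (.seq (.pair .fst c') (.ite (.seq .snd .fst)
      (.seq (.pair .fst (.seq .snd .snd)) f') (.seq (.pair .fst (.seq .snd .snd)) g')))
        (20 * (C₀ + C + C') + 100) := by
  intro x N N' B G W v s a t s' hG hW hV hr htN hB htB hN'
  rcases h1 : (c.run N v).det (M.answer x) (M.coin x) s with ⟨⟨a1, t1⟩, s1⟩
  rcases h2 : ((if a1 = .num 0 then g.run N v else f.run N v)).det (M.answer x) (M.coin x) s1
    with ⟨⟨a2, t2⟩, s2⟩
  simp only [Code.run, Comp.det_bind, h1, h2, Comp.det, Prod.mk.injEq] at hr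
  obtain ⟨⟨rfl, rfl⟩, rfl⟩ := hr
  have e1 : (20 * (C₀ + C + C') + 100) * (t1 + t2 + 1) * W = 20 * (C₀ * t1 * W) +
    20 * (C * t2 * W) + 20 * (C' * t2 * W) +
    100 * (t1 * W) + 100 * (t2 * W) + 100 * W + 20 * (C₀ * t2 * W +
    C * t1 * W + C' * t1 * W + C₀ * W + C * W + C' * W) := by ring
  have e2 : G * (t1 + t2 + 1) = G * t1 + G * t2 + G := by ring
  have hW' : B + 1 ≤ W := hW ▸ lt_slowdown (P := P) (e := e) x B
  obtain ⟨y1, V1, z1, l1, q1⟩ := hc x N N' B G W v s a1 t1 s1 hG hW hV h1 (by omega) (by omega) (by omega)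
    (by omega)
  have z1' : C₀ * t1 ≤ C₀ * t1 * W := Nat.le_mul_of_pos_right _ (by omega)
  have hsub : Yields (e x) (if a1 = .num 0 then g'.run N' (.pair v (M.enc x s1)) else
      f'.run N' (.pair v (M.enc x s1))) (M.dl x s1) (.pair a2 (M.enc x s2)) (M.dl x s2)
        (C * t2 * W + C' * t2 * W) ∧ M.Valid x s2 ∧ a2.size ≤ (C + C') * t2 ∧ 1 + v.size ≤ t2 ∧
      (M.enc x s2).size ≤ (M.enc x s1).size + G * t2 := by
    split at h2
    · rw [if_pos ‹_›]
      obtain ⟨y2, V2, z2, l2, q2⟩ := hg x N N' B G W v s1 a2 t2 s2 hG hW V1 h2 (by omega) (by omega)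
        (by omega) (by omega)
      exact ⟨y2.mono (by omega), V2, z2.trans (Nat.mul_le_mul_right _ (by omega)), l2, q2⟩
    · rw [if_neg ‹_›]
      obtain ⟨y2, V2, z2, l2, q2⟩ := hf x N N' B G W v s1 a2 t2 s2 hG hW V1 h2 (by omega) (by omega)
        (by omega) (by omega)
      exact ⟨y2.mono (by omega), V2, z2.trans (Nat.mul_le_mul_right _ (by omega)), l2, q2⟩
  obtain ⟨y2, V2, z2, l2, q2⟩ := hsub
  refine ⟨?_, V2, z2.trans (Nat.mul_le_mul (by omega) (by omega)), by omega, by omega⟩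
  simp only [Code.run, Comp.bind]
  refine Yields.bind (z := .pair v (.pair a1 (M.enc x s1))) (s' := M.dl x s1)
    (B := C₀ * t1 * W + 1 + (1 + (1 + v.size + (M.enc x s).size))) ?_ fun r hr => ?_
  · refine y1.bind fun t ht => Yields.ret ?_
    simp only [Val.size]; omega
  refine Yields.bind (z := .pair a2 (M.enc x s2)) (s' := M.dl x s2)
    (B := C * t2 * W + C' * t2 * W + 30 + 10 * (v.size + a1.size + (M.enc x s1).size))
    ?_ fun r' hr' => ?_
  · refine Yields.bind (z := .pair a2 (M.enc x s2)) (s' := M.dl x s2)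
      (B := C * t2 * W + C' * t2 * W + 15 + 5 * (v.size + a1.size + (M.enc x s1).size))
      ?_ fun r' hr' => ?_
    · split at y2
      · rw [if_pos ‹_›]
        refine y2.bind fun t ht => Yields.ret ?_
        simp only [Val.size]; omega
      · rw [if_neg ‹_›]
        refine y2.bind fun t ht => Yields.ret ?_
        simp only [Val.size]; omega
    · refine Yields.ret ?_
      simp only [Val.size]; omega
  · refine Yields.ret ?_
    simp only; omega

/-- Evaluate a simulated loop condition, given by `c'`, in front of the current value. -/
def evalCond (c' : Code DLOracle) : Code DLOracle :=
  .seq (.pair .fst c') (.pair (.seq .snd .fst) (.pair .fst (.seq .snd .snd)))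

theorem yields_evalCond {c' : Code DLOracle} {x : X} {N' : ℕ} {v a E E1 : Val}
    {s s1 : DLState} {K : ℕ} (h : Yields (e x) (c'.run N' (.pair v E)) s (.pair a E1) s1 K) :
    Yields (e x) ((evalCond c').run N' (.pair v E)) s (.pair a (.pair v E1)) s1
      (K + 30 + 10 * (v.size + a.size + E.size + E1.size)) := by
  simp only [evalCond, Code.run, Comp.bind]
  refine Yields.bind (z := .pair v (.pair a E1)) (s' := s1)
    (B := K + 1 + (1 + (1 + v.size + E.size))) ?_ fun r hr => ?_
  · refine h.bind fun t ht => Yields.ret ?_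
    simp only [Val.size]; omega
  · refine Yields.ret ?_
    simp only [Val.size]; omega

/-- A simulated condition may change the encoded oracle state, but the value produced by the test of
a while loop is thrown away. So the condition is evaluated once before the loop and again at the end
of each body, and the test of the simulating loop merely reads off the stored truth value. -/
theorem simulates_loop {c f : Code O} {c' f' : Code DLOracle} {C C' : ℕ}
    (hc : M.Simulates P c c' C) (hf : M.Simulates P f f' C') :
    M.Simulates P (.loop c f) (.seq (evalCond c') (.seq (.loop .fst (.seq .snd (.seq f'
      (evalCond c')))) .snd)) (100 * (C + C') + 500) := by
  -- The first condition, with its `t1` steps, has been evaluated before the loop starts, so the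
  -- loop itself has to account for `t - t1` steps. These also bound the number of its rounds,
  -- whence `t ≤ m + t1`.
  have key : ∀ x N N' B G W (D : ℕ), G = M.growth.eval (e x).k → W = slowdown (e := e) P x B →
      D = 50 * (C + C') + 200 → ∀ n m v s a t s' b t1 s1, M.Valid x s →
      (Comp.whileLoop (c.run N) (f.run N) n v).det (M.answer x) (M.coin x) s = ((a, t), s') →
      (c.run N v).det (M.answer x) (M.coin x) s = ((b, t1), s1) →
      t ≤ n → t ≤ N → (M.enc x s).size + G * t ≤ B → t ≤ B →
      2 * D * t * W ≤ N' → t ≤ m + t1 →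
      t1 < t ∧ a.size ≤ t ∧ M.Valid x s' ∧ 1 + v.size ≤ t ∧ b.size ≤ C * t1 ∧
      (M.enc x s').size ≤ (M.enc x s).size + G * t ∧
      Yields (e x) (Comp.whileLoop (Code.run N' .fst) (Code.run N' (.seq .snd (.seq f'
        (evalCond c')))) m (.pair b (.pair v (M.enc x s1)))) (M.dl x s1)
          (.pair (.num 0) (.pair a (M.enc x s'))) (M.dl x s')
          (D * (t - t1) * W) := by
    intro x N N' B G W D hG hW hD n
    have hW' : B + 1 ≤ W := hW ▸ lt_slowdown (P := P) (e := e) x B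
    induction n with
    | zero =>
      intro m v s a t s' b t1 s1 hV hr hc1 htn
      simp only [Comp.whileLoop, Comp.det, Prod.mk.injEq] at hr
      omega
    | succ n ih =>
      intro m v s a t s' b t1 s1 hV hr hc1 htn htN hB htB hN' htm
      simp only [Comp.whileLoop, Comp.det_bind, hc1] at hr
      have hDC : C ≤ D := by omega
      have hDC' : C' ≤ D := by omega
      split at hr
      · rename_i hb
        simp only [Comp.det, Prod.mk.injEq] at hr
        obtain ⟨⟨rfl, rfl⟩, rfl⟩ := hr
        have e2 : G * (t1 + 1) = G * t1 + G := by ring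
        have e3 : 2 * D * (t1 + 1) * W = 2 * (D * t1 * W) + 2 * (D * W) := by ring
        have i1 : C * t1 * W ≤ D * t1 * W := by gcongr
        obtain ⟨y1, V1, z1, l1, q1⟩ := hc x N N' B G W v s b t1 s1 hG hW hV hc1 (by omega) (by omega)
          (by omega) (by omega)
        refine ⟨by omega, by omega, V1, by omega, z1, by omega, ?_⟩
        obtain ⟨m, rfl⟩ : ∃ m', m = m' + 1 := ⟨m - 1, by omega⟩
        simp only [Comp.whileLoop, Code.run, Comp.bind, hb, if_true]
        refine Yields.ret ?_
        simp only [Val.size, Nat.size_zero, Nat.add_sub_cancel_left, mul_one]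
        have i2 : 200 * W ≤ D * W := Nat.mul_le_mul_right _ (by omega)
        omega
      · rename_i hb
        rcases h2 : (f.run N v).det (M.answer x) (M.coin x) s1 with ⟨⟨w, t2⟩, s2⟩
        rcases h3 : (Comp.whileLoop (c.run N) (f.run N) n w).det (M.answer x) (M.coin x) s2 with
          ⟨⟨u, t3⟩, s3⟩
        rcases h4 : (c.run N w).det (M.answer x) (M.coin x) s2 with ⟨⟨b', t4⟩, s4⟩
        simp only [Comp.det_bind, h2, h3, Comp.det, Prod.mk.injEq] at hr
        obtain ⟨⟨rfl, rfl⟩, rfl⟩ := hr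
        have e2 : G * (t1 + t2 + t3 + 1) = G * t1 + G * t2 + G * t3 + G := by ring
        have e3 : 2 * D * (t1 + t2 + t3 + 1) * W = 2 * (D * t1 * W) + 2 * (D * t2 * W) +
          2 * D * t3 * W + 2 * (D * W) := by ring
        have i1 : C * t1 * W ≤ D * t1 * W := by gcongr
        have i2 : C' * t2 * W ≤ D * t2 * W := by gcongr
        obtain ⟨y1, V1, z1, l1, q1⟩ := hc x N N' B G W v s b t1 s1 hG hW hV hc1 (by omega) (by omega)
          (by omega) (by omega)
        obtain ⟨y2, V2, z2, l2, q2⟩ := hf x N N' B G W v s1 w t2 s2 hG hW V1 h2 (by omega) (by omega)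
          (by omega) (by omega)
        obtain ⟨m, rfl⟩ : ∃ m', m = m' + 1 := ⟨m - 1, by omega⟩
        have ih' := ih m w s2 u t3 s3 b' t4 s4 V2 h3 h4 (by omega) (by omega) (by omega)
          (by omega) (by omega)
        have e5 : 2 * D * t3 * W = D * t3 * W + D * t3 * W := by ring
        by_cases ht4 : t4 < t3
        · have i3 : D * t4 * W ≤ D * t3 * W := by gcongr
          have i3' : C * t4 * W ≤ D * t4 * W := by gcongr
          have i4 : G * t4 ≤ G * t3 := by gcongr
          obtain ⟨y4, V4, z4, l4, q4⟩ := hc x N N' B G W w s2 b' t4 s4 hG hW V2 h4 (by omega) (by omega)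
            (by omega) (by omega)
          obtain ⟨-, j1, j2, j3, j4, j5, j6⟩ := ih' (by omega)
          refine ⟨by omega, by omega, j2, by omega, z1, by omega, ?_⟩
          have e4 : D * (t1 + t2 + t3 + 1 - t1) * W = D * t2 * W + (D * t4 * W +
              D * (t3 - t4) * W) + D * W := by
            rw [show t1 + t2 + t3 + 1 - t1 = t2 + (t4 + (t3 - t4)) + 1 by omega]; ring
          have i5 : C * t1 ≤ C * W := Nat.mul_le_mul_left _ (by omega)
          have i6 : C * t4 ≤ C * W := Nat.mul_le_mul_left _ (by omega)
          have i7 : C' * t2 ≤ C' * W := Nat.mul_le_mul_left _ (by omega)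
          have e6 : D * W = 50 * (C * W) + 50 * (C' * W) + 200 * W := by rw [hD]; ring
          rw [Comp.whileLoop]
          refine Yields.bind (z := b) (s' := M.dl x s1)
            (B := 3 + b.size + v.size + (M.enc x s1).size) ?_ fun r hr => ?_
          · exact Yields.ret (by simp only [Val.size]; omega)
          simp only [hb, if_false]
          refine Yields.bind (z := .pair b' (.pair w (M.enc x s4))) (s' := M.dl x s4)
            (B := (C' * t2 * W + (C * t4 * W + 30 + 10 * (w.size + b'.size + (M.enc x s2).size +
              (M.enc x s4).size)) + 1) + (4 + b.size + v.size + (M.enc x s1).size))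
              ?_ fun r' hr' => ?_
          · simp only [Code.run, Comp.bind]
            refine Yields.bind (z := .pair b' (.pair w (M.enc x s4))) (s' := M.dl x s4)
              (B := C' * t2 * W + (C * t4 * W + 30 + 10 * (w.size + b'.size + (M.enc x s2).size +
                (M.enc x s4).size)) + 1) ?_ fun r' hr' => ?_
            · refine y2.bind fun r' hr' => ?_
              refine (yields_evalCond y4).bind fun r'' hr'' => ?_
              exact Yields.ret (by simp only; omega)
            · exact Yields.ret (by simp only [Val.size]; omega)
          · refine j6.bind fun r'' hr'' => ?_
            refine Yields.ret ?_
            simp only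
            omega
        · exact absurd (ih' (by omega)).1 ht4
  intro x N N' B G W v s a t s' hG hW hV hr htN hB htB hN'
  have hW' : B + 1 ≤ W := hW ▸ lt_slowdown (P := P) (e := e) x B
  rcases h1 : (c.run N v).det (M.answer x) (M.coin x) s with ⟨⟨b, t1⟩, s1⟩
  have ht0 : t ≤ (100 * (C + C') + 500) * t * W := by
    rw [mul_assoc]
    refine le_trans ?_ (Nat.mul_le_mul_right _ (show 1 ≤ 100 * (C + C') + 500 by omega))
    rw [one_mul]
    exact Nat.le_mul_of_pos_right _ (by omega)
  obtain ⟨k1, k2, k3, k4, k5, k6, k7⟩ := key x N N' B G W _ hG hW rfl N N' v s a t s' b t1 s1 hV hr h1 htN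
    htN hB htB (le_trans (by gcongr; omega) hN') (by omega)
  have i4 : G * t1 ≤ G * t := by gcongr
  have e1 : (100 * (C + C') + 500) * t * W = 100 * (C * t * W) + 100 * (C' * t * W) +
    500 * (t * W) := by ring
  have e2 : (50 * (C + C') + 200) * (t - t1) * W ≤ (50 * (C + C') + 200) * t * W := by
    gcongr; omega
  have e3 : (50 * (C + C') + 200) * t * W = 50 * (C * t * W) + 50 * (C' * t * W) +
    200 * (t * W) := by ring
  have i1 : C * t1 * W ≤ C * t * W := by gcongr
  have i2 : C * t1 ≤ C * t1 * W := Nat.le_mul_of_pos_right _ (by omega)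
  have i3 : W ≤ t * W := Nat.le_mul_of_pos_left _ (by omega)
  obtain ⟨y1, V1, z1, l1, q1⟩ := hc x N N' B G W v s b t1 s1 hG hW hV h1 (by omega) (by omega) (by omega)
    (by omega)
  refine ⟨?_, k3, ?_, k4, k6⟩
  · simp only [Code.run, Comp.bind]
    refine (yields_evalCond y1).bind fun r hr => ?_
    refine Yields.bind (z := .pair a (M.enc x s')) (s' := M.dl x s')
      (B := (50 * (C + C') + 200) * (t - t1) * W + 10 + a.size + (M.enc x s').size)
      ?_ fun r' hr' => ?_
    · refine k7.bind fun r' hr' => ?_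
      refine Yields.ret ?_
      simp only [Val.size, Nat.size_zero]; omega
    · refine Yields.ret ?_
      simp only; omega
  · exact k2.trans (Nat.le_mul_of_pos_left _ (by omega))

/-- The argument of `P` in `slowdown` is made for this: the value and the encoded state have size at
most `B` each, and pairing adds one. The steps `t` exceed the size of the request, so they also pay
for the growth of the state. -/
theorem simulates_oracle {c : Code O} {d : Code DLOracle} {Q : Polynomial ℕ}
    {f : X → S → Val → Val × S}
    (hQ : Performs (fun y : {y : X × S × Val // M.Valid y.1 y.2.1} => e y.1.1) d Q
      (fun y => .pair y.1.2.2 (M.enc y.1.1 y.1.2.1)) (fun y => M.dl y.1.1 y.1.2.1)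
      (fun y => .pair (f y.1.1 y.1.2.1 y.1.2.2).1 (M.enc y.1.1 (f y.1.1 y.1.2.1 y.1.2.2).2))
      (fun y => M.dl y.1.1 (f y.1.1 y.1.2.1 y.1.2.2).2))
    (hle : ∀ n, Q.eval n ≤ P.eval n)
    (hV : ∀ x s v, M.Valid x s → M.Valid x (f x s v).2)
    (hs : ∀ x s v, M.Valid x s → (M.enc x (f x s v).2).size ≤
      (M.enc x s).size + M.growth.eval (e x).k * (1 + v.size))
    (hc : ∀ x N v s, ∃ t, (c.run N v).det (M.answer x) (M.coin x) s =
      (((f x s v).1, t), (f x s v).2) ∧ 1 + v.size ≤ t ∧ (f x s v).1.size ≤ 2 * t) :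
    M.Simulates P c d 2 := by
  intro x N N' B G W v s a t s' hG hW hVs hr htN hB htB hN'
  obtain ⟨t', h1, h2, h3⟩ := hc x N v s
  rw [h1] at hr
  simp only [Prod.mk.injEq] at hr
  obtain ⟨⟨rfl, rfl⟩, rfl⟩ := hr
  have hQ' := (hQ ⟨(x, s, v), hVs⟩).1
  have hb : Q.eval ((e x).k + (Val.pair v (M.enc x s)).size) ≤ W := by
    rw [hW]
    refine (hle _).trans (le_trans (P.monotone_eval_nat ?_) (Nat.le_add_right _ (B + 1)))
    simp only [Val.size]
    omega
  have hb' : W ≤ 2 * t' * W :=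
    Nat.le_mul_of_pos_left _ (by omega)
  subst hG
  refine ⟨(hQ' N' (by simp only; omega)).mono (by simp only; omega), hV x s v hVs, h3, h2,
    (hs x s v hVs).trans (Nat.add_le_add_left (Nat.mul_le_mul_left _ h2) _)⟩

/-- Induction on the program; the simulation keeps the encoded oracle state next to the current
value. All sizes are controlled by the number `t` of simulated steps: an instruction pays for the
length of its argument, so after `t` steps a value has size at most `C * t` and the state has grown
by at most `growth * t`. Hence one step costs at most `slowdown`. The polynomial `P` is the sum of
the time bounds of the programs for the oracles and the coins and serves all programs; only the
constant `C` depends on the program. -/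
theorem exists_simulates [Fintype O] (M : Simulator e O S) :
    ∃ P : Polynomial ℕ, ∀ c : Code O, ∃ c' C, M.Simulates P c c' C := by
  choose d Q hQ using M.answer_act
  obtain ⟨d', Q', hQ'⟩ := M.coin_act
  refine ⟨(∑ o, Q o) + Q', fun c => ?_⟩
  induction c with
  | skip => exact ⟨_, _, simulates_atomic 0 (f := fun v => v) (d := .skip) (fun _ _ => rfl)
      (fun _ _ => rfl) fun v => by omega⟩
  | const n => exact ⟨_, _, simulates_atomic (1 + Nat.size n) (f := fun v => .num n)
      (d := .const n) (fun _ _ => rfl) (fun _ _ => rfl) fun v => by simp [Val.size]⟩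
  | fst => exact ⟨_, _, simulates_atomic 1 (f := Val.fst)
      (d := .fst) (fun _ v => by cases v <;> rfl) (fun _ v => by cases v <;> rfl) fun v => by
        cases v <;> simp [Val.size, Val.fst]; omega⟩
  | snd => exact ⟨_, _, simulates_atomic 1 (f := Val.snd)
      (d := .snd) (fun _ v => by cases v <;> rfl) (fun _ v => by cases v <;> rfl) fun v => by
        cases v <;> simp [Val.size, Val.snd]; omega⟩
  | isPair => exact ⟨_, _, simulates_atomic 1 (f := fun v => .bit v.isPair)
      (d := .isPair) (fun _ v => by cases v <;> rfl) (fun _ v => by cases v <;> rfl) fun v => by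
        cases v <;> simp [Val.size, Val.isPair, Val.bit]; omega⟩
  | equal => exact ⟨_, _, simulates_atomic 1 (f := fun v => .bit (decide (v.isPair ∧ v.fst = v.snd)))
      (d := .equal) (fun _ v => by
        cases v <;> simp [Code.run, Val.bit, Val.fst, Val.snd, Val.isPair]; split <;> rfl)
      (fun _ v => by
        cases v <;> simp [Code.run, Val.bit, Val.fst, Val.snd, Val.isPair]; split <;> rfl)
      fun v => by
        cases v <;> simp [Val.size, Val.bit, Val.isPair]; split <;> simp; omega⟩
  | arith o => exact ⟨_, _, simulates_atomic 2 (f := fun v => match v with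
      | .pair (.num a) (.num b) => .num (o.eval a b)
      | _ => .num 0) (d := .arith o) (fun _ v => rfl) (fun _ v => rfl) fun v => by
        rcases v with _ | ⟨_ | _, _ | _⟩ <;> simp [Val.size] <;> try omega
        have := o.size_eval
        rename_i a b
        have := this a b
        omega⟩
  | rand =>
    refine ⟨d', 2, simulates_oracle (f := fun x => drawVal (M.coin x)) hQ'
      (fun n => by rw [Polynomial.eval_add]; exact Nat.le_add_left _ _) ?_ ?_ ?_⟩
    · intro x s v hV
      cases v with
      | num n => exact M.coin_valid x n s hV
      | pair a b => exact hV
    · intro x s v hV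
      cases v with
      | num n =>
        refine (M.coin_size x n s hV).trans (Nat.add_le_add_left ?_ _)
        exact Nat.le_mul_of_pos_right _ (by omega)
      | pair a b => exact Nat.le_add_right _ _
    · intro x N v s
      cases v with
      | num n =>
        refine ⟨1 + (Val.num n).size, rfl, le_rfl, ?_⟩
        have := Nat.size_le_size (M.coin_le x n s)
        simp only [drawVal, Val.size]
        omega
      | pair a b => exact ⟨1 + (Val.pair a b).size, rfl, le_rfl, by simp [drawVal, Val.size]; omega⟩
  | call o =>
    refine ⟨d o, 2, simulates_oracle (hQ o) (fun n => ?_) (fun x s v => M.answer_valid x o s v)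
      (fun x s v => M.answer_size x o s v) fun x N v s => ⟨1 + v.size +
        (M.answer x o s v).1.size, rfl, by omega, by omega⟩⟩
    rw [Polynomial.eval_add, Polynomial.eval_finsetSum]
    exact le_trans (Finset.single_le_sum (f := fun o => (Q o).eval n) (by simp)
      (Finset.mem_univ o)) (Nat.le_add_right _ _)
  | pair f g ihf ihg =>
    obtain ⟨f', C, hf⟩ := ihf
    obtain ⟨g', C', hg⟩ := ihg
    exact ⟨_, _, simulates_pair hf hg⟩
  | seq f g ihf ihg =>
    obtain ⟨f', C, hf⟩ := ihf
    obtain ⟨g', C', hg⟩ := ihg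
    exact ⟨_, _, simulates_seq hf hg⟩
  | ite c f g ihc ihf ihg =>
    obtain ⟨c', C₀, hc⟩ := ihc
    obtain ⟨f', C, hf⟩ := ihf
    obtain ⟨g', C', hg⟩ := ihg
    exact ⟨_, _, simulates_ite hc hf hg⟩
  | loop c f ihc ihf =>
    obtain ⟨c', C, hc⟩ := ihc
    obtain ⟨f', C', hf⟩ := ihf
    exact ⟨_, _, simulates_loop hc hf⟩

end Simulator

/-! ## The simulated oracles of the forger -/

/-- The list with its elements keyed by the values `1, 2, …`. -/
def keyed (l : List ℕ) : List (Val × ℕ) := (l.zipIdx 1).map fun t => (.num t.2, t.1)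

/-- The element with key `J`. -/
def look (l : List ℕ) (J : Val) : Option ℕ := (keyed l).lookup J

/-- An accepted signing session: a `Session` together with the slot of the hash value that was
used and this hash value. -/
structure Record extends Session where
  slot : ℕ
  hash : ℕ

/-- State of the simulated oracles. Answers are taken from tapes. An entry of the table of hash
values is a point, its value, and its slot: the number of the hash query which fixed the value,
and `0` if it was fixed in a signing session. -/
structure Core where
  hashTape : List ℕ
  prfTape : List ℕ
  coinTape : List ℕ
  hashTbl : List (Val × ℕ × ℕ)
  prfTbl : List (Val × ℕ)
  sessions : List Record
  hashQueries : ℕ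
  /-- the keys for which the forger has asked for a nonce -/
  probes : List ℕ
  /-- whether one of these keys was that of the honest card -/
  hit : Bool

/-- What the simulated oracles depend on: the group, the secret key `x` of the honest card, its
nonces, and the values of fresh hashes in signing sessions. -/
structure World (𝒢 : GroupGen) where
  env : Env 𝒢
  x : ℕ
  nonces : List ℕ
  fresh : List ℕ

namespace World

variable {𝒢 : GroupGen} (w : World 𝒢)

/-- The second part `r - x ε` of a signature share. -/
def sig (r ε : ℕ) : ℕ := (r + (w.env.p - ε % w.env.p) * w.x) % w.env.p

/-- The hash of a point in the signing session with index `J`: value, slot, new table. -/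
def hashIn (c : Core) (q J : Val) : ℕ × ℕ × List (Val × ℕ × ℕ) :=
  match c.hashTbl.lookup q with
  | some t => (t.1, t.2, c.hashTbl)
  | none => ((look w.fresh J).getD 0, 0, (q, (look w.fresh J).getD 0, 0) :: c.hashTbl)

/-- The point that is hashed in the signing session with request `v`. -/
def signPoint (v : Val) : Val := hashInput v.snd.fst v.snd.snd.fst v.snd.snd.snd

/-- Whether a signing request is accepted: if so, the nonce. -/
def accepts (c : Core) (v : Val) : Option ℕ :=
  if v.snd.snd.snd.toNat ∈ c.sessions.map (fun t => t.index) then none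
  else look w.nonces v.snd.snd.snd

/-- The nonce that a query to the pseudorandom function asks for, with the key. -/
def probe (v : Val) : Option (ℕ × ℕ) :=
  if v.isPair = true ∧ ¬ v.fst.isPair = true then (look w.nonces v.snd).map fun r => (v.fst.toNat, r)
  else none

/-- A query to the pseudorandom function that does not ask for a nonce. -/
def askTable (c : Core) (f : ℕ) (v : Val) : Val × Core :=
  match c.prfTbl.lookup v with
  | some a => (.num a, c)
  | none => (.num f, { c with prfTbl := (v, f) :: c.prfTbl })

/-- The simulated oracles. If a key `s` is given, it is that of the honest card. -/
def answer (s : Option ℕ) : ForgerOracle → Core → Val → Val × Core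
  | .hash, c, v => match c.hashTape with
    | [] => (.num 0, c)
    | a :: tape => match c.hashTbl.lookup v with
      | some t => (.num t.1, { c with hashTape := tape, hashQueries := c.hashQueries + 1 })
      | none => (.num a, { c with
          hashTape := tape
          hashTbl := (v, a, c.hashQueries + 1) :: c.hashTbl
          hashQueries := c.hashQueries + 1 })
  | .prf, c, v => match c.prfTape with
    | [] => (.num 0, c)
    | f :: tape => match w.probe v with
      | some t =>
        if s = some t.1 then
          (.num t.2, { c with prfTape := tape, probes := t.1 :: c.probes, hit := true })
        else askTable { c with prfTape := tape, probes := t.1 :: c.probes } f v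
      | none => askTable { c with prfTape := tape } f v
  | .cache, c, v => match look w.nonces v with
    | some r => (𝒢.point w.env.i r, c)
    | none => (.num 0, c)
  | .sign, c, v => match w.accepts c v with
    | none => (.num 0, c)
    | some r =>
      let t := w.hashIn c (signPoint v) v.snd.snd.snd
      (.pair (.num (w.sig r t.1)) (.num t.1), { c with
        hashTbl := t.2.2
        sessions := ⟨⟨v.snd.snd.snd.toNat, v.fst, v.snd.snd.fst⟩, t.2.1, t.1⟩ :: c.sessions })

/-- The simulated coins. -/
def coin (n : ℕ) (c : Core) : ℕ × Core :=
  match c.coinTape with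
  | [] => (0, c)
  | u :: tape => (if n = 0 then 0 else u % n, { c with coinTape := tape })

end World

/-- What the adversary keeps about its use of the discrete logarithm oracle: signature shares
`(J, (ε, σ))`, and the number of queries. -/
structure Book where
  shares : List (Val × ℕ × ℕ)
  queries : ℕ

namespace World

variable {𝒢 : GroupGen} (w : World 𝒢)

/-- Obtain a signature share, from the book if possible. -/
def Book.use (b : Book) (J : Val) (ε σ : ℕ) : Book :=
  if (b.shares.lookup J).map Prod.fst = some ε then b
  else ⟨(J, ε, σ) :: b.shares, b.queries + 1⟩

/-- The effect of a query on the book. -/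
def bookkeep (s : ℕ) : ForgerOracle → Core → Val → Book → Book
  | .prf, c, v, b =>
    if ¬ c.prfTape = [] ∧ (w.probe v).map Prod.fst = some s then ⟨b.shares, b.queries + 1⟩ else b
  | .sign, c, v, b => match w.accepts c v with
    | none => b
    | some r =>
      Book.use b v.snd.snd.snd (w.hashIn c (signPoint v) v.snd.snd.snd).1
        (w.sig r (w.hashIn c (signPoint v) v.snd.snd.snd).1)
  | .hash, _, _, b => b
  | .cache, _, _, b => b

/-- The oracles with bookkeeping. -/
def answerBook (s : ℕ) (o : ForgerOracle) (c : Core × Book) (v : Val) : Val × Core × Book :=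
  ((w.answer (some s) o c.1 v).1, (w.answer (some s) o c.1 v).2, w.bookkeep s o c.1 v c.2)

/-- The coins with bookkeeping. -/
def coinBook (n : ℕ) (c : Core × Book) : ℕ × Core × Book :=
  ((coin n c.1).1, (coin n c.1).2, c.2)

/-- The challenges obtained by the adversary: the public key of the honest card, and the nonces in
reversed order. -/
def challenges : List ℕ := w.x :: w.nonces.reverse

/-- Encoding of what does not change. -/
def encStatic (s : ℕ) : Val :=
  .pair w.env.inst (.pair (𝒢.point w.env.i w.x) (.pair (.ofTable (𝒢.point w.env.i) (keyed w.nonces))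
    (.pair (.ofTable .num (keyed w.fresh)) (.num s))))

end World

namespace Core

/-- Encoding of the tape of hash values. -/
def encTape (l : List ℕ) (n : ℕ) : Val :=
  .ofList ((l.zipIdx (n + 1)).map fun t => .pair (.num t.2) (.num t.1))

/-- Encoding of the table of hash values. -/
def encTbl (l : List (Val × ℕ × ℕ)) : Val :=
  .ofTable (fun t : ℕ × ℕ => .pair (.num t.1) (.num t.2)) l

/-- Encoding of the signing sessions. -/
def encSessions (l : List Record) : Val :=
  .ofList (l.map fun t => .pair (.num t.index) (.num t.slot))

/-- Encoding of a state of the simulated oracles. -/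
def enc (c : Core) (b : Book) : Val :=
  .pair (encTape c.hashTape c.hashQueries) (.pair (.ofList (c.prfTape.map .num))
    (.pair (.ofList (c.coinTape.map .num)) (.pair (encTbl c.hashTbl)
      (.pair (.ofTable .num c.prfTbl) (.pair (encSessions c.sessions) (encTbl b.shares))))))

end Core

open Val

/-! ### Programs that answer single oracle queries of the forger -/

section components

variable {𝒢 : GroupGen} {X : Type} {e : X → Env 𝒢} {φ : X → Val} {w : X → World 𝒢}
  {s : X → ℕ} {c : X → Core} {b : X → Book}

theorem Fn.static_inst (h : Fn e φ fun x => (w x).encStatic (s x)) :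
    Fn e φ fun x => (w x).env.inst := h.left

theorem Fn.static_key (h : Fn e φ fun x => (w x).encStatic (s x)) :
    Fn e φ fun x => 𝒢.point (w x).env.i (w x).x := h.right.left

theorem Fn.static_nonces (h : Fn e φ fun x => (w x).encStatic (s x)) :
    Fn e φ fun x => ofTable (𝒢.point (w x).env.i) (keyed (w x).nonces) := h.right.right.left

theorem Fn.static_fresh (h : Fn e φ fun x => (w x).encStatic (s x)) :
    Fn e φ fun x => ofTable .num (keyed (w x).fresh) := h.right.right.right.left

theorem Fn.static_s (h : Fn e φ fun x => (w x).encStatic (s x)) :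
    Fn e φ fun x => .num (s x) := h.right.right.right.right

theorem Fn.core_hashTape (h : Fn e φ fun x => (c x).enc (b x)) :
    Fn e φ fun x => Core.encTape (c x).hashTape (c x).hashQueries := h.left

theorem Fn.core_prfTape (h : Fn e φ fun x => (c x).enc (b x)) :
    Fn e φ fun x => ofList ((c x).prfTape.map .num) := h.right.left

theorem Fn.core_coinTape (h : Fn e φ fun x => (c x).enc (b x)) :
    Fn e φ fun x => ofList ((c x).coinTape.map .num) := h.right.right.left

theorem Fn.core_hashTbl (h : Fn e φ fun x => (c x).enc (b x)) :
    Fn e φ fun x => Core.encTbl (c x).hashTbl := h.right.right.right.left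

theorem Fn.core_prfTbl (h : Fn e φ fun x => (c x).enc (b x)) :
    Fn e φ fun x => ofTable .num (c x).prfTbl := h.right.right.right.right.left

theorem Fn.core_sessions (h : Fn e φ fun x => (c x).enc (b x)) :
    Fn e φ fun x => Core.encSessions (c x).sessions := h.right.right.right.right.right.left

theorem Fn.core_shares (h : Fn e φ fun x => (c x).enc (b x)) :
    Fn e φ fun x => Core.encTbl (b x).shares := h.right.right.right.right.right.right

theorem Act.congr {s₁ s₂ s₂' : X → DLState} {ψ ψ' : X → Val} (h : Act e φ s₁ ψ s₂)
    (hψ : ∀ x, ψ x = ψ' x) (hs : ∀ x, s₂ x = s₂' x) : Act e φ s₁ ψ' s₂' := by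
  rwa [← show ψ = ψ' from funext hψ, ← show s₂ = s₂' from funext hs]

/-- What is returned by the simulated oracles is computed from the request and the state. -/
theorem Fn.answer_hash {v : X → Val} (hv : Fn e φ v)
    (hw : Fn e φ fun x => (w x).encStatic (s x)) (hc : Fn e φ fun x => (c x).enc (b x)) :
    Fn e φ fun x => .pair ((w x).answer (some (s x)) .hash (c x) (v x)).1
      (.pair ((w x).encStatic (s x)) (((w x).answer (some (s x)) .hash (c x) (v x)).2.enc (b x))) := by
  have hl := Fn.lookup _ hc.core_hashTbl hv
  have ht := hc.core_hashTape
  have rest := hc.right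
  have h1 := hl.snd.fst.pair (hw.pair (ht.snd.pair rest))
  have h2 := ht.fst.snd.pair (hw.pair (ht.snd.pair (rest.left.pair (rest.right.left.pair
    (((hv.pair (ht.fst.snd.pair ht.fst.fst)).pair hc.core_hashTbl).pair rest.right.right.right)))))
  have h3 := (Fn.const (e := e) (φ := φ) 0).pair (hw.pair hc)
  refine (Fn.ite (c := fun x => (Core.encTape (c x).hashTape (c x).hashQueries).isPair = true)
    ((FnB.isPair ht).congr fun x => by simp) (Fn.ite (c := fun x => (ofOption
      (fun t : ℕ × ℕ => Val.pair (.num t.1) (.num t.2)) ((c x).hashTbl.lookup (v x))).isPair = true)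
      ((FnB.isPair hl).congr fun x => by simp) h1 h2) h3).congr fun x => ?_
  simp only [World.answer]
  rcases h : (c x).hashTape with _ | ⟨a, tape⟩
  · simp [Core.encTape, Val.isPair, h, Core.enc]
  · rcases h' : (c x).hashTbl.lookup (v x) with _ | t
    · simp [Core.encTape, Val.isPair, h, h', Core.enc, ofOption, Val.fst, Val.snd, Core.encTbl,
        ofTable]
    · simp [Core.encTape, Val.isPair, h, h', Core.enc, ofOption, Val.fst, Val.snd]

theorem Fn.answer_cache {v : X → Val} (hv : Fn e φ v)
    (hw : Fn e φ fun x => (w x).encStatic (s x)) (hc : Fn e φ fun x => (c x).enc (b x)) :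
    Fn e φ fun x => .pair ((w x).answer (some (s x)) .cache (c x) (v x)).1
      (.pair ((w x).encStatic (s x)) (((w x).answer (some (s x)) .cache (c x) (v x)).2.enc (b x))) := by
  have hl := Fn.lookup _ hw.static_nonces hv
  refine (hl.snd.pair (hw.pair hc)).congr fun x => ?_
  simp only [World.answer, look]
  rcases (keyed (w x).nonces).lookup (v x) with _ | r <;> rfl

theorem Fn.drawVal_coin {v : X → Val} (hv : Fn e φ v)
    (hw : Fn e φ fun x => (w x).encStatic (s x)) (hc : Fn e φ fun x => (c x).enc (b x)) :
    Fn e φ fun x => .pair (drawVal World.coin (c x) (v x)).1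
      (.pair ((w x).encStatic (s x)) ((drawVal World.coin (c x) (v x)).2.enc (b x))) := by
  have ht := hc.core_coinTape
  have h3 := (Fn.const (e := e) (φ := φ) 0).pair (hw.pair hc)
  have hn := ht.fst.toNat.mod hv.toNat
  have h1 := (Fn.ite (c := fun x => v x = .num 0) (FnB.eq hv (Fn.const 0)) (Fn.const 0) hn).pair
    (hw.pair (hc.left.pair (hc.right.left.pair (ht.snd.pair hc.right.right.right))))
  refine (Fn.ite (c := fun x => (v x).isPair = true) ((FnB.isPair hv).congr fun x => by simp) h3
    (Fn.ite (c := fun x => (ofList ((c x).coinTape.map .num)).isPair = true)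
    ((FnB.isPair ht).congr fun x => by simp) h1 h3)).congr fun x => ?_
  rcases v x with n | ⟨a, a'⟩
  · rcases h : (c x).coinTape with _ | ⟨u, tape⟩
    · simp [Val.isPair, drawVal, World.coin, h]
    · simp [Val.isPair, drawVal, World.coin, h, Core.enc, Val.fst, Val.snd, Val.toNat]
      split <;> rfl
  · simp [Val.isPair, drawVal]

theorem lookup_ofTable_mem {l : List (Val × ℕ × ℕ)} {q : Val} {t : ℕ × ℕ}
    (h : l.lookup q = some t) : (q, t) ∈ l := by
  induction l with
  | nil => simp at h
  | cons a l ih =>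
    rw [List.lookup_cons] at h
    split at h
    · rename_i h'
      simp only [Option.some.injEq] at h
      rw [beq_iff_eq] at h'
      subst h h'
      simp
    · exact List.mem_cons_of_mem _ (ih h)

theorem look_mem {l : List ℕ} {J : Val} {r : ℕ} (h : look l J = some r) : r ∈ l := by
  have : ∀ (l : List (Val × ℕ)) q, l.lookup q = some r → ∃ q', (q', r) ∈ l := by
    intro l
    induction l with
    | nil => simp
    | cons a l ih =>
      intro q h
      rw [List.lookup_cons] at h
      split at h
      · simp only [Option.some.injEq] at h
        exact ⟨a.1, by rw [← h]; simp⟩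
      · obtain ⟨q', hq'⟩ := ih q h
        exact ⟨q', by simp [hq']⟩
  obtain ⟨q', hq'⟩ := this _ _ h
  simp only [keyed, List.mem_map, Prod.mk.injEq] at hq'
  obtain ⟨a, ha, -, rfl⟩ := hq'
  exact List.fst_mem_of_mem_zipIdx ha

/-- Requests for values of the pseudorandom function. -/
theorem Act.answer_prf {v : X → Val} {s' : X → DLState} (he : ∀ x, e x = (w x).env)
    (hr : ∀ x, ∀ r ∈ (w x).nonces, r < (w x).env.p) (hv : Fn e φ v)
    (hw : Fn e φ fun x => (w x).encStatic (s x)) (hc : Fn e φ fun x => (c x).enc (b x))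
    (hs' : ∀ x, (s' x).dlogQueries = (b x).queries) :
    Act e φ s' (fun x => .pair ((w x).answer (some (s x)) .prf (c x) (v x)).1
      (.pair ((w x).encStatic (s x)) (((w x).answer (some (s x)) .prf (c x) (v x)).2.enc
        ((w x).bookkeep (s x) .prf (c x) (v x) (b x)))))
      (fun x => ⟨(s' x).challenges, ((w x).bookkeep (s x) .prf (c x) (v x) (b x)).queries⟩) := by
  obtain rfl : e = fun x => (w x).env := funext he
  have ht := hc.core_prfTape
  have rest := hc.right.right
  have hl := Fn.lookup _ hc.core_prfTbl hv
  have hn := Fn.lookup _ hw.static_nonces hv.snd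
  have h3 := (Fn.const (e := fun x => (w x).env) (φ := φ) 0).pair (hw.pair hc)
  -- the table
  have h1 := hl.snd.pair (hw.pair (hc.left.pair (ht.snd.pair rest)))
  have h2 := ht.fst.pair (hw.pair (hc.left.pair (ht.snd.pair (rest.left.pair (rest.right.left.pair
    (((hv.pair ht.fst).pair hc.core_prfTbl).pair rest.right.right.right))))))
  have h12 := Fn.ite (c := fun x => (ofOption (fun t : ℕ => Val.num t)
    ((c x).prfTbl.lookup (v x))).isPair = true)
      ((FnB.isPair hl).congr fun x => by simp) h1 h2
  have hhit := (FnB.eq hv.fst hw.static_s).and (((FnB.isPair hv).congr fun x =>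
    (show _ = decide ((v x).isPair = true) by simp)).and ((FnB.isPair hn).congr fun x =>
    (show _ = decide ((ofOption (𝒢.point (w x).env.i)
      ((keyed (w x).nonces).lookup (v x).snd)).isPair = true) by simp)))
  have htp := (FnB.isPair ht).congr fun x =>
    (show _ = decide ((ofList ((c x).prfTape.map .num)).isPair = true) by simp)
  have h4 : Fn (fun x => (w x).env) (fun x => .pair (φ x) (.num (𝒢.dlog (w x).env.i
      (ofOption (𝒢.point (w x).env.i) ((keyed (w x).nonces).lookup (v x).snd)).snd)))
      (fun x => .pair (.num (𝒢.dlog (w x).env.i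
        (ofOption (𝒢.point (w x).env.i) ((keyed (w x).nonces).lookup (v x).snd)).snd))
        (.pair ((w x).encStatic (s x)) (.pair (Core.encTape (c x).hashTape (c x).hashQueries)
          (.pair (ofList ((c x).prfTape.map .num)).snd ((c x).enc (b x)).snd.snd)))) :=
    (Fn.right Fn.id).pair (hw.inner.pair (hc.left.inner.pair (ht.snd.inner.pair rest.inner)))
  -- The nonce is known only as the point `r • G`. A query with the correct key must return `r`, so
  -- its logarithm is bought; this keeps the simulation exact, though such a run will not count as
  -- good.
  have h5 := Act.dlog (s := s') hn.snd (h4.act _)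
  have h6 := Act.ite htp (Act.ite hhit h5 (h12.act s')) (h3.act s')
  refine h6.congr (fun x => ?_) fun x => ?_
  · simp only [World.answer, World.bookkeep]
    rcases h : (c x).prfTape with _ | ⟨f, tape⟩
    · simp [Val.isPair]
    · simp only [List.map_cons, ofList_cons, Val.isPair, if_true, World.probe, look]
      rcases hvx : v x with n | ⟨v1, v2⟩
      · rcases h' : (c x).prfTbl.lookup (.num n) with _ | t <;>
        simp [Val.isPair, World.askTable, h', ofOption, Val.fst, Val.snd, Core.enc, ofTable]
      · rcases v1 with n | ⟨v3, v4⟩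
        · rcases hj : (keyed (w x).nonces).lookup v2 with _ | r
          · rcases h' : (c x).prfTbl.lookup (.pair (.num n) v2) with _ | t <;>
            simp [Val.isPair, World.askTable, h', hj, ofOption, Val.fst, Val.snd, Core.enc,
              ofTable]
          · by_cases hns : n = s x
            · have hrp : r < (w x).env.p := by
                apply hr x
                exact look_mem hj
              simp [Val.isPair, hj, ofOption, Val.fst, Val.snd, Core.enc, hns, Val.toNat,
                (w x).env.dlog_point, Nat.mod_eq_of_lt hrp]
            · rcases h' : (c x).prfTbl.lookup (.pair (.num n) v2) with _ | t <;>
              simp [Val.isPair, World.askTable, h', hj, ofOption, Val.fst, Val.snd, Core.enc,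
                ofTable, hns, Ne.symm hns, Val.toNat]
        · rcases h' : (c x).prfTbl.lookup (.pair (.pair v3 v4) v2) with _ | t <;>
          simp [Val.isPair, World.askTable, h', ofOption, Val.fst, Val.snd, Core.enc, ofTable]
  · simp only [World.bookkeep]
    rcases h : (c x).prfTape with _ | ⟨f, tape⟩
    · simp [Val.isPair, ← hs']
    · simp only [List.map_cons, ofList_cons, Val.isPair, if_true, World.probe, look]
      rcases hvx : v x with n | ⟨v1, v2⟩
      · simp [Val.isPair, ← hs']
      · rcases v1 with n | ⟨v3, v4⟩
        · rcases hj : (keyed (w x).nonces).lookup v2 with _ | r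
          · simp [Val.isPair, hj, ofOption, Val.fst, Val.snd, ← hs']
          · by_cases hns : n = s x
            · simp [Val.isPair, hj, ofOption, Val.fst, Val.snd, ← hs', hns, Val.toNat,
                DLState.tick]
            · simp [Val.isPair, hj, ofOption, Val.fst, Val.snd, ← hs', hns, Val.toNat]
        · simp [Val.isPair, Val.fst, Val.snd, ← hs']

end components

@[simp] theorem Val.fst_pair (a b : Val) : (Val.pair a b).fst = a := rfl

@[simp] theorem Val.snd_pair (a b : Val) : (Val.pair a b).snd = b := rfl

section sign

variable {𝒢 : GroupGen} {X : Type} {e : X → Env 𝒢} {φ : X → Val} {w : X → World 𝒢}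
  {s : X → ℕ} {c : X → Core} {b : X → Book}

/-- Only addition of points is available, so `-ε` is represented by `p - ε % p`. -/
theorem World.dlog_sig (w : World 𝒢) (r ε : ℕ) :
    𝒢.dlog w.env.i (𝒢.enc w.env.i (r • 𝒢.base w.env.i +
      (w.env.p - ε % w.env.p) • w.x • 𝒢.base w.env.i)) = w.sig r ε := by
  rw [← mul_smul, ← add_smul, World.sig]
  exact w.env.dlog_point _

/-- The share `r - x ε` is the logarithm of `R_J - ε • Y₁`, so one query answers a signing request
although neither the nonce nor the key is known. If the book contains a share for the same index and
the same `ε`, it is used instead; `hb` guarantees that it is the correct one. -/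
theorem Act.answer_sign {v : X → Val} {s' : X → DLState} (he : ∀ x, e x = (w x).env)
    (hv : Fn e φ v)
    (hw : Fn e φ fun x => (w x).encStatic (s x)) (hc : Fn e φ fun x => (c x).enc (b x))
    (hs' : ∀ x, (s' x).dlogQueries = (b x).queries)
    (hb : ∀ x J t r, (b x).shares.lookup J = some t → look (w x).nonces J = some r →
      t.2 = (w x).sig r t.1) :
    Act e φ s' (fun x => .pair ((w x).answer (some (s x)) .sign (c x) (v x)).1
      (.pair ((w x).encStatic (s x)) (((w x).answer (some (s x)) .sign (c x) (v x)).2.enc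
        ((w x).bookkeep (s x) .sign (c x) (v x) (b x)))))
      (fun x => ⟨(s' x).challenges, ((w x).bookkeep (s x) .sign (c x) (v x) (b x)).queries⟩) := by
  obtain rfl : e = fun x => (w x).env := funext he
  have hI := hw.static_inst
  have hJ := hv.snd.snd.snd
  have hq : Fn _ φ fun x => World.signPoint (v x) := hv.snd.fst.pair (hv.snd.snd.fst.pair hJ)
  have hn := Fn.lookup _ hw.static_nonces hJ
  have hf := Fn.lookup _ hw.static_fresh hJ
  have hl := Fn.lookup _ hc.core_hashTbl hq
  have hsh := Fn.lookup _ hc.core_shares hJ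
  have hfound := (FnB.isPair hl).congr fun x => (show _ = decide ((ofOption
    (fun t : ℕ × ℕ => Val.pair (.num t.1) (.num t.2))
      ((c x).hashTbl.lookup (World.signPoint (v x)))).isPair = true) by simp)
  have hnf := (FnB.isPair hn).congr fun x => (show _ = decide ((ofOption (𝒢.point (w x).env.i)
    ((keyed (w x).nonces).lookup (v x).snd.snd.snd)).isPair = true) by simp)
  let t : X → ℕ × ℕ × List (Val × ℕ × ℕ) := fun x =>
    (w x).hashIn (c x) (World.signPoint (v x)) (v x).snd.snd.snd
  have hε : Fn _ φ fun x => .num (t x).1 := (Fn.ite hfound hl.snd.fst hf.snd).congr fun x => by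
    simp only [t, World.hashIn, look]
    rcases (c x).hashTbl.lookup (World.signPoint (v x)) with _ | u
    · rcases (keyed (w x).fresh).lookup (v x).snd.snd.snd with _ | u <;> rfl
    · rfl
  have hslot : Fn _ φ fun x => .num (t x).2.1 :=
    (Fn.ite hfound hl.snd.snd (Fn.const 0)).congr fun x => by
      simp only [t, World.hashIn, look]
      rcases (c x).hashTbl.lookup (World.signPoint (v x)) with _ | u <;> rfl
  have htbl : Fn _ φ fun x => Core.encTbl (t x).2.2 :=
    (Fn.ite hfound hc.core_hashTbl ((hq.pair (hf.snd.pair (Fn.const 0))).pair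
      hc.core_hashTbl)).congr fun x => by
      simp only [t, World.hashIn, look]
      rcases (c x).hashTbl.lookup (World.signPoint (v x)) with _ | u
      · rcases (keyed (w x).fresh).lookup (v x).snd.snd.snd with _ | u <;> rfl
      · rfl
  -- whether the request is accepted
  have hused : FnB _ φ fun x => ((c x).sessions.any fun r => r.index = (v x).snd.snd.snd.toNat) :=
    FnB.any (α := fun _ => Record) (fun _ r => .pair (.num r.index) (.num r.slot))
      (fun x r => decide (r.index = (v x).snd.snd.snd.toNat)) hc.core_sessions
      ((FnB.eq (Fn.left (Fn.right Fn.id)) hJ.toNat.inner).congr fun y => by simp)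
  have hacc := (FnB.not (hused.congr fun x => (show _ = decide (((c x).sessions.any fun r =>
    r.index = (v x).snd.snd.snd.toNat) = true) from Bool.decide_eq_true.symm))).and hnf
  -- the share from the book
  have hshf := (FnB.isPair hsh).congr fun x => (show _ = decide ((ofOption
    (fun t : ℕ × ℕ => Val.pair (.num t.1) (.num t.2))
      ((b x).shares.lookup (v x).snd.snd.snd)).isPair = true) by simp)
  have hcached := hshf.and (FnB.eq hsh.snd.fst hε)
  -- the share from the discrete logarithm oracle
  have hR : Fn _ φ fun x => 𝒢.enc (w x).env.i
      (((look (w x).nonces (v x).snd.snd.snd).getD 1) • 𝒢.base (w x).env.i) :=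
    (Fn.ite hnf hn.snd hI.inst_base).congr fun x => by
      simp only [look]
      rcases (keyed (w x).nonces).lookup (v x).snd.snd.snd with _ | u
      · simp [ofOption, Val.isPair]
      · rfl
  have hp := hI.inst_p
  have hQ := Fn.groupAdd hI hR (Fn.groupSmul (P := fun x => (w x).x • 𝒢.base (w x).env.i) hI
    hw.static_key (hp.sub (hε.mod hp)))
  have hcore : ∀ {ψ : X → Val} {χ : X → Val}, Fn (fun x => (w x).env) ψ φ →
      Fn (fun x => (w x).env) ψ χ → Fn (fun x => (w x).env) ψ
      (fun x => .pair ((w x).encStatic (s x)) (.pair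
        (Core.encTape (c x).hashTape (c x).hashQueries) (.pair (.ofList ((c x).prfTape.map .num))
    (.pair (.ofList ((c x).coinTape.map .num)) (.pair (Core.encTbl (t x).2.2)
      (.pair (.ofTable .num (c x).prfTbl) (.pair (.pair (.pair (.num (v x).snd.snd.snd.toNat)
        (.num (t x).2.1)) (Core.encSessions (c x).sessions)) (χ x)))))))) := by
    intro ψ χ hψ hχ
    exact (hψ.trans hw).pair ((hψ.trans hc.core_hashTape).pair ((hψ.trans hc.core_prfTape).pair
      ((hψ.trans hc.core_coinTape).pair ((hψ.trans htbl).pair ((hψ.trans hc.core_prfTbl).pair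
        ((((hψ.trans hJ.toNat).pair (hψ.trans hslot)).pair (hψ.trans hc.core_sessions)).pair
          hχ))))))
  have h1 := (hsh.snd.snd.pair hε).pair (hcore Fn.id hc.core_shares)
  have hctx : Fn (fun x => (w x).env) (fun x => .pair (φ x) (.num (𝒢.dlog (w x).env.i
      (𝒢.enc (w x).env.i (((look (w x).nonces (v x).snd.snd.snd).getD 1) • 𝒢.base (w x).env.i +
      ((w x).env.p - (t x).1 % (w x).env.p) • (w x).x • 𝒢.base (w x).env.i))))) φ := Fn.left Fn.id
  have hd : Fn (fun x => (w x).env) (fun x => .pair (φ x) (.num (𝒢.dlog (w x).env.i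
      (𝒢.enc (w x).env.i (((look (w x).nonces (v x).snd.snd.snd).getD 1) • 𝒢.base (w x).env.i +
      ((w x).env.p - (t x).1 % (w x).env.p) • (w x).x • 𝒢.base (w x).env.i))))) (fun x =>
      .num (𝒢.dlog (w x).env.i
      (𝒢.enc (w x).env.i (((look (w x).nonces (v x).snd.snd.snd).getD 1) • 𝒢.base (w x).env.i +
      ((w x).env.p - (t x).1 % (w x).env.p) • (w x).x • 𝒢.base (w x).env.i)))) := Fn.right Fn.id
  have h2 := (hd.pair (hctx.trans hε)).pair (hcore hctx
    (((hctx.trans hJ).pair ((hctx.trans hε).pair hd)).pair (hctx.trans hc.core_shares)))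
  have h3 := (Fn.const (e := fun x => (w x).env) (φ := φ) 0).pair (hw.pair hc)
  have h4 := Act.ite hacc (Act.ite hcached (h1.act s') (Act.dlog hQ (h2.act _))) (h3.act s')
  have hany : ∀ x, ((c x).sessions.any fun r => r.index = (v x).snd.snd.snd.toNat) = true ↔
      (v x).snd.snd.snd.toNat ∈ (c x).sessions.map fun r => r.index := fun x => by
    simp only [List.any_eq_true, decide_eq_true_eq, List.mem_map]
  refine h4.congr (fun x => ?_) fun x => ?_
  · simp only [hany, World.answer, World.bookkeep, World.accepts]
    by_cases hu : (v x).snd.snd.snd.toNat ∈ (c x).sessions.map fun r => r.index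
    · simp [hu]
    · rcases hr : look (w x).nonces (v x).snd.snd.snd with _ | r
      · have hr' := hr
        simp only [look] at hr'
        simp [hu, hr', ofOption, Val.isPair]
      · have hr' := hr
        simp only [look] at hr'
        simp only [hu, hr', ofOption, Val.isPair, not_false_eq_true, and_self, if_true, if_false,
          World.dlog_sig, Option.getD_some, World.Book.use]
        rcases hsx : (b x).shares.lookup (v x).snd.snd.snd with _ | u
        · simp [Val.isPair, Core.enc, Core.encSessions, Core.encTbl, ofTable, t]
        · by_cases hu1 : u.1 = (t x).1
          · have := hb x _ u r hsx hr
            rw [hu1] at this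
            simp [Val.isPair, Core.enc, Core.encSessions, Core.encTbl, ofTable, hu1, t, this]
          · simp [Val.isPair, Core.enc, Core.encSessions, Core.encTbl, ofTable, hu1, show ¬ u.1 =
              ((w x).hashIn (c x) (World.signPoint (v x)) (v x).snd.snd.snd).1 from hu1, t]
  · simp only [hany, World.bookkeep, World.accepts]
    by_cases hu : (v x).snd.snd.snd.toNat ∈ (c x).sessions.map fun r => r.index
    · simp [hu, ← hs']
    · rcases hr : look (w x).nonces (v x).snd.snd.snd with _ | r
      · have hr' := hr
        simp only [look] at hr'
        simp [hu, hr', ofOption, Val.isPair, ← hs']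
      · have hr' := hr
        simp only [look] at hr'
        simp only [hu, hr', ofOption, Val.isPair, not_false_eq_true, and_self, if_true, if_false,
          World.Book.use]
        rcases hsx : (b x).shares.lookup (v x).snd.snd.snd with _ | u
        · simp [Val.isPair, ← hs', DLState.tick]
        · by_cases hu1 : u.1 = (t x).1
          · simp [Val.isPair, hu1, t, ← hs']
          · simp [Val.isPair, hu1, show ¬ u.1 =
              ((w x).hashIn (c x) (World.signPoint (v x)) (v x).snd.snd.snd).1 from hu1, ← hs',
              DLState.tick]

end sign

/-! ### The simulated oracles as a simulator: invariants and growth of the state -/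

instance : DecidableEq ForgerOracle := fun a b => by
  cases a <;> cases b <;> first | exact isTrue rfl | exact isFalse nofun

instance : Fintype ForgerOracle :=
  Fintype.ofList [ForgerOracle.hash, ForgerOracle.prf, ForgerOracle.cache, ForgerOracle.sign]
    fun o => by cases o <;> simp

/-- A world together with the key of the honest card. -/
structure Setup (𝒢 : GroupGen) extends World 𝒢 where
  s : ℕ
  nonces_lt : ∀ r ∈ nonces, r < env.p
  fresh_lt : ∀ ε ∈ fresh, ε < 2 ^ env.k

namespace Setup

variable {𝒢 : GroupGen}

/-- Consistency of the state of the simulated oracles, for at most `T` hash queries. -/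
structure Valid (T : Polynomial ℕ) (x : Setup 𝒢) (c : Core × Book) : Prop where
  hashTape_lt : ∀ a ∈ c.1.hashTape, a < 2 ^ x.env.k
  queries_le : c.1.hashQueries + c.1.hashTape.length ≤ T.eval x.env.k
  hashTbl_lt : ∀ t ∈ c.1.hashTbl, t.2.1 < 2 ^ x.env.k ∧ t.2.2 ≤ T.eval x.env.k
  shares : ∀ J t r, c.2.shares.lookup J = some t → look x.nonces J = some r →
    t.2 = x.sig r t.1

theorem hashIn_lt {T : Polynomial ℕ} {x : Setup 𝒢} {c : Core × Book} (h : Valid T x c)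
    (q J : Val) : (x.hashIn c.1 q J).1 < 2 ^ x.env.k ∧ (x.hashIn c.1 q J).2.1 ≤ T.eval x.env.k ∧
      ∀ t ∈ (x.hashIn c.1 q J).2.2, t.2.1 < 2 ^ x.env.k ∧ t.2.2 ≤ T.eval x.env.k := by
  have hf : (look x.fresh J).getD 0 < 2 ^ x.env.k := by
    rcases hl : look x.fresh J with _ | ε
    · simp
    · exact x.fresh_lt _ (look_mem hl)
  unfold World.hashIn
  rcases hl : c.1.hashTbl.lookup q with _ | t
  · refine ⟨hf, Nat.zero_le _, ?_⟩
    simp only [List.mem_cons, forall_eq_or_imp]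
    exact ⟨⟨hf, Nat.zero_le _⟩, h.hashTbl_lt⟩
  · have := h.hashTbl_lt _ (lookup_ofTable_mem hl)
    exact ⟨this.1, this.2, h.hashTbl_lt⟩

theorem valid_answer {T : Polynomial ℕ} {x : Setup 𝒢} {c : Core × Book} (o : ForgerOracle)
    (v : Val) (h : Valid T x c) : Valid T x (x.answerBook x.s o c v).2 := by
  obtain ⟨c, b⟩ := c
  have h' := h
  obtain ⟨h1, h2, h3, h4⟩ := h
  simp only at h1 h2 h3 h4
  cases o with
  | hash =>
    simp only [World.answerBook, World.answer, World.bookkeep]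
    rcases ht : c.hashTape with _ | ⟨a, tape⟩
    · exact ⟨h1, h2, h3, h4⟩
    · simp only [ht, List.mem_cons, forall_eq_or_imp, List.length_cons] at h1 h2
      rcases hl : c.hashTbl.lookup v with _ | t
      · refine ⟨h1.2, by simp only; omega, ?_, h4⟩
        simp only [List.mem_cons, forall_eq_or_imp]
        exact ⟨⟨h1.1, by omega⟩, h3⟩
      · exact ⟨h1.2, by simp only; omega, h3, h4⟩
  | prf =>
    have hsub : ∀ (c' : Core) (f : ℕ) (q : ℕ), c'.hashTape = c.hashTape →
        c'.hashTbl = c.hashTbl → c'.hashQueries = c.hashQueries →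
        Valid T x ((World.askTable c' f v).2, ⟨b.shares, q⟩) := by
      intro c' f q e1 e2 e3
      unfold World.askTable
      split <;> exact ⟨e1 ▸ h1, e1 ▸ e3 ▸ h2, e2 ▸ h3, h4⟩
    have hb : ∃ q, x.bookkeep x.s .prf c v b = ⟨b.shares, q⟩ := by
      simp only [World.bookkeep]
      split <;> exact ⟨_, rfl⟩
    obtain ⟨q, hq⟩ := hb
    simp only [World.answerBook, World.answer, hq]
    rcases ht : c.prfTape with _ | ⟨a, tape⟩
    · exact ⟨h1, h2, h3, h4⟩
    · rcases x.probe v with _ | t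
      · exact hsub _ _ _ rfl rfl rfl
      · dsimp only
        split
        · exact ⟨h1, h2, h3, h4⟩
        · exact hsub _ _ _ rfl rfl rfl
  | cache =>
    simp only [World.answerBook, World.answer, World.bookkeep]
    split <;> exact ⟨h1, h2, h3, h4⟩
  | sign =>
    simp only [World.answerBook, World.answer, World.bookkeep]
    rcases ha : x.accepts c v with _ | r
    · exact ⟨h1, h2, h3, h4⟩
    · obtain ⟨g1, g2, g3⟩ := hashIn_lt h' (World.signPoint v) v.snd.snd.snd
      have hr : look x.nonces v.snd.snd.snd = some r := by
        unfold World.accepts at ha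
        split at ha
        · simp at ha
        · exact ha
      refine ⟨h1, h2, g3, ?_⟩
      intro J t r' hJ hr'
      simp only [World.Book.use] at hJ
      split at hJ
      · exact h4 J t r' hJ hr'
      · simp only [List.lookup_cons] at hJ
        split at hJ
        · rename_i heq
          rw [beq_iff_eq] at heq
          subst heq
          rw [hr] at hr'
          simp only [Option.some.injEq] at hJ hr'
          subst hJ hr'
          rfl
        · exact h4 J t r' hJ hr'

theorem size_le_of_lt {a n : ℕ} (h : a < 2 ^ n) : Nat.size a ≤ n := Nat.size_le.2 h

/-- An answer adds a bounded number of entries to the state. What is not copied from the request is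
a hash value or a share, with at most `k` bits, or a slot, which `Valid` bounds by `T`; values taken
off a tape only move. -/
theorem size_answer {T : Polynomial ℕ} {x : Setup 𝒢} {c : Core × Book} (o : ForgerOracle)
    (v : Val) (h : Valid T x c) :
    ((x.answerBook x.s o c v).2.1.enc (x.answerBook x.s o c v).2.2).size ≤
      (c.1.enc c.2).size + (60 + 2 * T.eval x.env.k + 3 * x.env.k) * (1 + v.size) := by
  have hfst : ∀ v : Val, v.fst.size ≤ 1 + v.size := fun v => by
    cases v <;> simp [Val.fst, Val.size]; omega
  have hsnd : ∀ v : Val, v.snd.size ≤ 1 + v.size := fun v => by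
    cases v <;> simp [Val.snd, Val.size]; omega
  have e1 : (60 + 2 * T.eval x.env.k + 3 * x.env.k) * (1 + v.size) = 60 + 2 * T.eval x.env.k +
    3 * x.env.k + (60 * v.size + 2 * T.eval x.env.k * v.size + 3 * x.env.k * v.size) := by ring
  obtain ⟨c, b⟩ := c
  cases o with
  | hash =>
    simp only [World.answerBook, World.answer, World.bookkeep]
    rcases ht : c.hashTape with _ | ⟨a, tape⟩
    · exact Nat.le_add_right _ _
    · rcases hl : c.hashTbl.lookup v with _ | t
      · simp [Core.enc, Core.encTape, Core.encTbl, ofTable, ht, Val.size]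
        omega
      · simp [Core.enc, Core.encTape, Core.encTbl, ofTable, ht, Val.size]
        omega
  | prf =>
    have hsub : ∀ (c' : Core) (f : ℕ) (q : ℕ) tape, c'.hashTape = c.hashTape →
        c'.hashTbl = c.hashTbl → c'.hashQueries = c.hashQueries → c'.prfTape = tape →
        c'.coinTape = c.coinTape → c'.prfTbl = c.prfTbl → c'.sessions = c.sessions →
        c.prfTape = f :: tape →
        (((World.askTable c' f v).2).enc ⟨b.shares, q⟩).size ≤
          (c.enc b).size + (60 + 2 * T.eval x.env.k + 3 * x.env.k) * (1 + v.size) := by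
      intro c' f q tape e1 e2 e3 e4 e5 e6 e7 e8
      unfold World.askTable
      split
      · simp [Core.enc, e1, e2, e3, e4, e5, e6, e7, e8, Val.size]
        omega
      · simp [Core.enc, e1, e2, e3, e4, e5, e6, e7, e8, Val.size, ofTable]
        omega
    have hb : ∃ q, x.bookkeep x.s .prf c v b = ⟨b.shares, q⟩ := by
      simp only [World.bookkeep]
      split <;> exact ⟨_, rfl⟩
    obtain ⟨q, hq⟩ := hb
    simp only [World.answerBook, World.answer, hq]
    rcases ht : c.prfTape with _ | ⟨a, tape⟩
    · exact Nat.le_add_right _ _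
    · rcases x.probe v with _ | t
      · exact hsub _ _ _ tape rfl rfl rfl rfl rfl rfl rfl ht
      · dsimp only
        split
        · simp [Core.enc, ht, Val.size]
          omega
        · exact hsub _ _ _ tape rfl rfl rfl rfl rfl rfl rfl ht
  | cache =>
    simp only [World.answerBook, World.answer, World.bookkeep]
    split <;> exact Nat.le_add_right _ _
  | sign =>
    simp only [World.answerBook, World.answer, World.bookkeep]
    rcases ha : x.accepts c v with _ | r
    · exact Nat.le_add_right _ _
    · obtain ⟨g1, g2, g3⟩ := hashIn_lt h (World.signPoint v) v.snd.snd.snd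
      simp only at g1 g2 g3
      have g2' := size_le_of_lt (lt_of_le_of_lt g2 Nat.lt_two_pow_self)
      have g1' := size_le_of_lt g1
      have hσ : Nat.size (x.sig r (x.hashIn c (World.signPoint v) v.snd.snd.snd).1) ≤ x.env.k :=
        size_le_of_lt ((Nat.mod_lt _ x.env.prime.pos).trans x.env.lt_two_pow)
      have hJ : v.snd.snd.snd.size ≤ 3 + v.size := by
        have h1 := hsnd v
        have h2 := hsnd v.snd
        have h3 := hsnd v.snd.snd
        omega
      have hJ' : Nat.size v.snd.snd.snd.toNat ≤ 3 + v.size := by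
        refine le_trans ?_ hJ
        generalize v.snd.snd.snd = J
        cases J <;> simp [Val.toNat, Val.size]
      have hq : (World.signPoint v).size ≤ 20 + 3 * v.size := by
        have h1 := hsnd v
        have h2 := hsnd v.snd
        have h3 := hfst v.snd
        have h4 := hfst v.snd.snd
        simp only [World.signPoint, hashInput, Val.size]
        omega
      have htbl : (Core.encTbl (x.hashIn c (World.signPoint v) v.snd.snd.snd).2.2).size ≤
          (Core.encTbl c.hashTbl).size + 30 + 3 * v.size + x.env.k := by
        have g4 := g1
        unfold World.hashIn at g1 ⊢
        rcases hl : c.hashTbl.lookup (World.signPoint v) with _ | t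
        · simp only [hl] at g1 ⊢
          have := size_le_of_lt g1
          simp [Core.encTbl, ofTable, Val.size]
          omega
        · simp only
          omega
      have hbook : (Core.encTbl (World.Book.use b v.snd.snd.snd
          (x.hashIn c (World.signPoint v) v.snd.snd.snd).1
          (x.sig r (x.hashIn c (World.signPoint v) v.snd.snd.snd).1)).shares).size ≤
          (Core.encTbl b.shares).size + 10 + v.size + 2 * x.env.k := by
        unfold World.Book.use
        split
        · omega
        · simp [Core.encTbl, ofTable, Val.size]
          simp only [Core.encTbl, ofTable] at *
          omega
      simp only [Core.enc, Val.size, Core.encSessions, List.map_cons, ofList_cons]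
      omega

variable (𝒢)

/-- The simulated oracles as a simulator. -/
noncomputable def simulator (T : Polynomial ℕ) :
    Simulator (fun x : Setup 𝒢 => x.env) ForgerOracle (Core × Book) where
  answer x := x.answerBook x.s
  coin _ := World.coinBook
  enc x c := .pair (x.encStatic x.s) (c.1.enc c.2)
  dl x c := ⟨x.challenges, c.2.queries⟩
  Valid := Valid T
  growth := 60 + 2 * T + 3 * .X
  answer_act o := by
    have hv : Fn (fun y : {y : Setup 𝒢 × (Core × Book) × Val // Valid T y.1 y.2.1} => y.1.1.env)
        (fun y => .pair y.1.2.2 (.pair (y.1.1.encStatic y.1.1.s) (y.1.2.1.1.enc y.1.2.1.2)))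
        (fun y => y.1.2.2) := Fn.left Fn.id
    have hw : Fn (fun y : {y : Setup 𝒢 × (Core × Book) × Val // Valid T y.1 y.2.1} => y.1.1.env)
        (fun y => .pair y.1.2.2 (.pair (y.1.1.encStatic y.1.1.s) (y.1.2.1.1.enc y.1.2.1.2)))
        (fun y => y.1.1.encStatic y.1.1.s) := Fn.arg₂
    have hc : Fn (fun y : {y : Setup 𝒢 × (Core × Book) × Val // Valid T y.1 y.2.1} => y.1.1.env)
        (fun y => .pair y.1.2.2 (.pair (y.1.1.encStatic y.1.1.s) (y.1.2.1.1.enc y.1.2.1.2)))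
        (fun y => y.1.2.1.1.enc y.1.2.1.2) := Fn.arg₃
    cases o with
    | hash => exact ((Fn.answer_hash hv hw hc).act _).congr (fun y => rfl) (fun y => rfl)
    | prf =>
      exact Act.answer_prf (w := fun y : {y : Setup 𝒢 × (Core × Book) × Val // Valid T y.1 y.2.1} => y.1.1.toWorld) (fun y => rfl)
        (fun y => y.1.1.nonces_lt) hv hw hc (fun y => rfl)
    | cache => exact ((Fn.answer_cache hv hw hc).act _).congr (fun y => rfl) (fun y => rfl)
    | sign =>
      exact Act.answer_sign (w := fun y : {y : Setup 𝒢 × (Core × Book) × Val // Valid T y.1 y.2.1} => y.1.1.toWorld) (fun y => rfl)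
        hv hw hc (fun y => rfl) fun y => y.2.shares
  coin_act := by
    have hv : Fn (fun y : {y : Setup 𝒢 × (Core × Book) × Val // Valid T y.1 y.2.1} => y.1.1.env)
        (fun y => .pair y.1.2.2 (.pair (y.1.1.encStatic y.1.1.s) (y.1.2.1.1.enc y.1.2.1.2)))
        (fun y => y.1.2.2) := Fn.left Fn.id
    have hw : Fn (fun y : {y : Setup 𝒢 × (Core × Book) × Val // Valid T y.1 y.2.1} => y.1.1.env)
        (fun y => .pair y.1.2.2 (.pair (y.1.1.encStatic y.1.1.s) (y.1.2.1.1.enc y.1.2.1.2)))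
        (fun y => y.1.1.encStatic y.1.1.s) := Fn.arg₂
    have hc : Fn (fun y : {y : Setup 𝒢 × (Core × Book) × Val // Valid T y.1 y.2.1} => y.1.1.env)
        (fun y => .pair y.1.2.2 (.pair (y.1.1.encStatic y.1.1.s) (y.1.2.1.1.enc y.1.2.1.2)))
        (fun y => y.1.2.1.1.enc y.1.2.1.2) := Fn.arg₃
    refine ((Fn.drawVal_coin (w := fun y : {y : Setup 𝒢 × (Core × Book) × Val // Valid T y.1 y.2.1} => y.1.1.toWorld) hv hw hc).act _).congr (fun y => ?_)
      (fun y => ?_)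
    · rcases y.1.2.2 with n | ⟨a, b⟩ <;> rfl
    · rcases y.1.2.2 with n | ⟨a, b⟩ <;> rfl
  answer_valid x o c v h := valid_answer o v h
  coin_valid x n c h := by
    simp only [World.coinBook, World.coin]
    split <;> exact ⟨h.hashTape_lt, h.queries_le, h.hashTbl_lt, h.shares⟩
  coin_le x n c := by
    simp only [World.coinBook, World.coin]
    split
    · exact Nat.zero_le _
    · dsimp only
      split
      · exact Nat.zero_le _
      · exact (Nat.mod_lt _ (by omega)).le
  answer_size x o c v h := by
    have := size_answer o v h
    simp only [Val.size, Polynomial.eval_add, Polynomial.eval_mul, Polynomial.eval_ofNat,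
      Polynomial.eval_X]
    simp only [World.answerBook] at this ⊢
    omega
  coin_size x n c h := by
    simp only [World.coinBook, World.coin]
    split
    · exact Nat.le_add_right _ _
    · rename_i u tape ht
      simp [Val.size, Core.enc, ht]
      omega

end Setup

/-! ## Randomized programs -/

namespace PMF

variable {α β : Type}

theorem bind_congr_support {p : PMF α} {f g : α → PMF β} (h : ∀ a ∈ p.support, f a = g a) :
    p.bind f = p.bind g := by
  ext b
  rw [bind_apply, bind_apply]
  refine tsum_congr fun a => ?_
  by_cases ha : a ∈ p.support
  · rw [h a ha]
  · rw [mem_support_iff, not_not] at ha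
    rw [ha, zero_mul, zero_mul]

theorem map_congr_support {p : PMF α} {f g : α → β} (h : ∀ a ∈ p.support, f a = g a) :
    p.map f = p.map g :=
  bind_congr_support fun a ha => congrArg PMF.pure (h a ha)

theorem eq_pure_of_support {p : PMF α} {a : α} (h : ∀ b ∈ p.support, b = a) : p = PMF.pure a := by
  have : p.map _root_.id = p.map fun _ => a := map_congr_support fun b hb => h b hb
  rwa [map_id, show (fun _ : α => a) = Function.const α a from rfl, map_const] at this

end PMF

theorem Comp.bind_assoc {O α β γ : Type} (m : Comp O α) (f : α → Comp O β) (g : β → Comp O γ) :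
    (m.bind f).bind g = m.bind fun a => (f a).bind g := by
  induction m with
  | ret a => rfl
  | query o v k ih => simp only [Comp.bind, ih]
  | draw n k ih => simp only [Comp.bind, ih]

theorem unifList_length {n m : ℕ} {l : List ℕ} (h : l ∈ (unifList n m).support) :
    l.length = m := by
  induction m generalizing l with
  | zero => simp [unifList] at h; simp [h]
  | succ m ih =>
    simp only [unifList, PMF.mem_support_bind_iff, PMF.mem_support_pure_iff] at h
    obtain ⟨a, -, l', hl', rfl⟩ := h
    simp [ih hl']

theorem unifList_lt {n m : ℕ} {l : List ℕ} (hn : 0 < n) (h : l ∈ (unifList n m).support) :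
    ∀ a ∈ l, a < n := by
  induction m generalizing l with
  | zero => simp [unifList] at h; simp [h]
  | succ m ih =>
    simp only [unifList, PMF.mem_support_bind_iff, PMF.mem_support_pure_iff] at h
    obtain ⟨a, ha, l', hl', rfl⟩ := h
    have := unif_support n ha
    simp only [List.mem_cons, forall_eq_or_imp]
    exact ⟨by omega, ih hl'⟩

theorem unifList_succ (n m : ℕ) : unifList n (m + 1) =
    (unif n).bind fun a => (unifList n m).map fun l => a :: l := rfl

/-- The sampling loop counts down and puts every new entry in front, so the entry drawn first ends
up last. -/
theorem unifList_snoc (n m : ℕ) : unifList n (m + 1) =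
    (unif n).bind fun a => (unifList n m).map fun l => l ++ [a] := by
  induction m with
  | zero => simp [unifList_succ, unifList, PMF.pure_map]
  | succ m ih =>
    conv_lhs => rw [unifList_succ, ih]
    conv_rhs => rw [unifList_succ]
    simp only [PMF.map_bind, PMF.map_comp]
    rw [PMF.bind_comm]
    rfl

section draws

variable {𝒢 : GroupGen}

/-- Run from the oracle state `s`, the computation takes at most `B` steps, and the distribution
of the result and the final oracle state is `ν`. -/
structure Draws (e : Env 𝒢) (m : Comp DLOracle (Val × ℕ)) (s : DLState)
    (ν : PMF (Val × DLState)) (B : ℕ) : Prop where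
  map_eq : (m.exec (dlOracle 𝒢 e.i) s).map (fun r => (r.1.1, r.2)) = ν
  time_le : ∀ r ∈ (m.exec (dlOracle 𝒢 e.i) s).support, r.1.2 ≤ B

variable {e : Env 𝒢} {m : Comp DLOracle (Val × ℕ)} {s s' : DLState} {ν : PMF (Val × DLState)}
  {B B' : ℕ}

theorem Yields.draws {z : Val} (h : Yields e m s z s' B) : Draws e m s (.pure (z, s')) B where
  map_eq := PMF.eq_pure_of_support fun b hb => by
    rw [PMF.support_map] at hb
    obtain ⟨r, hr, rfl⟩ := hb
    obtain ⟨h1, -, h2⟩ := h r hr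
    simp [h1, h2]
  time_le := fun r hr => (h r hr).2.1

theorem Draws.ret {z : Val} {t : ℕ} (h : t ≤ B) : Draws e (.ret (z, t)) s (.pure (z, s)) B :=
  (Yields.ret h).draws

theorem Draws.mono (h : Draws e m s ν B) (hB : B ≤ B') : Draws e m s ν B' :=
  ⟨h.map_eq, fun r hr => (h.time_le r hr).trans hB⟩

theorem Draws.congr {ν' : PMF (Val × DLState)} (h : Draws e m s ν B) (hν : ν = ν') :
    Draws e m s ν' B := hν ▸ h

theorem Draws.bind {f : Val × ℕ → Comp DLOracle (Val × ℕ)} {κ : Val × DLState → PMF (Val × DLState)}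
    (h : Draws e m s ν B) (hf : ∀ q ∈ ν.support, ∀ t ≤ B, Draws e (f (q.1, t)) q.2 (κ q) B') :
    Draws e (m.bind f) s (ν.bind κ) B' := by
  have hmem : ∀ r ∈ (m.exec (dlOracle 𝒢 e.i) s).support, (r.1.1, r.2) ∈ ν.support := by
    intro r hr
    rw [← h.map_eq, PMF.support_map]
    exact ⟨r, hr, rfl⟩
  constructor
  · rw [Comp.exec_bind, PMF.map_bind, ← h.map_eq, PMF.bind_map]
    refine PMF.bind_congr_support fun r hr => ?_
    exact (hf _ (hmem r hr) r.1.2 (h.time_le r hr)).map_eq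
  · intro r hr
    rw [Comp.exec_bind, PMF.mem_support_bind_iff] at hr
    obtain ⟨q, hq, hr⟩ := hr
    exact (hf _ (hmem q hq) q.1.2 (h.time_le q hq)).time_le r hr

/-- Sequential composition with a computation that only rewrites the result. -/
theorem Draws.map {f : Val × ℕ → Val × ℕ} {g : Val → Val} (h : Draws e m s ν B)
    (hf : ∀ q ∈ ν.support, ∀ t ≤ B, (f (q.1, t)).1 = g q.1 ∧ (f (q.1, t)).2 ≤ B') :
    Draws e (m.bind fun r => .ret (f r)) s (ν.map fun q => (g q.1, q.2)) B' := by
  refine h.bind fun q hq t ht => ?_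
  obtain ⟨h1, h2⟩ := hf q hq t ht
  rw [Function.comp_apply, ← h1]
  exact Draws.ret h2

/-- The elements of a list, encoded by `f` and numbered from `n + 1` on, put in front. -/
def consTape (f : ℕ → Val) : List ℕ → ℕ → Val → Val
  | [], _, acc => acc
  | c :: l, n, acc => .pair (.pair (.num (n + 1)) (f c)) (consTape f l (n + 1) acc)

theorem consTape_snoc (f : ℕ → Val) (l : List ℕ) (c n : ℕ) (acc : Val) :
    consTape f (l ++ [c]) n acc =
      consTape f l n (.pair (.pair (.num (n + l.length + 1)) (f c)) acc) := by
  induction l generalizing n with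
  | nil => rfl
  | cons a l ih =>
    simp only [List.cons_append, consTape, ih, List.length_cons,
      show n + 1 + l.length + 1 = n + (l.length + 1) + 1 by omega]

theorem consTape_num (l : List ℕ) (n : ℕ) : consTape .num l n (.num 0) = Core.encTape l n := by
  induction l generalizing n with
  | nil => rfl
  | cons a l ih => simp [consTape, ih, Core.encTape]

theorem consTape_keyed (f : ℕ → Val) (l : List ℕ) :
    consTape f l 0 (.num 0) = .ofTable f (keyed l) := by
  have : ∀ n, consTape f l n (.num 0) = .ofTable f ((l.zipIdx (n + 1)).map fun t =>
      (.num t.2, t.1)) := by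
    induction l with
    | nil => intro n; rfl
    | cons a l ih => intro n; simp [consTape, ih, Val.ofTable]
  exact this 0

/-- The state of the sampling loop, and one round of it. -/
def loopState (ctx : Val) (j : ℕ) (acc : Val) : Val := .pair (.num j) (.pair ctx acc)

/-- One round of the sampling loop. -/
def sampleBody (d : Code DLOracle) : Code DLOracle :=
  .pair (.seq (.pair .fst (.const 1)) (.arith .sub)) (.pair (.seq .snd .fst)
    (.pair (.pair .fst (.seq (.seq .snd .fst) d)) (.seq .snd .snd)))

theorem draws_sampleBody {N : ℕ} {d : Code DLOracle} {ctx acc : Val} {n K j : ℕ} {f : ℕ → Val}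
    {upd : ℕ → DLState → DLState}
    (hd : Draws e (d.run N ctx) s ((unif n).map fun c => (f c, upd c s)) K) :
    Draws e ((sampleBody d).run N (loopState ctx (j + 1) acc)) s
      ((unif n).map fun c => (loopState ctx j (.pair (.pair (.num (j + 1)) (f c)) acc), upd c s))
      (K + 20 * (loopState ctx (j + 1) acc).size) := by
  simp only [sampleBody, loopState, Code.run, Comp.bind, Comp.bind_assoc]
  refine (hd.map (B' := K + 20 * (loopState ctx (j + 1) acc).size) (g := fun v =>
    loopState ctx j (.pair (.pair (.num (j + 1)) v) acc)) ?_).congr ?_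
  · intro q hq t ht
    refine ⟨rfl, ?_⟩
    simp only [loopState, Val.size, Nat.size_one, ArithOp.eval]
    omega
  · simp [PMF.map_comp, Function.comp_def, loopState]

/-- The counter gives each entry its key. As the last entry of `l` is drawn first, the oracle state
evolves by a right fold over `l`. The bound `B` covers the initial state and all entries still to be
added. -/
theorem draws_sampleLoop {N : ℕ} {d : Code DLOracle} {ctx : Val} {n K B : ℕ} {f : ℕ → Val}
    {upd : ℕ → DLState → DLState}
    (hd : ∀ s, Draws e (d.run N ctx) s ((unif n).map fun c => (f c, upd c s)) K)
    (hf : ∀ c < max n 1, (f c).size ≤ K) (j : ℕ) :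
    ∀ N' acc s, j < N' → (loopState ctx j acc).size + j * (K + 3 + Nat.size j) ≤ B →
      Draws e (Comp.whileLoop (Code.fst.run N) ((sampleBody d).run N) N' (loopState ctx j acc)) s
        ((unifList n j).map fun l => (loopState ctx 0 (consTape f l 0 acc), l.foldr upd s))
        ((j + 1) * (22 * B + K + 10)) := by
  induction j with
  | zero =>
    intro N' acc s hN' hB
    obtain ⟨N', rfl⟩ : ∃ m, N' = m + 1 := ⟨N' - 1, by omega⟩
    refine (Draws.ret (e := e) (s := s) (z := loopState ctx 0 acc) (t := 1 + (loopState ctx 0 acc).size + 1) ?_).congr ?_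
    · omega
    · simp [unifList, PMF.pure_map, consTape]
  | succ j ih =>
    intro N' acc s hN' hB
    obtain ⟨N', rfl⟩ : ∃ m, N' = m + 1 := ⟨N' - 1, by omega⟩
    have e1 : (j + 1 + 1) * (22 * B + K + 10) = (j + 1) * (22 * B + K + 10) +
      (22 * B + K + 10) := by ring
    have e2 : (j + 1) * (K + 3 + Nat.size (j + 1)) = j * (K + 3 + Nat.size (j + 1)) + K + 3 +
      Nat.size (j + 1) := by ring
    have e3 : j * (K + 3 + Nat.size j) ≤ j * (K + 3 + Nat.size (j + 1)) := by
      gcongr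
      exact Nat.size_le_size (by omega)
    have e4 : Nat.size j ≤ Nat.size (j + 1) := Nat.size_le_size (by omega)
    rw [Comp.whileLoop]
    have h0 : (Code.run N .fst (loopState ctx (j + 1) acc) : Comp DLOracle _) =
      .ret (.num (j + 1), 1 + (loopState ctx (j + 1) acc).size) := rfl
    simp only [h0, Comp.bind, Val.num.injEq, Nat.add_eq_zero_iff, one_ne_zero, and_false, if_false]
    refine ((draws_sampleBody (hd s)).bind (B' := (j + 1 + 1) * (22 * B + K + 10))
      (κ := fun q => (unifList n j).map fun l =>
        (loopState ctx 0 (consTape f l 0 q.1.snd.snd), l.foldr upd q.2)) ?_).congr ?_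
    · intro q hq t ht
      rw [PMF.support_map] at hq
      obtain ⟨c, hc, rfl⟩ := hq
      have hc' := hf c (unif_support n hc)
      have := ih N' (.pair (.pair (.num (j + 1)) (f c)) acc) (upd c s) (by omega) (by
        simp only [loopState, Val.size] at hB ⊢
        omega)
      refine (this.map (B' := (j + 1 + 1) * (22 * B + K + 10)) (g := fun v => v)
        fun q hq t' ht' => ⟨rfl, ?_⟩).congr ?_
      · simp only
        omega
      · exact PMF.map_id _
    · rw [unifList_snoc]
      simp only [PMF.map_bind, PMF.bind_map, PMF.map_comp]
      congr 1
      funext c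
      simp only [Function.comp_apply, loopState, Val.snd_pair]
      refine PMF.map_congr_support fun l hl => ?_
      simp [consTape_snoc, unifList_length hl]

end draws

/-- A polynomial-time program that takes `φ x` and the oracle state `s x` to `ψ x y` and `s' x y`,
where `y` has the distribution `μ x`. -/
def Samples {𝒢 : GroupGen} {X Y : Type} (e : X → Env 𝒢) (φ : X → Val) (s : X → DLState)
    (μ : X → PMF Y) (ψ : X → Y → Val) (s' : X → Y → DLState) : Prop :=
  ∃ (c : Code DLOracle) (P : Polynomial ℕ), ∀ x,
    (∀ N, P.eval ((e x).k + (φ x).size) ≤ N → Draws (e x) (c.run N (φ x)) (s x)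
      ((μ x).map fun y => (ψ x y, s' x y)) (P.eval ((e x).k + (φ x).size))) ∧
    ∀ y ∈ (μ x).support, (ψ x y).size ≤ P.eval ((e x).k + (φ x).size)

section samples

variable {𝒢 : GroupGen} {X Y Z : Type} {e : X → Env 𝒢} {φ χ : X → Val} {s s' : X → DLState}
  {μ : X → PMF Y} {ψ : X → Y → Val} {t : X → Y → DLState}

theorem Act.samples (h : Act e φ s χ s') :
    Samples e φ s (fun _ => PMF.pure ()) (fun x _ => χ x) (fun x _ => s' x) := by
  obtain ⟨c, P, h⟩ := h
  refine ⟨c, P, fun x => ⟨fun N hN => ?_, fun y _ => (h x).2⟩⟩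
  exact ((h x).1 N hN).draws.congr (by simp [PMF.pure_map])

/-- First a randomized program, then a deterministic one. -/
theorem Samples.then_act {ψ' : X → Y → Val} {t' : X → Y → DLState} (h : Samples e φ s μ ψ t)
    (h' : Act (fun y : {y : X × Y // y.2 ∈ (μ y.1).support} => e y.1.1)
      (fun y => ψ y.1.1 y.1.2) (fun y => t y.1.1 y.1.2) (fun y => ψ' y.1.1 y.1.2)
      (fun y => t' y.1.1 y.1.2)) : Samples e φ s μ ψ' t' := by
  obtain ⟨c, P, h⟩ := h
  obtain ⟨d, Q, h'⟩ := h'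
  refine ⟨.seq c d, P + Q.comp (.X + P) + 1, fun x => ?_⟩
  obtain ⟨h1, h2⟩ := h x
  set z := (e x).k + (φ x).size with hz
  have hle : ∀ y ∈ (μ x).support, Q.eval ((e x).k + (ψ x y).size) ≤ Q.eval (z + P.eval z) :=
    fun y hy => Q.monotone_eval_nat (by have := h2 y hy; omega)
  simp only [Polynomial.eval_add, Polynomial.eval_comp, Polynomial.eval_X, Polynomial.eval_one]
  refine ⟨fun N hN => ?_, fun y hy => ?_⟩
  · rw [Code.run]
    constructor
    · have hm := (h1 N (by omega)).map_eq
      rw [Comp.exec_bind, PMF.map_bind]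
      rw [show (μ x).map (fun y => (ψ' x y, t' x y)) = (μ x).bind fun y =>
        .pure (ψ' x y, t' x y) from rfl]
      have key : ∀ r ∈ ((c.run N (φ x)).exec (dlOracle 𝒢 (e x).i) (s x)).support,
          ∃ y ∈ (μ x).support, (r.1.1, r.2) = (ψ x y, t x y) := by
        intro r hr
        have : (r.1.1, r.2) ∈ ((μ x).map fun y => (ψ x y, t x y)).support := by
          rw [← hm, PMF.support_map]
          exact ⟨r, hr, rfl⟩
        rw [PMF.support_map] at this
        obtain ⟨y, hy, h⟩ := this
        exact ⟨y, hy, h.symm⟩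
      -- Different `y` may lead to the same value and oracle state. The second program is
      -- deterministic, so they also agree afterwards, and the final distribution is an image of the
      -- intermediate one.
      have hκ : ∀ q : Val × DLState, (∃ y ∈ (μ x).support, q = (ψ x y, t x y)) →
          ∃ q', ∀ y ∈ (μ x).support, q = (ψ x y, t x y) → q' = (ψ' x y, t' x y) := by
        rintro q ⟨y, hy, rfl⟩
        refine ⟨(ψ' x y, t' x y), fun y' hy' heq => ?_⟩
        rw [Prod.mk.injEq] at heq
        have g1 := ((h' ⟨(x, y), hy⟩).1 (Q.eval ((e x).k + (ψ x y).size)) le_rfl).draws.map_eq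
        have g2 := ((h' ⟨(x, y'), hy'⟩).1 (Q.eval ((e x).k + (ψ x y').size)) le_rfl).draws.map_eq
        simp only at g1 g2
        rw [← heq.1, ← heq.2, g1] at g2
        have : (ψ' x y, t' x y) ∈ (PMF.pure (ψ' x y', t' x y')).support := by
          rw [← g2]; simp
        simpa using this
      choose! κ hκ using hκ
      have e1 : (μ x).bind (fun y => PMF.pure (ψ' x y, t' x y)) =
          ((μ x).map fun y => (ψ x y, t x y)).bind fun q => .pure (κ q) := by
        rw [PMF.bind_map]
        refine PMF.bind_congr_support fun y hy => ?_
        rw [Function.comp_apply, hκ _ ⟨y, hy, rfl⟩ y hy rfl]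
      rw [e1, ← hm, PMF.bind_map]
      refine PMF.bind_congr_support fun r hr => ?_
      obtain ⟨y, hy, hry⟩ := key r hr
      rw [Prod.mk.injEq] at hry
      have g := ((h' ⟨(x, y), hy⟩).1 N (by have := hle y hy; simp only; omega)).draws
      simp only [Function.comp_apply]
      rw [Comp.exec_bind, PMF.map_bind, hry.1, hry.2, hκ _ ⟨y, hy, rfl⟩ y hy rfl, ← g.map_eq]
      simp only [Comp.exec, PMF.pure_map]
      rfl
    · intro r hr
      rw [Comp.exec_bind, PMF.mem_support_bind_iff] at hr
      obtain ⟨q, hq, hr⟩ := hr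
      have hm : (q.1.1, q.2) ∈ ((μ x).map fun y => (ψ x y, t x y)).support := by
        rw [← (h1 N (by omega)).map_eq, PMF.support_map]
        exact ⟨q, hq, rfl⟩
      rw [PMF.support_map] at hm
      obtain ⟨y, hy, hqy⟩ := hm
      simp only [Prod.mk.injEq] at hqy
      have g := ((h' ⟨(x, y), hy⟩).1 N (by have := hle y hy; simp only; omega))
      have := (h1 N (by omega)).time_le q hq
      rw [Comp.exec_bind, PMF.mem_support_bind_iff, ← hqy.1, ← hqy.2] at hr
      obtain ⟨q', hq', hr⟩ := hr
      obtain ⟨-, g2, -⟩ := g q' hq'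
      simp only [Comp.exec, PMF.mem_support_pure_iff] at hr
      subst hr
      have := hle y hy
      simp only at g2 ⊢
      omega
  · have := (h' ⟨(x, y), hy⟩).2
    have := hle y hy
    simp only at *
    omega

/-- Two randomized programs, one after the other. -/
theorem Samples.pair {μ' : X → PMF Z} {ψ' : X → Z → Val} {t' : X → Y → Z → DLState}
    (h : Samples e φ s μ ψ t)
    (h' : Samples (fun q : X × Y => e q.1) (fun q => φ q.1) (fun q => t q.1 q.2)
      (fun q => μ' q.1) (fun q => ψ' q.1) (fun q => t' q.1 q.2)) :
    Samples e φ s (fun x => (μ x).bind fun y => (μ' x).map fun z => (y, z))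
      (fun x q => .pair (ψ x q.1) (ψ' x q.2)) (fun x q => t' x q.1 q.2) := by
  obtain ⟨c, P, h⟩ := h
  obtain ⟨d, Q, h'⟩ := h'
  refine ⟨.pair c d, P + Q + 1, fun x => ?_⟩
  obtain ⟨h1, h2⟩ := h x
  simp only [Polynomial.eval_add, Polynomial.eval_one]
  refine ⟨fun N hN => ?_, fun q hq => ?_⟩
  · rw [Code.run]
    constructor
    · rw [Comp.exec_bind, PMF.map_bind, PMF.map_bind]
      simp only [PMF.map_comp]
      have hq : ∀ y : Y, Draws (e x) (d.run N (φ x)) (t x y) _ _ := fun y =>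
        (h' (x, y)).1 N (by simp only; omega)
      have e1 : ((μ x).bind fun y => (μ' x).map ((fun q : Y × Z =>
          (Val.pair (ψ x q.1) (ψ' x q.2), t' x q.1 q.2)) ∘ fun z => (y, z))) =
          ((μ x).map fun y => (ψ x y, t x y)).bind fun q =>
          ((d.run N (φ x)).exec (dlOracle 𝒢 (e x).i) q.2).map fun r =>
            (Val.pair q.1 r.1.1, r.2) := by
        rw [PMF.bind_map]
        congr 1
        funext y
        have := congrArg (PMF.map fun q : Val × DLState => (Val.pair (ψ x y) q.1, q.2))
          (hq y).map_eq
        simp only [PMF.map_comp, Function.comp_def] at this ⊢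
        exact this.symm
      rw [e1, ← (h1 N (by omega)).map_eq, PMF.bind_map]
      congr 1
      funext r
      simp only [Function.comp_apply, Comp.exec_bind, PMF.map_bind, Comp.exec, PMF.pure_map]
      rfl
    · intro r hr
      rw [Comp.exec_bind, PMF.mem_support_bind_iff] at hr
      obtain ⟨q, hq, hr⟩ := hr
      have hm : (q.1.1, q.2) ∈ ((μ x).map fun y => (ψ x y, t x y)).support := by
        rw [← (h1 N (by omega)).map_eq, PMF.support_map]
        exact ⟨q, hq, rfl⟩
      rw [PMF.support_map] at hm
      obtain ⟨y, hy, hqy⟩ := hm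
      simp only [Prod.mk.injEq] at hqy
      have := (h1 N (by omega)).time_le q hq
      rw [Comp.exec_bind, PMF.mem_support_bind_iff, ← hqy.2] at hr
      obtain ⟨q', hq', hr⟩ := hr
      have g := ((h' (x, y)).1 N (by simp only; omega)).time_le q' hq'
      simp only [Comp.exec, PMF.mem_support_pure_iff] at hr
      subst hr
      simp only at g ⊢
      omega
  · simp only [PMF.mem_support_bind_iff, PMF.support_map] at hq
    obtain ⟨y, hy, z, hz, rfl⟩ := hq
    have g1 := h2 y hy
    have g2 := (h' (x, y)).2 z hz
    simp only [Val.size] at g1 g2 ⊢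
    omega

end samples

section loops

variable {𝒢 : GroupGen} {X : Type} {e : X → Env 𝒢} {φ : X → Val} {s : X → DLState}

/-- Sampling in a loop. -/
theorem Samples.loop {d : Code DLOracle} {ctx : X → Val} {n m : X → ℕ} {f : X → ℕ → Val}
    {upd : X → ℕ → DLState → DLState} (hctx : Fn e φ ctx) (hm : Fn e φ fun x => .num (m x))
    (Q : Polynomial ℕ) (hQ : ∀ x, m x ≤ Q.eval ((e x).k + (φ x).size)) (R : Polynomial ℕ)
    (hd : ∀ x N s, Draws (e x) (d.run N (ctx x)) s ((unif (n x)).map fun c => (f x c, upd x c s))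
      (R.eval ((e x).k + (ctx x).size)))
    (hf : ∀ x, ∀ c < max (n x) 1, (f x c).size ≤ R.eval ((e x).k + (ctx x).size)) :
    Samples e φ s (fun x => unifList (n x) (m x)) (fun x l => consTape (f x) l 0 (.num 0))
      (fun x l => l.foldr (upd x) (s x)) := by
  obtain ⟨Pc, hPc⟩ := hctx.size_le
  have h0 : Fn e φ fun x => loopState (ctx x) (m x) (.num 0) := hm.pair (hctx.pair (Fn.const 0))
  obtain ⟨c, P, h0⟩ := h0.act s
  let R' := R.comp (.X + Pc)
  let B := Q + Pc + 5 + (Q * (R' + Q + 3))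
  refine ⟨.seq c (.seq (.loop .fst (sampleBody d)) (.seq .snd .snd)),
    P + (Q + 1) * (22 * B + R' + 10) + 20 + 10 * B, fun x => ?_⟩
  obtain ⟨h1, h2⟩ := h0 x
  set y := (e x).k + (φ x).size with hy
  have hm' := hQ x
  rw [← hy] at hm'
  have hms : Nat.size (m x) ≤ Q.eval y := le_trans (Nat.size_le.2 Nat.lt_two_pow_self) hm'
  have hc := hPc x
  rw [← hy] at hc
  have hR : R.eval ((e x).k + (ctx x).size) ≤ R'.eval y := by
    simp only [R', Polynomial.eval_comp, Polynomial.eval_add, Polynomial.eval_X]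
    exact R.monotone_eval_nat (by omega)
  have hB : (loopState (ctx x) (m x) (.num 0)).size + m x * (R'.eval y + 3 + Nat.size (m x)) ≤
      B.eval y := by
    simp only [B, loopState, Val.size, Nat.size_zero, Polynomial.eval_add, Polynomial.eval_mul,
      Polynomial.eval_ofNat]
    have : m x * (R'.eval y + 3 + Nat.size (m x)) ≤
      Q.eval y * (R'.eval y + Q.eval y + 3) := Nat.mul_le_mul hm' (by omega)
    omega
  have hlen : ∀ (l : List ℕ) j acc, (∀ c ∈ l, (f x c).size ≤ R'.eval y) → l.length + j ≤ m x →
      (consTape (f x) l j acc).size ≤ acc.size + l.length * (R'.eval y + 3 + Nat.size (m x)) := by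
    intro l
    induction l with
    | nil => intro j acc _ _; simp [consTape]
    | cons a l ih =>
      intro j acc hl hj
      simp only [List.mem_cons, forall_eq_or_imp, List.length_cons] at hl hj
      have g1 := ih (j + 1) acc hl.2 (by omega)
      have g2 : Nat.size (j + 1) ≤ Nat.size (m x) := Nat.size_le_size (by omega)
      have g3 : (l.length + 1) * (R'.eval y + 3 + Nat.size (m x)) = l.length * (R'.eval y + 3 +
        Nat.size (m x)) + (R'.eval y + 3 + Nat.size (m x)) := by ring
      simp only [consTape, Val.size, List.length_cons]
      omega
  have hout : ∀ l ∈ (unifList (n x) (m x)).support,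
      (consTape (f x) l 0 (.num 0)).size ≤ B.eval y := by
    intro l hl
    have hmem : ∀ c ∈ l, (f x c).size ≤ R'.eval y := by
      intro c hc
      refine (hf x c ?_).trans hR
      have : ∀ m, ∀ l ∈ (unifList (n x) m).support, ∀ c ∈ l, c < max (n x) 1 := by
        intro m
        induction m with
        | zero => intro l hl; simp [unifList] at hl; simp [hl]
        | succ m ih =>
          intro l hl
          simp only [unifList, PMF.mem_support_bind_iff, PMF.mem_support_pure_iff] at hl
          obtain ⟨a, ha, l', hl', rfl⟩ := hl
          simp only [List.mem_cons, forall_eq_or_imp]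
          exact ⟨unif_support _ ha, ih l' hl'⟩
      exact this _ l hl c hc
    have g := hlen l 0 (.num 0) hmem (by rw [unifList_length hl]; omega)
    rw [unifList_length hl] at g
    simp only [loopState, Val.size] at hB g ⊢
    omega
  simp only [Polynomial.eval_add, Polynomial.eval_mul, Polynomial.eval_ofNat, Polynomial.eval_one]
  have hb1 : (m x + 1) * (22 * B.eval y + R'.eval y + 10) ≤
      (Q.eval y + 1) * (22 * B.eval y + R'.eval y + 10) := Nat.mul_le_mul_right _ (by omega)
  have hb2 : m x + 1 ≤ (m x + 1) * (22 * B.eval y + R'.eval y + 10) :=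
    Nat.le_mul_of_pos_right _ (by omega)
  refine ⟨fun N hN => ?_, fun l hl => (hout l hl).trans (by omega)⟩
  have hl := draws_sampleLoop (e := e x) (N := N) (d := d) (ctx := ctx x) (B := B.eval y)
    (fun s => (hd x N s).mono hR) (fun c hc => (hf x c hc).trans hR) (m x) N (.num 0) (s x)
    (by omega) hB
  simp only [Code.run, Comp.bind] at hl ⊢
  refine ((h1 N (by omega)).draws.bind (κ := fun q => (unifList (n x) (m x)).map fun l =>
    (consTape (f x) l 0 (.num 0), l.foldr (upd x) (s x))) fun q hq u hu => ?_).congr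
      (by rw [PMF.pure_bind])
  rw [PMF.mem_support_pure_iff] at hq
  subst hq
  simp only [Comp.bind_assoc, Comp.bind]
  refine (hl.map (g := fun v => v.snd.snd) fun q hq u' hu' => ⟨?_, ?_⟩).congr ?_
  · rw [PMF.support_map] at hq
    obtain ⟨l, hl, rfl⟩ := hq
    rfl
  · rw [PMF.support_map] at hq
    obtain ⟨l, hl, rfl⟩ := hq
    have := hout l hl
    have hB' := hB
    simp only [loopState, Val.size] at this hB' ⊢
    simp only [Nat.size_zero] at *
    omega
  · rw [PMF.map_comp]
    rfl

/-- Sampling a list of numbers. -/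
theorem Samples.unifList {n m : X → ℕ} (hn : Fn e φ fun x => .num (n x))
    (hm : Fn e φ fun x => .num (m x))
    (Q : Polynomial ℕ) (hQ : ∀ x, m x ≤ Q.eval ((e x).k + (φ x).size)) :
    Samples e φ s (fun x => unifList (n x) (m x)) (fun _ l => Core.encTape l 0)
      (fun x _ => s x) := by
  have h := Samples.loop (s := s) (d := .rand) (n := n) (f := fun _ c => .num c) (upd := fun _ _ s => s)
    hn hm Q hQ (.X + 2) (fun x N s => ?_) fun x c hc => ?_
  · have e1 : (fun (x : X) (l : List ℕ) => l.foldr (fun _ s => s) (s x)) = fun x _ => s x := by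
      funext x l
      induction l with
      | nil => rfl
      | cons a l ih => exact ih
    simp only [consTape_num] at h
    rwa [← e1]
  · constructor
    · simp only [Code.run, Comp.exec, PMF.map_bind, PMF.pure_map]
      rfl
    · intro r hr
      simp only [Code.run, Comp.exec, PMF.mem_support_bind_iff, PMF.mem_support_pure_iff] at hr
      obtain ⟨c, hc, rfl⟩ := hr
      simp only [Val.size, Polynomial.eval_add, Polynomial.eval_X, Polynomial.eval_ofNat]
      omega
  · have h1 : Nat.size c ≤ Nat.size (n x) + 1 := by
      rcases Nat.eq_zero_or_pos (n x) with h0 | h0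
      · have : c = 0 := by omega
        simp [this]
      · exact (Nat.size_le_size (show c ≤ n x by omega)).trans (by omega)
    simp only [Val.size, Polynomial.eval_add, Polynomial.eval_X, Polynomial.eval_ofNat]
    omega

/-- Obtaining challenges. -/
theorem Samples.challenges {m : X → ℕ} (hm : Fn e φ fun x => .num (m x))
    (Q : Polynomial ℕ) (hQ : ∀ x, m x ≤ Q.eval ((e x).k + (φ x).size)) :
    Samples e φ s (fun x => _root_.unifList (e x).p (m x))
      (fun x l => ofTable (𝒢.point (e x).i) (keyed l))
      (fun x l => { s x with challenges := (s x).challenges ++ l.reverse }) := by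
  have h := Samples.loop (s := s) (d := .call .challenge) (n := fun x => (e x).p)
    (f := fun x c => 𝒢.point (e x).i c)
    (upd := fun _ c s => { s with challenges := s.challenges ++ [c] })
    (Fn.const 0) hm Q hQ (.X + 𝒢.bound + 1) (fun x N s => ?_) fun x c hc => ?_
  -- The entries are obtained from the last to the first, so the recorded challenges grow by the
  -- reversed list. This is why the nonces are reversed in `World.challenges`.
  · have e1 : (fun (x : X) (l : List ℕ) => l.foldr (fun c (s : DLState) =>
        { s with challenges := s.challenges ++ [c] }) (s x)) =
        fun x l => { s x with challenges := (s x).challenges ++ l.reverse } := by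
      funext x l
      induction l with
      | nil => simp
      | cons a l ih => rw [List.foldr_cons, ih]; simp
    simp only [consTape_keyed] at h
    rwa [← e1]
  · have hsz : ∀ c, (𝒢.point (e x).i c).size ≤ 𝒢.bound.eval ((e x).k + (Val.num 0).size) :=
      fun c => (𝒢.enc_size _ (e x).two_le _ (e x).mem _).trans
        (𝒢.bound.monotone_eval_nat (Nat.le_add_right _ _))
    constructor
    · simp only [Code.run, Comp.exec, dlOracle, PMF.bind_bind, PMF.pure_bind, PMF.map_bind,
        PMF.pure_map]
      rfl
    · intro r hr
      simp only [Code.run, Comp.exec, dlOracle, PMF.mem_support_bind_iff,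
        PMF.mem_support_pure_iff] at hr
      obtain ⟨c, ⟨c', hc', rfl⟩, rfl⟩ := hr
      have := hsz c'
      simp only [Polynomial.eval_add, Polynomial.eval_X, Polynomial.eval_one]
      omega
  · have := (𝒢.enc_size _ (e x).two_le _ (e x).mem (c • 𝒢.base (e x).i)).trans
      (𝒢.bound.monotone_eval_nat (Nat.le_add_right (e x).k (Val.num 0).size))
    simp only [Polynomial.eval_add, Polynomial.eval_X, Polynomial.eval_one] at this ⊢
    exact this.trans (by omega)

end loops

/-! ## The adversary against the one-more discrete logarithm problem -/

section spec

/-- The slot of the value `ε` in a table of hash values. -/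
def slotOf (l : List (Val × ℕ × ℕ)) (ε : ℕ) : ℕ :=
  (l.findSome? fun t => if t.2.1 = ε then some t.2.2 else none).getD 0

/-- Replace the entries of a tape in the slots that are not kept by those of a second tape; the
first entry is in slot `n + 1`. -/
def merge (keep : ℕ → Bool) : ℕ → List ℕ → List ℕ → List ℕ
  | _, [], _ => []
  | n, a :: l, l' => (if keep (n + 1) then a else l'.headD 0) :: merge keep (n + 1) l l'.tail

/-- The claimed values `ε` and `σ` of an output of the forger. -/
def outHash (out : Val) : ℕ := out.snd.snd.snd.toNat

/-- The claimed value `σ` of an output of the forger. -/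
def outSig (out : Val) : ℕ := out.snd.snd.fst.toNat

/-- The slots kept when the forger is run again. -/
def keeps (out : Val) (c : Core) (n : ℕ) : Bool :=
  decide (n < slotOf c.hashTbl (outHash out) ∨ (c.sessions.any fun t => t.slot = n) = true)

/-- The secret key extracted from two outputs of the forger. -/
def extract (p : ℕ) (xs : List ℕ) (out₁ out₂ : Val) : ℕ :=
  ((outSig out₁ + (p - outSig out₂ % p)) *
    (((outHash out₂ + (p - outHash out₁ % p)) ^ (p - 2)) % p) +
      (p - xs.foldl (fun r c => (r + c) % p) 0)) % p

variable {𝒢 : GroupGen}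

/-- The initial state of the simulated oracles. -/
def Core.start (a f u : List ℕ) : Core := ⟨a, f, u, [], [], [], 0, [], false⟩

/-- What the adversary draws: the setup, the secret keys of the corrupted cards, two tapes of hash
values, a tape of other values of the pseudorandom function, and a tape of coins. -/
structure Trial (𝒢 : GroupGen) extends Setup 𝒢 where
  xs : List ℕ
  hashTape : List ℕ
  altTape : List ℕ
  prfTape : List ℕ
  coinTape : List ℕ

namespace Trial

variable (F : Code ForgerOracle) (T : Polynomial ℕ) (t : Trial 𝒢)

/-- The input of the forger. -/
abbrev input : Val := forgerInput 𝒢 t.env.k t.env.i t.x t.xs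

/-- Run the forger with a given tape of hash values. -/
def runBook (tape : List ℕ) (b : Book) : (Val × ℕ) × Core × Book :=
  (F.run (T.eval t.env.k) t.input).det (t.answerBook t.s) World.coinBook
    (Core.start tape t.prfTape t.coinTape, b)

/-- The first run of the forger. -/
abbrev first : (Val × ℕ) × Core × Book := t.runBook F T t.hashTape ⟨[], 0⟩

/-- The tape of hash values for the second run. -/
def forked : List ℕ :=
  merge (keeps (t.first F T).1.1 (t.first F T).2.1) 0 t.hashTape t.altTape

/-- The second run of the forger. -/
abbrev second : (Val × ℕ) × Core × Book := t.runBook F T (t.forked F T) (t.first F T).2.2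

/-- The secret key of the honest card, as found by the adversary. -/
def key : ℕ := extract t.env.p t.xs (t.first F T).1.1 (t.second F T).1.1

/-- The nonce with key `J`, as found by the adversary. -/
def findNonce (b : Book) (z J : ℕ) : ℕ :=
  if (b.shares.lookup (.num J)).isSome then
    (((b.shares.lookup (.num J)).getD (0, 0)).2 +
      z * ((b.shares.lookup (.num J)).getD (0, 0)).1) % t.env.p
  else (look t.nonces (.num J)).getD 0 % t.env.p

/-- The number of queries for the logarithms of the first `J` nonces. -/
def finalQueries (b : Book) : ℕ → ℕ
  | 0 => b.queries
  | J + 1 => finalQueries b J + if (b.shares.lookup (.num (J + 1))).isSome then 0 else 1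

/-- The first `J` nonces, in reversed order. -/
def findNonces (b : Book) (z : ℕ) : ℕ → List ℕ
  | 0 => []
  | J + 1 => t.findNonce b z (J + 1) :: findNonces b z J

/-- The output of the adversary. -/
def output (qS : ℕ) : List ℕ :=
  t.key F T :: t.findNonces (t.second F T).2.2 (t.key F T) qS

/-- The number of queries of the adversary to the discrete logarithm oracle. -/
def queries (qS : ℕ) : ℕ := finalQueries (t.second F T).2.2 qS

/-- The tapes are sufficiently long, and the forger is fast. -/
structure Proper (qS : ℕ) : Prop where
  length_nonces : t.nonces.length = qS
  length_hashTape : t.hashTape.length = T.eval t.env.k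
  hashTape_lt : ∀ a ∈ t.hashTape, a < 2 ^ t.env.k
  altTape_lt : ∀ a ∈ t.altTape, a < 2 ^ t.env.k
  time : ∀ (tape : List ℕ) (b : Book), tape.length = T.eval t.env.k → (∀ a ∈ tape, a < 2 ^ t.env.k) →
    (t.runBook F T tape b).1.2 ≤ T.eval t.env.k

end Trial

end spec

/-! ### Merged tapes and lists with keys -/

theorem length_merge (keep : ℕ → Bool) (n : ℕ) (l l' : List ℕ) :
    (merge keep n l l').length = l.length := by
  induction l generalizing n l' with
  | nil => rfl
  | cons a l ih => simp [merge, ih]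

theorem merge_lt {keep : ℕ → Bool} {n B : ℕ} {l l' : List ℕ} (h : ∀ a ∈ l, a < B)
    (h' : ∀ a ∈ l', a < B) : ∀ a ∈ merge keep n l l', a < B := by
  induction l generalizing n l' with
  | nil => simp [merge]
  | cons a l ih =>
    simp only [List.mem_cons, forall_eq_or_imp] at h
    simp only [merge, List.mem_cons, forall_eq_or_imp]
    refine ⟨?_, ih h.2 fun a ha => h' a (List.mem_of_mem_tail ha)⟩
    split
    · exact h.1
    · rcases l' with _ | ⟨b, l'⟩
      · exact lt_of_le_of_lt (Nat.zero_le _) h.1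
      · exact h' b (by simp)

theorem lookup_zipIdx (l : List ℕ) (n j : ℕ) :
    ((l.zipIdx (n + 1)).map fun t => (Val.num t.2, t.1)).lookup (.num (n + 1 + j)) = l[j]? := by
  induction l generalizing n j with
  | nil => simp
  | cons a l ih =>
    rw [List.zipIdx_cons, List.map_cons, List.lookup_cons]
    rcases j with _ | j
    · simp
    · rw [show ((Val.num (n + 1 + (j + 1)) == Val.num (n + 1))) = false from
        beq_eq_false_iff_ne.2 (by simp), show n + 1 + (j + 1) = n + 1 + 1 + j by omega]
      simpa using ih (n + 1) j

theorem look_succ (l : List ℕ) (j : ℕ) : look l (.num (j + 1)) = l[j]? := by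
  have := lookup_zipIdx l 0 j
  rw [show 0 + 1 + j = j + 1 by omega] at this
  exact this

theorem look_eq_some {l : List ℕ} {J : Val} {r : ℕ} (h : look l J = some r) :
    ∃ j, J = .num (j + 1) ∧ l[j]? = some r := by
  have : ∃ j, J = .num (j + 1) := by
    by_contra hJ
    have key : ∀ (l : List ℕ) n, ((l.zipIdx (n + 1)).map fun t => (Val.num t.2, t.1)).lookup J = none := by
      intro l
      induction l with
      | nil => simp
      | cons a l ih =>
        intro n
        rw [List.zipIdx_cons, List.map_cons, List.lookup_cons, ih,
          show ((J == Val.num (n + 1))) = false from beq_eq_false_iff_ne.2 fun h => hJ ⟨n, h⟩]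
    rw [look, keyed, show (1 : ℕ) = 0 + 1 from rfl, key l 0] at h
    simp at h
  obtain ⟨j, rfl⟩ := this
  exact ⟨j, rfl, by rwa [look_succ] at h⟩

/-- The entrywise form of the recursion, in which `Fn.map` can compute it. In the induction the rest
of the second tape is the whole tape shifted by `n`. -/
theorem merge_eq (keep : ℕ → Bool) (l l' : List ℕ) :
    merge keep 0 l l' = (l.zipIdx 1).map fun t =>
      if keep t.2 then t.1 else (look l' (.num t.2)).getD 0 := by
  have : ∀ (l : List ℕ) n l'', (∀ j, l'[n + j]? = l''[j]?) → merge keep n l l'' =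
      (l.zipIdx (n + 1)).map fun t =>
        if keep t.2 then t.1 else (look l' (.num t.2)).getD 0 := by
    intro l
    induction l with
    | nil => intro n l'' _; rfl
    | cons a l ih =>
      intro n l'' h
      rw [merge, List.zipIdx_cons, List.map_cons, ih (n + 1) l''.tail]
      · rw [look_succ, show n = n + 0 from rfl, h 0]
        simp [List.headD_eq_head?_getD, List.head?_eq_getElem?]
      · intro j
        rw [show n + 1 + j = n + (j + 1) by omega, h]
        simp
  exact this l 0 l' fun j => by simp

theorem encTape_map (l : List ℕ) (g : ℕ × ℕ → ℕ) :
    Core.encTape ((l.zipIdx 1).map g) 0 =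
      .ofList (((l.zipIdx 1).map fun t => (g t, t.2)).map fun t => .pair (.num t.2) (.num t.1)) := by
  have : ∀ n, ((l.zipIdx n).map g).zipIdx n = (l.zipIdx n).map fun t => (g t, t.2) := by
    induction l with
    | nil => intro n; rfl
    | cons a l ih => intro n; simp [ih]
  rw [Core.encTape, this]

/-! ### Programs for the input of the forger, the merged tape, the extracted key, and a simulated
run -/

section programs

variable {𝒢 : GroupGen} {X : Type} {e : X → Env 𝒢} {φ : X → Val}

theorem Fn.forgerInput {x : X → ℕ} {xs : X → List ℕ} (hI : Fn e φ fun x => (e x).inst)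
    (hx : Fn e φ fun y => 𝒢.point (e y).i (x y))
    (hxs : Fn e φ fun y => ofList ((xs y).map .num)) :
    Fn e φ fun y => _root_.forgerInput 𝒢 (e y).k (e y).i (x y) (xs y) := by
  have h1 : Fn e φ fun y => ofList ((((xs y).map fun c => c • 𝒢.base (e y).i)).map
      (𝒢.enc (e y).i)) :=
    Fn.map (α := fun _ => ℕ) (β := fun y => 𝒢.El (e y).i) (fun _ => .num)
      (fun y => 𝒢.enc (e y).i) (fun y c => c • 𝒢.base (e y).i) hxs
      (Fn.groupSmul hI.inner hI.inst_base.inner (Fn.right Fn.id))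
  have h2 := Fn.foldl (α := fun y => 𝒢.El (e y).i) (β := fun y => 𝒢.El (e y).i)
    (fun y => 𝒢.enc (e y).i) (fun y => 𝒢.enc (e y).i) (fun _ A B => A + B)
    (b₀ := fun y => x y • 𝒢.base (e y).i) h1 hx
    (Fn.groupAdd hI.inner Fn.arg₃ Fn.arg₂) 𝒢.bound fun y j =>
      (𝒢.enc_size _ (e y).two_le _ (e y).mem _).trans
        (𝒢.bound.monotone_eval_nat (Nat.le_add_right _ _))
  refine (hI.pair (h2.pair ((hx.pair h1).pair hxs))).congr fun y => ?_
  have : ∀ (l : List (𝒢.El (e y).i)) A, l.foldl (fun A B => A + B) A = A + l.sum := by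
    intro l
    induction l with
    | nil => simp
    | cons a l ih => intro A; rw [List.foldl_cons, ih, List.sum_cons, add_assoc]
  rw [this]
  simp only [_root_.forgerInput, List.map_cons, List.sum_cons, ofList_cons, List.map_map]
  rfl

theorem Fn.untape {l : X → List ℕ} {n : X → ℕ} (h : Fn e φ fun x => Core.encTape (l x) (n x)) :
    Fn e φ fun x => ofList ((l x).map .num) := by
  refine (Fn.map (α := fun _ => ℕ × ℕ) (β := fun _ => ℕ) (fun _ t => .pair (.num t.2) (.num t.1))
    (fun _ => .num) (fun _ t => t.1) (l := fun x => (l x).zipIdx (n x + 1)) h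
    (Fn.right (Fn.right Fn.id))).congr fun x => ?_
  congr 1
  rw [show (fun t : ℕ × ℕ => t.1) = Prod.fst from rfl, List.zipIdx_map_fst]

theorem Fn.slotOf {l : X → List (Val × ℕ × ℕ)} {ε : X → ℕ}
    (hl : Fn e φ fun x => Core.encTbl (l x)) (hε : Fn e φ fun x => .num (ε x)) :
    Fn e φ fun x => .num (slotOf (l x) (ε x)) := by
  have h := Fn.findSome? (α := fun _ => Val × ℕ × ℕ) (β := fun _ => ℕ)
    (fun _ t => .pair t.1 (.pair (.num t.2.1) (.num t.2.2))) (fun _ => .num)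
    (fun x t => if t.2.1 = ε x then some t.2.2 else none) (l := l) hl ?_
  · refine h.snd.congr fun x => ?_
    rw [_root_.slotOf]
    rcases (l x).findSome? _ with _ | u <;> rfl
  · have h1 : Fn (fun y : (_ : X) × Val × ℕ × ℕ => e y.1) (fun y => .pair (φ y.1)
        (.pair y.2.1 (.pair (.num y.2.2.1) (.num y.2.2.2))))
        (fun y => .pair (.num y.2.2.1) (.num y.2.2.2)) := Fn.arg₃
    refine (Fn.ite (c := fun y : (_ : X) × Val × ℕ × ℕ => y.2.2.1 = ε y.1)
      (FnB.eq_num h1.left hε.inner) ((Fn.const 1).pair h1.right) (Fn.const 0)).congr fun y => ?_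
    split <;> rfl

theorem Fn.merge {a b : X → List ℕ} {out : X → Val} {c : X → Core}
    (ha : Fn e φ fun x => Core.encTape (a x) 0) (hb : Fn e φ fun x => Core.encTape (b x) 0)
    (hout : Fn e φ out) (ht : Fn e φ fun x => Core.encTbl (c x).hashTbl)
    (hs : Fn e φ fun x => Core.encSessions (c x).sessions) :
    Fn e φ fun x => Core.encTape (_root_.merge (keeps (out x) (c x)) 0 (a x) (b x)) 0 := by
  have hsl := Fn.slotOf ht hout.snd.snd.snd.toNat
  have hb' : Fn e φ fun x => ofTable .num (keyed (b x)) := hb.congr fun x => by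
    rw [← consTape_keyed, consTape_num]
  have h1 : Fn (fun y : (_ : X) × ℕ × ℕ => e y.1)
      (fun y => .pair (φ y.1) (.pair (.num y.2.2) (.num y.2.1))) (fun y => .num y.2.2) := Fn.arg₂
  have h2 : Fn (fun y : (_ : X) × ℕ × ℕ => e y.1)
      (fun y => .pair (φ y.1) (.pair (.num y.2.2) (.num y.2.1))) (fun y => .num y.2.1) := Fn.arg₃
  have hany : FnB (fun y : (_ : X) × ℕ × ℕ => e y.1)
      (fun y => .pair (φ y.1) (.pair (.num y.2.2) (.num y.2.1)))
      (fun y => (c y.1).sessions.any fun t => t.slot = y.2.2) :=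
    FnB.any (α := fun _ => Record) (fun _ r => .pair (.num r.index) (.num r.slot))
      (fun (y : (_ : X) × ℕ × ℕ) (r : Record) => decide (r.slot = y.2.2)) hs.inner (FnB.eq_num
        (b := fun z : (_ : (_ : X) × ℕ × ℕ) × Record => z.1.2.2) (Fn.arg₃ (ψ := fun z :
          (_ : (_ : X) × ℕ × ℕ) × Record => .num z.2.index)) (Fn.inner h1))
  have hk : FnB (fun y : (_ : X) × ℕ × ℕ => e y.1)
      (fun y => .pair (φ y.1) (.pair (.num y.2.2) (.num y.2.1)))
      (fun y => keeps (out y.1) (c y.1) y.2.2) :=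
    (FnB.lt h1 hsl.inner).or (hany.congr fun y => Bool.decide_eq_true.symm)
  have hl : Fn (fun y : (_ : X) × ℕ × ℕ => e y.1)
      (fun y => .pair (φ y.1) (.pair (.num y.2.2) (.num y.2.1)))
      (fun y => .num ((look (b y.1) (.num y.2.2)).getD 0)) :=
    (Fn.lookup _ hb'.inner h1).snd.congr fun y =>
      (show ∀ o : Option ℕ, (ofOption num o).snd = num (o.getD 0) by rintro (_ | _) <;> rfl) _
  have h3 : Fn (fun y : (_ : X) × ℕ × ℕ => e y.1)
      (fun y => .pair (φ y.1) (.pair (.num y.2.2) (.num y.2.1)))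
      (fun y => .num (if keeps (out y.1) (c y.1) y.2.2 then y.2.1
        else (look (b y.1) (.num y.2.2)).getD 0)) :=
    (Fn.ite (hk.congr fun y => Bool.decide_eq_true.symm) h2 hl).congr fun y => by split <;> rfl
  have h4 := Fn.map (α := fun _ => ℕ × ℕ) (β := fun _ => ℕ × ℕ)
    (fun _ t => .pair (.num t.2) (.num t.1)) (fun _ t => .pair (.num t.2) (.num t.1))
    (fun x t => (if keeps (out x) (c x) t.2 then t.1 else (look (b x) (.num t.2)).getD 0, t.2))
    (l := fun x => (a x).zipIdx 1) ha (h1.pair h3)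
  refine h4.congr fun x => ?_
  rw [merge_eq, encTape_map]

theorem Fn.extract {xs : X → List ℕ} {o₁ o₂ : X → Val} (hI : Fn e φ fun x => (e x).inst)
    (hxs : Fn e φ fun y => ofList ((xs y).map .num)) (h₁ : Fn e φ o₁) (h₂ : Fn e φ o₂) :
    Fn e φ fun y => .num (_root_.extract (e y).p (xs y) (o₁ y) (o₂ y)) := by
  have hp := hI.inst_p
  have hsum := Fn.foldl (α := fun _ => ℕ) (β := fun _ => ℕ) (fun _ => .num) (fun _ => .num)
    (fun x r c => (r + c) % (e x).p) (b₀ := fun _ => 0) hxs (Fn.const 0)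
    ((Fn.add (Fn.right (Fn.right Fn.id)) Fn.arg₂).mod hp.inner) (.X + 1) fun y j => ?_
  · have hs₁ : Fn e φ fun y => .num (outSig (o₁ y)) := h₁.snd.snd.fst.toNat
    have hs₂ : Fn e φ fun y => .num (outSig (o₂ y)) := h₂.snd.snd.fst.toNat
    have he₁ : Fn e φ fun y => .num (outHash (o₁ y)) := h₁.snd.snd.snd.toNat
    have he₂ : Fn e φ fun y => .num (outHash (o₂ y)) := h₂.snd.snd.snd.toNat
    have hpow := Fn.powMod hI (he₂.add (hp.sub (he₁.mod hp))) (hp.sub (Fn.const 2)) fun x => by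
      have := (e x).prime.two_le
      omega
    exact (((hs₁.add (hp.sub (hs₂.mod hp))).mul hpow).add (hp.sub hsum)).mod hp
  · have hlt : ∀ (l : List ℕ) r, r < (e y).p →
        l.foldl (fun r c => (r + c) % (e y).p) r < (e y).p := by
      intro l
      induction l with
      | nil => exact fun r h => h
      | cons c l ih => exact fun r _ => ih _ (Nat.mod_lt _ (e y).prime.pos)
    have := Nat.size_le.2 ((hlt ((xs y).take j) 0 (e y).prime.pos).trans (e y).lt_two_pow)
    simp only [Val.size, Polynomial.eval_add, Polynomial.eval_X, Polynomial.eval_one]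
    omega

/-- A simulated run of a program. -/
theorem Act.simulate {S : Type} {Y : Type} {e : Y → Env 𝒢} {g : X → Y}
    {M : Simulator e ForgerOracle S} (c : Code ForgerOracle) (T : Polynomial ℕ)
    {φ v : X → Val} {s : X → S} {dl : X → DLState} (hv : Fn (fun x => e (g x)) φ v)
    (hs : Fn (fun x => e (g x)) φ fun x => M.enc (g x) (s x))
    (hdl : ∀ x, M.dl (g x) (s x) = dl x)
    (hV : ∀ x, M.Valid (g x) (s x))
    (ht : ∀ x, ((c.run (T.eval (e (g x)).k) (v x)).det (M.answer (g x)) (M.coin (g x)) (s x)).1.2 ≤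
      T.eval (e (g x)).k) :
    Act (fun x => e (g x)) φ dl
      (fun x => .pair (φ x) (.pair
        ((c.run (T.eval (e (g x)).k) (v x)).det (M.answer (g x)) (M.coin (g x)) (s x)).1.1
        (M.enc (g x)
          ((c.run (T.eval (e (g x)).k) (v x)).det (M.answer (g x)) (M.coin (g x)) (s x)).2)))
      (fun x => M.dl (g x)
          ((c.run (T.eval (e (g x)).k) (v x)).det (M.answer (g x)) (M.coin (g x)) (s x)).2) := by
  obtain rfl : (fun x => M.dl (g x) (s x)) = dl := funext hdl
  obtain ⟨P, hP⟩ := M.exists_simulates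
  obtain ⟨c', C, hc'⟩ := hP c
  have hin := (Fn.id.pair (hv.pair hs)).act fun x => M.dl (g x) (s x)
  refine hin.seq ?_
  -- `B` bounds values and encoded states during the whole run: the size at the start, the growth in
  -- at most `T` steps, and the steps themselves. `W` is a polynomial bound for the slowdown at `B`.
  let B : Polynomial ℕ := .X + M.growth * T + T
  let W : Polynomial ℕ := P.comp (.X + (2 * B + 1)) + B + 1
  refine ⟨.pair .fst (.seq .snd c'), 10 + 10 * .X + C * T * W + 10 * B, fun x => ?_⟩
  set y := (e (g x)).k + (Val.pair (φ x) (.pair (v x) (M.enc (g x) (s x)))).size with hy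
  have hy' : (e (g x)).k ≤ y := by omega
  have hT : T.eval (e (g x)).k ≤ T.eval y := T.monotone_eval_nat hy'
  have hG : M.growth.eval (e (g x)).k ≤ M.growth.eval y := M.growth.monotone_eval_nat hy'
  rcases hr : (c.run (T.eval (e (g x)).k) (v x)).det (M.answer (g x)) (M.coin (g x)) (s x) with
    ⟨⟨a, t⟩, s'⟩
  have ht' := ht x
  rw [hr] at ht'
  simp only at ht'
  have hGt : M.growth.eval (e (g x)).k * t ≤ M.growth.eval y * T.eval y :=
    Nat.mul_le_mul hG (ht'.trans hT)
  have hWle : Simulator.slowdown (e := e) P (g x) (B.eval y) ≤ W.eval y := by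
    simp only [W, Simulator.slowdown, Polynomial.eval_add, Polynomial.eval_comp, Polynomial.eval_X,
      Polynomial.eval_mul, Polynomial.eval_ofNat, Polynomial.eval_one]
    have := P.monotone_eval_nat (show (e (g x)).k + (2 * B.eval y + 1) ≤
      y + (2 * B.eval y + 1) by omega)
    simp only at this
    omega
  have hCW : C * t * Simulator.slowdown (e := e) P (g x) (B.eval y) ≤ C * T.eval y * W.eval y :=
    Nat.mul_le_mul (Nat.mul_le_mul_left _ (ht'.trans hT)) hWle
  have hBy : B.eval y = y + M.growth.eval y * T.eval y + T.eval y := by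
    simp only [B, Polynomial.eval_add, Polynomial.eval_mul, Polynomial.eval_X]
  have hsz : (Val.pair (φ x) (.pair (v x) (M.enc (g x) (s x)))).size =
      2 + (φ x).size + (v x).size + (M.enc (g x) (s x)).size := by
    simp only [Val.size]; omega
  have hev : (10 + 10 * .X + C * T * W + 10 * B : Polynomial ℕ).eval y =
      10 + 10 * y + C * T.eval y * W.eval y + 10 * B.eval y := by
    simp only [Polynomial.eval_add, Polynomial.eval_mul, Polynomial.eval_X, Polynomial.eval_ofNat,
      Polynomial.eval_natCast]
    rfl
  have hrun := fun N' hN' => hc' (g x) (T.eval (e (g x)).k) N' (B.eval y) _ _ (v x) (s x) a t s'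
    rfl rfl (hV x) hr ht' (by omega) (by omega) hN'
  rw [hev]
  refine ⟨fun N hN => ?_, ?_⟩
  · obtain ⟨h1, -⟩ := hrun N (by omega)
    simp only [hr, Code.run, Comp.bind, Comp.bind_assoc]
    refine h1.bind fun u hu => Yields.ret ?_
    rw [hsz] at hy
    simp only [Val.size]
    omega
  · obtain ⟨-, -, h3, -, h5⟩ := hrun _ le_rfl
    have h6 : C * t ≤ C * t * Simulator.slowdown (e := e) P (g x) (B.eval y) :=
      Nat.le_mul_of_pos_right _ (by have := Simulator.lt_slowdown (e := e) (P := P) (g x) (B.eval y); omega)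
    rw [hsz] at hy
    simp only [hr, Val.size]
    omega

end programs

theorem Simulator.valid_det {𝒢 : GroupGen} {X : Type} {e : X → Env 𝒢} {O S α : Type}
    (M : Simulator e O S) {x : X} (m : Comp O α) {s : S} (h : M.Valid x s) :
    M.Valid x (m.det (M.answer x) (M.coin x) s).2 := by
  induction m generalizing s with
  | ret a => exact h
  | query o v k ih => exact ih _ (M.answer_valid x o s v h)
  | draw n k ih => exact ih _ (M.coin_valid x n s h)

theorem Val.isPair_ofOption {α : Type} (f : α → Val) (o : Option α) :
    (ofOption f o).isPair = decide (o.isSome = true) := by cases o <;> rfl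

theorem Val.fst_snd_ofOption (o : Option (ℕ × ℕ)) :
    (ofOption (fun t : ℕ × ℕ => Val.pair (.num t.1) (.num t.2)) o).snd.fst =
      .num (o.getD (0, 0)).1 := by cases o <;> rfl

theorem Val.snd_snd_ofOption (o : Option (ℕ × ℕ)) :
    (ofOption (fun t : ℕ × ℕ => Val.pair (.num t.1) (.num t.2)) o).snd.snd =
      .num (o.getD (0, 0)).2 := by cases o <;> rfl

/-! ### The deterministic part of the adversary: two runs and the final queries -/

namespace Trial

variable {𝒢 : GroupGen} {F : Code ForgerOracle} {T : Polynomial ℕ} {qS : ℕ}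

/-- Encoding of what the adversary draws. -/
def enc (t : Trial 𝒢) : Val :=
  .pair (t.encStatic t.s) (.pair (ofList (t.xs.map .num)) (.pair (Core.encTape t.hashTape 0)
    (.pair (Core.encTape t.altTape 0) (.pair (ofList (t.prfTape.map .num))
      (ofList (t.coinTape.map .num))))))

theorem valid_start {t : Trial 𝒢} {tape : List ℕ} {b : Book}
    (hl : tape.length = T.eval t.env.k) (hlt : ∀ a ∈ tape, a < 2 ^ t.env.k)
    (hb : ∀ J u r, b.shares.lookup J = some u → look t.nonces J = some r → u.2 = t.sig r u.1) :
    Setup.Valid T t.toSetup (Core.start tape t.prfTape t.coinTape, b) where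
  hashTape_lt := hlt
  queries_le := by simp [Core.start, hl]
  hashTbl_lt := by simp [Core.start]
  shares := hb

theorem valid_runBook {t : Trial 𝒢} {tape : List ℕ} {b : Book}
    (hl : tape.length = T.eval t.env.k) (hlt : ∀ a ∈ tape, a < 2 ^ t.env.k)
    (hb : ∀ J u r, b.shares.lookup J = some u → look t.nonces J = some r → u.2 = t.sig r u.1) :
    Setup.Valid T t.toSetup (t.runBook F T tape b).2 :=
  (Setup.simulator 𝒢 T).valid_det (x := t.toSetup) _ (valid_start hl hlt hb)

theorem Proper.valid_first {t : Trial 𝒢} (h : t.Proper F T qS) :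
    Setup.Valid T t.toSetup (t.first F T).2 :=
  valid_runBook h.length_hashTape h.hashTape_lt (by simp)

theorem Proper.forked_lt {t : Trial 𝒢} (h : t.Proper F T qS) :
    ∀ a ∈ t.forked F T, a < 2 ^ t.env.k := merge_lt h.hashTape_lt h.altTape_lt

theorem Proper.length_forked {t : Trial 𝒢} (h : t.Proper F T qS) :
    (t.forked F T).length = T.eval t.env.k := (length_merge _ _ _ _).trans h.length_hashTape

variable (F T qS)

/-- The index type of the programs of the adversary. -/
abbrev Index (𝒢 : GroupGen) (F : Code ForgerOracle) (T : Polynomial ℕ) (qS : ℕ) : Type :=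
  {t : Trial 𝒢 // t.Proper F T qS}

/-- Encoding of the situation after the first run. -/
def enc₁ (t : Trial 𝒢) : Val :=
  .pair t.enc (.pair (t.first F T).1.1 (.pair (t.encStatic t.s)
    ((t.first F T).2.1.enc (t.first F T).2.2)))

/-- Encoding of the situation after the second run. -/
def enc₂ (t : Trial 𝒢) : Val :=
  .pair (t.enc₁ F T) (.pair (t.second F T).1.1 (.pair (t.encStatic t.s)
    ((t.second F T).2.1.enc (t.second F T).2.2)))

section enc

variable {F T qS}

theorem fn_static : Fn (fun t : Index 𝒢 F T qS => t.1.env) (fun t => t.1.enc)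
    fun t => t.1.encStatic t.1.s := Fn.left Fn.id

theorem fn_inst : Fn (fun t : Index 𝒢 F T qS => t.1.env) (fun t => t.1.enc)
    fun t => t.1.env.inst :=
  Fn.static_inst (w := fun t : Index 𝒢 F T qS => t.1.toWorld) fn_static

theorem fn_xs : Fn (fun t : Index 𝒢 F T qS => t.1.env) (fun t => t.1.enc)
    fun t => ofList (t.1.xs.map .num) := Fn.arg₂

theorem fn_tapes : Fn (fun t : Index 𝒢 F T qS => t.1.env) (fun t => t.1.enc)
    fun t => .pair (Core.encTape t.1.hashTape 0)
    (.pair (Core.encTape t.1.altTape 0) (.pair (ofList (t.1.prfTape.map .num))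
      (ofList (t.1.coinTape.map .num)))) := Fn.arg₃

theorem fn_input : Fn (fun t : Index 𝒢 F T qS => t.1.env) (fun t => t.1.enc)
    fun t => t.1.input :=
  Fn.forgerInput (e := fun t : Index 𝒢 F T qS => t.1.env) fn_inst
    (Fn.static_key (w := fun t : Index 𝒢 F T qS => t.1.toWorld) fn_static) fn_xs

theorem act_first : Act (fun t : Index 𝒢 F T qS => t.1.env) (fun t => t.1.enc)
    (fun t => ⟨t.1.challenges, 0⟩) (fun t => t.1.enc₁ F T)
    (fun t => ⟨t.1.challenges, (t.1.first F T).2.2.queries⟩) := by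
  have h0 : Fn (fun t : Index 𝒢 F T qS => t.1.env) (fun t => t.1.enc) (fun _ => .num 0) :=
    Fn.const 0
  exact Act.simulate (M := Setup.simulator 𝒢 T)
      (g := fun t : Index 𝒢 F T qS => t.1.toSetup) F T
      (s := fun t => (Core.start t.1.hashTape t.1.prfTape t.1.coinTape, ⟨[], 0⟩)) fn_input
      (fn_static.pair (fn_tapes.left.pair (fn_tapes.right.right.left.pair
        (fn_tapes.right.right.right.pair (h0.pair (h0.pair (h0.pair h0)))))))
      (fun t => rfl)
      (fun t => valid_start t.2.length_hashTape t.2.hashTape_lt (by simp))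
      (fun t => t.2.time _ _ t.2.length_hashTape t.2.hashTape_lt)

theorem fn_first : Fn (fun t : Index 𝒢 F T qS => t.1.env) (fun t => t.1.enc₁ F T)
    fun t => t.1.enc := Fn.left Fn.id

theorem fn_first_out : Fn (fun t : Index 𝒢 F T qS => t.1.env) (fun t => t.1.enc₁ F T)
    fun t => (t.1.first F T).1.1 := Fn.arg₂

theorem fn_first_core : Fn (fun t : Index 𝒢 F T qS => t.1.env) (fun t => t.1.enc₁ F T)
    fun t => (t.1.first F T).2.1.enc (t.1.first F T).2.2 :=
  Fn.right (Fn.right (Fn.right Fn.id))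

theorem fn_forked : Fn (fun t : Index 𝒢 F T qS => t.1.env) (fun t => t.1.enc₁ F T)
    fun t => Core.encTape (t.1.forked F T) 0 := by
  have h1 : Fn (fun t : Index 𝒢 F T qS => t.1.env) (fun t => t.1.enc₁ F T)
      fun t => Core.encTbl (t.1.first F T).2.1.hashTbl :=
    Fn.core_hashTbl (c := fun t : Index 𝒢 F T qS => (t.1.first F T).2.1)
      (b := fun t : Index 𝒢 F T qS => (t.1.first F T).2.2) fn_first_core
  have h2 : Fn (fun t : Index 𝒢 F T qS => t.1.env) (fun t => t.1.enc₁ F T)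
      fun t => Core.encSessions (t.1.first F T).2.1.sessions :=
    Fn.core_sessions (c := fun t : Index 𝒢 F T qS => (t.1.first F T).2.1)
      (b := fun t : Index 𝒢 F T qS => (t.1.first F T).2.2) fn_first_core
  have h3 : Fn (fun t : Index 𝒢 F T qS => t.1.env) (fun t => t.1.enc₁ F T)
      fun t => Core.encTape t.1.hashTape 0 := fn_first.trans fn_tapes.left
  have h4 : Fn (fun t : Index 𝒢 F T qS => t.1.env) (fun t => t.1.enc₁ F T)
      fun t => Core.encTape t.1.altTape 0 := fn_first.trans fn_tapes.right.left
  have h5 := Fn.merge (c := fun t : Index 𝒢 F T qS => (t.1.first F T).2.1) h3 h4 fn_first_out h1 h2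
  simp only [forked]
  exact h5

theorem act_second : Act (fun t : Index 𝒢 F T qS => t.1.env) (fun t => t.1.enc₁ F T)
    (fun t => ⟨t.1.challenges, (t.1.first F T).2.2.queries⟩) (fun t => t.1.enc₂ F T)
    (fun t => ⟨t.1.challenges, (t.1.second F T).2.2.queries⟩) := by
  have h0 : Fn (fun t : Index 𝒢 F T qS => t.1.env) (fun t => t.1.enc₁ F T) (fun _ => .num 0) :=
    Fn.const 0
  exact Act.simulate (M := Setup.simulator 𝒢 T)
      (g := fun t : Index 𝒢 F T qS => t.1.toSetup) F T
      (s := fun t => (Core.start (t.1.forked F T) t.1.prfTape t.1.coinTape, (t.1.first F T).2.2))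
      (fn_first.trans fn_input)
      ((fn_first.trans fn_static).pair (fn_forked.pair ((fn_first.trans
        fn_tapes.right.right.left).pair ((fn_first.trans fn_tapes.right.right.right).pair
          (h0.pair (h0.pair (h0.pair (Fn.core_shares
            (c := fun t : Index 𝒢 F T qS => (t.1.first F T).2.1) fn_first_core))))))))
      (fun t => rfl)
      (fun t => valid_start t.2.length_forked t.2.forked_lt t.2.valid_first.shares)
      (fun t => t.2.time _ _ t.2.length_forked t.2.forked_lt)

theorem fn_second : Fn (fun t : Index 𝒢 F T qS => t.1.env) (fun t => t.1.enc₂ F T)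
    fun t => t.1.enc₁ F T := Fn.left Fn.id

theorem fn_second_core : Fn (fun t : Index 𝒢 F T qS => t.1.env) (fun t => t.1.enc₂ F T)
    fun t => (t.1.second F T).2.1.enc (t.1.second F T).2.2 :=
  Fn.right (Fn.right (Fn.right Fn.id))

theorem fn_key : Fn (fun t : Index 𝒢 F T qS => t.1.env) (fun t => t.1.enc₂ F T)
    fun t => .num (t.1.key F T) :=
  Fn.extract (e := fun t : Index 𝒢 F T qS => t.1.env) (fn_second.trans (fn_first.trans fn_inst))
    (fn_second.trans (fn_first.trans fn_xs)) (fn_second.trans fn_first_out) Fn.arg₂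

/-- Once the key is known, a share `r - x ε` in the book yields its nonce without a query; the other
nonces are bought. Since `qS` is a constant, the loop over the indices is unrolled into the program
by induction on `J`. -/
theorem act_nonces (J : ℕ) (hJ : J ≤ qS) :
    Act (fun t : Index 𝒢 F T qS => t.1.env) (fun t => t.1.enc₂ F T)
      (fun t => ⟨t.1.challenges, (t.1.second F T).2.2.queries⟩)
      (fun t => .pair (t.1.enc₂ F T)
        (ofList ((t.1.findNonces (t.1.second F T).2.2 (t.1.key F T) J).map .num)))
      (fun t => ⟨t.1.challenges, finalQueries (t.1.second F T).2.2 J⟩) := by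
  have hsh : Fn (fun t : Index 𝒢 F T qS => t.1.env) (fun t => t.1.enc₂ F T)
      fun t => Core.encTbl (t.1.second F T).2.2.shares :=
    Fn.core_shares (c := fun t : Index 𝒢 F T qS => (t.1.second F T).2.1) fn_second_core
  have hnon : Fn (fun t : Index 𝒢 F T qS => t.1.env) (fun t => t.1.enc₂ F T)
      fun t => ofTable (𝒢.point t.1.env.i) (keyed t.1.nonces) :=
    Fn.static_nonces (w := fun t : Index 𝒢 F T qS => t.1.toWorld)
      (fn_second.trans (fn_first.trans fn_static))
  induction J with
  | zero => exact (Fn.id.pair (Fn.const 0)).act _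
  | succ J ih =>
    refine (ih (by omega)).seq ?_
    let ψ : Index 𝒢 F T qS → Val := fun t => .pair (t.1.enc₂ F T)
      (ofList ((t.1.findNonces (t.1.second F T).2.2 (t.1.key F T) J).map .num))
    have o : Fn (fun t : Index 𝒢 F T qS => t.1.env) ψ fun t => t.1.enc₂ F T := Fn.left Fn.id
    have acc : Fn (fun t : Index 𝒢 F T qS => t.1.env) ψ
      fun t => ofList ((t.1.findNonces (t.1.second F T).2.2
      (t.1.key F T) J).map .num) := Fn.right Fn.id
    have hJc : Fn (fun t : Index 𝒢 F T qS => t.1.env) ψ fun _ => .num (J + 1) := Fn.const (J + 1)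
    have hl := Fn.lookup _ (o.trans hsh) hJc
    have hn := Fn.lookup _ (o.trans hnon) hJc
    have hp : Fn (fun t : Index 𝒢 F T qS => t.1.env) ψ fun t => .num t.1.env.p :=
      (o.trans (fn_second.trans (fn_first.trans fn_inst))).inst_p
    have hfound : FnB (fun t : Index 𝒢 F T qS => t.1.env) ψ fun t => decide
        (((t.1.second F T).2.2.shares.lookup (.num (J + 1))).isSome = true) :=
      (FnB.isPair hl).congr fun t => Val.isPair_ofOption _ _
    have hε : Fn (fun t : Index 𝒢 F T qS => t.1.env) ψ
        fun t => .num (((t.1.second F T).2.2.shares.lookup (.num (J + 1))).getD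
        (0, 0)).1 := hl.snd.fst.congr fun t => Val.fst_snd_ofOption _
    have hσ : Fn (fun t : Index 𝒢 F T qS => t.1.env) ψ
        fun t => .num (((t.1.second F T).2.2.shares.lookup (.num (J + 1))).getD
        (0, 0)).2 := hl.snd.snd.congr fun t => Val.snd_snd_ofOption _
    have hR : Fn (fun t : Index 𝒢 F T qS => t.1.env) ψ
        fun t => 𝒢.point t.1.env.i ((look t.1.nonces (.num (J + 1))).getD 0) :=
      hn.snd.congr fun t => by
        rw [look_succ, List.getElem?_eq_getElem (by rw [t.2.length_nonces]; omega)]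
        have := look_succ t.1.nonces J
        rw [look, List.getElem?_eq_getElem (by rw [t.2.length_nonces]; omega)] at this
        rw [this]
        rfl
    have h1 := o.pair (((hσ.add ((o.trans fn_key).mul hε)).mod hp).pair acc)
    have hd : Act (fun t : Index 𝒢 F T qS => t.1.env) ψ
        (fun t => ⟨t.1.challenges, finalQueries (t.1.second F T).2.2 J⟩)
        (fun t => .pair (t.1.enc₂ F T) (.pair (.num (𝒢.dlog t.1.env.i (𝒢.point t.1.env.i
          ((look t.1.nonces (.num (J + 1))).getD 0)))) (ofList ((t.1.findNonces
            (t.1.second F T).2.2 (t.1.key F T) J).map .num))))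
        (fun t => ⟨t.1.challenges, finalQueries (t.1.second F T).2.2 J + 1⟩) :=
      Act.dlog hR (((Fn.left (Fn.left Fn.id)).pair ((Fn.right Fn.id).pair
        (Fn.right (Fn.left Fn.id)))).act _)
    refine (Act.ite hfound (h1.act _) hd).congr (fun t => ?_) fun t => ?_
    · simp only [findNonces, findNonce, List.map_cons, ofList_cons, t.1.env.dlog_point,
        decide_eq_true_eq]
      split <;> rfl
    · simp only [finalQueries, decide_eq_true_eq]
      split <;> rfl

end enc

/-- What the adversary does with its random values. -/
theorem act_output :
    Act (fun t : Index 𝒢 F T qS => t.1.env) (fun t => t.1.enc)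
      (fun t => ⟨t.1.challenges, 0⟩) (fun t => ofList ((t.1.output F T qS).map .num))
      (fun t => ⟨t.1.challenges, t.1.queries F T qS⟩) :=
  (act_first.seq (act_second.seq (act_nonces qS le_rfl))).seq
    ((((Fn.left Fn.id).trans fn_key).pair (Fn.right Fn.id)).act _)

/-- The trial with the given random values, reduced to the right ranges. -/
def ofDraws (e : Env 𝒢) (x : ℕ) (nonces xs : List ℕ) (s : ℕ) (fresh f u a b : List ℕ) :
    Trial 𝒢 where
  env := e
  x := x
  nonces := nonces.map (· % e.p)
  fresh := fresh.map (· % 2 ^ e.k)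
  s := s
  nonces_lt := by
    intro r hr
    obtain ⟨r, -, rfl⟩ := List.mem_map.1 hr
    exact Nat.mod_lt _ e.prime.pos
  fresh_lt := by
    intro r hr
    obtain ⟨r, -, rfl⟩ := List.mem_map.1 hr
    exact Nat.mod_lt _ (by positivity)
  xs := xs
  hashTape := a
  altTape := b
  prfTape := f
  coinTape := u

end Trial

/-- The distribution of what the adversary draws. -/
noncomputable def trialLaw {𝒢 : GroupGen} (e : Env 𝒢) (n qS M : ℕ) : PMF (Trial 𝒢) :=
  (unif e.p).bind fun x => (unifList e.p qS).bind fun nonces =>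
  (unifList e.p (n - 1)).bind fun xs => (unif (2 ^ e.k)).bind fun s =>
  (unifList (2 ^ e.k) qS).bind fun fresh => (unifList e.p M).bind fun f =>
  (unifList (2 ^ (M + e.k)) M).bind fun u => (unifList (2 ^ e.k) M).bind fun a =>
  (unifList (2 ^ e.k) M).bind fun b =>
  .pure (Trial.ofDraws e x nonces xs s fresh f u a b)

theorem map_mod {l : List ℕ} {n : ℕ} (h : ∀ a ∈ l, a < n) : l.map (· % n) = l := by
  conv_rhs => rw [← List.map_id l]
  exact List.map_congr_left fun a ha => Nat.mod_eq_of_lt (h a ha)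

theorem unifList_one (n : ℕ) : unifList n 1 = (unif n).map fun a => [a] := by
  simp [unifList, PMF.map, Function.comp_def]

/-- Add an independent list of uniform numbers. -/
noncomputable def withList {X Y : Type} (μ : X → PMF Y) (n m : X → ℕ) (x : X) : PMF (Y × List ℕ) :=
  (μ x).bind fun y => (unifList (n x) (m x)).map fun l => (y, l)

/-- The random values of the adversary in the order in which they are drawn. -/
noncomputable def drawsLaw {𝒢 : GroupGen} (n qS : ℕ) (M : ℕ → ℕ) : Env 𝒢 →
    PMF (((((((((Unit × List ℕ) × List ℕ) × List ℕ) × List ℕ) × List ℕ) × List ℕ) × List ℕ) ×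
      List ℕ) × List ℕ) :=
  withList (withList (withList (withList (withList (withList (withList (withList (withList
    (fun _ => PMF.pure ()) (fun e => e.p) fun _ => 1) (fun e => e.p) fun _ => qS)
    (fun e => e.p) fun _ => n - 1) (fun e => 2 ^ e.k) fun _ => 1) (fun e => 2 ^ e.k) fun _ => qS)
    (fun e => e.p) fun e => M e.k) (fun e => 2 ^ (M e.k + e.k)) fun e => M e.k)
    (fun e => 2 ^ e.k) fun e => M e.k) (fun e => 2 ^ e.k) fun e => M e.k

/-- The trial made of the random values of the adversary. -/
def trialOf {𝒢 : GroupGen} (e : Env 𝒢) (y : ((((((((Unit × List ℕ) × List ℕ) × List ℕ) × List ℕ) ×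
    List ℕ) × List ℕ) × List ℕ) × List ℕ) × List ℕ) : Trial 𝒢 :=
  Trial.ofDraws e (y.1.1.1.1.1.1.1.1.2.headD 0)
    y.1.1.1.1.1.1.1.2 y.1.1.1.1.1.1.2 (y.1.1.1.1.1.2.headD 0) y.1.1.1.1.2 y.1.1.1.2 y.1.1.2
    y.1.2 y.2

theorem map_drawsLaw {𝒢 : GroupGen} (n qS : ℕ) (M : ℕ → ℕ) (e : Env 𝒢) :
    (drawsLaw n qS M e).map (trialOf e) = trialLaw e n qS (M e.k) := by
  simp only [drawsLaw, withList, trialOf, trialLaw, PMF.map_bind, PMF.map_comp, PMF.pure_bind,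
    PMF.bind_bind, PMF.bind_map, unifList_one, Function.comp_def, List.headD_cons]
  rfl

theorem drawsLaw_support {𝒢 : GroupGen} {n qS : ℕ} {M : ℕ → ℕ} {e : Env 𝒢}
    {y : ((((((((Unit × List ℕ) × List ℕ) × List ℕ) × List ℕ) ×
      List ℕ) × List ℕ) × List ℕ) × List ℕ) × List ℕ} (hy : y ∈ (drawsLaw n qS M e).support) :
    (∃ x, y.1.1.1.1.1.1.1.1.2 = [x]) ∧ (∃ s, y.1.1.1.1.1.2 = [s]) ∧
      (∀ a ∈ y.1.1.1.1.1.1.1.2, a < e.p) ∧ (∀ a ∈ y.1.1.1.1.2, a < 2 ^ e.k) := by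
  simp only [drawsLaw, withList, PMF.mem_support_bind_iff, PMF.support_map, Set.mem_image,
    PMF.mem_support_pure_iff] at hy
  obtain ⟨y8, ⟨y7, ⟨y6, ⟨y5, ⟨y4, ⟨y3, ⟨y2, ⟨y1, ⟨y0, h0, l1, hl1, rfl⟩, l2, hl2, rfl⟩, l3, hl3,
    rfl⟩, l4, hl4, rfl⟩, l5, hl5, rfl⟩, l6, hl6, rfl⟩, l7, hl7, rfl⟩, l8, hl8, rfl⟩, l9, hl9, rfl⟩
    := hy
  exact ⟨List.length_eq_one_iff.1 (unifList_length hl1),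
    List.length_eq_one_iff.1 (unifList_length hl4), unifList_lt e.prime.pos hl2,
    unifList_lt (by positivity) hl5⟩

/-! ### Drawing the random values of the adversary -/

section draws

variable {𝒢 : GroupGen} {X Y : Type} {e : X → Env 𝒢} {φ : X → Val} {s : X → DLState}
  {μ : X → PMF Y} {ψ : X → Y → Val} {t : X → Y → DLState}

theorem Samples.with_challenges (m : ℕ) (h : Samples e φ s μ ψ t) :
    Samples e φ s (withList μ (fun x => (e x).p) fun _ => m)
      (fun x q => .pair (ψ x q.1) (ofTable (𝒢.point (e x).i) (keyed q.2)))
      (fun x q => { t x q.1 with challenges := (t x q.1).challenges ++ q.2.reverse }) :=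
  Samples.pair (μ' := fun x => _root_.unifList (e x).p m)
    (ψ' := fun x l => ofTable (𝒢.point (e x).i) (keyed l))
    (t' := fun x y l => { t x y with challenges := (t x y).challenges ++ l.reverse }) h
    (Samples.challenges (Fn.const m) (.C m) fun q => by simp)

theorem Samples.with_list {n m : X → ℕ} (R : Polynomial ℕ) (h : Samples e φ s μ ψ t)
    (hn : Fn e φ fun x => .num (n x)) (hm : Fn e φ fun x => .num (m x))
    (hR : ∀ x, m x ≤ R.eval ((e x).k + (φ x).size)) :
    Samples e φ s (withList μ n m) (fun x q => .pair (ψ x q.1) (Core.encTape q.2 0))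
      (fun x q => t x q.1) :=
  Samples.pair (μ' := fun x => _root_.unifList (n x) (m x))
    (ψ' := fun _ l => Core.encTape l 0) (t' := fun x y _ => t x y) h
    (Samples.unifList (hn.reindex Prod.fst) (hm.reindex Prod.fst) R fun q => hR q.1)

/-- Drawing the random values of the adversary. -/
theorem samples_drawsLaw (𝒢 : GroupGen) (T : Polynomial ℕ) (n qS : ℕ) :
    Samples (fun e : Env 𝒢 => e) (fun e => e.inst) (fun _ => ⟨[], 0⟩)
      (drawsLaw n qS fun k => T.eval k)
      (fun e y => .pair (.pair (.pair (.pair (.pair (.pair (.pair (.pair (.pair e.inst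
        (ofTable (𝒢.point e.i) (keyed y.1.1.1.1.1.1.1.1.2)))
        (ofTable (𝒢.point e.i) (keyed y.1.1.1.1.1.1.1.2))) (Core.encTape y.1.1.1.1.1.1.2 0))
        (Core.encTape y.1.1.1.1.1.2 0)) (Core.encTape y.1.1.1.1.2 0))
        (Core.encTape y.1.1.1.2 0)) (Core.encTape y.1.1.2 0)) (Core.encTape y.1.2 0))
        (Core.encTape y.2 0))
      (fun _ y => ⟨([] ++ y.1.1.1.1.1.1.1.1.2.reverse) ++ y.1.1.1.1.1.1.1.2.reverse, 0⟩) := by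
  have hI : Fn (fun e : Env 𝒢 => e) (fun e => e.inst) fun e => e.inst := Fn.id
  have hM : Fn (fun e : Env 𝒢 => e) (fun e => e.inst) fun e => .num (T.eval e.k) :=
    Fn.eval T hI.inst_k
  have hMk : ∀ e : Env 𝒢, T.eval e.k ≤ T.eval (e.k + e.inst.size) := fun e =>
    T.monotone_eval_nat (Nat.le_add_right _ _)
  have h2k : Fn (fun e : Env 𝒢 => e) (fun e => e.inst) fun e => .num (2 ^ e.k) :=
    Fn.two_pow hI.inst_k .X fun e => by simp
  have h2M : Fn (fun e : Env 𝒢 => e) (fun e => e.inst) fun e => .num (2 ^ (T.eval e.k + e.k)) :=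
    Fn.two_pow (hM.add hI.inst_k) (T + .X) fun e => by
      have := hMk e
      simp only [Polynomial.eval_add, Polynomial.eval_X]
      omega
  have hconst : ∀ m : ℕ, ∀ e : Env 𝒢, m ≤ (Polynomial.C m : Polynomial ℕ).eval
    (e.k + e.inst.size) := fun m e => by simp
  have S0 := (hI.act fun _ => (⟨[], 0⟩ : DLState)).samples
  have S2 := (S0.with_challenges 1).with_challenges qS
  have S3 := S2.with_list (.C (n - 1)) hI.inst_p (Fn.const (n - 1)) (hconst _)
  have S4 := S3.with_list (.C 1) h2k (Fn.const 1) (hconst _)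
  have S5 := S4.with_list (.C qS) h2k (Fn.const qS) (hconst _)
  have S6 := S5.with_list T hI.inst_p hM hMk
  have S7 := S6.with_list T h2M hM hMk
  have S8 := S7.with_list T h2k hM hMk
  exact S8.with_list T h2k hM hMk

end draws

/-- What the programs of the adversary get. -/
abbrev DrawsIndex (𝒢 : GroupGen) (T : Polynomial ℕ) (n qS : ℕ) : Type :=
  {y : Env 𝒢 × (((((((((Unit × List ℕ) × List ℕ) × List ℕ) × List ℕ) × List ℕ) × List ℕ) ×
    List ℕ) × List ℕ) × List ℕ) // y.2 ∈ (drawsLaw n qS (fun k => T.eval k) y.1).support}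

/-- The draws only have to be repacked. The reductions modulo `p` and `2 ^ k` in `Trial.ofDraws` are
the identity on values that can be drawn, so nothing is computed for them. -/
theorem fn_trialOf (𝒢 : GroupGen) (T : Polynomial ℕ) (n qS : ℕ) :
    Fn (fun y : DrawsIndex 𝒢 T n qS => y.1.1)
      (fun y => .pair (.pair (.pair (.pair (.pair (.pair (.pair (.pair (.pair y.1.1.inst
        (ofTable (𝒢.point y.1.1.i) (keyed y.1.2.1.1.1.1.1.1.1.1.2)))
        (ofTable (𝒢.point y.1.1.i) (keyed y.1.2.1.1.1.1.1.1.1.2)))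
        (Core.encTape y.1.2.1.1.1.1.1.1.2 0)) (Core.encTape y.1.2.1.1.1.1.1.2 0))
        (Core.encTape y.1.2.1.1.1.1.2 0)) (Core.encTape y.1.2.1.1.1.2 0))
        (Core.encTape y.1.2.1.1.2 0)) (Core.encTape y.1.2.1.2 0)) (Core.encTape y.1.2.2 0))
      (fun y => (trialOf y.1.1 y.1.2).enc) := by
  have h8 := (Fn.id (e := fun y : DrawsIndex 𝒢 T n qS => y.1.1) (φ :=
      (fun y => .pair (.pair (.pair (.pair (.pair (.pair (.pair (.pair (.pair y.1.1.inst
        (ofTable (𝒢.point y.1.1.i) (keyed y.1.2.1.1.1.1.1.1.1.1.2)))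
        (ofTable (𝒢.point y.1.1.i) (keyed y.1.2.1.1.1.1.1.1.1.2)))
        (Core.encTape y.1.2.1.1.1.1.1.1.2 0)) (Core.encTape y.1.2.1.1.1.1.1.2 0))
        (Core.encTape y.1.2.1.1.1.1.2 0)) (Core.encTape y.1.2.1.1.1.2 0))
        (Core.encTape y.1.2.1.1.2 0)) (Core.encTape y.1.2.1.2 0)) (Core.encTape y.1.2.2 0)))).left
  have h7 := h8.left
  have h6 := h7.left
  have h5 := h6.left
  have h4 := h5.left
  have h3 := h4.left
  have h2 := h3.left
  have h1 := h2.left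
  refine ((h1.left.pair (h1.right.fst.snd.pair (h2.right.pair (h5.right.pair
    h4.right.fst.snd)))).pair (h3.right.untape.pair (h8.right.pair ((Fn.right Fn.id).pair
      (h6.right.untape.pair h7.right.untape))))).congr fun y => ?_
  obtain ⟨⟨x, hx⟩, ⟨s, hs⟩, hn, hf⟩ := drawsLaw_support y.2
  have e1 : y.1.2.1.1.1.1.1.1.1.2.map (· % y.1.1.p) = y.1.2.1.1.1.1.1.1.1.2 := map_mod hn
  have e2 : y.1.2.1.1.1.1.2.map (· % 2 ^ y.1.1.k) = y.1.2.1.1.1.1.2 := map_mod hf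
  have e3 : ofTable .num (keyed y.1.2.1.1.1.1.2) = Core.encTape y.1.2.1.1.1.1.2 0 := by
    rw [← consTape_keyed, consTape_num]
  simp only [Trial.enc, World.encStatic, trialOf, Trial.ofDraws, e1, e2, e3, hx, hs]
  rfl

theorem challenges_trialOf {𝒢 : GroupGen} {T : Polynomial ℕ} {n qS : ℕ}
    (y : DrawsIndex 𝒢 T n qS) :
    (⟨([] ++ y.1.2.1.1.1.1.1.1.1.1.2.reverse) ++ y.1.2.1.1.1.1.1.1.1.2.reverse, 0⟩ : DLState) =
      ⟨(trialOf y.1.1 y.1.2).challenges, 0⟩ := by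
  obtain ⟨⟨x, hx⟩, -, hn, -⟩ := drawsLaw_support y.2
  have e1 : y.1.2.1.1.1.1.1.1.1.2.map (· % y.1.1.p) = y.1.2.1.1.1.1.1.1.1.2 := map_mod hn
  simp only [World.challenges, trialOf, Trial.ofDraws, e1, hx]
  rfl

theorem Act.of_state {𝒢 : GroupGen} {X : Type} {e : X → Env 𝒢} {φ ψ : X → Val}
    {s₀ s s' : X → DLState} (h : Act e φ s ψ s') (hs : ∀ x, s₀ x = s x) : Act e φ s₀ ψ s' := by
  rwa [show s₀ = s from funext hs]

theorem Env.size_inst {𝒢 : GroupGen} (e : Env 𝒢) :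
    e.inst.size ≤ 5 + 2 * e.k + 2 * 𝒢.bound.eval e.k := by
  have h1 := 𝒢.descr_size e.k e.two_le e.i e.mem
  have h2 := 𝒢.enc_size e.k e.two_le e.i e.mem (𝒢.base e.i)
  have h3 := 𝒢.order_size e.k e.two_le e.i e.mem
  have h4 : Nat.size e.k ≤ e.k := Nat.size_le.2 Nat.lt_two_pow_self
  simp only [Env.inst, GroupGen.inst, Val.size]
  omega

/-- The adversary. -/
theorem exists_adversary (𝒢 : GroupGen) (F : Code ForgerOracle) (T : Polynomial ℕ) (n qS : ℕ)
    (hT : ∀ e : Env 𝒢, ∀ t ∈ (trialLaw e n qS (T.eval e.k)).support, t.Proper F T qS) :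
    ∃ (A : Code DLOracle) (P : Polynomial ℕ), ∀ e : Env 𝒢,
      Draws e (A.run (P.eval e.k) e.inst) ⟨[], 0⟩ ((trialLaw e n qS (T.eval e.k)).map fun t =>
        (ofList ((t.output F T qS).map .num), ⟨t.challenges, t.queries F T qS⟩))
        (P.eval e.k) := by
  have hsup : ∀ (e : Env 𝒢), ∀ y ∈ (drawsLaw n qS (fun k => T.eval k) e).support,
      (trialOf e y).Proper F T qS := by
    intro e y hy
    apply hT e
    rw [← map_drawsLaw n qS (fun k => T.eval k) e, PMF.support_map]
    exact ⟨y, hy, rfl⟩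
  have hfin := Act.reindex (fun y : DrawsIndex 𝒢 T n qS => (⟨trialOf y.1.1 y.1.2, hsup _ _ y.2⟩ :
    Trial.Index 𝒢 F T qS)) (Trial.act_output F T qS)
  obtain ⟨A, P, hA⟩ := (samples_drawsLaw 𝒢 T n qS).then_act (ψ' := fun e y =>
      ofList (((trialOf e y).output F T qS).map .num))
      (t' := fun e y => ⟨(trialOf e y).challenges, (trialOf e y).queries F T qS⟩) (by
    exact (((fn_trialOf 𝒢 T n qS).act _).seq hfin).of_state challenges_trialOf)
  refine ⟨A, P.comp (.X + (5 + 2 * .X + 2 * 𝒢.bound)), fun e => ?_⟩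
  have hle : P.eval (e.k + e.inst.size) ≤
      (P.comp (.X + (5 + 2 * .X + 2 * 𝒢.bound))).eval e.k := by
    rw [Polynomial.eval_comp]
    refine P.monotone_eval_nat ?_
    simpa using e.size_inst
  refine (((hA e).1 _ hle).mono hle).congr ?_
  rw [← map_drawsLaw n qS (fun k => T.eval k) e, PMF.map_comp]
  rfl

/-! ## Expectations -/

open scoped ENNReal

namespace PMF

variable {α β γ : Type*}

/-- The expectation of a nonnegative function. -/
noncomputable def mean (p : PMF α) (f : α → ℝ≥0∞) : ℝ≥0∞ := ∑' a, p a * f a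

@[simp] theorem mean_pure (a : α) (f : α → ℝ≥0∞) : (PMF.pure a).mean f = f a := by
  rw [mean, tsum_eq_single a fun b hb => by simp [hb]]
  simp

theorem mean_bind (p : PMF α) (q : α → PMF β) (f : β → ℝ≥0∞) :
    (p.bind q).mean f = p.mean fun a => (q a).mean f := by
  simp only [mean, PMF.bind_apply, ← ENNReal.tsum_mul_right, ← ENNReal.tsum_mul_left]
  rw [ENNReal.tsum_comm]
  simp only [mul_assoc]

theorem mean_map (p : PMF α) (g : α → β) (f : β → ℝ≥0∞) :
    (p.map g).mean f = p.mean fun a => f (g a) := by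
  simp [PMF.map, mean_bind]

theorem mean_mono {p : PMF α} {f g : α → ℝ≥0∞} (h : ∀ a ∈ p.support, f a ≤ g a) :
    p.mean f ≤ p.mean g := by
  refine ENNReal.tsum_le_tsum fun a => ?_
  by_cases ha : a ∈ p.support
  · gcongr
    exact h a ha
  · simp [(PMF.apply_eq_zero_iff _ _).2 ha]

theorem mean_congr {p : PMF α} {f g : α → ℝ≥0∞} (h : ∀ a ∈ p.support, f a = g a) :
    p.mean f = p.mean g :=
  le_antisymm (mean_mono fun a ha => (h a ha).le) (mean_mono fun a ha => (h a ha).ge)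

@[simp] theorem mean_const (p : PMF α) (c : ℝ≥0∞) : (p.mean fun _ => c) = c := by
  rw [mean, ENNReal.tsum_mul_right, PMF.tsum_coe, one_mul]

theorem mean_add (p : PMF α) (f g : α → ℝ≥0∞) :
    (p.mean fun a => f a + g a) = p.mean f + p.mean g := by
  simp only [mean, mul_add, ENNReal.tsum_add]

theorem mean_const_mul (p : PMF α) (c : ℝ≥0∞) (f : α → ℝ≥0∞) :
    (p.mean fun a => c * f a) = c * p.mean f := by
  simp only [mean, ← ENNReal.tsum_mul_left]
  exact tsum_congr fun a => by ring

theorem mean_sum {ι : Type*} (p : PMF α) (s : Finset ι) (f : ι → α → ℝ≥0∞) :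
    (p.mean fun a => ∑ i ∈ s, f i a) = ∑ i ∈ s, p.mean (f i) := by
  classical
  induction s using Finset.induction_on with
  | empty => simp
  | insert i s hi ih => simp only [Finset.sum_insert hi, mean_add, ih]

theorem mean_comm (p : PMF α) (q : PMF β) (f : α → β → ℝ≥0∞) :
    (p.mean fun a => q.mean (f a)) = q.mean fun b => p.mean fun a => f a b := by
  simp only [mean, ← ENNReal.tsum_mul_left]
  rw [ENNReal.tsum_comm]
  exact tsum_congr fun b => tsum_congr fun a => by ring

theorem mean_le (p : PMF α) {f : α → ℝ≥0∞} {c : ℝ≥0∞} (h : ∀ a ∈ p.support, f a ≤ c) :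
    p.mean f ≤ c := (mean_mono h).trans_eq (mean_const p c)

theorem two_mul_le_sq_add_sq (a b : ℝ≥0∞) : 2 * (a * b) ≤ a ^ 2 + b ^ 2 := by
  have key : ∀ a b : ℝ≥0∞, a ≤ b → 2 * (a * b) ≤ a ^ 2 + b ^ 2 := by
    intro a b h
    -- With `b = a + c` the two sides differ by `c ^ 2`; this avoids subtraction, which is truncated
    -- here.
    obtain ⟨c, rfl⟩ := exists_add_of_le h
    calc 2 * (a * (a + c)) ≤ 2 * (a * (a + c)) + c ^ 2 := le_self_add
      _ = a ^ 2 + (a + c) ^ 2 := by ring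
  rcases le_total a b with h | h
  · exact key a b h
  · rw [mul_comm a b, add_comm]
    exact key b a h

/-- The square of the expectation is at most the expectation of the square. -/
theorem sq_mean_le (p : PMF α) (f : α → ℝ≥0∞) : p.mean f ^ 2 ≤ p.mean fun a => f a ^ 2 := by
  have h : 2 * p.mean f ^ 2 ≤ 2 * p.mean fun a => f a ^ 2 := by
    calc 2 * p.mean f ^ 2 = p.mean fun a => p.mean fun b => 2 * (f a * f b) := by
          simp only [mean_const_mul]
          simp only [mul_comm _ (p.mean f), mean_const_mul, sq]
      _ ≤ p.mean fun a => p.mean fun b => f a ^ 2 + f b ^ 2 :=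
          mean_mono fun a _ => mean_mono fun b _ => two_mul_le_sq_add_sq _ _
      _ = 2 * p.mean fun a => f a ^ 2 := by
          simp only [mean_add, mean_const]
          ring
  exact (ENNReal.mul_le_mul_iff_right (by norm_num) (by norm_num)).1 h

theorem apply_eq_mean (p : PMF Bool) : p true = p.mean fun b => if b = true then 1 else 0 := by
  rw [mean, tsum_bool]
  simp

end PMF

theorem mem_support_unif {n c : ℕ} (h : c < n) : c ∈ (unif n).support := by
  rw [unif, dif_pos (by omega), PMF.mem_support_uniformOfFinset_iff]
  simpa using h

theorem mean_unif {n : ℕ} (hn : 0 < n) (f : ℕ → ℝ≥0∞) :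
    (unif n).mean f = (n : ℝ≥0∞)⁻¹ * ∑ c ∈ Finset.range n, f c := by
  rw [PMF.mean, tsum_eq_sum (s := Finset.range n), Finset.mul_sum]
  · refine Finset.sum_congr rfl fun c hc => ?_
    rw [unif, dif_pos hn, PMF.uniformOfFinset_apply_of_mem _ hc, Finset.card_range]
  · intro c hc
    rw [unif, dif_pos hn, PMF.uniformOfFinset_apply_of_notMem _ hc, zero_mul]

theorem mem_support_unifList {n m : ℕ} {l : List ℕ} (hl : l.length = m) (h : ∀ a ∈ l, a < n) :
    l ∈ (unifList n m).support := by
  induction l generalizing m with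
  | nil => subst hl; simp [unifList]
  | cons a l ih =>
    subst hl
    simp only [List.mem_cons, forall_eq_or_imp] at h
    simp only [List.length_cons, unifList, PMF.mem_support_bind_iff, PMF.mem_support_pure_iff]
    exact ⟨a, mem_support_unif h.1, l, ih rfl h.2, rfl⟩

/-! ## Costs of the branches of a computation -/

namespace Comp

variable {O α β : Type}

/-- Every result `a` has cost `g a` at least `c` plus the number of queries and draws on the way;
a draw below `n` counts with the length of `n`. -/
def Weighs (g : α → ℕ) : ℕ → Comp O α → Prop
  | c, ret a => c ≤ g a
  | c, query _ _ k => ∀ w, Weighs g (c + 1) (k w)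
  | c, draw n k => ∀ j, Weighs g (c + 1 + Nat.size n) (k j)

theorem Weighs.mono {g : α → ℕ} {c c' : ℕ} {m : Comp O α} (h : m.Weighs g c) (hc : c' ≤ c) :
    m.Weighs g c' := by
  induction m generalizing c c' with
  | ret a => exact hc.trans h
  | query o v k ih => exact fun w => ih w (h w) (by omega)
  | draw n k ih => exact fun j => ih j (h j) (by omega)

theorem Weighs.add {g : α → ℕ} {c : ℕ} {m : Comp O α} (h : m.Weighs g c) (d : ℕ) :
    m.Weighs (fun a => d + g a) (d + c) := by
  induction m generalizing c with
  | ret a => exact Nat.add_le_add_left h d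
  | query o v k ih => exact fun w => (ih w (h w)).mono (by omega)
  | draw n k ih => exact fun j => (ih j (h j)).mono (by omega)

theorem Weighs.bind {g : α → ℕ} {g' : β → ℕ} {c : ℕ} {m : Comp O α} {f : α → Comp O β}
    (h : m.Weighs g c) (hf : ∀ a, (f a).Weighs g' (g a)) : (m.bind f).Weighs g' c := by
  induction m generalizing c with
  | ret a => exact (hf a).mono h
  | query o v k ih => exact fun w => ih w (h w)
  | draw n k ih => exact fun j => ih j (h j)

theorem weighs_whileLoop {c f : Val → Comp O (Val × ℕ)} (hc : ∀ v, (c v).Weighs Prod.snd 0)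
    (hf : ∀ v, (f v).Weighs Prod.snd 0) (N : ℕ) (v : Val) :
    (whileLoop c f N v).Weighs Prod.snd 0 := by
  induction N generalizing v with
  | zero => exact Nat.zero_le _
  | succ N ih =>
    refine (hc v).bind fun b => ?_
    split
    · exact Nat.le_succ _
    · refine ((hf v).add b.2).bind fun w => ?_
      refine ((ih w.1).add (b.2 + w.2)).bind fun u => ?_
      simp only [Weighs]
      omega

/-- Some run always has positive probability, so a weight forced on all continuations is a lower
bound for the cost of a result that can occur. Together with a time bound this limits the queries
and draws along every branch. -/
theorem Weighs.le {σ : Type} {h : O → σ → Val → PMF (Val × σ)} {g : α → ℕ} {c : ℕ}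
    {m : Comp O α} (hm : m.Weighs g c) (s : σ) : ∃ r ∈ (m.exec h s).support, c ≤ g r.1 := by
  induction m generalizing c s with
  | ret a => exact ⟨(a, s), by simp [exec], hm⟩
  | query o v k ih =>
    obtain ⟨r, hr⟩ := (h o s v).support_nonempty
    obtain ⟨q, hq, hc⟩ := ih r.1 (hm r.1) r.2
    exact ⟨q, (PMF.mem_support_bind_iff _ _ _).2 ⟨r, hr, hq⟩, by omega⟩
  | draw n k ih =>
    obtain ⟨j, hj⟩ := (unif n).support_nonempty
    obtain ⟨q, hq, hc⟩ := ih j (hm j) s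
    exact ⟨q, (PMF.mem_support_bind_iff _ _ _).2 ⟨j, hj, hq⟩, by omega⟩

end Comp

/-- Each oracle call costs a step, and `rand` pays for the length of its argument. So a program with
at most `M` steps makes at most `M` queries and draws, and every draw is below a number `n ≤ 2 ^ M`.
-/
theorem Code.weighs_run {O : Type} (N : ℕ) (c : Code O) (v : Val) :
    (c.run N v).Weighs Prod.snd 0 := by
  induction c generalizing v with
  | rand =>
    rcases v with n | ⟨a, b⟩
    · intro j
      simp only [Comp.Weighs, Val.size]
      omega
    · exact Nat.zero_le _
  | call o =>
    intro w
    simp only [Comp.Weighs]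
    omega
  | pair f g ihf ihg =>
    refine (ihf v).bind fun a => ((ihg v).add a.2).bind fun b => ?_
    simp only [Comp.Weighs]
    omega
  | seq f g ihf ihg =>
    refine (ihf v).bind fun a => ((ihg a.1).add a.2).bind fun b => ?_
    simp only [Comp.Weighs]
    omega
  | ite c f g ihc ihf ihg =>
    refine (ihc v).bind fun b => ?_
    split
    · refine ((ihg v).add b.2).bind fun a => ?_
      simp only [Comp.Weighs]
      omega
    · refine ((ihf v).add b.2).bind fun a => ?_
      simp only [Comp.Weighs]
      omega
  | loop c f ihc ihf => exact Comp.weighs_whileLoop ihc ihf N v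
  | _ => exact Nat.zero_le _

/-! ## Coins from a tape -/

/-- Execution with coins from given distributions. -/
noncomputable def Comp.execCoin {O α σ : Type} (d : ℕ → PMF ℕ)
    (h : O → σ → Val → PMF (Val × σ)) : Comp O α → σ → PMF (α × σ)
  | .ret a, s => PMF.pure (a, s)
  | .query o v k, s => (h o s v).bind fun r => (k r.1).execCoin d h r.2
  | .draw n k, s => (d n).bind fun c => (k c).execCoin d h s

/-- A coin made of a uniform number below `L`. -/
noncomputable def modCoin (L n : ℕ) : PMF ℕ := (unif L).map fun u => if n = 0 then 0 else u % n

theorem support_modCoin {L n c : ℕ} (h : c ∈ (modCoin L n).support) : c ∈ (unif n).support := by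
  rw [modCoin, PMF.support_map] at h
  obtain ⟨u, -, rfl⟩ := h
  rcases n with _ | n
  · simp [unif]
  · exact mem_support_unif (by simpa using Nat.mod_lt _ (Nat.succ_pos n))

theorem Comp.support_execCoin {O α σ : Type} {L : ℕ} {h : O → σ → Val → PMF (Val × σ)}
    {m : Comp O α} {s : σ} {r : α × σ} (hr : r ∈ (m.execCoin (modCoin L) h s).support) :
    r ∈ (m.exec h s).support := by
  induction m generalizing s with
  | ret a => exact hr
  | query o v k ih =>
    obtain ⟨q, hq, hr⟩ := (PMF.mem_support_bind_iff _ _ _).1 hr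
    exact (PMF.mem_support_bind_iff _ _ _).2 ⟨q, hq, ih _ hr⟩
  | draw n k ih =>
    obtain ⟨q, hq, hr⟩ := (PMF.mem_support_bind_iff _ _ _).1 hr
    exact (PMF.mem_support_bind_iff _ _ _).2 ⟨q, support_modCoin hq, ih _ hr⟩

theorem sum_mod_range (f : ℕ → ℝ≥0∞) (n q : ℕ) :
    ∑ u ∈ Finset.range (q * n), f (u % n) = q * ∑ c ∈ Finset.range n, f c := by
  induction q with
  | zero => simp
  | succ q ih =>
    rw [Nat.succ_mul, Finset.sum_range_add, ih]
    have : ∑ x ∈ Finset.range n, f ((q * n + x) % n) = ∑ c ∈ Finset.range n, f c :=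
      Finset.sum_congr rfl fun c hc => by
        rw [mul_comm q n, Nat.mul_add_mod, Nat.mod_eq_of_lt (Finset.mem_range.1 hc)]
    rw [this]
    push_cast
    ring

/-- With `L = 2 ^ (M + k)`, every residue modulo `n > 0` has at least `⌊L / n⌋` representatives
below `L`, so its probability is at least `1 / n` times `1 - n / L`, and `n / L ≤ 2 ^ (-k)`. A
one-sided bound suffices, as only a lower bound for success is needed. -/
theorem mean_modCoin {M k n : ℕ} (hn : n ≤ 2 ^ M) (f : ℕ → ℝ≥0∞) :
    (1 - (2 ^ k)⁻¹) * (unif n).mean f ≤ (modCoin (2 ^ (M + k)) n).mean f := by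
  rcases Nat.eq_zero_or_pos n with rfl | hn0
  · simp only [modCoin, unif, PMF.mean_map]
    simp only [lt_irrefl, dite_false, if_true, PMF.mean_pure, PMF.mean_const]
    exact mul_le_of_le_one_left zero_le tsub_le_self
  · set L := 2 ^ (M + k) with hL
    have hLpos : 0 < L := by positivity
    have hL0 : (L : ℝ≥0∞) ≠ 0 := by simp [hL]
    have hLt : (L : ℝ≥0∞) ≠ ⊤ := ENNReal.natCast_ne_top _
    have hn0' : (n : ℝ≥0∞) ≠ 0 := by exact_mod_cast hn0.ne'
    have hnt : (n : ℝ≥0∞) ≠ ⊤ := ENNReal.natCast_ne_top _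
    rw [modCoin, PMF.mean_map, mean_unif hLpos, mean_unif hn0]
    simp only [hn0.ne', if_false]
    set q := L / n with hq
    have h1 : q * n ≤ L := Nat.div_mul_le_self _ _
    have h2 : L ≤ 2 ^ M + q * n := by
      have : L < q * n + n := Nat.lt_div_mul_add hn0
      omega
    have h3 : (q : ℝ≥0∞) * ∑ c ∈ Finset.range n, f c ≤ ∑ u ∈ Finset.range L, f (u % n) := by
      rw [← sum_mod_range]
      exact Finset.sum_le_sum_of_subset (Finset.range_mono h1)
    have h4 : (1 : ℝ≥0∞) - (2 ^ k)⁻¹ ≤ (L : ℝ≥0∞)⁻¹ * (q * n) := by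
      rw [tsub_le_iff_left]
      have h5 : ((2 : ℝ≥0∞) ^ k)⁻¹ = (L : ℝ≥0∞)⁻¹ * 2 ^ M := by
        rw [hL]
        push_cast
        rw [pow_add, ENNReal.mul_inv (by simp) (by simp), mul_right_comm,
          ENNReal.inv_mul_cancel (by simp) (by simp), one_mul]
      rw [h5, ← mul_add, ← ENNReal.inv_mul_cancel hL0 hLt]
      gcongr
      exact_mod_cast h2
    calc (1 - (2 ^ k)⁻¹) * ((n : ℝ≥0∞)⁻¹ * ∑ c ∈ Finset.range n, f c)
        ≤ ((L : ℝ≥0∞)⁻¹ * (q * n)) * ((n : ℝ≥0∞)⁻¹ * ∑ c ∈ Finset.range n, f c) := by gcongr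
      _ = (L : ℝ≥0∞)⁻¹ * (q * ((n : ℝ≥0∞) * (n : ℝ≥0∞)⁻¹) * ∑ c ∈ Finset.range n, f c) := by ring
      _ = (L : ℝ≥0∞)⁻¹ * (q * ∑ c ∈ Finset.range n, f c) := by
          rw [ENNReal.mul_inv_cancel hn0' hnt, mul_one]
      _ ≤ _ := by gcongr

theorem Comp.mean_execCoin {O α σ : Type} {M k c : ℕ} {h : O → σ → Val → PMF (Val × σ)}
    {g : α → ℕ} {m : Comp O α} {s : σ} (hm : m.Weighs g c)
    (hM : ∀ r ∈ (m.exec h s).support, g r.1 ≤ M) (φ : α × σ → ℝ≥0∞) :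
    (1 - (2 ^ k)⁻¹) ^ (M - c) * (m.exec h s).mean φ ≤
      (m.execCoin (modCoin (2 ^ (M + k))) h s).mean φ := by
  have h1 : (1 : ℝ≥0∞) - (2 ^ k)⁻¹ ≤ 1 := tsub_le_self
  induction m generalizing s c with
  | ret a =>
    simp only [exec, execCoin, PMF.mean_pure]
    exact mul_le_of_le_one_left zero_le (pow_le_one₀ zero_le h1)
  | query o v j ih =>
    rw [exec, execCoin, PMF.mean_bind, PMF.mean_bind, ← PMF.mean_const_mul]
    refine PMF.mean_mono fun r hr => ?_
    refine le_trans ?_ (ih r.1 (hm r.1) fun q hq => hM q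
      ((PMF.mem_support_bind_iff _ _ _).2 ⟨r, hr, hq⟩))
    gcongr ?_ * _
    exact pow_le_pow_of_le_one zero_le h1 (by omega)
  | draw n j ih =>
    have hle : c + 1 + Nat.size n ≤ M := by
      obtain ⟨a, ha⟩ := (unif n).support_nonempty
      obtain ⟨q, hq, hc⟩ := (hm a).le (h := h) s
      exact hc.trans (hM q ((PMF.mem_support_bind_iff _ _ _).2 ⟨a, ha, hq⟩))
    simp only [exec, execCoin, PMF.mean_bind]
    have hn : n ≤ 2 ^ M := (Nat.size_le.1 (by omega : Nat.size n ≤ M)).le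
    refine le_trans ?_ (PMF.mean_mono fun a ha => ih a (hm a) fun q hq => hM q
      ((PMF.mem_support_bind_iff _ _ _).2 ⟨a, support_modCoin ha, hq⟩))
    rw [PMF.mean_const_mul]
    refine le_trans ?_ (mul_le_mul_right (mean_modCoin (k := k) hn _) _)
    rw [← mul_assoc, ← pow_succ]
    gcongr ?_ * _
    exact pow_le_pow_of_le_one zero_le h1 (by omega)

/-! ## Random values from tapes -/

/-- Fill the gaps of a list with uniform numbers. -/
noncomputable def fill (n : ℕ) : List (Option ℕ) → PMF (List ℕ)
  | [] => .pure []
  | o :: l => (o.elim (unif n) PMF.pure).bind fun a => (fill n l).map fun l => a :: l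

/-- An independent entry may be drawn ahead of the others. This is how a list drawn in advance
becomes equivalent to lazy sampling: an entry is fixed when it is needed for the first time, and
left alone if it was fixed before. -/
theorem fill_set {n j : ℕ} {l : List (Option ℕ)} {o : Option ℕ} (h : l[j]? = some o) :
    fill n l = (o.elim (unif n) PMF.pure).bind fun c => fill n (l.set j (some c)) := by
  induction l generalizing j with
  | nil => simp at h
  | cons o' l ih =>
    rcases j with _ | j
    · simp only [List.getElem?_cons_zero, Option.some.injEq] at h
      subst h
      simp [fill, PMF.pure_bind]
    · simp only [List.getElem?_cons_succ] at h
      simp only [fill, List.set_cons_succ]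
      rw [PMF.bind_comm]
      congr 1
      funext a
      rw [ih h, PMF.map_bind]

theorem fill_replicate (n m : ℕ) : fill n (List.replicate m none) = unifList n m := by
  induction m with
  | zero => rfl
  | succ m ih => rw [List.replicate_succ, fill, ih]; rfl

theorem mem_support_fill {n : ℕ} {l : List (Option ℕ)} {l' : List ℕ}
    (h : l' ∈ (fill n l).support) :
    l'.length = l.length ∧ ∀ j c : ℕ, l[j]? = some (some c) → l'[j]? = some c := by
  induction l generalizing l' with
  | nil =>
    rw [fill, PMF.mem_support_pure_iff] at h
    simp [h]
  | cons o l ih =>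
    rw [fill, PMF.mem_support_bind_iff] at h
    obtain ⟨a, ha, h⟩ := h
    rw [PMF.support_map] at h
    obtain ⟨l', hl', rfl⟩ := h
    obtain ⟨h1, h2⟩ := ih hl'
    refine ⟨by simp [h1], fun j c hc => ?_⟩
    rcases j with _ | j
    · simp only [List.getElem?_cons_zero, Option.some.injEq] at hc ⊢
      subst hc
      simpa using ha
    · simpa using h2 j c (by simpa using hc)

/-- The random values on which a run of the forger with simulated oracles depends. -/
structure Tapes where
  nonces : List ℕ
  fresh : List ℕ
  prf : List ℕ
  coin : List ℕ
  hash : List ℕ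

/-- The distribution of the tapes if some of the nonces and fresh hash values are given. -/
noncomputable def tapesLaw (p K L : ℕ) (rn rf : List (Option ℕ)) (A B C : ℕ) : PMF Tapes :=
  (fill p rn).bind fun no => (fill K rf).bind fun fr => (unifList p A).bind fun f =>
  (unifList L B).bind fun u => (unifList K C).map fun a => ⟨no, fr, f, u, a⟩

section tapesLaw

variable {p K L : ℕ} {rn rf : List (Option ℕ)} {A B C : ℕ}

/-- Independent draws commute, so the first entry of any tape can be drawn before everything else.
-/
theorem tapesLaw_hash : tapesLaw p K L rn rf A B (C + 1) =
    (unif K).bind fun a => (tapesLaw p K L rn rf A B C).map fun τ =>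
      { τ with hash := a :: τ.hash } := by
  simp only [tapesLaw, unifList_succ, PMF.map_bind, PMF.map_comp]
  simp only [PMF.bind_comm (unif K)]
  rfl

theorem tapesLaw_coin : tapesLaw p K L rn rf A (B + 1) C =
    (unif L).bind fun a => (tapesLaw p K L rn rf A B C).map fun τ =>
      { τ with coin := a :: τ.coin } := by
  simp only [tapesLaw, unifList_succ, PMF.map_bind, PMF.map_comp, PMF.bind_bind, PMF.bind_map,
    Function.comp_def]
  simp only [PMF.bind_comm (unif L)]

theorem tapesLaw_prf : tapesLaw p K L rn rf (A + 1) B C =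
    (unif p).bind fun a => (tapesLaw p K L rn rf A B C).map fun τ =>
      { τ with prf := a :: τ.prf } := by
  simp only [tapesLaw, unifList_succ, PMF.map_bind, PMF.map_comp, PMF.bind_bind, PMF.bind_map,
    Function.comp_def]
  simp only [PMF.bind_comm (unif p)]

theorem tapesLaw_nonce {j : ℕ} {o : Option ℕ} (h : rn[j]? = some o) :
    tapesLaw p K L rn rf A B C = (o.elim (unif p) PMF.pure).bind fun c =>
      tapesLaw p K L (rn.set j (some c)) rf A B C := by
  rw [tapesLaw, fill_set h, PMF.bind_bind]
  rfl

theorem tapesLaw_fresh {j : ℕ} {o : Option ℕ} (h : rf[j]? = some o) :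
    tapesLaw p K L rn rf A B C = (o.elim (unif K) PMF.pure).bind fun c =>
      tapesLaw p K L rn (rf.set j (some c)) A B C := by
  simp only [tapesLaw, PMF.bind_comm (o.elim (unif K) PMF.pure)]
  rw [fill_set h]
  simp only [PMF.bind_bind]

theorem mem_support_tapesLaw {τ : Tapes} (h : τ ∈ (tapesLaw p K L rn rf A B C).support) :
    τ.nonces ∈ (fill p rn).support ∧ τ.fresh ∈ (fill K rf).support ∧
      τ.prf ∈ (unifList p A).support ∧ τ.coin ∈ (unifList L B).support ∧
      τ.hash ∈ (unifList K C).support := by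
  simp only [tapesLaw, PMF.mem_support_bind_iff, PMF.support_map] at h
  obtain ⟨a, ha, b, hb, c, hc, d, hd, e, he, rfl⟩ := h
  exact ⟨ha, hb, hc, hd, he⟩

end tapesLaw

theorem askRandom_eq (n : ℕ) (tbl : Val → Option ℕ) (v : Val) : askRandom n tbl v =
    ((tbl v).elim (unif n) PMF.pure).map fun c => (c, Function.update tbl v (some c)) := by
  rcases h : tbl v with _ | c
  · simp [askRandom, h, PMF.map, Function.comp_def]
  · have : Function.update tbl v (some c) = tbl := by rw [← h, Function.update_eq_self]
    simp [askRandom, h, PMF.pure_map, this]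

/-- What the experiment looks at: hash values, sessions, and the number of hash queries. -/
abbrev View : Type := (Val → Option ℕ) × List Session × ℕ

/-- What the experiment looks at. -/
def ForgerState.view (st : ForgerState) : View := (st.hashTbl, st.sessions, st.hashQueries)

/-- What the experiment looks at. -/
def Core.view (c : Core) : View :=
  (fun v => (c.hashTbl.lookup v).map Prod.fst, c.sessions.map Record.toSession, c.hashQueries)

/-- Supply tapes. -/
def Core.load (c : Core) (τ : Tapes) : Core :=
  { c with hashTape := τ.hash, prfTape := τ.prf, coinTape := τ.coin }

/-- A state of the oracles of the forger corresponds to one of the simulated oracles. -/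
structure Matches (qS s : ℕ) (st : ForgerState) (c : Core) (rn rf : List (Option ℕ)) : Prop where
  hashTbl : st.hashTbl = fun v => (c.hashTbl.lookup v).map Prod.fst
  sessions : st.sessions = c.sessions.map Record.toSession
  hashQueries : st.hashQueries = c.hashQueries
  nonce : ∀ j o, rn[j]? = some o → st.prfTbl (.pair (.num s) (.num (j + 1))) = o
  other : ∀ v, (∀ j < qS, v ≠ .pair (.num s) (.num (j + 1))) → st.prfTbl v = c.prfTbl.lookup v
  length_nonces : rn.length = qS
  length_fresh : rf.length = qS
  fresh : ∀ j < qS, j + 1 ∉ c.sessions.map (fun t => t.index) → rf[j]? = some none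

theorem Matches.set_nonce {qS s : ℕ} {st : ForgerState} {c : Core} {rn rf : List (Option ℕ)}
    (h : Matches qS s st c rn rf) {j : ℕ} (hj : j < qS) (r : ℕ) :
    Matches qS s
      { st with prfTbl := Function.update st.prfTbl (.pair (.num s) (.num (j + 1))) (some r) } c
      (rn.set j (some r)) rf where
  hashTbl := h.hashTbl
  sessions := h.sessions
  hashQueries := h.hashQueries
  nonce := fun j' o ho => by
    by_cases hjj : j' = j
    · subst hjj
      rw [List.getElem?_set_self (by rw [h.length_nonces]; exact hj)] at ho
      simpa using ho
    · rw [List.getElem?_set_ne (Ne.symm hjj)] at ho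
      refine (Function.update_of_ne (by simpa using hjj) _ _).trans ?_
      exact h.nonce j' o ho
  other := fun v hv => by
    refine (Function.update_of_ne (hv j hj) _ _).trans ?_
    exact h.other v hv
  length_nonces := by simpa using h.length_nonces
  length_fresh := h.length_fresh
  fresh := h.fresh

theorem view_cons (l : List (Val × ℕ × ℕ)) (q : Val) (a n : ℕ) :
    (fun v => (((q, a, n) :: l).lookup v).map Prod.fst) =
      Function.update (fun v => (l.lookup v).map Prod.fst) q (some a) := by
  funext v
  by_cases h : v = q
  · subst h; simp
  · rw [Function.update_of_ne h, List.lookup_cons, show (v == q) = false from beq_eq_false_iff_ne.2 h]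

theorem lookup_cons_update (l : List (Val × ℕ)) (q : Val) (a : ℕ) :
    (fun v => ((q, a) :: l).lookup v) = Function.update (fun v => l.lookup v) q (some a) := by
  funext v
  by_cases h : v = q
  · subst h; simp
  · rw [Function.update_of_ne h, List.lookup_cons, show (v == q) = false from beq_eq_false_iff_ne.2 h]

theorem World.sig_eq {𝒢 : GroupGen} (w : World 𝒢) (r ε : ℕ) :
    ((r : ZMod w.env.p) - (w.x : ZMod w.env.p) * (ε : ZMod w.env.p)).val = w.sig r ε := by
  have hp := w.env.prime
  have : NeZero w.env.p := ⟨hp.ne_zero⟩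
  have h : (w.sig r ε : ZMod w.env.p) = (r : ZMod w.env.p) - (w.x : ZMod w.env.p) * ε := by
    have hle : ε % w.env.p ≤ w.env.p := (Nat.mod_lt _ hp.pos).le
    rw [World.sig, ZMod.natCast_mod, Nat.cast_add, Nat.cast_mul, Nat.cast_sub hle,
      ZMod.natCast_self, ZMod.natCast_mod]
    ring
  rw [← h, ZMod.val_natCast_of_lt]
  exact Nat.mod_lt _ hp.pos

/-! ### Coupling of the oracles of the experiment with the simulated oracles -/

section step

variable {𝒢 : GroupGen} (e : Env 𝒢) (x s qS : ℕ)

/-- The world with given nonces and fresh hash values. -/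
def Tapes.world (τ : Tapes) : World 𝒢 := ⟨e, x, τ.nonces, τ.fresh⟩

/-- A query to the oracles of the forger corresponds to one to the simulated oracles: the answer
and the new state depend on random values that can be split off the tapes. -/
def Couples (o : ForgerOracle) (v : Val) (st : ForgerState) (c : Core) (L : ℕ)
    (rn rf : List (Option ℕ)) (A B C : ℕ) : Prop :=
  ∃ (ν : PMF (ℕ × ℕ)) (w : ℕ × ℕ → Val) (st' : ℕ × ℕ → ForgerState) (c' : ℕ × ℕ → Core)
    (rn' rf' : ℕ × ℕ → List (Option ℕ)) (A' C' : ℕ), A ≤ A' + 1 ∧ C ≤ C' + 1 ∧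
    forgerOracle 𝒢 e.k e.i qS x s o st v = ν.map (fun z => (w z, st' z)) ∧
    (tapesLaw e.p (2 ^ e.k) L rn rf A B C).map
      (fun τ => (τ.nonces, τ.fresh, (τ.world e x).answer (some s) o (c.load τ) v)) =
      (ν.bind fun z => (tapesLaw e.p (2 ^ e.k) L (rn' z) (rf' z) A' B C').map
        fun τ => (τ.nonces, τ.fresh, w z, (c' z).load τ)) ∧
    ∀ z, Matches qS s (st' z) (c' z) (rn' z) (rf' z)

variable {e x s qS} {v : Val} {st : ForgerState} {c : Core} {L : ℕ}
  {rn rf : List (Option ℕ)} {A B C : ℕ}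

theorem couples_hash (h : Matches qS s st c rn rf) :
    Couples e x s qS .hash v st c L rn rf A B (C + 1) := by
  have h1 : st.hashTbl v = (c.hashTbl.lookup v).map Prod.fst := congrFun h.hashTbl v
  rcases hl : c.hashTbl.lookup v with _ | t
  · rw [hl, Option.map_none] at h1
    refine ⟨(unif (2 ^ e.k)).map fun a => (a, 0), fun z => .num z.1,
      fun z => { st with hashTbl := Function.update st.hashTbl v (some z.1), hashQueries := st.hashQueries + 1 },
      fun z => { c with hashTbl := (v, z.1, c.hashQueries + 1) :: c.hashTbl,
                        hashQueries := c.hashQueries + 1 },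
      fun _ => rn, fun _ => rf, A, C, by omega, le_rfl, ?_, ?_, fun z => ?_⟩
    · simp [forgerOracle, hashOf, askRandom_eq, h1, PMF.map_comp, PMF.bind_map, PMF.map,
        Function.comp_def, PMF.bind_bind]
    · rw [tapesLaw_hash, PMF.map_bind, PMF.bind_map]
      congr 1
      funext a
      rw [PMF.map_comp]
      congr 1
      funext τ
      simp [Function.comp_def, World.answer, Core.load, hl, Tapes.world]
    · exact ⟨by simp only [view_cons, h.hashTbl], h.sessions, by simp [h.hashQueries], h.nonce,
        h.other, h.length_nonces, h.length_fresh, h.fresh⟩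
  · rw [hl, Option.map_some] at h1
    refine ⟨PMF.pure (0, 0), fun z => .num t.1,
      fun z => { st with hashQueries := st.hashQueries + 1 },
      fun z => { c with hashQueries := c.hashQueries + 1 },
      fun _ => rn, fun _ => rf, A, C, by omega, le_rfl, ?_, ?_, fun z => ?_⟩
    · have : Function.update st.hashTbl v (some t.1) = st.hashTbl := by
        rw [← h1, Function.update_eq_self]
      simp [forgerOracle, hashOf, askRandom_eq, h1, PMF.pure_map, this]
    · rw [tapesLaw_hash, PMF.map_bind, PMF.pure_bind]
      simp only [PMF.map_comp]
      -- A repeated query also takes an entry off the tape and ignores it, so that the number of a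
      -- hash query is always the slot of the entry it reads. The ignored entry integrates out.
      rw [← PMF.bind_const (unif (2 ^ e.k)) (PMF.map (fun τ : Tapes => (τ.nonces, τ.fresh, num t.1, _))
        (tapesLaw _ _ L rn rf A B C))]
      congr 1
      funext a
      congr 1
      funext τ
      simp [Function.comp_def, World.answer, Core.load, hl, Tapes.world]
    · exact ⟨h.hashTbl, h.sessions, by simp [h.hashQueries], h.nonce,
        h.other, h.length_nonces, h.length_fresh, h.fresh⟩

theorem mem_support_nonce {τ : Tapes} {p K L j r : ℕ} (hj : j < rn.length)
    (h : τ ∈ (tapesLaw p K L (rn.set j (some r)) rf A B C).support) :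
    look τ.nonces (.num (j + 1)) = some r := by
  rw [look_succ]
  exact (mem_support_fill (mem_support_tapesLaw h).1).2 j r (List.getElem?_set_self hj)

theorem mem_support_fresh {τ : Tapes} {p K L j r : ℕ} (hj : j < rf.length)
    (h : τ ∈ (tapesLaw p K L rn (rf.set j (some r)) A B C).support) :
    look τ.fresh (.num (j + 1)) = some r := by
  rw [look_succ]
  exact (mem_support_fill (mem_support_tapesLaw h).2.1).2 j r (List.getElem?_set_self hj)

theorem look_nonces_eq_none {τ : Tapes} {p K L : ℕ} {J : Val}
    (hJ : ∀ j < rn.length, J ≠ .num (j + 1))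
    (h : τ ∈ (tapesLaw p K L rn rf A B C).support) : look τ.nonces J = none := by
  rcases hl : look τ.nonces J with _ | r
  · rfl
  · obtain ⟨j, rfl, hj⟩ := look_eq_some hl
    have h1 := (List.getElem?_eq_some_iff.1 hj).1
    rw [(mem_support_fill (mem_support_tapesLaw h).1).1] at h1
    exact absurd rfl (hJ j h1)

theorem couples_cache (h : Matches qS s st c rn rf) :
    Couples e x s qS .cache v st c L rn rf A B C := by
  by_cases hv : ∃ j < qS, v = .num (j + 1)
  · obtain ⟨j, hj, rfl⟩ := hv
    obtain ⟨o, ho⟩ : ∃ o, rn[j]? = some o :=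
      ⟨_, List.getElem?_eq_getElem (by rw [h.length_nonces]; exact hj)⟩
    have h1 := h.nonce j o ho
    refine ⟨(o.elim (unif e.p) PMF.pure).map fun r => (r, 0), fun z => 𝒢.point e.i z.1,
      fun z => { st with prfTbl := Function.update st.prfTbl (.pair (.num s) (.num (j + 1))) (some z.1) },
      fun z => c, fun z => rn.set j (some z.1), fun _ => rf, A, C, by omega, by omega, ?_, ?_,
      fun z => h.set_nonce hj z.1⟩
    · have hj1 : j + 1 ≤ qS := hj
      simp [forgerOracle, nonce, askRandom_eq, h1, PMF.map_comp, PMF.bind_map, PMF.map,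
        Function.comp_def, PMF.bind_bind, hj1]
    · rw [tapesLaw_nonce ho, PMF.map_bind, PMF.bind_map]
      congr 1
      funext r
      refine PMF.map_congr_support fun τ hτ => ?_
      have := mem_support_nonce (by rw [h.length_nonces]; exact hj) hτ
      simp [World.answer, Tapes.world, this]
  · push Not at hv
    refine ⟨PMF.pure (0, 0), fun z => .num 0, fun z => st, fun z => c, fun z => rn, fun _ => rf,
      A, C, by omega, by omega, ?_, ?_, fun z => h⟩
    · rcases v with j | ⟨a, b⟩
      · have : ¬ (1 ≤ j ∧ j ≤ qS) := fun hj => hv (j - 1) (by omega) (by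
          rw [Nat.sub_add_cancel hj.1])
        simp only [forgerOracle]
        rw [if_neg this, PMF.pure_map]
      · simp [forgerOracle, PMF.pure_map]
    · rw [PMF.pure_bind]
      refine PMF.map_congr_support fun τ hτ => ?_
      have := look_nonces_eq_none (by rw [h.length_nonces]; exact hv) hτ
      simp [World.answer, Tapes.world, this]

end step

section step

variable {𝒢 : GroupGen} {e : Env 𝒢} {x s qS : ℕ} {v : Val} {st : ForgerState} {c : Core} {L : ℕ}
  {rn rf : List (Option ℕ)} {A B C : ℕ}

theorem tapesLaw_prf_const {γ : Type} {p K L : ℕ} {f g : Tapes → γ}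
    (h : ∀ a, ∀ τ ∈ (tapesLaw p K L rn rf A B C).support, f { τ with prf := a :: τ.prf } = g τ) :
    (tapesLaw p K L rn rf (A + 1) B C).map f = (tapesLaw p K L rn rf A B C).map g := by
  rw [tapesLaw_prf, PMF.map_bind, ← PMF.bind_const (unif p) (PMF.map g _)]
  congr 1
  funext a
  rw [PMF.map_comp]
  exact PMF.map_congr_support fun τ hτ => h a τ hτ

/-- The case of a query that does not hit a nonce of the honest card. The list `pr` of keys tried is
free because `Matches` ignores it. -/
theorem couples_ask (h : Matches qS s st c rn rf)
    (hv : ∀ j < qS, v ≠ .pair (.num s) (.num (j + 1))) (pr : List ℕ)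
    (hans : ∀ a, ∀ τ ∈ (tapesLaw e.p (2 ^ e.k) L rn rf A B C).support,
      (τ.world e x).answer (some s) .prf (c.load { τ with prf := a :: τ.prf }) v =
        World.askTable ({ c with probes := pr }.load τ) a v) :
    Couples e x s qS .prf v st c L rn rf (A + 1) B C := by
  have h1 := h.other v hv
  rcases hl : c.prfTbl.lookup v with _ | a
  · rw [hl] at h1
    refine ⟨(unif e.p).map fun a => (a, 0), fun z => .num z.1,
      fun z => { st with prfTbl := Function.update st.prfTbl v (some z.1) },
      fun z => { c with probes := pr, prfTbl := (v, z.1) :: c.prfTbl },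
      fun _ => rn, fun _ => rf, A, C, by omega, by omega, ?_, ?_, fun z => ?_⟩
    · simp [forgerOracle, askRandom_eq, h1, PMF.map_comp, PMF.bind_map, PMF.map,
        Function.comp_def, PMF.bind_bind]
    · rw [tapesLaw_prf, PMF.map_bind, PMF.bind_map]
      congr 1
      funext a
      rw [PMF.map_comp]
      refine PMF.map_congr_support fun τ hτ => ?_
      have := hans a τ hτ
      simp only [Function.comp_def, Tapes.world] at this ⊢
      rw [this]
      simp [World.askTable, Core.load, hl]
    · refine ⟨h.hashTbl, h.sessions, h.hashQueries, fun j o ho => ?_, fun v' hv' => ?_,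
        h.length_nonces, h.length_fresh, h.fresh⟩
      · have hj : j < qS := by
          rw [← h.length_nonces]
          exact (List.getElem?_eq_some_iff.1 ho).1
        exact (Function.update_of_ne (Ne.symm (hv j hj)) _ _).trans (h.nonce j o ho)
      · refine Eq.trans ?_ (congrFun (lookup_cons_update c.prfTbl v z.1) v').symm
        by_cases hvv : v' = v
        · subst hvv; simp
        · simp only [Function.update_of_ne hvv]
          exact h.other v' hv'
  · rw [hl] at h1
    refine ⟨PMF.pure (0, 0), fun z => .num a, fun z => st,
      fun z => { c with probes := pr },
      fun _ => rn, fun _ => rf, A, C, by omega, by omega, ?_, ?_, fun z => ?_⟩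
    · have : Function.update st.prfTbl v (some a) = st.prfTbl := by
        rw [← h1, Function.update_eq_self]
      simp [forgerOracle, askRandom_eq, h1, PMF.pure_map, this]
    · rw [PMF.pure_bind]
      refine tapesLaw_prf_const fun f τ hτ => ?_
      have := hans f τ hτ
      simp only [Tapes.world] at this ⊢
      rw [this]
      simp [World.askTable, Core.load, hl]
    · exact ⟨h.hashTbl, h.sessions, h.hashQueries, h.nonce, h.other,
        h.length_nonces, h.length_fresh, h.fresh⟩

theorem couples_prf (h : Matches qS s st c rn rf) :
    Couples e x s qS .prf v st c L rn rf (A + 1) B C := by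
  by_cases hv : ∃ t, ∃ j < qS, v = .pair (.num t) (.num (j + 1))
  · obtain ⟨t, j, hj, rfl⟩ := hv
    -- With the key `s` the answer is a nonce of the honest card and comes from the list of nonces,
    -- and the entry taken off the tape of other values is wasted. With another key the query is an
    -- ordinary one, recorded as a probe.
    by_cases hts : t = s
    · subst hts
      obtain ⟨o, ho⟩ : ∃ o, rn[j]? = some o :=
        ⟨_, List.getElem?_eq_getElem (by rw [h.length_nonces]; exact hj)⟩
      have h1 := h.nonce j o ho
      refine ⟨(o.elim (unif e.p) PMF.pure).map fun r => (r, 0), fun z => .num z.1,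
        fun z => { st with prfTbl := Function.update st.prfTbl (.pair (.num t) (.num (j + 1))) (some z.1) },
        fun z => { c with probes := t :: c.probes, hit := true }, fun z => rn.set j (some z.1),
        fun _ => rf, A, C, by omega, by omega, ?_, ?_, fun z => ?_⟩
      · simp [forgerOracle, askRandom_eq, h1, PMF.map_comp, PMF.bind_map, PMF.map,
          Function.comp_def, PMF.bind_bind]
      · rw [tapesLaw_prf_const (g := fun τ => (τ.nonces, τ.fresh,
          num ((look τ.nonces (.num (j + 1))).getD 0),
          { c with probes := t :: c.probes, hit := true }.load τ)), tapesLaw_nonce ho,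
          PMF.map_bind, PMF.bind_map]
        · congr 1
          funext r
          refine PMF.map_congr_support fun τ hτ => ?_
          rw [mem_support_nonce (by rw [h.length_nonces]; exact hj) hτ]
          rfl
        · intro f τ hτ
          have hlt : j < τ.nonces.length := by
            rw [(mem_support_fill (mem_support_tapesLaw hτ).1).1, h.length_nonces]
            exact hj
          have : look τ.nonces (.num (j + 1)) = some τ.nonces[j] := by
            rw [look_succ, List.getElem?_eq_getElem hlt]
          simp [World.answer, Core.load, World.probe, Tapes.world, Val.isPair, Val.fst, Val.snd,
            Val.toNat, this]
      · have := h.set_nonce hj z.1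
        exact ⟨this.hashTbl, this.sessions, this.hashQueries, this.nonce, this.other,
          this.length_nonces, this.length_fresh, this.fresh⟩
    · refine couples_ask h (fun j' _ hv => hts (by simp at hv; exact hv.1)) (t :: c.probes)
        fun f τ hτ => ?_
      have hlt : j < τ.nonces.length := by
        rw [(mem_support_fill (mem_support_tapesLaw hτ).1).1, h.length_nonces]
        exact hj
      have : look τ.nonces (.num (j + 1)) = some τ.nonces[j] := by
        rw [look_succ, List.getElem?_eq_getElem hlt]
      simp [World.answer, Core.load, World.probe, Tapes.world, Val.isPair, Val.fst, Val.snd,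
        Val.toNat, this, Ne.symm hts]
  · push Not at hv
    refine couples_ask h (hv s) c.probes fun f τ hτ => ?_
    have : (τ.world e x).probe v = none := by
      unfold World.probe
      split
      · next hp =>
        rcases v with n | ⟨a, b⟩
        · simp [Val.isPair] at hp
        · rcases a with t | _
          · rw [show (Val.pair (num t) b).snd = b from rfl]
            have := look_nonces_eq_none (τ := τ) (J := b) (fun j hj hb => hv t j
              (by rwa [h.length_nonces] at hj) (by rw [hb])) hτ
            simp [Tapes.world, this]
          · simp [Val.isPair, Val.fst] at hp
      · rfl
    simp [World.answer, Core.load, this]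

theorem couples_sign (h : Matches qS s st c rn rf) :
    Couples e x s qS .sign v st c L rn rf A B C := by
  have hidx : st.sessions.map Session.index = c.sessions.map fun t => t.index := by
    rw [h.sessions, List.map_map]
    rfl
  by_cases hv : ∃ j < qS, v.snd.snd.snd = .num (j + 1) ∧ j + 1 ∉ c.sessions.map fun t => t.index
  · obtain ⟨j, hj, hvj, hnew⟩ := hv
    obtain ⟨m, R, d, rfl⟩ : ∃ m R d, v = .pair m (.pair R (.pair d (.num (j + 1)))) := by
      rcases v with n | ⟨m, n | ⟨R, n | ⟨d, J⟩⟩⟩ <;> simp [Val.snd] at hvj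
      exact ⟨m, R, d, by rw [hvj]⟩
    obtain ⟨o, ho⟩ : ∃ o, rn[j]? = some o :=
      ⟨_, List.getElem?_eq_getElem (by rw [h.length_nonces]; exact hj)⟩
    have h1 := h.nonce j o ho
    have hnew' : j + 1 ∉ st.sessions.map Session.index := by rwa [hidx]
    have hcond : 1 ≤ j + 1 ∧ j + 1 ≤ qS ∧ j + 1 ∉ st.sessions.map Session.index :=
      ⟨by omega, hj, hnew'⟩
    set q := hashInput R d (.num (j + 1)) with hq
    have h2 : st.hashTbl q = (c.hashTbl.lookup q).map Prod.fst := congrFun h.hashTbl q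
    let w : World 𝒢 := ⟨e, x, [], []⟩
    -- No session has used this index yet, so the hash value reserved for it is still undetermined
    -- and can be drawn now.
    have hfresh := h.fresh j hj hnew
    rcases hl : c.hashTbl.lookup q with _ | t
    · rw [hl, Option.map_none] at h2
      refine ⟨(unif (2 ^ e.k)).bind fun ε => (o.elim (unif e.p) PMF.pure).map fun r => (ε, r),
        fun z => .pair (.num (w.sig z.2 z.1)) (.num z.1),
        fun z => { st with
          hashTbl := Function.update st.hashTbl q (some z.1)
          prfTbl := Function.update st.prfTbl (.pair (.num s) (.num (j + 1))) (some z.2)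
          sessions := ⟨j + 1, m, d⟩ :: st.sessions },
        fun z => { c with
          hashTbl := (q, z.1, 0) :: c.hashTbl
          sessions := ⟨⟨j + 1, m, d⟩, 0, z.1⟩ :: c.sessions },
        fun z => rn.set j (some z.2), fun z => rf.set j (some z.1), A, C, by omega, by omega,
        ?_, ?_, fun z => ?_⟩
      · simp only [forgerOracle]
        rw [if_pos hcond]
        simp only [sigShare, hashOf, nonce, askRandom_eq, ← hq, h2, h1, PMF.map, PMF.bind_bind,
          PMF.pure_bind, Function.comp_def, Option.elim_none, w, ← World.sig_eq]
      · rw [tapesLaw_fresh hfresh, PMF.map_bind, PMF.bind_bind, Option.elim_none]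
        congr 1
        funext ε
        rw [tapesLaw_nonce ho, PMF.map_bind, PMF.bind_map]
        congr 1
        funext r
        refine PMF.map_congr_support fun τ hτ => ?_
        have e1 := mem_support_nonce (by rw [h.length_nonces]; exact hj) hτ
        have e2 := mem_support_fresh (by rw [h.length_fresh]; exact hj) hτ
        simp [World.answer, World.accepts, World.hashIn, World.signPoint, Tapes.world, Core.load,
          Val.snd, Val.fst, Val.toNat, e1, e2, hl, ← hq, hnew, World.sig, w]
      · have hs := h.set_nonce hj z.2
        refine ⟨by simp only [view_cons, h.hashTbl], by simp [h.sessions], h.hashQueries, hs.nonce,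
          hs.other, hs.length_nonces, by simpa using h.length_fresh, fun j' hj' hn' => ?_⟩
        simp only [List.map_cons, List.mem_cons, not_or] at hn'
        rw [List.getElem?_set_ne (by omega)]
        exact h.fresh j' hj' hn'.2
    · rw [hl, Option.map_some] at h2
      refine ⟨(o.elim (unif e.p) PMF.pure).map fun r => (t.1, r),
        fun z => .pair (.num (w.sig z.2 t.1)) (.num t.1),
        fun z => { st with
          prfTbl := Function.update st.prfTbl (.pair (.num s) (.num (j + 1))) (some z.2)
          sessions := ⟨j + 1, m, d⟩ :: st.sessions },
        fun z => { c with
          sessions := ⟨⟨j + 1, m, d⟩, t.2, t.1⟩ :: c.sessions },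
        fun z => rn.set j (some z.2), fun z => rf, A, C, by omega, by omega,
        ?_, ?_, fun z => ?_⟩
      · have hupd : Function.update st.hashTbl q (some t.1) = st.hashTbl := by
          rw [← h2, Function.update_eq_self]
        simp only [forgerOracle]
        rw [if_pos hcond]
        simp only [sigShare, hashOf, nonce, askRandom_eq, ← hq, h2, h1, PMF.map, PMF.bind_bind,
          PMF.pure_bind, Function.comp_def, Option.elim_some, hupd, w, ← World.sig_eq]
      · rw [tapesLaw_nonce ho, PMF.map_bind, PMF.bind_map]
        congr 1
        funext r
        refine PMF.map_congr_support fun τ hτ => ?_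
        have e1 := mem_support_nonce (by rw [h.length_nonces]; exact hj) hτ
        simp [World.answer, World.accepts, World.hashIn, World.signPoint, Tapes.world, Core.load,
          Val.snd, Val.fst, Val.toNat, e1, hl, ← hq, hnew, World.sig, w]
      · have hs := h.set_nonce hj z.2
        refine ⟨h.hashTbl, by simp [h.sessions], h.hashQueries, hs.nonce,
          hs.other, hs.length_nonces, h.length_fresh, fun j' hj' hn' => ?_⟩
        simp only [List.map_cons, List.mem_cons, not_or] at hn'
        exact h.fresh j' hj' hn'.2
  · push Not at hv
    refine ⟨PMF.pure (0, 0), fun z => .num 0, fun z => st, fun z => c, fun z => rn, fun _ => rf,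
      A, C, by omega, by omega, ?_, ?_, fun z => h⟩
    · rw [PMF.pure_map]
      rcases v with n | ⟨m, n | ⟨R, n | ⟨d, J | _⟩⟩⟩ <;> try rfl
      simp only [forgerOracle]
      rw [if_neg]
      rintro ⟨h1, h2, h3⟩
      rw [hidx] at h3
      obtain ⟨J, rfl⟩ : ∃ j, J = j + 1 := ⟨J - 1, by omega⟩
      exact h3 (hv J h2 rfl)
    · rw [PMF.pure_bind]
      refine PMF.map_congr_support fun τ hτ => ?_
      have : (τ.world e x).accepts (c.load τ) v = none := by
        unfold World.accepts
        split
        · rfl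
        · next hn =>
          refine look_nonces_eq_none (fun j hj hJ => hn ?_) hτ
          rw [hJ]
          exact hv j (by rwa [h.length_nonces] at hj) hJ
      simp [World.answer, this]

theorem couples (o : ForgerOracle) (h : Matches qS s st c rn rf) :
    Couples e x s qS o v st c L rn rf (A + 1) B (C + 1) := by
  cases o with
  | hash => exact couples_hash h
  | prf => exact couples_prf h
  | cache => exact couples_cache h
  | sign => exact couples_sign h

/-- Running with simulated oracles and random tapes is the same as running with the oracles of the
experiment. -/
theorem map_det_tapesLaw {α : Type} {g : α → ℕ} {m : Comp ForgerOracle α} {M d : ℕ}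
    (hm : m.Weighs g d) (h : Matches qS s st c rn rf) (hA : M ≤ d + A) (hB : M ≤ d + B)
    (hC : M ≤ d + C)
    (hM : ∀ r ∈ (m.exec (forgerOracle 𝒢 e.k e.i qS x s) st).support, g r.1 ≤ M) :
    (tapesLaw e.p (2 ^ e.k) L rn rf A B C).map (fun τ =>
      ((m.det ((τ.world e x).answer (some s)) World.coin (c.load τ)).1,
        (m.det ((τ.world e x).answer (some s)) World.coin (c.load τ)).2.view)) =
      (m.execCoin (modCoin L) (forgerOracle 𝒢 e.k e.i qS x s) st).map fun r => (r.1, r.2.view) := by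
  induction m generalizing st c rn rf A B C d with
  | ret a =>
    rw [Comp.execCoin, PMF.pure_map, ← PMF.map_const (tapesLaw e.p (2 ^ e.k) L rn rf A B C)]
    congr 1
    funext τ
    simp [Comp.det, Core.view, Core.load, ForgerState.view, h.hashTbl, h.sessions, h.hashQueries]
  | query o v k ih =>
    -- The query itself costs a step and some run through it ends within `M` steps, so the tapes
    -- still contain an entry.
    have hle : d + 1 ≤ M := by
      obtain ⟨a, ha⟩ := (forgerOracle 𝒢 e.k e.i qS x s o st v).support_nonempty
      obtain ⟨q, hq, hc⟩ := (hm a.1).le (h := forgerOracle 𝒢 e.k e.i qS x s) a.2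
      have := hM q ((PMF.mem_support_bind_iff _ _ _).2 ⟨a, ha, hq⟩)
      omega
    obtain ⟨A, rfl⟩ : ∃ A', A = A' + 1 := ⟨A - 1, by omega⟩
    obtain ⟨C, rfl⟩ : ∃ C', C = C' + 1 := ⟨C - 1, by omega⟩
    obtain ⟨ν, w, st', c', rn', rf', A', C', hA', hC', h1, h2, h3⟩ :=
      couples (e := e) (x := x) (v := v) (L := L) (A := A) (B := B) (C := C) o h
    have h4 := congrArg (PMF.map fun z : List ℕ × List ℕ × Val × Core =>
      (((k z.2.2.1).det ((⟨e, x, z.1, z.2.1⟩ : World 𝒢).answer (some s)) World.coin z.2.2.2).1,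
      ((k z.2.2.1).det ((⟨e, x, z.1, z.2.1⟩ : World 𝒢).answer (some s)) World.coin
        z.2.2.2).2.view)) h2
    rw [PMF.map_comp, PMF.map_bind] at h4
    refine Eq.trans h4 ?_
    rw [Comp.execCoin, h1, PMF.bind_map, PMF.map_bind]
    refine PMF.bind_congr_support fun z hz => ?_
    rw [PMF.map_comp]
    refine ih (w z) (hm (w z)) (h3 z) (by omega) (by omega) (by omega) fun r hr => hM r ?_
    rw [Comp.exec, h1, PMF.mem_support_bind_iff]
    exact ⟨(w z, st' z), by rw [PMF.support_map]; exact ⟨z, hz, rfl⟩, hr⟩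
  | draw n k ih =>
    have hle : d + 1 ≤ M := by
      obtain ⟨a, ha⟩ := (unif n).support_nonempty
      obtain ⟨q, hq, hc⟩ := (hm a).le (h := forgerOracle 𝒢 e.k e.i qS x s) st
      have := hM q ((PMF.mem_support_bind_iff _ _ _).2 ⟨a, ha, hq⟩)
      omega
    obtain ⟨B, rfl⟩ : ∃ B', B = B' + 1 := ⟨B - 1, by omega⟩
    rw [tapesLaw_coin, PMF.map_bind, Comp.execCoin, PMF.map_bind, modCoin, PMF.bind_map]
    refine PMF.bind_congr_support fun u hu => ?_
    rw [PMF.map_comp]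
    refine ih (d := d + 1) _ ((hm _).mono (by omega)) h (by omega) (by omega) (by omega) fun r hr => hM r ?_
    refine (PMF.mem_support_bind_iff _ _ _).2 ⟨_, ?_, hr⟩
    exact support_modCoin (L := L) (by rw [modCoin, PMF.support_map]; exact ⟨u, hu, rfl⟩)

end step

/-! ## Runs with simulated oracles -/

theorem Comp.det_invariant {O α S : Type} {D : O → S → Val → Val × S} {R : ℕ → S → ℕ × S}
    {P : S → Prop} (hD : ∀ o s v, P s → P (D o s v).2) (hR : ∀ n s, P s → P (R n s).2)
    (m : Comp O α) {s : S} (h : P s) : P (m.det D R s).2 := by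
  induction m generalizing s with
  | ret a => exact h
  | query o v k ih => exact ih _ (hD o s v h)
  | draw n k ih => exact ih _ (hR n s h)

namespace World

variable {𝒢 : GroupGen} (w : World 𝒢)

/-- The book never influences an answer, so runs can be analysed without it. -/
theorem det_answerBook {α : Type} (s : ℕ) (m : Comp ForgerOracle α) (c : Core) (b : Book) :
    (m.det (w.answerBook s) coinBook (c, b)).1 = (m.det (w.answer (some s)) coin c).1 ∧
      (m.det (w.answerBook s) coinBook (c, b)).2.1 = (m.det (w.answer (some s)) coin c).2 := by
  induction m generalizing c b with
  | ret a => exact ⟨rfl, rfl⟩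
  | query o v k ih => exact ih _ _ _
  | draw n k ih => exact ih _ _ _

/-- Consistency of a state that was reached with the tape `a` of hash values. -/
structure Consistent (a : List ℕ) (c : Core) : Prop where
  hashTape : c.hashTape = a.drop c.hashQueries
  value : ∀ q v n, c.hashTbl.lookup q = some (v, n + 1) → n < c.hashQueries ∧ a[n]? = some v
  fresh : ∀ q v, c.hashTbl.lookup q = some (v, 0) → ∃ t ∈ c.sessions, q.snd.snd = .num t.index ∧
    v = (look w.fresh (.num t.index)).getD 0 ∧ t.slot = 0
  slot_inj : ∀ q q' v v' n, c.hashTbl.lookup q = some (v, n) → c.hashTbl.lookup q' = some (v', n) →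
    (n = 0 → q.snd.snd = q'.snd.snd) → q = q'
  session : ∀ t ∈ c.sessions, ∃ R,
    c.hashTbl.lookup (hashInput R t.digest (.num t.index)) = some (t.hash, t.slot)
  index : ∀ t ∈ c.sessions, ∃ r, look w.nonces (.num t.index) = some r

theorem consistent_start (a f u : List ℕ) : w.Consistent a (Core.start a f u) := by
  constructor <;> simp [Core.start]

theorem lookup_cons_eq {β : Type} {l : List (Val × β)} {q q' : Val} {a b : β} :
    ((q, a) :: l).lookup q' = some b ↔ (q' = q ∧ b = a) ∨ (q' ≠ q ∧ l.lookup q' = some b) := by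
  rw [List.lookup_cons]
  by_cases h : q' = q
  · simp [h, eq_comm]
  · simp [h, show (q' == q) = false from beq_eq_false_iff_ne.2 h]

/-- An accepted signing request. -/
theorem accepts_eq_some {c : Core} {v : Val} {r : ℕ} (h : w.accepts c v = some r) :
    ∃ j, v.snd.snd.snd = .num (j + 1) ∧ w.nonces[j]? = some r ∧
      j + 1 ∉ c.sessions.map (fun t => t.index) ∧
      v = .pair v.fst (.pair v.snd.fst (.pair v.snd.snd.fst (.num (j + 1)))) := by
  unfold accepts at h
  split at h
  · simp at h
  · next hn =>
    obtain ⟨j, hj, hr⟩ := look_eq_some h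
    refine ⟨j, hj, hr, by rwa [hj] at hn, ?_⟩
    rcases v with n | ⟨m, n | ⟨R, n | ⟨d, J⟩⟩⟩ <;> simp [Val.snd] at hj
    simp [Val.fst, Val.snd, hj]

theorem Consistent.answer {a : List ℕ} {c : Core} (s : Option ℕ) (o : ForgerOracle) (v : Val)
    (h : w.Consistent a c) : w.Consistent a (w.answer s o c v).2 := by
  have same : ∀ c' : Core, c'.hashTape = c.hashTape → c'.hashQueries = c.hashQueries →
      c'.hashTbl = c.hashTbl → c'.sessions = c.sessions → w.Consistent a c' := by
    intro c' e1 e2 e3 e4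
    exact ⟨by rw [e1, e2, h.hashTape], by rw [e2, e3]; exact h.value,
      by rw [e3, e4]; exact h.fresh, by rw [e3]; exact h.slot_inj, by rw [e3, e4]; exact h.session,
      by rw [e4]; exact h.index⟩
  cases o with
  | hash =>
    simp only [World.answer]
    rcases ht : c.hashTape with _ | ⟨b, tape⟩
    · exact h
    · have hd := h.hashTape
      rw [ht] at hd
      have hb : a[c.hashQueries]? = some b := by
        rw [← List.head?_drop, ← hd]
        rfl
      have htape : tape = a.drop (c.hashQueries + 1) := by
        rw [← List.tail_drop, ← hd]
        rfl
      rcases hl : c.hashTbl.lookup v with _ | t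
      · refine ⟨htape, fun q x n hq => ?_, fun q x hq => ?_, fun q q' x x' n hq hq' hn => ?_,
          fun t ht => ?_, h.index⟩
        · rcases lookup_cons_eq.1 hq with ⟨rfl, h1⟩ | ⟨-, h1⟩
          · simp only [Prod.mk.injEq, Nat.add_right_cancel_iff] at h1
            obtain ⟨rfl, rfl⟩ := h1
            exact ⟨Nat.lt_succ_self _, hb⟩
          · have := h.value q x n h1
            exact ⟨by simp only; omega, this.2⟩
        · rcases lookup_cons_eq.1 hq with ⟨rfl, h1⟩ | ⟨-, h1⟩
          · simp at h1
          · exact h.fresh q x h1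
        · rcases lookup_cons_eq.1 hq with ⟨h0, h1⟩ | ⟨-, h1⟩ <;>
          rcases lookup_cons_eq.1 hq' with ⟨h0', h1'⟩ | ⟨-, h1'⟩
          · rw [h0, h0']
          · obtain ⟨rfl, rfl⟩ := Prod.mk.inj h1
            have := (h.value _ _ _ h1').1
            omega
          · obtain ⟨rfl, rfl⟩ := Prod.mk.inj h1'
            have := (h.value _ _ _ h1).1
            omega
          · exact h.slot_inj q q' x x' n h1 h1' hn
        · obtain ⟨R, hR⟩ := h.session t ht
          refine ⟨R, lookup_cons_eq.2 (Or.inr ⟨fun hv => ?_, hR⟩)⟩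
          rw [hv, hl] at hR
          simp at hR
      · refine ⟨htape, fun q x n hq => ?_, h.fresh, h.slot_inj, h.session, h.index⟩
        have := h.value q x n hq
        exact ⟨by simp only; omega, this.2⟩
  | prf =>
    simp only [World.answer]
    rcases c.prfTape with _ | ⟨f, tape⟩
    · exact h
    · rcases w.probe v with _ | t
      · simp only [askTable]
        split <;> exact same _ rfl rfl rfl rfl
      · simp only [askTable]
        split
        · exact same _ rfl rfl rfl rfl
        · split <;> exact same _ rfl rfl rfl rfl
  | cache =>
    simp only [World.answer]
    split <;> exact h
  | sign =>
    simp only [World.answer]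
    rcases hacc : w.accepts c v with _ | r
    · exact h
    · obtain ⟨j, hj, hr, hnew, hv⟩ := w.accepts_eq_some hacc
      have hpt : signPoint v = hashInput v.snd.fst v.snd.snd.fst (.num (j + 1)) := by
        rw [signPoint, hj]
      have hlook : ∃ r, look w.nonces (.num (j + 1)) = some r := ⟨r, by rw [look_succ, hr]⟩
      have hpj : (signPoint v).snd.snd = .num (j + 1) := by rw [hpt]; rfl
      simp only [hj, Val.toNat]
      rcases hl : c.hashTbl.lookup (signPoint v) with _ | t
      · simp only [hashIn, hl]
        -- An entry of slot `0` stems from a session with the index in its point, and the present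
        -- index is new.
        have hne : ∀ q x, c.hashTbl.lookup q = some (x, 0) → q.snd.snd ≠ .num (j + 1) := by
          intro q x hq hqj
          obtain ⟨t, ht, h1, -⟩ := h.fresh q x hq
          rw [hqj, Val.num.injEq] at h1
          exact hnew (List.mem_map.2 ⟨t, ht, h1.symm⟩)
        refine ⟨h.hashTape, fun q x n hq => ?_, fun q x hq => ?_, fun q q' x x' n hq hq' hn => ?_,
          fun t ht => ?_, ?_⟩
        · rcases lookup_cons_eq.1 hq with ⟨-, h1⟩ | ⟨-, h1⟩
          · simp at h1
          · exact h.value q x n h1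
        · rcases lookup_cons_eq.1 hq with ⟨h0, h1⟩ | ⟨-, h1⟩
          · exact ⟨_, List.mem_cons_self, by rw [h0, hpj], (Prod.mk.inj h1).1, rfl⟩
          · obtain ⟨t, ht, h2⟩ := h.fresh q x h1
            exact ⟨t, List.mem_cons_of_mem _ ht, h2⟩
        · rcases lookup_cons_eq.1 hq with ⟨h0, h1⟩ | ⟨-, h1⟩ <;>
          rcases lookup_cons_eq.1 hq' with ⟨h0', h1'⟩ | ⟨-, h1'⟩
          · rw [h0, h0']
          · obtain ⟨rfl, rfl⟩ := Prod.mk.inj h1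
            exact absurd ((hn rfl).symm.trans (by rw [h0, hpj])) (hne _ _ h1')
          · obtain ⟨rfl, rfl⟩ := Prod.mk.inj h1'
            exact absurd ((hn rfl).trans (by rw [h0', hpj])) (hne _ _ h1)
          · exact h.slot_inj q q' x x' n h1 h1' hn
        · rcases List.mem_cons.1 ht with rfl | ht
          · exact ⟨v.snd.fst, lookup_cons_eq.2 (Or.inl ⟨hpt.symm, rfl⟩)⟩
          · obtain ⟨R, hR⟩ := h.session t ht
            refine ⟨R, lookup_cons_eq.2 (Or.inr ⟨fun hv => ?_, hR⟩)⟩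
            rw [hv, hl] at hR
            simp at hR
        · intro t ht
          rcases List.mem_cons.1 ht with rfl | ht
          · exact hlook
          · exact h.index t ht
      · simp only [hashIn, hl]
        refine ⟨h.hashTape, h.value, fun q x hq => ?_, h.slot_inj, fun t' ht => ?_, ?_⟩
        · obtain ⟨t, ht, h2⟩ := h.fresh q x hq
          exact ⟨t, List.mem_cons_of_mem _ ht, h2⟩
        · rcases List.mem_cons.1 ht with rfl | ht
          · exact ⟨v.snd.fst, by rw [← hpt]; exact hl⟩
          · exact h.session t' ht
        · intro t ht
          rcases List.mem_cons.1 ht with rfl | ht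
          · exact hlook
          · exact h.index t ht

theorem Consistent.coin {a : List ℕ} {c : Core} (n : ℕ) (h : w.Consistent a c) :
    w.Consistent a (coin n c).2 := by
  rw [World.coin]
  split
  · exact h
  · exact ⟨h.hashTape, h.value, h.fresh, h.slot_inj, h.session, h.index⟩

theorem consistent_det {α : Type} {a f u : List ℕ} (s : Option ℕ) (m : Comp ForgerOracle α) :
    w.Consistent a (m.det (w.answer s) World.coin (Core.start a f u)).2 :=
  m.det_invariant (fun o _ v h => h.answer w s o v) (fun n _ h => h.coin w n)
    (w.consistent_start a f u)

/-- Different points have different hash values if no value occurs twice. -/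
theorem Consistent.value_inj {a : List ℕ} {c : Core} (h : w.Consistent a c)
    (hlen : w.fresh.length = w.nonces.length) (hnd : (a ++ w.fresh).Nodup) {q q' : Val}
    {v n n' : ℕ} (hq : c.hashTbl.lookup q = some (v, n)) (hq' : c.hashTbl.lookup q' = some (v, n')) :
    q = q' := by
  obtain ⟨h1, h2, h3⟩ := List.nodup_append.1 hnd
  have key : ∀ q, c.hashTbl.lookup q = some (v, 0) → ∃ j, q.snd.snd = .num (j + 1) ∧
      w.fresh[j]? = some v := by
    intro q hq
    obtain ⟨t, ht, e1, e2, -⟩ := h.fresh q v hq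
    obtain ⟨r, hr⟩ := h.index t ht
    obtain ⟨j, hj, hjr⟩ := look_eq_some hr
    rw [hj] at e1 e2
    have hlt : j < w.fresh.length := by
      rw [hlen]
      exact (List.getElem?_eq_some_iff.1 hjr).1
    rw [look_succ, List.getElem?_eq_getElem hlt, Option.getD_some] at e2
    exact ⟨j, e1, by rw [List.getElem?_eq_getElem hlt, e2]⟩
  -- Values in slot `0` come from `fresh` and the others from the tape. As the concatenation has no
  -- repetition, a common value fixes the index of the session or the slot, and the mixed cases are
  -- impossible.
  rcases n with _ | n <;> rcases n' with _ | n'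
  · obtain ⟨j, e1, e2⟩ := key q hq
    obtain ⟨j', e1', e2'⟩ := key q' hq'
    obtain ⟨l1, l2⟩ := List.getElem?_eq_some_iff.1 e2
    obtain ⟨l1', l2'⟩ := List.getElem?_eq_some_iff.1 e2'
    have : j = j' := (List.Nodup.getElem_inj_iff h2).1 (l2.trans l2'.symm)
    subst this
    exact h.slot_inj q q' v v 0 hq hq' fun _ => e1.trans e1'.symm
  · obtain ⟨j, e1, e2⟩ := key q hq
    exact absurd rfl (h3 v (List.mem_of_getElem? (h.value _ _ _ hq').2) v
      (List.mem_of_getElem? e2))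
  · obtain ⟨j, e1, e2⟩ := key q' hq'
    exact absurd rfl (h3 v (List.mem_of_getElem? (h.value _ _ _ hq).2) v
      (List.mem_of_getElem? e2))
  · obtain ⟨l1, l2⟩ := List.getElem?_eq_some_iff.1 (h.value _ _ _ hq).2
    obtain ⟨l1', l2'⟩ := List.getElem?_eq_some_iff.1 (h.value _ _ _ hq').2
    have : n = n' := (List.Nodup.getElem_inj_iff h1).1 (l2.trans l2'.symm)
    subst this
    exact h.slot_inj q q' v v (n + 1) hq hq' (by simp)

/-- At most the point `q₀` is hashed in slot `i`, and all further slots are later. -/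
def SlotIs (i : ℕ) (q₀ : Val) (c : Core) : Prop :=
  i ≤ c.hashQueries ∧ ∀ q v, c.hashTbl.lookup q = some (v, i) → q = q₀

theorem SlotIs.answer {i : ℕ} {q₀ : Val} {c : Core} (hi : 0 < i) (s : Option ℕ) (o : ForgerOracle)
    (v : Val) (h : SlotIs i q₀ c) : SlotIs i q₀ (w.answer s o c v).2 := by
  obtain ⟨h1, h2⟩ := h
  cases o with
  | hash =>
    simp only [World.answer]
    rcases c.hashTape with _ | ⟨b, tape⟩
    · exact ⟨h1, h2⟩
    · rcases c.hashTbl.lookup v with _ | t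
      · refine ⟨by simp only; omega, fun q x hq => ?_⟩
        rcases lookup_cons_eq.1 hq with ⟨-, h3⟩ | ⟨-, h3⟩
        · have := (Prod.mk.inj h3).2
          omega
        · exact h2 q x h3
      · exact ⟨by simp only; omega, h2⟩
  | prf =>
    simp only [World.answer]
    rcases c.prfTape with _ | ⟨f, tape⟩
    · exact ⟨h1, h2⟩
    · rcases w.probe v with _ | t
      · simp only [askTable]
        split <;> exact ⟨h1, h2⟩
      · simp only [askTable]
        split
        · exact ⟨h1, h2⟩
        · split <;> exact ⟨h1, h2⟩
  | cache =>
    simp only [World.answer]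
    split <;> exact ⟨h1, h2⟩
  | sign =>
    simp only [World.answer]
    rcases w.accepts c v with _ | r
    · exact ⟨h1, h2⟩
    · refine ⟨h1, fun q x hq => ?_⟩
      simp only [hashIn] at hq
      rcases hl : c.hashTbl.lookup (signPoint v) with _ | t
      · rw [hl] at hq
        rcases lookup_cons_eq.1 hq with ⟨-, h3⟩ | ⟨-, h3⟩
        · have := (Prod.mk.inj h3).2
          omega
        · exact h2 q x h3
      · rw [hl] at hq
        exact h2 q x hq

theorem slotIs_det {α : Type} {i : ℕ} {q₀ : Val} {c : Core} (hi : 0 < i) (s : Option ℕ)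
    (m : Comp ForgerOracle α) (h : SlotIs i q₀ c) :
    SlotIs i q₀ (m.det (w.answer s) coin c).2 :=
  m.det_invariant (fun o _ v h => h.answer w hi s o v) (fun n c h => by
    rw [World.coin]
    split <;> exact h) h

/-- Two runs with tapes that agree before slot `i` hash the same point in slot `i`. -/
theorem exists_slot_point {α : Type} {i : ℕ} (s : Option ℕ) (m : Comp ForgerOracle α) {c : Core}
    {l l' : List ℕ} (hlen : l.length = l'.length) (hq : c.hashQueries < i)
    (hslot : ∀ q v n, c.hashTbl.lookup q = some (v, n) → n ≤ c.hashQueries)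
    (hl : ∀ n, c.hashQueries + n + 1 < i → l[n]? = l'[n]?) :
    ∃ q₀, (∀ q v, (m.det (w.answer s) coin { c with hashTape := l }).2.hashTbl.lookup q =
        some (v, i) → q = q₀) ∧
      ∀ q v, (m.det (w.answer s) coin { c with hashTape := l' }).2.hashTbl.lookup q =
        some (v, i) → q = q₀ := by
  induction m generalizing c l l' with
  | ret a =>
    refine ⟨.num 0, fun q v h => ?_, fun q v h => ?_⟩ <;>
    · have := hslot q v i h
      omega
  | draw n k ih =>
    simp only [Comp.det, coin]
    rcases c.coinTape with _ | ⟨u, tape⟩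
    · exact ih (c := { c with coinTape := [] }) _ hlen hq hslot hl
    · exact ih (c := { c with coinTape := tape }) _ hlen hq hslot hl
  | query o v k ih =>
    have hi : 0 < i := by omega
    cases o with
    | hash =>
      simp only [Comp.det, answer]
      rcases l with _ | ⟨b, l⟩ <;> rcases l' with _ | ⟨b', l'⟩ <;> simp at hlen
      · exact ih _ (c := c) (l := []) (l' := []) rfl hq hslot hl
      · rcases hv : c.hashTbl.lookup v with _ | t
        -- Before query number `i` both runs have read the same entries and are in the same state,
        -- so this query asks for the same point `v` in both. Afterwards slot `i` is never filled
        -- again, however the runs diverge.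
        · by_cases hqi : c.hashQueries + 1 = i
          · have : ∀ b tape, SlotIs i v { c with
                hashTape := tape, hashTbl := (v, b, c.hashQueries + 1) :: c.hashTbl,
                hashQueries := c.hashQueries + 1 } := by
              intro b tape
              refine ⟨hqi.ge, fun q x hx => ?_⟩
              rcases lookup_cons_eq.1 hx with ⟨h3, -⟩ | ⟨-, h3⟩
              · exact h3
              · have := hslot _ _ _ h3
                omega
            exact ⟨v, (w.slotIs_det hi s _ (this b l)).2, (w.slotIs_det hi s _ (this b' l')).2⟩
          · obtain rfl : b = b' := by simpa using hl 0 (by omega)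
            refine ih _ (c := { c with hashTbl := (v, b, c.hashQueries + 1) :: c.hashTbl, hashQueries := c.hashQueries + 1 }) hlen (by simp only; omega) (fun q x n hx => ?_)
              fun n hn => by simpa using hl (n + 1) (by simp only at hn; omega)
            rcases lookup_cons_eq.1 hx with ⟨-, h3⟩ | ⟨-, h3⟩
            · exact (Prod.mk.inj h3).2.le
            · exact (hslot _ _ _ h3).trans (Nat.le_succ _)
        -- If query number `i` repeats an old point, slot `i` stays empty in both runs.
        · by_cases hqi : c.hashQueries + 1 = i
          · have : ∀ tape, SlotIs i v { c with
                hashTape := tape, hashQueries := c.hashQueries + 1 } := by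
              intro tape
              refine ⟨hqi.ge, fun q x hx => ?_⟩
              have := hslot _ _ _ hx
              omega
            exact ⟨v, (w.slotIs_det hi s _ (this l)).2, (w.slotIs_det hi s _ (this l')).2⟩
          · refine ih _ (c := { c with hashQueries := c.hashQueries + 1 }) hlen
              (by simp only; omega) (fun q x n hx => (hslot q x n hx).trans (Nat.le_succ _))
              fun n hn => by simpa using hl (n + 1) (by simp only at hn; omega)
    | prf =>
      simp only [Comp.det, answer]
      rcases c.prfTape with _ | ⟨f, tape⟩
      · exact ih _ (c := { c with prfTape := [] }) hlen hq hslot hl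
      · rcases w.probe v with _ | t
        · simp only [askTable]
          rcases c.prfTbl.lookup v with _ | a
          · exact ih _ (c := { c with prfTape := tape, prfTbl := (v, f) :: c.prfTbl }) hlen hq hslot hl
          · exact ih _ (c := { c with prfTape := tape }) hlen hq hslot hl
        · simp only [askTable]
          by_cases hst : s = some t.1
          · simp only [hst, if_true]
            rw [← hst]
            exact ih _ (c := { c with prfTape := tape, probes := t.1 :: c.probes, hit := true }) hlen hq hslot hl
          · simp only [hst, if_false]
            rcases c.prfTbl.lookup v with _ | a
            · exact ih _ (c := { c with prfTape := tape, probes := t.1 :: c.probes, prfTbl := (v, f) :: c.prfTbl }) hlen hq hslot hl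
            · exact ih _ (c := { c with prfTape := tape, probes := t.1 :: c.probes }) hlen hq hslot hl
    | cache =>
      simp only [Comp.det, answer]
      rcases look w.nonces v with _ | r <;> exact ih _ hlen hq hslot hl
    | sign =>
      have hacc : ∀ l, w.accepts { c with hashTape := l } v = w.accepts c v := fun _ => rfl
      have hin : ∀ l, w.hashIn { c with hashTape := l } = w.hashIn c := fun _ => rfl
      simp only [Comp.det, answer, hacc, hin]
      rcases w.accepts c v with _ | r
      · exact ih _ hlen hq hslot hl
      · refine ih _ (c := { c with
          hashTbl := (w.hashIn c (signPoint v) v.snd.snd.snd).2.2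
          sessions := ⟨⟨v.snd.snd.snd.toNat, v.fst, v.snd.snd.fst⟩,
            (w.hashIn c (signPoint v) v.snd.snd.snd).2.1,
            (w.hashIn c (signPoint v) v.snd.snd.snd).1⟩ :: c.sessions }) hlen hq (fun q x n hx => ?_) hl
        simp only [hashIn] at hx
        rcases hl : c.hashTbl.lookup (signPoint v) with _ | t
        · rw [hl] at hx
          rcases lookup_cons_eq.1 hx with ⟨-, h3⟩ | ⟨-, h3⟩
          · rw [(Prod.mk.inj h3).2]
            exact Nat.zero_le _
          · exact hslot _ _ _ h3
        · rw [hl] at hx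
          exact hslot _ _ _ hx

theorem nodup_hashTbl {α : Type} (s : Option ℕ) (m : Comp ForgerOracle α) (a f u : List ℕ) :
    ((m.det (w.answer s) coin (Core.start a f u)).2.hashTbl.map Prod.fst).Nodup := by
  have hcons : ∀ (l : List (Val × ℕ × ℕ)) q b, (l.map Prod.fst).Nodup → l.lookup q = none →
      (((q, b) :: l).map Prod.fst).Nodup := by
    intro l q b hl hq
    simp only [List.map_cons, List.nodup_cons]
    refine ⟨fun hmem => ?_, hl⟩
    obtain ⟨t, ht, hte⟩ := List.mem_map.1 hmem
    rw [List.lookup_eq_none_iff] at hq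
    simpa [hte] using hq t ht
  refine Comp.det_invariant (D := w.answer s) (R := coin)
    (P := fun c => (c.hashTbl.map Prod.fst).Nodup) (fun o c v h => ?_)
    (fun n c h => ?_) m (s := Core.start a f u) (by simp [Core.start])
  · cases o with
    | hash =>
      simp only [answer]
      split
      · exact h
      · split
        · exact h
        · exact hcons _ _ _ h ‹_›
    | prf =>
      simp only [answer, askTable]
      split
      · exact h
      · split
        · split
          · exact h
          · split <;> exact h
        · split <;> exact h
    | cache => simp only [answer]; split <;> exact h
    | sign =>
      simp only [answer]
      split
      · exact h
      · simp only [hashIn]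
        split
        · exact h
        · exact hcons _ _ _ h ‹_›
  · rw [coin]
    split <;> exact h

/-- If the forger asks for a nonce with the key `s` of the honest card, then `s` is among the keys
that it tries in a run that does not depend on `s`. -/
theorem mem_probes_of_hit {α : Type} (s : ℕ) (m : Comp ForgerOracle α) {c c₀ : Core}
    (h : (c = c₀ ∧ c.hit = false) ∨ s ∈ c₀.probes)
    (hhit : (m.det (w.answer (some s)) coin c).2.hit = true) :
    s ∈ (m.det (w.answer none) coin c₀).2.probes := by
  have key : ∀ o (c : Core) v, s ∈ c.probes → s ∈ (w.answer none o c v).2.probes := by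
    intro o c v hs
    cases o with
    | hash =>
      simp only [answer]
      split
      · exact hs
      · split <;> exact hs
    | prf =>
      simp only [answer, askTable]
      split
      · exact hs
      · split
        · simp only [reduceCtorEq, if_false]
          split <;> exact List.mem_cons_of_mem _ hs
        · split <;> exact hs
    | cache => simp only [answer]; split <;> exact hs
    | sign => simp only [answer]; split <;> exact hs
  have key' : ∀ n (c : Core), s ∈ c.probes → s ∈ (coin n c).2.probes := by
    intro n c hs
    rw [coin]
    split <;> exact hs
  rcases h with ⟨rfl, hf⟩ | h
  · induction m generalizing c with
    | ret a => simp [Comp.det, hf] at hhit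
    | draw n k ih =>
      refine ih _ hhit ?_
      rw [coin]
      split <;> exact hf
    | query o v k ih =>
      -- Up to the first query for a nonce with the key `s` both runs answer alike. At that query
      -- the run without `s` records the key as a probe, and probes are never removed.
      by_cases hp : o = .prf ∧ ¬ c.prfTape = [] ∧ (w.probe v).map Prod.fst = some s
      · obtain ⟨rfl, hp1, hp2⟩ := hp
        rw [Comp.det]
        refine Comp.det_invariant (P := fun c => s ∈ c.probes) (fun o c v h => key o c v h)
          (fun n c h => key' n c h) _ ?_
        obtain ⟨f, tape, hft⟩ := List.exists_cons_of_ne_nil hp1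
        obtain ⟨t, ht, rfl⟩ := Option.map_eq_some_iff.1 hp2
        simp only [answer, hft, ht, reduceCtorEq, if_false, askTable]
        split <;> simp
      · have hEq : w.answer none o c v = w.answer (some s) o c v ∧
            (w.answer (some s) o c v).2.hit = false := by
          cases o with
          | hash =>
            simp only [answer]
            split
            · exact ⟨by trivial, hf⟩
            · split <;> exact ⟨by trivial, hf⟩
          | cache => simp only [answer]; split <;> exact ⟨by trivial, hf⟩
          | sign => simp only [answer]; split <;> exact ⟨by trivial, hf⟩
          | prf =>
            simp only [answer]
            rcases hft : c.prfTape with _ | ⟨f, tape⟩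
            · exact ⟨by trivial, hf⟩
            · rcases ht : w.probe v with _ | t
              · simp only [askTable]
                split <;> exact ⟨by trivial, hf⟩
              · have : ¬ (some s = some t.1) := fun hst => hp ⟨rfl, by simp [hft], by
                  rw [ht, Option.map_some, hst]⟩
                simp only [this, reduceCtorEq, if_false, askTable]
                split <;> exact ⟨by trivial, hf⟩
        simp only [Comp.det] at hhit ⊢
        rw [hEq.1]
        exact ih _ hhit hEq.2
  · exact Comp.det_invariant (P := fun c => s ∈ c.probes) (fun o c v h => key o c v h)
      (fun n c h => key' n c h) m h

/-- Every probe takes an entry off the tape of values of the pseudorandom function. -/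
theorem length_probes {α : Type} (m : Comp ForgerOracle α) (a f u : List ℕ) :
    (m.det (w.answer none) coin (Core.start a f u)).2.probes.length ≤ f.length := by
  have := Comp.det_invariant (D := w.answer none) (R := coin)
    (P := fun c => c.probes.length + c.prfTape.length ≤ f.length) (fun o c v h => ?_)
    (fun n c h => ?_) m (s := Core.start a f u) (by simp [Core.start])
  · omega
  · cases o with
    | hash =>
      simp only [answer]
      split
      · exact h
      · split <;> exact h
    | prf =>
      simp only [answer, askTable]
      split
      · exact h
      · next hft =>
        rw [hft] at h
        simp only [List.length_cons] at h
        split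
        · simp only [reduceCtorEq, if_false]
          split <;> (simp only [List.length_cons]; omega)
        · split <;> (simp only; omega)
    | cache => simp only [answer]; split <;> exact h
    | sign => simp only [answer]; split <;> exact h
  · rw [coin]
    split <;> exact h

end World

namespace World

variable {𝒢 : GroupGen} (w : World 𝒢)

theorem nodup_sessions {α : Type} (s : Option ℕ) (m : Comp ForgerOracle α) (a f u : List ℕ) :
    ((m.det (w.answer s) coin (Core.start a f u)).2.sessions.map fun t => t.index).Nodup := by
  refine Comp.det_invariant (D := w.answer s) (R := coin)
    (P := fun c => (c.sessions.map fun t => t.index).Nodup) (fun o c v h => ?_)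
    (fun n c h => ?_) m (s := Core.start a f u) (by simp [Core.start])
  · cases o with
    | hash =>
      simp only [answer]
      split
      · exact h
      · split <;> exact h
    | prf =>
      simp only [answer, askTable]
      split
      · exact h
      · split
        · split
          · exact h
          · split <;> exact h
        · split <;> exact h
    | cache => simp only [answer]; split <;> exact h
    | sign =>
      simp only [answer]
      rcases hacc : w.accepts c v with _ | r
      · exact h
      · obtain ⟨j, hj, -, hnew, -⟩ := w.accepts_eq_some hacc
        simp only [List.map_cons, List.nodup_cons, hj, Val.toNat]
        exact ⟨hnew, h⟩
  · rw [coin]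
    split <;> exact h

/-- The shares in the book come from an earlier book `b₁` or from signing sessions, and each of
them was paid for once, provided that the hash values of the sessions are those in `b₁`. -/
def BookOk (b₁ : Book) (c : Core × Book) : Prop :=
  c.1.hit = false →
  (∀ t ∈ c.1.sessions, ∀ u, b₁.shares.lookup (.num t.index) = some u → u.1 = t.hash) →
  c.2.queries = c.2.shares.length ∧ (c.2.shares.map Prod.fst).Nodup ∧
  (∀ J u, c.2.shares.lookup J = some u → ∃ r, look w.nonces J = some r) ∧
  ∀ J u, c.2.shares.lookup J = some u → b₁.shares.lookup J = some u ∨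
    ∃ t ∈ c.1.sessions, J = .num t.index ∧ u.1 = t.hash

/-- When a session is accepted, a share in the book for its index but with another hash value would
come from `b₁`, contrary to the assumption on the sessions, or from an earlier session with the same
index, which is new. So a share is either reused or bought for an index that has none, and the
number of queries stays equal to the number of shares. A query bought for a nonce would break this
equality, but it sets `hit`. -/
theorem BookOk.answer {b₁ : Book} {c : Core × Book} (s : ℕ) (o : ForgerOracle) (v : Val)
    (h : w.BookOk b₁ c) : w.BookOk b₁ (w.answerBook s o c v).2 := by
  obtain ⟨c, b⟩ := c
  simp only [answerBook]
  have same : ∀ c' : Core, (c'.hit = false → c.hit = false) → c'.sessions = c.sessions →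
      w.BookOk b₁ (c', b) := by
    intro c' h1 h2 hh hs
    have := h (h1 hh) (by simpa [h2] using hs)
    simpa [h2] using this
  cases o with
  | hash =>
    simp only [World.answer, bookkeep]
    split
    · exact h
    · split <;> exact same _ id rfl
  | cache =>
    simp only [World.answer, bookkeep]
    split <;> exact h
  | prf =>
    simp only [World.answer, bookkeep]
    rcases hft : c.prfTape with _ | ⟨f, tape⟩
    · simpa using h
    · rcases ht : w.probe v with _ | t
      · simp only [askTable, Option.map_none, reduceCtorEq, and_false, if_false]
        split <;> exact same _ id rfl
      · by_cases hs : s = t.1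
        · subst hs
          intro hh
          simp at hh
        · simp only [Option.map_some, Option.some.injEq, hs, Ne.symm hs, and_false, if_false, askTable]
          split <;> exact same _ id rfl
  | sign =>
    simp only [World.answer, bookkeep]
    rcases hacc : w.accepts c v with _ | r
    · exact h
    · obtain ⟨j, hj, hr, hnew, -⟩ := w.accepts_eq_some hacc
      simp only [hj, Val.toNat]
      set ε := (w.hashIn c (signPoint v) (.num (j + 1))).1 with hε
      intro hh hs
      simp only [List.mem_cons, forall_eq_or_imp] at hs
      obtain ⟨h1, h2, h3, h4⟩ := h hh hs.2
      have h4' : ∀ u, b.shares.lookup (.num (j + 1)) = some u → u.1 = ε := by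
        intro u hu
        rcases h4 _ _ hu with h5 | ⟨t, ht, h5, -⟩
        · exact hs.1 u h5
        · rw [Val.num.injEq] at h5
          exact absurd (List.mem_map.2 ⟨t, ht, h5.symm⟩) hnew
      rw [Book.use]
      split
      · refine ⟨h1, h2, h3, fun J u hu => ?_⟩
        rcases h4 J u hu with h5 | ⟨t, ht, h5⟩
        · exact Or.inl h5
        · exact Or.inr ⟨t, List.mem_cons_of_mem _ ht, h5⟩
      · next hne =>
        have hnone : b.shares.lookup (.num (j + 1)) = none := by
          rcases hl : b.shares.lookup (.num (j + 1)) with _ | u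
          · exact hl
          · exact absurd (by rw [hl, Option.map_some, h4' u hl]) hne
        refine ⟨by simpa using h1, ?_, fun J u hu => ?_, fun J u hu => ?_⟩
        · simp only [List.map_cons, List.nodup_cons]
          refine ⟨fun hmem => ?_, h2⟩
          obtain ⟨t, ht, hte⟩ := List.mem_map.1 hmem
          rw [List.lookup_eq_none_iff] at hnone
          simpa [hte] using hnone t ht
        · rcases lookup_cons_eq.1 hu with ⟨h0, -⟩ | ⟨-, h5⟩
          · exact ⟨r, by rw [h0, look_succ, hr]⟩
          · exact h3 J u h5
        · rcases lookup_cons_eq.1 hu with ⟨h0, h5⟩ | ⟨-, h5⟩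
          · exact Or.inr ⟨_, List.mem_cons_self, h0, by rw [h5]⟩
          · rcases h4 J u h5 with h6 | ⟨t, ht, h6⟩
            · exact Or.inl h6
            · exact Or.inr ⟨t, List.mem_cons_of_mem _ ht, h6⟩

theorem bookOk_det {α : Type} {b₁ : Book} {c : Core × Book} (s : ℕ) (m : Comp ForgerOracle α)
    (h : w.BookOk b₁ c) : w.BookOk b₁ (m.det (w.answerBook s) coinBook c).2 :=
  m.det_invariant (fun o _ v h => h.answer w s o v) (fun n c h => by
    simp only [coinBook, World.coin]
    split <;> exact h) h

end World

/-! ### Extraction of the key and number of queries -/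

theorem getElem?_merge (keep : ℕ → Bool) (l l' : List ℕ) (j : ℕ) :
    (merge keep 0 l l')[j]? = l[j]?.map fun a => if keep (j + 1) then a else l'[j]?.getD 0 := by
  rw [merge_eq, List.getElem?_map, List.getElem?_zipIdx, Option.map_map]
  congr 1
  funext a
  simp only [Function.comp_apply, add_comm 1 j, look_succ]

/-- The slot of the hash value used in the signing session `J`. -/
def sessionSlot (c : Core) (J : ℕ) : ℕ :=
  ((c.sessions.find? fun t => t.index = J).map fun t => t.slot).getD 0

theorem sessionSlot_eq {c : Core} (h : (c.sessions.map fun t => t.index).Nodup) {t : Record}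
    (ht : t ∈ c.sessions) : sessionSlot c t.index = t.slot := by
  rw [sessionSlot]
  obtain ⟨t', ht'⟩ := Option.isSome_iff_exists.1
    (List.find?_isSome (p := fun t' : Record => decide (t'.index = t.index)).2 ⟨t, ht, by simp⟩)
  rw [ht']
  have h1 : t'.index = t.index := by simpa using List.find?_some ht'
  have h2 := List.inj_on_of_nodup_map h (List.mem_of_find?_eq_some ht') ht h1
  simp [h2]

/-- An outcome of a run of the forger from which, together with a second one, the secret key can
be extracted. -/
def Good {𝒢 : GroupGen} (e : Env 𝒢) (Y : 𝒢.El e.i) (out : Val) (c : Core) : Prop :=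
  c.hit = false ∧ 0 < slotOf c.hashTbl (outHash out) ∧
  (∀ t ∈ c.sessions, t.slot ≠ slotOf c.hashTbl (outHash out)) ∧
  ∃ h j, c.hashTbl.lookup (hashInput (𝒢.enc e.i (outSig out • 𝒢.base e.i + outHash out • Y)) h j) =
    some (outHash out, slotOf c.hashTbl (outHash out))

section extract

variable {𝒢 : GroupGen} (e : Env 𝒢)

theorem cast_fold (p : ℕ) (xs : List ℕ) (r : ℕ) :
    ((xs.foldl (fun r c => (r + c) % p) r : ℕ) : ZMod p) = r + (xs.sum : ℕ) := by
  induction xs generalizing r with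
  | nil => simp
  | cons a l ih => simp [ih, add_assoc]

theorem fold_lt (p : ℕ) (hp : 0 < p) (xs : List ℕ) (r : ℕ) (hr : r < p) :
    xs.foldl (fun r c => (r + c) % p) r < p := by
  induction xs generalizing r with
  | nil => exact hr
  | cons a l ih => exact ih _ (Nat.mod_lt _ hp)

theorem Env.cast_sub_mod (c : ℕ) : ((e.p - c % e.p : ℕ) : ZMod e.p) = -(c : ZMod e.p) := by
  rw [Nat.cast_sub (Nat.mod_lt _ e.prime.pos).le, ZMod.natCast_self, ZMod.natCast_mod, zero_sub]

/-- Two representations of a group element give the secret key. -/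
theorem cast_extract {x : ℕ} {xs : List ℕ} {o₁ o₂ : Val}
    (h : (outSig o₁ : ZMod e.p) + outHash o₁ * (x + (xs.sum : ℕ)) =
      outSig o₂ + outHash o₂ * (x + (xs.sum : ℕ)))
    (hne : (outHash o₁ : ZMod e.p) ≠ outHash o₂) :
    (extract e.p xs o₁ o₂ : ZMod e.p) = x := by
  have : Fact e.p.Prime := ⟨e.prime⟩
  rw [extract, ZMod.natCast_mod]
  push_cast
  rw [Nat.cast_sub (fold_lt e.p e.prime.pos xs 0 e.prime.pos).le, ZMod.natCast_self, cast_fold,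
    e.cast_sub_mod, ZMod.natCast_mod]
  push_cast
  rw [e.cast_sub_mod]
  set d : ZMod e.p := outHash o₂ + -outHash o₁ with hd
  have hd0 : d ≠ 0 := by
    rw [hd, ← sub_eq_add_neg]
    exact sub_ne_zero.2 (Ne.symm hne)
  -- Fermat's little theorem: the power computed by `extract` is the inverse of the difference of
  -- the hash values.
  have hpow : d * d ^ (e.p - 2) = 1 := by
    rw [← pow_succ', show e.p - 2 + 1 = e.p - 1 by have := e.prime.two_le; omega]
    exact ZMod.pow_card_sub_one_eq_one hd0
  have hy : (outSig o₁ : ZMod e.p) + -outSig o₂ = d * (x + (xs.sum : ℕ)) := by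
    rw [hd]
    linear_combination h
  rw [hy, show d * (↑x + ((xs.sum : ℕ) : ZMod e.p)) * d ^ (e.p - 2) = (d * d ^ (e.p - 2)) *
    (x + (xs.sum : ℕ)) by ring, hpow]
  push_cast
  ring

end extract

theorem Env.sum_smul_base {𝒢 : GroupGen} (e : Env 𝒢) (l : List ℕ) :
    (l.map fun c => c • 𝒢.base e.i).sum = l.sum • 𝒢.base e.i := by
  induction l with
  | nil => simp
  | cons a l ih => simp [ih, add_smul]

theorem World.sig_add {𝒢 : GroupGen} (w : World 𝒢) {r : ℕ} (hr : r < w.env.p) {z : ℕ}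
    (hz : (z : ZMod w.env.p) = w.x) (ε : ℕ) : (w.sig r ε + z * ε) % w.env.p = r := by
  have hp := w.env.prime
  have h : ((w.sig r ε + z * ε : ℕ) : ZMod w.env.p) = r := by
    have hs : (w.sig r ε : ZMod w.env.p) = r - w.x * ε := by
      rw [← w.sig_eq r ε]
      have : NeZero w.env.p := ⟨hp.ne_zero⟩
      rw [ZMod.natCast_val, ZMod.cast_id]
    push_cast
    rw [hs, hz]
    ring
  rw [ZMod.natCast_eq_natCast_iff, Nat.ModEq, Nat.mod_eq_of_lt hr] at h
  exact h

namespace Trial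

variable {𝒢 : GroupGen} {F : Code ForgerOracle} {T : Polynomial ℕ} {qS : ℕ} {t : Trial 𝒢}

variable (F T) in
/-- A run of the forger with a given tape of hash values. -/
def run (t : Trial 𝒢) (tape : List ℕ) : (Val × ℕ) × Core :=
  (F.run (T.eval t.env.k) t.input).det (t.answer (some t.s)) World.coin
    (Core.start tape t.prfTape t.coinTape)

theorem runBook_eq (t : Trial 𝒢) (tape : List ℕ) (b : Book) :
    (t.runBook F T tape b).1 = (t.run F T tape).1 ∧
      (t.runBook F T tape b).2.1 = (t.run F T tape).2 :=
  t.det_answerBook _ _ _ _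

theorem consistent_run (t : Trial 𝒢) (tape : List ℕ) :
    t.Consistent tape (t.run F T tape).2 := t.consistent_det _ _

/-- The shared public key. -/
def publicKey (t : Trial 𝒢) : 𝒢.El t.env.i := ((t.x :: t.xs).map fun c => c • 𝒢.base t.env.i).sum

variable (F T) in
/-- The run with the given tape is good. -/
def IsGood (t : Trial 𝒢) (tape : List ℕ) : Prop :=
  Good t.env t.publicKey (t.run F T tape).1.1 (t.run F T tape).2

variable (F T) in
/-- The slot of the hash value of the forgery. -/
def forgerySlot (t : Trial 𝒢) (tape : List ℕ) : ℕ :=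
  slotOf (t.run F T tape).2.hashTbl (outHash (t.run F T tape).1.1)

theorem forked_eq (t : Trial 𝒢) : t.forked F T =
    merge (fun n => decide (n < t.forgerySlot F T t.hashTape ∨
      ((t.run F T t.hashTape).2.sessions.any fun u => u.slot = n) = true)) 0 t.hashTape t.altTape := by
  rw [forked, first, (t.runBook_eq t.hashTape ⟨[], 0⟩).1, (t.runBook_eq t.hashTape ⟨[], 0⟩).2]
  rfl

/-- Two good runs yield the secret key. -/
theorem cast_key (hlen : t.altTape.length = t.hashTape.length)
    (h₁ : t.IsGood F T t.hashTape) (h₂ : t.IsGood F T (t.forked F T))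
    (hslot : t.forgerySlot F T (t.forked F T) = t.forgerySlot F T t.hashTape)
    (hne : ∀ n, n + 1 = t.forgerySlot F T t.hashTape → ∀ v v', t.hashTape[n]? = some v →
      t.altTape[n]? = some v' → (v : ZMod t.env.p) ≠ v') :
    (t.key F T : ZMod t.env.p) = t.x := by
  set a := t.hashTape with ha
  set a' := t.forked F T with ha'
  obtain ⟨-, hi, hs, h, j, hq⟩ := h₁
  obtain ⟨-, -, -, h', j', hq'⟩ := h₂
  have hi' : ∃ n, t.forgerySlot F T a = n + 1 := ⟨t.forgerySlot F T a - 1, by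
    have : 0 < t.forgerySlot F T a := hi
    omega⟩
  obtain ⟨n, hn⟩ := hi'
  have e1 : slotOf (t.run F T a).2.hashTbl (outHash (t.run F T a).1.1) = n + 1 := hn
  have e2 : slotOf (t.run F T a').2.hashTbl (outHash (t.run F T a').1.1) = n + 1 := hslot.trans hn
  rw [e1] at hq hs
  rw [e2] at hq'
  have hget : ∀ m, a'[m]? = a[m]?.map fun c => if m + 1 < n + 1 ∨
      ((t.run F T a).2.sessions.any fun u => u.slot = m + 1) = true then c else t.altTape[m]?.getD 0 := by
    intro m
    rw [ha', forked_eq, getElem?_merge, hn]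
    simp only [decide_eq_true_eq]
    rfl
  have hlen' : a.length = a'.length := by
    rw [ha', forked_eq, length_merge]
  -- All slots before that of the forgery are kept, so the two tapes agree there and both forgeries
  -- concern the same point.
  obtain ⟨q₀, p1, p2⟩ := t.exists_slot_point (i := n + 1) (some t.s)
    (F.run (T.eval t.env.k) t.input) (c := Core.start [] t.prfTape t.coinTape) hlen'
    (by simp [Core.start]) (by simp [Core.start]) (fun m hm => by
      have : m + 1 < n + 1 := by simpa [Core.start] using hm
      rw [hget m]
      simp [this])
  have hpt := (p1 _ _ hq).trans (p2 _ _ hq').symm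
  have hv := ((t.consistent_run a).value _ _ _ hq).2
  have hv' := ((t.consistent_run a').value _ _ _ hq').2
  -- No session of the first run used the slot of its forgery, so this slot is not kept: the second
  -- run reads the entry of `altTape` there, and `hne` makes the two hash values differ modulo `p`.
  have hnot : ¬ ((t.run F T a).2.sessions.any fun u => u.slot = n + 1) = true := by
    simp only [List.any_eq_true, decide_eq_true_eq, not_exists, not_and]
    exact hs
  have hlt : n < t.altTape.length := by
    rw [hlen]
    exact (List.getElem?_eq_some_iff.1 hv).1
  rw [hget n, hv, Option.map_some, if_neg (by
    rintro (h | h)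
    · omega
    · exact hnot h), List.getElem?_eq_getElem hlt, Option.getD_some, Option.some.injEq] at hv'
  have hne' := hne n hn.symm _ _ hv (List.getElem?_eq_getElem hlt)
  rw [hv'] at hne'
  have hkey : t.key F T = extract t.env.p t.xs (t.run F T a).1.1 (t.run F T a').1.1 := by
    rw [key, second, first, (t.runBook_eq _ _).1, (t.runBook_eq _ _).1]
  rw [hkey]
  refine cast_extract t.env ?_ hne'
  have hpt' := t.env.enc_inj (Val.pair.inj hpt).1
  have hY : t.publicKey = (t.x + t.xs.sum) • 𝒢.base t.env.i := by
    rw [publicKey, t.env.sum_smul_base, List.sum_cons]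
  rw [hY, ← mul_smul, ← mul_smul, ← add_smul, ← add_smul] at hpt'
  have := t.env.smul_base_inj hpt'
  push_cast at this ⊢
  exact this

theorem findNonces_eq {b : Book} {z : ℕ} (hz : (z : ZMod t.env.p) = t.x)
    (hb : ∀ J u r, b.shares.lookup J = some u → look t.nonces J = some r → u.2 = t.sig r u.1)
    (J : ℕ) (hJ : J ≤ t.nonces.length) : t.findNonces b z J = (t.nonces.take J).reverse := by
  induction J with
  | zero => rfl
  | succ J ih =>
    have hlt : J < t.nonces.length := by omega
    have hr : t.nonces[J] < t.env.p := t.nonces_lt _ (List.getElem_mem _)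
    have hl : look t.nonces (.num (J + 1)) = some t.nonces[J] := by
      rw [look_succ, List.getElem?_eq_getElem hlt]
    rw [findNonces, ih (by omega), List.take_succ_eq_append_getElem hlt, List.reverse_append]
    simp only [List.reverse_cons, List.reverse_nil, List.nil_append, List.singleton_append,
      List.cons.injEq, and_true]
    rw [findNonce]
    rcases hu : b.shares.lookup (.num (J + 1)) with _ | u
    · rw [if_neg (by simp [hu]), hl, Option.getD_some, Nat.mod_eq_of_lt hr]
    · rw [if_pos (by simp [hu]), hu, Option.getD_some, hb _ _ _ hu hl]
      exact t.sig_add hr hz _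

/-- Each of the first `J` nonces either has a share in the book or costs one further query. -/
theorem finalQueries_add (b : Book) (J : ℕ) : finalQueries b J +
    ((Finset.range J).filter fun j => (b.shares.lookup (.num (j + 1))).isSome = true).card =
      b.queries + J := by
  induction J with
  | zero => simp [finalQueries]
  | succ J ih =>
    rw [finalQueries, Finset.range_add_one, Finset.filter_insert]
    split
    · rw [Finset.card_insert_of_notMem (by simp)]
      omega
    · omega

/-- In two good runs of the same shape every nonce costs one discrete logarithm. -/
theorem queries_le (hnon : t.nonces.length = qS)
    (h₁ : t.IsGood F T t.hashTape) (h₂ : t.IsGood F T (t.forked F T))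
    (hshape : ∀ j < qS, sessionSlot (t.run F T (t.forked F T)).2 (j + 1) =
      sessionSlot (t.run F T t.hashTape).2 (j + 1)) : t.queries F T qS ≤ qS := by
  have hc₁ := t.consistent_run (F := F) (T := T) t.hashTape
  have hc₂ := t.consistent_run (F := F) (T := T) (t.forked F T)
  have hn₁ : ((t.run F T t.hashTape).2.sessions.map fun u => u.index).Nodup :=
    t.nodup_sessions _ _ _ _ _
  have hn₂ : ((t.run F T (t.forked F T)).2.sessions.map fun u => u.index).Nodup :=
    t.nodup_sessions _ _ _ _ _
  have hb₁ : t.BookOk ⟨[], 0⟩ (t.first F T).2 := t.bookOk_det _ _ fun _ _ => by simp [Core.start]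
  obtain ⟨q1, q2, q3, q4⟩ := hb₁ (by rw [(t.runBook_eq _ _).2]; exact h₁.1) (by simp)
  rw [(t.runBook_eq _ _).2] at q4
  have hb₂ : t.BookOk (t.first F T).2.2 (t.second F T).2 :=
    t.bookOk_det _ _ fun _ _ => ⟨q1, q2, q3, fun J u hu => Or.inl hu⟩
  -- To be shown: a session of the second run whose index has a share from the first run uses the
  -- same hash value. By the equality of shapes its slot is the same. In slot `0` the value is the
  -- fresh one belonging to the index; any other slot of a session of the first run was kept in the
  -- forked tape.
  obtain ⟨r1, r2, r3, -⟩ := hb₂ (by rw [(t.runBook_eq _ _).2]; exact h₂.1) (by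
    rw [(t.runBook_eq _ _).2]
    intro u hu v hv
    rcases q4 _ _ hv with h | ⟨u', hu', hidx, hval⟩
    · simp at h
    · rw [Val.num.injEq] at hidx
      obtain ⟨r, hr⟩ := hc₂.index u hu
      obtain ⟨j, hj, hjr⟩ := look_eq_some hr
      rw [Val.num.injEq] at hj
      have hslots : u.slot = u'.slot := by
        rw [← sessionSlot_eq hn₁ hu', ← sessionSlot_eq hn₂ hu, ← hidx, hj]
        refine hshape j ?_
        rw [← hnon]
        exact (List.getElem?_eq_some_iff.1 hjr).1
      rw [hval]
      obtain ⟨R, hR⟩ := hc₂.session u hu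
      obtain ⟨R', hR'⟩ := hc₁.session u' hu'
      rcases hsl : u'.slot with _ | n
      · rw [hsl] at hR' hslots
        rw [hslots] at hR
        obtain ⟨v, -, e1, e2, -⟩ := hc₂.fresh _ _ hR
        obtain ⟨v', -, e1', e2', -⟩ := hc₁.fresh _ _ hR'
        rw [e2, e2', ← e1, ← e1']
        simp [hashInput, Val.snd, hidx]
      · rw [hsl] at hR' hslots
        rw [hslots] at hR
        have g := (hc₂.value _ _ _ hR).2
        have g' := (hc₁.value _ _ _ hR').2
        rw [forked_eq, getElem?_merge, g', Option.map_some, if_pos, Option.some.injEq] at g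
        · exact g
        · simp only [decide_eq_true_eq, List.any_eq_true]
          exact Or.inr ⟨u', hu', hsl⟩)
  have hadd := finalQueries_add (t.second F T).2.2 qS
  rw [queries]
  -- The shares belong to different indices below `qS`. The queries made so far are as many as the
  -- shares, so they are compensated by the indices that need no final query.
  have hle : (t.second F T).2.2.shares.length ≤ ((Finset.range qS).filter fun j =>
      ((t.second F T).2.2.shares.lookup (.num (j + 1))).isSome = true).card := by
    have : ((t.second F T).2.2.shares.map Prod.fst).toFinset ⊆
        ((Finset.range qS).filter fun j =>
          ((t.second F T).2.2.shares.lookup (.num (j + 1))).isSome = true).image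
          fun j => Val.num (j + 1) := by
      intro J hJ
      rw [List.mem_toFinset, List.mem_map] at hJ
      obtain ⟨u, hu, rfl⟩ := hJ
      have hs : ∃ v, (t.second F T).2.2.shares.lookup u.1 = some v := by
        rcases hl : (t.second F T).2.2.shares.lookup u.1 with _ | v
        · rw [List.lookup_eq_none_iff] at hl
          simpa using hl u hu
        · exact ⟨v, rfl⟩
      obtain ⟨v, hv⟩ := hs
      obtain ⟨r, hr⟩ := r3 _ _ hv
      obtain ⟨j, hj, hjr⟩ := look_eq_some hr
      rw [Finset.mem_image]
      refine ⟨j, Finset.mem_filter.2 ⟨Finset.mem_range.2 ?_, ?_⟩, hj.symm⟩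
      · rw [← hnon]
        exact (List.getElem?_eq_some_iff.1 hjr).1
      · rw [← hj, hv]
        rfl
    calc (t.second F T).2.2.shares.length
        = ((t.second F T).2.2.shares.map Prod.fst).toFinset.card := by
          rw [List.toFinset_card_of_nodup r2, List.length_map]
      _ ≤ _ := (Finset.card_le_card this).trans Finset.card_image_le
  omega

/-- The adversary wins if both runs are good and have the same shape. -/
theorem wins (hP : t.Proper F T qS) (hlen : t.altTape.length = t.hashTape.length)
    (h₁ : t.IsGood F T t.hashTape) (h₂ : t.IsGood F T (t.forked F T))
    (hslot : t.forgerySlot F T (t.forked F T) = t.forgerySlot F T t.hashTape)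
    (hshape : ∀ j < qS, sessionSlot (t.run F T (t.forked F T)).2 (j + 1) =
      sessionSlot (t.run F T t.hashTape).2 (j + 1))
    (hne : ∀ n, n + 1 = t.forgerySlot F T t.hashTape → ∀ v v', t.hashTape[n]? = some v →
      t.altTape[n]? = some v' → (v : ZMod t.env.p) ≠ v') :
    t.challenges.length = qS + 1 ∧ t.queries F T qS < qS + 1 ∧
      SolvesDL 𝒢 t.env.i t.challenges (ofList ((t.output F T qS).map .num)) := by
  have hk := cast_key hlen h₁ h₂ hslot hne
  refine ⟨by simp [World.challenges, hP.length_nonces],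
    Nat.lt_succ_of_le (queries_le hP.length_nonces h₁ h₂ hshape), _, rfl, ?_⟩
  rw [output, findNonces_eq hk (valid_runBook hP.length_forked hP.forked_lt
    hP.valid_first.shares).shares _ hP.length_nonces.ge, ← hP.length_nonces, List.take_length,
    World.challenges, List.map_cons, List.map_cons]
  congr 1
  rw [GroupGen.point, GroupGen.point, t.env.smul_base_congr hk]

end Trial

/-! ## Forgeries in the experiment -/

open Classical in
/-- The indicator of a proposition. -/
noncomputable def ind (P : Prop) : ℝ≥0∞ := if P then 1 else 0

theorem ind_of {P : Prop} (h : P) : ind P = 1 := if_pos h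

theorem ind_of_not {P : Prop} (h : ¬ P) : ind P = 0 := if_neg h

theorem ind_le_one (P : Prop) : ind P ≤ 1 := by
  unfold ind
  split <;> simp

theorem ind_mono {P Q : Prop} (h : P → Q) : ind P ≤ ind Q := by
  by_cases hP : P
  · rw [ind_of hP, ind_of (h hP)]
  · rw [ind_of_not hP]
    exact zero_le

theorem ind_or_le (P Q : Prop) : ind (P ∨ Q) ≤ ind P + ind Q := by
  by_cases hP : P
  · rw [ind_of hP]
    exact (ind_le_one _).trans le_self_add
  · exact (ind_mono fun h => h.resolve_left hP).trans le_add_self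

theorem mean_unif_ind_le {K : ℕ} (hK : 0 < K) {P : ℕ → Prop} (a : ℕ) (h : ∀ c, P c → c = a) :
    ((unif K).mean fun c => ind (P c)) ≤ (K : ℝ≥0∞)⁻¹ := by
  rw [mean_unif hK]
  refine mul_le_of_le_one_right zero_le ?_
  calc ∑ c ∈ Finset.range K, ind (P c) ≤ ∑ c ∈ Finset.range K, if c = a then 1 else 0 :=
        Finset.sum_le_sum fun c _ => by
          by_cases hc : P c
          · rw [ind_of hc, if_pos (h c hc)]
          · rw [ind_of_not hc]
            exact zero_le
    _ ≤ 1 := by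
        rw [Finset.sum_ite_eq']
        split <;> simp

section forgery

variable {k : ℕ}

theorem hashOf_eq (k : ℕ) (v : Val) (st : ForgerState) : hashOf k v st =
    ((st.hashTbl v).elim (unif (2 ^ k)) PMF.pure).map fun c =>
      (c, { st with hashTbl := Function.update st.hashTbl v (some c) }) := by
  simp [hashOf, askRandom_eq, PMF.map, Function.comp_def, PMF.bind_bind]

theorem hashOf_some {v : Val} {st : ForgerState} {c : ℕ} (h : st.hashTbl v = some c) :
    hashOf k v st = PMF.pure (c, st) := by
  have : Function.update st.hashTbl v (some c) = st.hashTbl := by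
    rw [← h, Function.update_eq_self]
  rw [hashOf_eq, h, Option.elim_some, PMF.pure_map, this]

theorem hashOf_none {v : Val} {st : ForgerState} (h : st.hashTbl v = none) :
    hashOf k v st = (unif (2 ^ k)).map fun c =>
      (c, { st with hashTbl := Function.update st.hashTbl v (some c) }) := by
  rw [hashOf_eq, h, Option.elim_none]

theorem mem_support_hashOf {v : Val} {st : ForgerState} {r : ℕ × ForgerState}
    (h : r ∈ (hashOf k v st).support) : r.2.hashTbl v = some r.1 ∧
      (∀ q ≠ v, r.2.hashTbl q = st.hashTbl q) ∧
      ∀ q c, st.hashTbl q = some c → r.2.hashTbl q = some c := by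
  rw [hashOf_eq, PMF.support_map] at h
  obtain ⟨c, hc, rfl⟩ := h
  have h1 : ∀ q ≠ v, Function.update st.hashTbl v (some c) q = st.hashTbl q :=
    fun q hq => Function.update_of_ne hq _ _
  refine ⟨Function.update_self _ _ _, h1, fun q c' hq => ?_⟩
  by_cases hqv : q = v
  · subst hqv
    rw [hq] at hc
    simp only [Option.elim_some, PMF.support_pure, Set.mem_singleton_iff] at hc
    rw [hc]
    exact Function.update_self _ _ _
  · exact (h1 q hqv).trans hq

/-- The value of a truth value. -/
def tv (b : Bool) : ℝ≥0∞ := if b = true then 1 else 0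

theorem tv_le_one (b : Bool) : tv b ≤ 1 := by
  unfold tv
  split <;> simp

theorem mean_tv_le_one (p : PMF Bool) : p.mean tv ≤ 1 := p.mean_le fun b _ => tv_le_one b

/-- A session whose digest is the hash of `m` makes `m` used in either case: `m` was announced, or
the announced message has another hash, and then all messages with that digest count as used. -/
theorem mean_isNew_eq_zero {m : Val} {h : ℕ} {t : Session} (l : List Session) {st : ForgerState}
    (hm : st.hashTbl m = some h) (ht : t ∈ l) (hd : t.digest = .num h)
    (hC : m = t.msg ∨ ∃ h', h' ≠ h ∧ st.hashTbl t.msg = some h') :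
    ((isNew k m l st).mean fun b => tv b.1) = 0 := by
  induction l generalizing st with
  | nil => simp at ht
  | cons t' l ih =>
    rw [isNew, hashOf_some hm, PMF.pure_bind, PMF.mean_bind]
    refine le_antisymm (PMF.mean_le _ fun r hr => ?_) zero_le
    obtain ⟨e1, -, e2⟩ := mem_support_hashOf hr
    split
    · simp [tv]
    · next hn =>
      rcases List.mem_cons.1 ht with rfl | ht
      · refine absurd ?_ hn
        rcases hC with hC | ⟨h', hne, hh'⟩
        · exact Or.inl hC
        · have := e2 _ _ hh'
          rw [e1, Option.some.injEq] at this
          exact Or.inr ⟨by rw [hd, this]; simpa using hne, hd.symm⟩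
      · refine (ih (e2 _ _ hm) ht ?_).le
        rcases hC with hC | ⟨h', hne, hh'⟩
        · exact Or.inl hC
        · exact Or.inr ⟨h', hne, e2 _ _ hh'⟩

/-- Here the announced message has not been hashed before, so its hash is drawn during the check.
Unless it happens to be `h`, the announcement was false and `m` counts as used. -/
theorem mean_isNew_le {m : Val} {h : ℕ} {t : Session} (l : List Session) {st : ForgerState}
    (hm : st.hashTbl m = some h) (ht : t ∈ l) (hd : t.digest = .num h)
    (hn : st.hashTbl t.msg = none) :
    ((isNew k m l st).mean fun b => tv b.1) ≤ ((2 ^ k : ℕ) : ℝ≥0∞)⁻¹ := by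
  induction l generalizing st with
  | nil => simp at ht
  | cons t' l ih =>
    rw [isNew, hashOf_some hm, PMF.pure_bind, PMF.mean_bind]
    by_cases hmsg : t'.msg = t.msg
    · rw [hmsg, hashOf_none hn, PMF.mean_map]
      refine le_trans (PMF.mean_mono (g := fun h' => ind (h' = h)) fun h' _ => ?_)
        (mean_unif_ind_le (by positivity) h fun c hc => hc)
      by_cases hh : h' = h
      · rw [ind_of hh]
        exact PMF.mean_le _ fun b _ => tv_le_one _
      · rw [ind_of_not hh]
        dsimp only
        split
        · simp [tv]
        · next hcond =>
          rcases List.mem_cons.1 ht with rfl | ht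
          · exact absurd (Or.inr ⟨by rw [hd]; simpa using hh, hd.symm⟩) hcond
          · refine (mean_isNew_eq_zero l ?_ ht hd (Or.inr ⟨h', hh, Function.update_self _ _ _⟩)).le
            refine (Function.update_of_ne ?_ _ _).trans hm
            rintro rfl
            rw [hm] at hn
            simp at hn
    · refine PMF.mean_le _ fun r hr => ?_
      obtain ⟨-, e1, e2⟩ := mem_support_hashOf hr
      split
      · simp [tv]
      · refine ih (e2 _ _ hm) ?_ ((e1 _ (Ne.symm hmsg)).trans hn)
        rcases List.mem_cons.1 ht with rfl | ht
        · exact absurd rfl hmsg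
        · exact ht

variable {𝒢 : GroupGen}

/-- The forger has hashed the message and the point of its forgery, and has not requested a
signature on the digest. -/
def Claims (𝒢 : GroupGen) (i : 𝒢.Inst) (Y : 𝒢.El i) (out : Val) (V : View) : Prop :=
  ∃ m j σ ε h, out = .pair m (.pair j (.pair (.num σ) (.num ε))) ∧ V.1 m = some h ∧
    V.1 (hashInput (𝒢.enc i (σ • 𝒢.base i + ε • Y)) (.num h) j) = some ε ∧
    ∀ t ∈ V.2.1, t.digest ≠ .num h

/-- Different points have different hash values. -/
def HashInj (V : View) : Prop := ∀ q q' v, V.1 q = some v → V.1 q' = some v → q = q'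

/-- If the message or the point of the forgery has not been hashed before, the verification draws a
fresh value and succeeds only by a lucky guess. If both have been hashed and the signature is valid,
but a session has the digest of `m`, then `m` counts as used: the announced message is `m` itself as
hash values are not repeated, or it has another hash, or its hash is drawn only now and must be
guessed. -/
theorem mean_isForgery_le (i : 𝒢.Inst) (Y : 𝒢.El i) (out : Val) (st : ForgerState) :
    (isForgery 𝒢 k i Y out st).mean tv ≤ ind (¬ HashInj st.view) +
      ind (Claims 𝒢 i Y out st.view) + 3 * ((2 ^ k : ℕ) : ℝ≥0∞)⁻¹ := by
  have hK : 0 < 2 ^ k := by positivity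
  set δ := ((2 ^ k : ℕ) : ℝ≥0∞)⁻¹ with hδ
  by_cases hinj : HashInj st.view
  swap
  · rw [ind_of hinj]
    exact (mean_tv_le_one _).trans (le_self_add.trans le_self_add)
  by_cases hcl : Claims 𝒢 i Y out st.view
  · rw [ind_of hcl]
    exact (mean_tv_le_one _).trans (le_add_self.trans le_self_add)
  suffices hs : (isForgery 𝒢 k i Y out st).mean tv ≤ 3 * δ from hs.trans le_add_self
  rw [show 3 * δ = δ + δ + δ by ring]
  rcases out with n | ⟨m, n | ⟨j, n | ⟨σ | _, ε | _⟩⟩⟩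
  all_goals try (simp [isForgery, tv]; done)
  set q : ℕ → Val := fun h => hashInput (𝒢.enc i (σ • 𝒢.base i + ε • Y)) (.num h) j with hq
  have hqinj : ∀ h h', q h = q h' → h = h' := fun h h' hh => by simpa [q, hashInput] using hh
  have hpair : ∀ (b : Bool) st', ((isNew k m st.sessions st').bind fun b' =>
      PMF.pure (b && b'.1)).mean tv ≤ ind (b = true) := by
    intro b st'
    rw [PMF.mean_bind]
    refine PMF.mean_le _ fun b' _ => ?_
    rw [PMF.mean_pure]
    cases b
    · simp [tv]
    · rw [ind_of rfl]
      exact tv_le_one _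
  simp only [isForgery, verify, PMF.bind_bind, PMF.pure_bind]
  rcases hm : st.hashTbl m with _ | h
  · rw [hashOf_none hm, PMF.bind_map, PMF.mean_bind]
    -- The three ways to be lucky when the hash of `m` is drawn now: the point formed with it
    -- already has the value `ε`; this point is `m` itself; or the point is new and its value is
    -- guessed. Each of the first two determines the hash of `m`.
    calc _ ≤ (unif (2 ^ k)).mean fun h => ind (st.hashTbl (q h) = some ε) + ind (q h = m) + δ := by
          refine PMF.mean_mono fun h _ => ?_
          dsimp only [Function.comp]
          set st' : ForgerState := { st with hashTbl := Function.update st.hashTbl m (some h) } with hst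
          by_cases hqm : q h = m
          · rw [ind_of hqm]
            exact (mean_tv_le_one _).trans (le_add_self.trans le_self_add)
          have hst' : st'.hashTbl (q h) = st.hashTbl (q h) := Function.update_of_ne hqm _ _
          rcases ht : st.hashTbl (q h) with _ | ε'
          · rw [ht] at hst'
            rw [hashOf_none hst', PMF.bind_map, PMF.mean_bind]
            refine le_trans ?_ (le_add_self (a := δ))
            refine le_trans (PMF.mean_mono (g := fun e => ind (e = ε)) fun e _ => ?_)
              (mean_unif_ind_le hK ε fun c hc => hc)
            refine (hpair _ _).trans (ind_mono fun h => ?_)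
            simpa [eq_comm] using h
          · rw [ht] at hst'
            rw [hashOf_some hst', PMF.pure_bind]
            refine (hpair _ _).trans (le_trans (ind_mono fun h => ?_) (le_self_add.trans le_self_add))
            simpa [eq_comm] using h
      _ ≤ δ + δ + δ := by
          rw [PMF.mean_add, PMF.mean_add, PMF.mean_const]
          have h1 : ∀ P : ℕ → Prop, (∀ h h', P h → P h' → h = h') →
              ((unif (2 ^ k)).mean fun h => ind (P h)) ≤ δ := by
            intro P hP
            by_cases hex : ∃ h, P h
            · obtain ⟨h₀, hh₀⟩ := hex
              exact mean_unif_ind_le hK h₀ fun c hc => hP _ _ hc hh₀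
            · exact mean_unif_ind_le hK 0 fun c hc => absurd ⟨c, hc⟩ hex
          gcongr
          · exact h1 _ fun h h' hh hh' => hqinj _ _ (hinj _ _ _ hh hh')
          · exact h1 _ fun h h' hh hh' => hqinj _ _ (hh.trans hh'.symm)
  · rw [hashOf_some hm, PMF.pure_bind]
    refine le_trans ?_ (le_add_self (a := δ))
    dsimp only
    rcases ht : st.hashTbl (q h) with _ | ε'
    · rw [hashOf_none ht, PMF.bind_map, PMF.mean_bind]
      refine le_trans (PMF.mean_mono (g := fun e => ind (e = ε)) fun e _ => ?_)
        (mean_unif_ind_le hK ε fun c hc => hc)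
      refine (hpair _ _).trans (ind_mono fun h => ?_)
      simpa [eq_comm] using h
    · rw [hashOf_some ht, PMF.pure_bind]
      by_cases hε : ε = ε'
      swap
      · refine (hpair _ _).trans ?_
        rw [ind_of_not (by simpa using hε)]
        exact zero_le
      subst hε
      obtain ⟨t, hts, htd⟩ : ∃ t ∈ st.sessions, t.digest = .num h := by
        by_contra hno
        push Not at hno
        exact hcl ⟨m, j, σ, ε, h, rfl, hm, ht, hno⟩
      simp only [PMF.mean_bind, PMF.mean_pure, decide_true, Bool.true_and]
      rcases hmsg : st.hashTbl t.msg with _ | h'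
      · exact mean_isNew_le _ hm hts htd hmsg
      · rw [mean_isNew_eq_zero _ hm hts htd]
        · exact zero_le
        · by_cases hh : h' = h
          · subst hh
            exact Or.inl (hinj _ _ _ hm hmsg)
          · exact Or.inr ⟨h', hh, hmsg⟩

end forgery

/-! ## The forking argument -/

theorem lookup_of_mem {β : Type} {l : List (Val × β)} (hl : (l.map Prod.fst).Nodup) {q : Val} {b : β}
    (h : (q, b) ∈ l) : l.lookup q = some b := by
  induction l with
  | nil => simp at h
  | cons t l ih =>
    simp only [List.map_cons, List.nodup_cons] at hl
    refine World.lookup_cons_eq.2 ?_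
    rcases List.mem_cons.1 h with rfl | h
    · exact Or.inl ⟨rfl, rfl⟩
    · refine Or.inr ⟨?_, ih hl.2 h⟩
      rintro rfl
      exact hl.1 (List.mem_map.2 ⟨_, h, rfl⟩)

theorem slotOf_eq {l : List (Val × ℕ × ℕ)} (hl : (l.map Prod.fst).Nodup) {q : Val} {ε n : ℕ}
    (hq : l.lookup q = some (ε, n)) (hinj : ∀ q' n', l.lookup q' = some (ε, n') → q' = q) :
    slotOf l ε = n := by
  rw [slotOf]
  rcases hf : l.findSome? fun t => if t.2.1 = ε then some t.2.2 else none with _ | n'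
  · rw [List.findSome?_eq_none_iff] at hf
    simpa using hf _ (lookup_ofTable_mem hq)
  · obtain ⟨⟨q', ε', n''⟩, ht, hte⟩ := List.exists_of_findSome?_eq_some hf
    simp only [Option.ite_none_right_eq_some, Option.some.injEq] at hte
    obtain ⟨rfl, rfl⟩ := hte
    have h1 := lookup_of_mem hl ht
    obtain rfl := hinj _ _ h1
    rw [hq] at h1
    rw [hf]
    simpa using h1.symm

namespace Trial

variable {𝒢 : GroupGen} {F : Code ForgerOracle} {T : Polynomial ℕ} {qS : ℕ}

theorem hashInj_run {t : Trial 𝒢} {a : List ℕ} (hlen : t.fresh.length = t.nonces.length)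
    (hnd : (a ++ t.fresh).Nodup) : HashInj (t.run F T a).2.view := by
  intro q q' v hq hq'
  obtain ⟨⟨v₁, n₁⟩, h₁, rfl⟩ := Option.map_eq_some_iff.1 hq
  obtain ⟨⟨v₂, n₂⟩, h₂, hv⟩ := Option.map_eq_some_iff.1 hq'
  obtain rfl : v₂ = v₁ := hv
  exact (t.consistent_run a).value_inj t.toWorld hlen hnd h₁ h₂

/-- A point in slot `0`, or in the slot of a session, is the point of a session and contains the
digest sent there. The point of the forgery contains the hash of the message, which is the digest of
no session; so the forger hashed it itself, in a positive slot that belongs to no session. -/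
theorem isGood_of_claims {t : Trial 𝒢} {a : List ℕ} (hlen : t.fresh.length = t.nonces.length)
    (hnd : (a ++ t.fresh).Nodup) (hhit : (t.run F T a).2.hit = false)
    (hcl : Claims 𝒢 t.env.i t.publicKey (t.run F T a).1.1 (t.run F T a).2.view) :
    t.IsGood F T a := by
  have hc := t.consistent_run (F := F) (T := T) a
  obtain ⟨m, j, σ, ε, h, hout, -, hq, hs⟩ := hcl
  obtain ⟨⟨ε', n⟩, hl, hε⟩ := Option.map_eq_some_iff.1 hq
  obtain rfl : ε' = ε := hε
  have hslot : slotOf (t.run F T a).2.hashTbl ε' = n :=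
    slotOf_eq (t.nodup_hashTbl _ _ _ _ _) hl fun q' n' hq' =>
      hc.value_inj t.toWorld hlen hnd hq' hl
  have hoh : outHash (t.run F T a).1.1 = ε' := by rw [hout]; rfl
  have hos : outSig (t.run F T a).1.1 = σ := by rw [hout]; rfl
  have hses : ∀ u ∈ (t.run F T a).2.sessions, u.digest ≠ .num h := fun u hu =>
    hs u.toSession (List.mem_map.2 ⟨u, hu, rfl⟩)
  refine ⟨hhit, ?_, fun u hu hun => ?_, .num h, j, ?_⟩
  · rw [hoh, hslot]
    refine Nat.pos_of_ne_zero fun hn => ?_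
    subst hn
    obtain ⟨u, hu, e1, -, e3⟩ := hc.fresh _ _ hl
    obtain ⟨R, hR⟩ := hc.session u hu
    rw [e3] at hR
    have := hc.slot_inj _ _ _ _ _ hR hl fun _ => by
      rw [e1]
      rfl
    exact hses u hu (Val.pair.inj (Val.pair.inj this).2).1
  · rw [hoh, hslot] at hun
    obtain ⟨R, hR⟩ := hc.session u hu
    rw [hun] at hR
    rcases n with _ | n
    · obtain ⟨u', hu', e1, -, e3⟩ := hc.fresh _ _ hl
      obtain ⟨R', hR'⟩ := hc.session u' hu'
      rw [e3] at hR'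
      have := hc.slot_inj _ _ _ _ _ hR' hl fun _ => by
        rw [e1]
        rfl
      exact hses u' hu' (Val.pair.inj (Val.pair.inj this).2).1
    · have := hc.slot_inj _ _ _ _ _ hR hl (by simp)
      exact hses u hu (Val.pair.inj (Val.pair.inj this).2).1
  · rw [hoh, hos, hslot]
    exact hl

end Trial

theorem mean_unifList_succ (n m : ℕ) (f : List ℕ → ℝ≥0∞) : (unifList n (m + 1)).mean f =
    (unif n).mean fun c => (unifList n m).mean fun l => f (c :: l) := by
  simp only [unifList_succ, PMF.mean_bind, PMF.mean_map]

/-- Two lists that share the entries which are kept: the events are positively correlated. -/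
theorem sq_mean_le_merge {Z : Type} (μ : PMF Z) (keep : ℕ → Bool) (i n m : ℕ)
    (φ : Z → List ℕ → ℝ≥0∞) : (μ.mean fun z => (unifList n m).mean (φ z)) ^ 2 ≤
      μ.mean fun z => μ.mean fun z' => (unifList n m).mean fun a => (unifList n m).mean fun b =>
        φ z a * φ z' (merge keep i a b) := by
  induction m generalizing Z i with
  | zero =>
    simp only [unifList, PMF.mean_pure, merge, PMF.mean_const_mul]
    simp only [mul_comm _ (μ.mean _), PMF.mean_const_mul, sq]
    exact le_rfl
  | succ m ih =>
    simp only [mean_unifList_succ, merge]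
    -- A kept entry `c` is common to both lists: Jensen's inequality for the average over `c`, then
    -- the induction hypothesis for each `c`.
    by_cases hk : keep (i + 1) = true
    · simp only [hk, if_true, PMF.mean_const, List.tail_cons]
      calc _ = ((unif n).mean fun c => μ.mean fun z => (unifList n m).mean fun l =>
            φ z (c :: l)) ^ 2 := by rw [PMF.mean_comm]
        _ ≤ _ := PMF.sq_mean_le _ _
        _ ≤ (unif n).mean fun c => μ.mean fun z => μ.mean fun z' => (unifList n m).mean fun a =>
            (unifList n m).mean fun b => φ z (c :: a) * φ z' (c :: merge keep (i + 1) a b) :=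
          PMF.mean_mono fun c _ => ih μ (i + 1) fun z l => φ z (c :: l)
        _ = _ := by
          rw [PMF.mean_comm]
          refine PMF.mean_congr fun z _ => ?_
          rw [PMF.mean_comm]
    · simp only [hk, List.headD_cons, List.tail_cons]
      -- An entry that is not kept is independent in the two lists, like `z` and `z'`, and is
      -- absorbed into them. The auxiliary variable `z` is there for this purpose.
      have h := ih (μ.bind fun z => (unif n).map fun c => (z, c)) (i + 1)
        fun zc l => φ zc.1 (zc.2 :: l)
      simp only [PMF.mean_bind, PMF.mean_map] at h
      refine h.trans_eq (PMF.mean_congr fun z _ => ?_)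
      rw [PMF.mean_comm]
      refine PMF.mean_congr fun z' _ => PMF.mean_congr fun c _ => ?_
      rw [PMF.mean_comm]
      rfl

/-- Cauchy–Schwarz against the constant function `1`; it will be applied with one summand for each
shape. -/
theorem sq_sum_le {ι : Type} (s : Finset ι) (x : ι → ℝ≥0∞) :
    (∑ i ∈ s, x i) ^ 2 ≤ s.card * ∑ i ∈ s, x i ^ 2 := by
  have h : 2 * (∑ i ∈ s, x i) ^ 2 ≤ 2 * (s.card * ∑ i ∈ s, x i ^ 2) := by
    calc 2 * (∑ i ∈ s, x i) ^ 2 = ∑ i ∈ s, ∑ j ∈ s, 2 * (x i * x j) := by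
          rw [sq, Finset.sum_mul_sum, Finset.mul_sum]
          exact Finset.sum_congr rfl fun i _ => Finset.mul_sum _ _ _
      _ ≤ ∑ i ∈ s, ∑ j ∈ s, (x i ^ 2 + x j ^ 2) :=
          Finset.sum_le_sum fun i _ => Finset.sum_le_sum fun j _ => PMF.two_mul_le_sq_add_sq _ _
      _ = 2 * (s.card * ∑ i ∈ s, x i ^ 2) := by
          simp only [Finset.sum_add_distrib, Finset.sum_const, nsmul_eq_mul, ← Finset.mul_sum]
          ring
  exact (ENNReal.mul_le_mul_iff_right (by norm_num) (by norm_num)).1 h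

theorem mean_unif_mem_le {K : ℕ} (hK : 0 < K) (l : List ℕ) :
    ((unif K).mean fun c => ind (c ∈ l)) ≤ l.length * (K : ℝ≥0∞)⁻¹ := by
  induction l with
  | nil => simp [ind_of_not]
  | cons a l ih =>
    calc _ ≤ (unif K).mean fun c => ind (c = a) + ind (c ∈ l) :=
          PMF.mean_mono fun c _ => by
            rw [List.mem_cons]
            exact ind_or_le _ _
      _ ≤ (K : ℝ≥0∞)⁻¹ + l.length * (K : ℝ≥0∞)⁻¹ := by
          rw [PMF.mean_add]
          exact add_le_add (mean_unif_ind_le hK a fun c hc => hc) ih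
      _ = _ := by
          push_cast [List.length_cons]
          ring

/-- Birthday bound: each new entry has to avoid the fewer than `m + L.length` entries behind it. -/
theorem mean_not_nodup_le {K : ℕ} (hK : 0 < K) (m : ℕ) (L : List ℕ) :
    ((unifList K m).mean fun a => ind (¬ (a ++ L).Nodup)) ≤
      ind (¬ L.Nodup) + ((m * (m + L.length) : ℕ) : ℝ≥0∞) * (K : ℝ≥0∞)⁻¹ := by
  induction m with
  | zero => simp [unifList]
  | succ m ih =>
    rw [mean_unifList_succ, PMF.mean_comm]
    calc _ ≤ (unifList K m).mean fun a => ((m + L.length : ℕ) : ℝ≥0∞) * (K : ℝ≥0∞)⁻¹ +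
            ind (¬ (a ++ L).Nodup) := by
          refine PMF.mean_mono fun a ha => ?_
          calc _ ≤ (unif K).mean fun c => ind (c ∈ a ++ L) + ind (¬ (a ++ L).Nodup) := by
                refine PMF.mean_mono fun c _ => le_trans (ind_mono fun h => ?_) (ind_or_le _ _)
                rw [List.cons_append, List.nodup_cons] at h
                tauto
            _ ≤ _ := by
                rw [PMF.mean_add, PMF.mean_const]
                refine add_le_add ((mean_unif_mem_le hK _).trans_eq ?_) le_rfl
                rw [List.length_append, unifList_length ha]
      _ ≤ ((m + L.length : ℕ) : ℝ≥0∞) * (K : ℝ≥0∞)⁻¹ +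
            (ind (¬ L.Nodup) + ((m * (m + L.length) : ℕ) : ℝ≥0∞) * (K : ℝ≥0∞)⁻¹) := by
          rw [PMF.mean_add, PMF.mean_const]
          exact add_le_add le_rfl ih
      _ = ind (¬ L.Nodup) + (((m + 1) * (m + L.length) : ℕ) : ℝ≥0∞) * (K : ℝ≥0∞)⁻¹ := by
          push_cast
          ring
      _ ≤ _ := by
          gcongr
          omega

theorem mean_getElem? {K m n : ℕ} (hn : n < m) (f : Option ℕ → ℝ≥0∞) :
    ((unifList K m).mean fun l => f l[n]?) = (unif K).mean fun c => f (some c) := by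
  induction m generalizing n with
  | zero => omega
  | succ m ih =>
    rw [mean_unifList_succ]
    rcases n with _ | n
    · simp
    · simp only [List.getElem?_cons_succ]
      rw [ih (by omega), PMF.mean_const]

/-- The extraction divides by a difference of hash values modulo `p`, whereas hash values are
uniform below `K = 2 ^ k`. As `K ≤ 2 * p`, a residue class has at most two members in that range. -/
theorem mean_congruent_le {K m n p v : ℕ} (hK : 0 < K) (hn : n < m) (hp : K ≤ 2 * p) :
    ((unifList K m).mean fun b => ind (∃ v', b[n]? = some v' ∧ (v : ZMod p) = v')) ≤
      2 * (K : ℝ≥0∞)⁻¹ := by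
  rw [mean_getElem? hn fun o => ind (∃ v', o = some v' ∧ (v : ZMod p) = v')]
  calc _ ≤ (unif K).mean fun c => ind (c = v % p) + ind (c = v % p + p) := by
        refine PMF.mean_mono fun c hc => le_trans (ind_mono ?_) (ind_or_le _ _)
        rintro ⟨v', hv', h⟩
        obtain rfl := Option.some.inj hv'
        rw [ZMod.natCast_eq_natCast_iff] at h
        have hlt : c < K := by
          have := unif_support K hc
          omega
        have h1 : v % p = c % p := h
        have hp0 : 0 < p := by omega
        rw [h1]
        rcases lt_or_ge c p with h2 | h2
        · exact Or.inl (Nat.mod_eq_of_lt h2).symm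
        · right
          rw [Nat.mod_eq_sub_mod h2, Nat.mod_eq_of_lt (by omega)]
          omega
    _ ≤ _ := by
        rw [PMF.mean_add, two_mul]
        exact add_le_add (mean_unif_ind_le hK _ fun c hc => hc)
          (mean_unif_ind_le hK _ fun c hc => hc)

theorem merge_congr {keep keep' : ℕ → Bool} (h : ∀ n, keep (n + 1) = keep' (n + 1)) (i : ℕ)
    (l l' : List ℕ) : merge keep i l l' = merge keep' i l l' := by
  induction l generalizing i l' with
  | nil => rfl
  | cons a l ih => rw [merge, merge, h i, ih]

namespace Trial

variable {𝒢 : GroupGen} {F : Code ForgerOracle} {T : Polynomial ℕ} {qS : ℕ}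

/-- The trial with other tapes of hash values. -/
def withTapes (t : Trial 𝒢) (a b : List ℕ) : Trial 𝒢 := { t with hashTape := a, altTape := b }

variable (F T qS) in
/-- The slots of the forgery and of the signing sessions. -/
def shape (t : Trial 𝒢) (a : List ℕ) : (_ : ℕ) × (Fin qS → ℕ) :=
  ⟨t.forgerySlot F T a, fun j => sessionSlot (t.run F T a).2 (j + 1)⟩

/-- The possible shapes of good runs with at most `H` hash queries. -/
def shapes (qS H : ℕ) : Finset ((_ : ℕ) × (Fin qS → ℕ)) :=
  (Finset.Icc 1 H).sigma fun i => Fintype.piFinset fun _ => (Finset.range (H + 1)).erase i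

/-- There are `H` slots for the forgery. The slot of a session is one of `0, …, H` but not that of
the forgery, which again leaves `H` choices; so the base is `H` and not `H + 1`. -/
theorem card_shapes (qS H : ℕ) : (shapes qS H).card = H ^ (qS + 1) := by
  rw [shapes, Finset.card_sigma]
  have : ∀ i ∈ Finset.Icc 1 H, (Fintype.piFinset fun _ : Fin qS =>
      (Finset.range (H + 1)).erase i).card = H ^ qS := by
    intro i hi
    rw [Finset.mem_Icc] at hi
    rw [Fintype.card_piFinset, Finset.prod_const, Finset.card_erase_of_mem (by simp; omega)]
    simp
  rw [Finset.sum_congr rfl this]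
  simp [pow_succ, mul_comm]

theorem shape_mem {t : Trial 𝒢} {a : List ℕ} {H : ℕ} (h : t.IsGood F T a)
    (hH : (t.run F T a).2.hashQueries ≤ H) : t.shape F T qS a ∈ shapes qS H := by
  have hc := t.consistent_run (F := F) (T := T) a
  obtain ⟨-, hi, hs, h', j, hq⟩ := h
  have hle : ∀ q v n, (t.run F T a).2.hashTbl.lookup q = some (v, n) → n ≤ H := by
    intro q v n hq
    rcases n with _ | n
    · exact Nat.zero_le _
    · have := (hc.value _ _ _ hq).1
      omega
  rw [shapes, Finset.mem_sigma, Fintype.mem_piFinset]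
  refine ⟨Finset.mem_Icc.2 ⟨hi, hle _ _ _ hq⟩, fun j => ?_⟩
  simp only [shape, sessionSlot]
  rw [Finset.mem_erase, Finset.mem_range]
  rcases hf : (t.run F T a).2.sessions.find? fun u => u.index = (j : ℕ) + 1 with _ | u
  -- An index without session is given slot `0`, as is a session with a fresh hash value; the
  -- forgery has a positive slot, so no conflict arises.
  · simp only [hf, Option.map_none, Option.getD_none]
    exact ⟨hi.ne, Nat.succ_pos _⟩
  · simp only [hf, Option.map_some, Option.getD_some]
    have hu := List.mem_of_find?_eq_some hf
    obtain ⟨R, hR⟩ := hc.session u hu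
    exact ⟨hs u hu, Nat.lt_succ_of_le (hle _ _ _ hR)⟩

/-- The slots that are kept depend only on the shape. -/
theorem forked_withTapes {t : Trial 𝒢} (hnon : t.nonces.length = qS) (a b : List ℕ)
    (g : (_ : ℕ) × (Fin qS → ℕ)) (hg : t.shape F T qS a = g) :
    (t.withTapes a b).forked F T =
      merge (fun n => decide (n < g.1 ∨ ∃ j, g.2 j = n)) 0 a b := by
  subst hg
  rw [forked_eq]
  -- Only positive slots are ever looked up, so the default slot `0` of unused indices does no harm.
  refine merge_congr (fun n => ?_) 0 a b
  refine decide_eq_decide.2 (or_congr Iff.rfl ?_)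
  change ((t.run F T a).2.sessions.any fun u => u.slot = n + 1) = true ↔ _
  rw [List.any_eq_true]
  have hn : ((t.run F T a).2.sessions.map fun u => u.index).Nodup := t.nodup_sessions _ _ _ _ _
  constructor
  · rintro ⟨u, hu, hun⟩
    obtain ⟨r, hr⟩ := (t.consistent_run (F := F) (T := T) a).index u hu
    obtain ⟨j, hj, hjr⟩ := look_eq_some hr
    rw [Val.num.injEq] at hj
    have hlt : j < qS := by
      rw [← hnon]
      exact (List.getElem?_eq_some_iff.1 hjr).1
    refine ⟨⟨j, hlt⟩, ?_⟩
    simp only [shape]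
    rw [← hj, sessionSlot_eq hn hu]
    simpa using hun
  · rintro ⟨j, hj⟩
    simp only [shape, sessionSlot] at hj
    rcases hf : (t.run F T a).2.sessions.find? fun u => u.index = (j : ℕ) + 1 with _ | u
    · simp [hf] at hj
    · rw [hf] at hj
      exact ⟨u, List.mem_of_find?_eq_some hf, by simpa using hj⟩

variable (F T qS) in
/-- The adversary wins. -/
def Wins (t : Trial 𝒢) : Prop :=
  t.challenges.length = qS + 1 ∧ t.queries F T qS < qS + 1 ∧
    SolvesDL 𝒢 t.env.i t.challenges (ofList ((t.output F T qS).map .num))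

/-- The adversary wins with probability about the square of that of a good run. -/
theorem sq_mean_good_le (t : Trial 𝒢) (H : ℕ)
    (hP : ∀ a ∈ (unifList (2 ^ t.env.k) (T.eval t.env.k)).support,
      ∀ b ∈ (unifList (2 ^ t.env.k) (T.eval t.env.k)).support, (t.withTapes a b).Proper F T qS)
    (hH : ∀ a ∈ (unifList (2 ^ t.env.k) (T.eval t.env.k)).support,
      (t.run F T a).2.hashQueries ≤ H) :
    ((unifList (2 ^ t.env.k) (T.eval t.env.k)).mean fun a => ind (t.IsGood F T a)) ^ 2 ≤
      (H : ℝ≥0∞) ^ (qS + 1) * (((unifList (2 ^ t.env.k) (T.eval t.env.k)).mean fun a =>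
        (unifList (2 ^ t.env.k) (T.eval t.env.k)).mean fun b =>
          ind ((t.withTapes a b).Wins F T qS)) + 2 * ((2 ^ t.env.k : ℕ) : ℝ≥0∞)⁻¹) := by
  have hK : 0 < 2 ^ t.env.k := by positivity
  set μ := unifList (2 ^ t.env.k) (T.eval t.env.k) with hμ
  set φ : ((_ : ℕ) × (Fin qS → ℕ)) → List ℕ → ℝ≥0∞ := fun g a =>
    ind (t.IsGood F T a ∧ t.shape F T qS a = g) with hφ
  have hsum : ∀ a ∈ μ.support, ∑ g ∈ shapes qS H, φ g a = ind (t.IsGood F T a) := by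
    intro a ha
    by_cases hg : t.IsGood F T a
    · rw [ind_of hg, Finset.sum_eq_single_of_mem _ (shape_mem hg (hH a ha))
        fun g _ hne => ind_of_not fun h => hne h.2.symm]
      exact ind_of ⟨hg, rfl⟩
    · rw [ind_of_not hg]
      exact Finset.sum_eq_zero fun g _ => ind_of_not fun h => hg h.1
  -- The one failure of the extraction: the redrawn value in the slot of the forgery is congruent to
  -- the old one.
  set bad : List ℕ → List ℕ → Prop := fun a b => ∃ n v, n + 1 = t.forgerySlot F T a ∧
    a[n]? = some v ∧ ∃ v', b[n]? = some v' ∧ (v : ZMod t.env.p) = v' with hbad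
  have hbadle : ∀ a ∈ μ.support, (μ.mean fun b => ind (bad a b)) ≤
      2 * ((2 ^ t.env.k : ℕ) : ℝ≥0∞)⁻¹ := by
    intro a ha
    by_cases hex : ∃ n v, n + 1 = t.forgerySlot F T a ∧ a[n]? = some v
    · obtain ⟨n, v, hn, hv⟩ := hex
      have hlt : n < T.eval t.env.k := by
        rw [← unifList_length ha]
        exact (List.getElem?_eq_some_iff.1 hv).1
      refine le_trans (PMF.mean_mono fun b _ => ind_mono ?_) (mean_congruent_le (p := t.env.p) (v := v) hK hlt ?_)
      · rintro ⟨n', v', hn', hv', h⟩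
        obtain rfl : n' = n := by omega
        rw [hv, Option.some.injEq] at hv'
        subst hv'
        exact h
      · have := t.env.two_pow_le
        have h2 := t.env.two_le
        obtain ⟨k, hk⟩ : ∃ k, t.env.k = k + 1 := ⟨t.env.k - 1, by omega⟩
        rw [hk, Nat.add_sub_cancel] at this
        rw [hk, pow_succ]
        omega
    · refine (PMF.mean_le _ (c := 0) fun b _ => ?_).trans zero_le
      rw [ind_of_not]
      rintro ⟨n, v, hn, hv, -⟩
      exact hex ⟨n, v, hn, hv⟩
  -- For a given first tape only its own shape contributes to the sum, and for this shape the merged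
  -- tape is the tape of the second run.
  have hmain : ∀ a ∈ μ.support, ∀ b ∈ μ.support, ∑ g ∈ shapes qS H,
      φ g a * φ g (merge (fun n => decide (n < g.1 ∨ ∃ j, g.2 j = n)) 0 a b) ≤
        ind ((t.withTapes a b).Wins F T qS) + ind (bad a b) := by
    intro a ha b hb
    by_cases hg : t.IsGood F T a
    swap
    · rw [Finset.sum_eq_zero fun g _ => by
        rw [show φ g a = 0 from ind_of_not fun h => hg h.1, zero_mul]]
      exact zero_le
    rw [Finset.sum_eq_single_of_mem _ (shape_mem hg (hH a ha)) fun g _ hne => by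
      simp only [hφ]
      rw [ind_of_not fun h => hne h.2.symm, zero_mul]]
    have hnon : t.nonces.length = qS := (hP a ha b hb).length_nonces
    rw [← forked_withTapes hnon a b _ rfl]
    simp only [hφ]
    rw [ind_of ⟨hg, trivial⟩, one_mul]
    refine le_trans (ind_mono fun h => ?_) (ind_or_le _ _)
    by_cases hb' : bad a b
    · exact Or.inr hb'
    refine Or.inl (wins (hP a ha b hb) ?_ hg h.1 ?_ ?_ ?_)
    · exact (unifList_length hb).trans (unifList_length ha).symm
    · exact congrArg Sigma.fst h.2
    · intro j hj
      exact congrFun (congrArg Sigma.snd (show (⟨_, _⟩ : (_ : ℕ) × (Fin qS → ℕ)) = ⟨_, _⟩ from h.2))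
        ⟨j, hj⟩
    · intro n hn v v' hv hv' heq
      exact hb' ⟨n, v, hn, hv, v', hv', heq⟩
  calc (μ.mean fun a => ind (t.IsGood F T a)) ^ 2
      = (∑ g ∈ shapes qS H, μ.mean (φ g)) ^ 2 := by
        rw [← PMF.mean_sum, PMF.mean_congr hsum]
    _ ≤ (shapes qS H).card * ∑ g ∈ shapes qS H, μ.mean (φ g) ^ 2 := sq_sum_le _ _
    _ ≤ (shapes qS H).card * ∑ g ∈ shapes qS H, μ.mean fun a => μ.mean fun b =>
          φ g a * φ g (merge (fun n => decide (n < g.1 ∨ ∃ j, g.2 j = n)) 0 a b) := by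
        gcongr with g hg
        -- Once the shape `g` is fixed, the set of kept slots no longer depends on the tape; this is
        -- what makes the correlation inequality applicable. No auxiliary variable is needed at the
        -- top level.
        have := sq_mean_le_merge (PMF.pure ()) (fun n => decide (n < g.1 ∨ ∃ j, g.2 j = n)) 0
          (2 ^ t.env.k) (T.eval t.env.k) fun _ => φ g
        simpa only [PMF.mean_pure] using this
    _ = (H : ℝ≥0∞) ^ (qS + 1) * μ.mean fun a => μ.mean fun b => ∑ g ∈ shapes qS H,
          φ g a * φ g (merge (fun n => decide (n < g.1 ∨ ∃ j, g.2 j = n)) 0 a b) := by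
        simp only [PMF.mean_sum, card_shapes, Nat.cast_pow]
    _ ≤ _ := by
        gcongr
        refine (PMF.mean_mono fun a ha => PMF.mean_mono fun b hb => hmain a ha b hb).trans ?_
        simp only [PMF.mean_add]
        exact add_le_add le_rfl (PMF.mean_le _ hbadle)

end Trial

/-! ## The probability that the adversary wins -/

/-- The state of the oracles of the forger at the start. -/
def ForgerState.init : ForgerState := ⟨fun _ => none, fun _ => none, [], 0⟩

/-- Bernoulli's inequality `(1 - δ) ^ M ≥ 1 - M * δ`, arranged so that nothing is subtracted from
`1` but `δ`. -/
theorem one_le_pow_add_mul {δ : ℝ≥0∞} (hδ : δ ≤ 1) (M : ℕ) : 1 ≤ (1 - δ) ^ M + M * δ := by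
  induction M with
  | zero => simp
  | succ M ih =>
    have h1 : (1 - δ) ^ M ≤ 1 := pow_le_one₀ zero_le tsub_le_self
    calc 1 ≤ (1 - δ) ^ M * 1 + M * δ := by rwa [mul_one]
      _ = (1 - δ) ^ M * (1 - δ + δ) + M * δ := by rw [tsub_add_cancel_of_le hδ]
      _ = (1 - δ) ^ (M + 1) + (1 - δ) ^ M * δ + M * δ := by ring
      _ ≤ (1 - δ) ^ (M + 1) + 1 * δ + M * δ := by gcongr
      _ = _ := by push_cast; ring

section tapes

variable {𝒢 : GroupGen} {F : Code ForgerOracle} {T : Polynomial ℕ} {n qS H : ℕ} {e : Env 𝒢}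
  {x s : ℕ} {xs : List ℕ}

variable (F T qS) in
/-- The runs of the forger in the experiment. -/
noncomputable def realLaw (e : Env 𝒢) (x : ℕ) (xs : List ℕ) (s : ℕ) :
    PMF ((Val × ℕ) × ForgerState) :=
  (F.run (T.eval e.k) (forgerInput 𝒢 e.k e.i x xs)).exec (forgerOracle 𝒢 e.k e.i qS x s) .init

/-- The distribution of the tapes at the start. -/
noncomputable def initTapes (e : Env 𝒢) (qS M : ℕ) : PMF Tapes :=
  tapesLaw e.p (2 ^ e.k) (2 ^ (M + e.k)) (.replicate qS none) (.replicate qS none) M M M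

/-- The trial with given tapes. -/
def Tapes.trial (τ : Tapes) (e : Env 𝒢) (x : ℕ) (xs : List ℕ) (s : ℕ) : Trial 𝒢 :=
  .ofDraws e x τ.nonces xs s τ.fresh τ.prf τ.coin τ.hash []

theorem matches_init (s : ℕ) : Matches qS s .init (Core.start [] [] []) (.replicate qS none)
    (.replicate qS none) where
  hashTbl := by simp [ForgerState.init, Core.start]
  sessions := rfl
  hashQueries := rfl
  nonce j o h := by
    rw [List.getElem?_replicate] at h
    split at h
    · exact Option.some.inj h
    · simp at h
  other v _ := by simp [ForgerState.init, Core.start]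
  length_nonces := by simp
  length_fresh := by simp
  fresh j hj _ := by simp [hj]

theorem mem_support_initTapes {M : ℕ} {τ : Tapes} :
    τ ∈ (initTapes e qS M).support ↔ τ.nonces ∈ (unifList e.p qS).support ∧
      τ.fresh ∈ (unifList (2 ^ e.k) qS).support ∧ τ.prf ∈ (unifList e.p M).support ∧
      τ.coin ∈ (unifList (2 ^ (M + e.k)) M).support ∧
      τ.hash ∈ (unifList (2 ^ e.k) M).support := by
  simp only [initTapes, tapesLaw, fill_replicate, PMF.mem_support_bind_iff, PMF.support_map]
  constructor
  · rintro ⟨a, ha, b, hb, c, hc, d, hd, f, hf, rfl⟩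
    exact ⟨ha, hb, hc, hd, hf⟩
  · rintro ⟨ha, hb, hc, hd, hf⟩
    exact ⟨_, ha, _, hb, _, hc, _, hd, _, hf, rfl⟩

theorem run_trial {M : ℕ} {τ : Tapes} (hτ : τ ∈ (initTapes e qS M).support) :
    (τ.trial e x xs s).run F T τ.hash =
      (F.run (T.eval e.k) (forgerInput 𝒢 e.k e.i x xs)).det ((τ.world e x).answer (some s))
        World.coin ((Core.start [] [] []).load τ) := by
  obtain ⟨h1, h2, -⟩ := mem_support_initTapes.1 hτ
  have e1 := map_mod (unifList_lt e.prime.pos h1)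
  have e2 := map_mod (unifList_lt (by positivity) h2)
  have : (τ.trial e x xs s).toWorld = τ.world e x := by
    simp only [Tapes.trial, Trial.ofDraws, e1, e2]
    rfl
  rw [Trial.run, this]
  rfl

variable (F T qS) in
/-- The bounds on the resources of the forger. -/
def Bounded (e : Env 𝒢) (H x : ℕ) (xs : List ℕ) (s : ℕ) : Prop :=
  ∀ r ∈ (realLaw F T qS e x xs s).support, r.1.2 ≤ T.eval e.k ∧ r.2.hashQueries ≤ H

theorem map_initTapes (hb : Bounded F T qS e H x xs s) :
    ((initTapes e qS (T.eval e.k)).map fun τ => (((τ.trial e x xs s).run F T τ.hash).1,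
      ((τ.trial e x xs s).run F T τ.hash).2.view)) =
      ((F.run (T.eval e.k) (forgerInput 𝒢 e.k e.i x xs)).execCoin
        (modCoin (2 ^ (T.eval e.k + e.k))) (forgerOracle 𝒢 e.k e.i qS x s) .init).map
          fun r => (r.1, r.2.view) := by
  rw [← map_det_tapesLaw (Code.weighs_run _ _ _) (matches_init s) (Nat.le_add_left _ _)
    (Nat.le_add_left _ _) (Nat.le_add_left _ _) fun r hr => (hb r hr).1]
  exact PMF.map_congr_support fun τ hτ => by rw [run_trial hτ]

theorem run_bounded (hb : Bounded F T qS e H x xs s) {τ : Tapes}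
    (hτ : τ ∈ (initTapes e qS (T.eval e.k)).support) :
    ((τ.trial e x xs s).run F T τ.hash).1.2 ≤ T.eval e.k ∧
      ((τ.trial e x xs s).run F T τ.hash).2.hashQueries ≤ H := by
  have : (((τ.trial e x xs s).run F T τ.hash).1, ((τ.trial e x xs s).run F T τ.hash).2.view) ∈
      (((F.run (T.eval e.k) (forgerInput 𝒢 e.k e.i x xs)).execCoin
        (modCoin (2 ^ (T.eval e.k + e.k))) (forgerOracle 𝒢 e.k e.i qS x s) .init).map
          fun r => (r.1, r.2.view)).support := by
    rw [← map_initTapes hb, PMF.support_map]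
    exact ⟨τ, hτ, rfl⟩
  rw [PMF.support_map] at this
  obtain ⟨r, hr, he⟩ := this
  obtain ⟨h1, h2⟩ := hb r (Comp.support_execCoin hr)
  obtain ⟨e1, e2⟩ := Prod.ext_iff.1 he
  refine ⟨?_, ?_⟩
  · rw [← show r.1 = _ from e1]
    exact h1
  · have := congrArg (fun v : View => v.2.2) e2
    exact le_of_eq_of_le this.symm h2

/-- The forger wins only if the simulated run is good, up to an error. -/
theorem mean_realLaw_le (hb : Bounded F T qS e H x xs s) :
    ((realLaw F T qS e x xs s).mean fun r => (isForgery 𝒢 e.k e.i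
        ((x :: xs).map fun c => c • 𝒢.base e.i).sum r.1.1 r.2).mean tv) ≤
      ((initTapes e qS (T.eval e.k)).mean fun τ =>
        ind ((τ.trial e x xs s).IsGood F T τ.hash) +
          ind (((τ.trial e x xs s).run F T τ.hash).2.hit = true)) +
      ((2 * ((T.eval e.k) * (T.eval e.k + qS) + qS * qS) + 3 + T.eval e.k : ℕ) : ℝ≥0∞) *
        ((2 ^ e.k : ℕ) : ℝ≥0∞)⁻¹ := by
  have hK : 0 < 2 ^ e.k := by positivity
  set M := T.eval e.k with hM
  set δ := ((2 ^ e.k : ℕ) : ℝ≥0∞)⁻¹ with hδ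
  have hδ' : ((2 : ℝ≥0∞) ^ e.k)⁻¹ = δ := by rw [hδ]; push_cast; rfl
  have hδ1 : δ ≤ 1 := by
    rw [hδ, ENNReal.inv_le_one]
    exact_mod_cast hK
  set Y := ((x :: xs).map fun c => c • 𝒢.base e.i).sum with hY
  set φ : Val × ℕ → View → ℝ≥0∞ := fun a V =>
    ind (¬ HashInj V) + ind (Claims 𝒢 e.i Y a.1 V) + 3 * δ with hφ
  set W := (realLaw F T qS e x xs s).mean fun r => (isForgery 𝒢 e.k e.i Y r.1.1 r.2).mean tv
    with hW
  have hW1 : W ≤ 1 := PMF.mean_le _ fun r _ => mean_tv_le_one _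
  have hreal : (1 - δ) ^ M * W ≤ (initTapes e qS M).mean fun τ =>
      φ ((τ.trial e x xs s).run F T τ.hash).1 ((τ.trial e x xs s).run F T τ.hash).2.view := by
    calc (1 - δ) ^ M * W
        ≤ (1 - δ) ^ M * (realLaw F T qS e x xs s).mean fun r => φ r.1 r.2.view := by
          gcongr
          exact PMF.mean_mono fun r _ => mean_isForgery_le _ _ _ _
      _ ≤ _ := by
          have := Comp.mean_execCoin (k := e.k) (Code.weighs_run M F (forgerInput 𝒢 e.k e.i x xs))
            (fun r hr => (hb r hr).1) fun r => φ r.1 r.2.view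
          rw [hδ', Nat.sub_zero] at this
          refine this.trans_eq ?_
          have h2 := congrArg (fun p => p.mean fun z => φ z.1 z.2) (map_initTapes hb)
          simp only [PMF.mean_map] at h2
          exact h2.symm
  -- A repetition among the hash values is charged twice: it may spoil injectivity, and it may
  -- prevent a run with a claim from being good.
  have hpoint : ∀ τ ∈ (initTapes e qS M).support,
      φ ((τ.trial e x xs s).run F T τ.hash).1 ((τ.trial e x xs s).run F T τ.hash).2.view ≤
        (ind ((τ.trial e x xs s).IsGood F T τ.hash) +
          ind (((τ.trial e x xs s).run F T τ.hash).2.hit = true)) +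
        (2 * ind (¬ (τ.hash ++ τ.fresh).Nodup) + 3 * δ) := by
    intro τ hτ
    obtain ⟨h1, h2, -⟩ := mem_support_initTapes.1 hτ
    have e2 := map_mod (unifList_lt (by positivity) h2)
    have hfresh : (τ.trial e x xs s).fresh = τ.fresh := e2
    have hlen : (τ.trial e x xs s).fresh.length = (τ.trial e x xs s).nonces.length := by
      rw [hfresh, unifList_length h2]
      exact ((List.length_map _).trans (unifList_length h1)).symm
    rw [← add_assoc, two_mul]
    simp only [hφ]
    refine add_le_add ?_ le_rfl
    rw [add_comm (ind (¬ HashInj _)), ← add_assoc]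
    refine add_le_add ?_ (ind_mono fun h hnd => h (Trial.hashInj_run hlen (by rwa [hfresh])))
    refine le_trans (ind_mono fun hcl => ?_) ((ind_or_le _ _).trans
      (add_le_add (ind_or_le _ _) le_rfl))
    by_contra! hcon
    obtain ⟨⟨hng, hnh⟩, hnd⟩ := hcon
    exact hng (Trial.isGood_of_claims hlen (by rwa [hfresh]) (by simpa using hnh) hcl)
  have hdup : ((initTapes e qS M).mean fun τ => ind (¬ (τ.hash ++ τ.fresh).Nodup)) ≤
      ((M * (M + qS) + qS * qS : ℕ) : ℝ≥0∞) * δ := by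
    simp only [initTapes, tapesLaw, fill_replicate, PMF.mean_bind, PMF.mean_map]
    refine PMF.mean_le _ fun _ _ => ?_
    calc _ ≤ (unifList (2 ^ e.k) qS).mean fun fr =>
          ind (¬ (fr ++ []).Nodup) + ((M * (M + qS) : ℕ) : ℝ≥0∞) * δ := by
          refine PMF.mean_mono fun fr hfr => PMF.mean_le _ fun _ _ => PMF.mean_le _ fun _ _ => ?_
          have := mean_not_nodup_le hK M fr
          rw [unifList_length hfr] at this
          refine this.trans_eq ?_
          rw [List.append_nil]
      _ ≤ ((qS * qS : ℕ) : ℝ≥0∞) * δ + ((M * (M + qS) : ℕ) : ℝ≥0∞) * δ := by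
          rw [PMF.mean_add, PMF.mean_const]
          refine add_le_add ((mean_not_nodup_le hK qS []).trans ?_) le_rfl
          rw [ind_of_not (by simp), zero_add, List.length_nil, add_zero]
      _ = _ := by push_cast; ring
  -- The multiplicative loss from the biased coins becomes the additive loss `M * δ`, because `W` is
  -- a probability.
  calc W = 1 * W := (one_mul _).symm
    _ ≤ ((1 - δ) ^ M + M * δ) * W := by
        gcongr
        exact one_le_pow_add_mul hδ1 M
    _ = (1 - δ) ^ M * W + M * δ * W := add_mul _ _ _
    _ ≤ _ := by
        refine (add_le_add (hreal.trans (PMF.mean_mono hpoint))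
          (mul_le_of_le_one_right zero_le hW1)).trans ?_
        rw [PMF.mean_add, PMF.mean_add (f := fun τ : Tapes => 2 * ind (¬ (τ.hash ++ τ.fresh).Nodup)), PMF.mean_const_mul,
          PMF.mean_const]
        calc _ ≤ _ + (2 * (((M * (M + qS) + qS * qS : ℕ) : ℝ≥0∞) * δ) + 3 * δ) + M * δ := by gcongr
          _ = _ := by push_cast; ring

/-- The keys probed by the run that ignores `s` form a list of at most `T` numbers independent of
`s`, and a hit forces the uniform key `s` into this list. -/
theorem mean_hit_le (e : Env 𝒢) (x : ℕ) (xs : List ℕ) :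
    ((unif (2 ^ e.k)).mean fun s => (initTapes e qS (T.eval e.k)).mean fun τ =>
      ind (((τ.trial e x xs s).run F T τ.hash).2.hit = true)) ≤
      ((T.eval e.k : ℕ) : ℝ≥0∞) * ((2 ^ e.k : ℕ) : ℝ≥0∞)⁻¹ := by
  rw [PMF.mean_comm]
  refine PMF.mean_le _ fun τ hτ => ?_
  set l := ((F.run (T.eval e.k) (forgerInput 𝒢 e.k e.i x xs)).det ((τ.world e x).answer none)
    World.coin (Core.start τ.hash τ.prf τ.coin)).2.probes with hl
  have hlen : l.length ≤ T.eval e.k :=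
    (World.length_probes _ _ _ _ _).trans_eq (unifList_length (mem_support_initTapes.1 hτ).2.2.1)
  refine (PMF.mean_mono (g := fun s => ind (s ∈ l)) fun s _ => ind_mono fun h => ?_).trans
    ((mean_unif_mem_le (by positivity) l).trans ?_)
  · rw [run_trial hτ] at h
    exact World.mem_probes_of_hit _ s _ (Or.inl ⟨rfl, rfl⟩) h
  · gcongr

/-- The distribution of the trial without the tapes of hash values. -/
noncomputable def outerLaw (e : Env 𝒢) (n qS M : ℕ) : PMF (Trial 𝒢) :=
  (unif e.p).bind fun x => (unifList e.p qS).bind fun nonces =>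
  (unifList e.p (n - 1)).bind fun xs => (unif (2 ^ e.k)).bind fun s =>
  (unifList (2 ^ e.k) qS).bind fun fresh => (unifList e.p M).bind fun f =>
  (unifList (2 ^ (M + e.k)) M).bind fun u =>
  .pure (Trial.ofDraws e x nonces xs s fresh f u [] [])

theorem mean_trialLaw (e : Env 𝒢) (n qS M : ℕ) (φ : Trial 𝒢 → ℝ≥0∞) :
    (trialLaw e n qS M).mean φ = (outerLaw e n qS M).mean fun t =>
      (unifList (2 ^ e.k) M).mean fun a => (unifList (2 ^ e.k) M).mean fun b =>
        φ (t.withTapes a b) := by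
  simp only [trialLaw, outerLaw, PMF.mean_bind, PMF.mean_pure]
  rfl

theorem mean_outerLaw (e : Env 𝒢) (n qS M : ℕ) (φ : Trial 𝒢 → ℝ≥0∞) :
    ((outerLaw e n qS M).mean fun t => (unifList (2 ^ e.k) M).mean fun a =>
        φ (t.withTapes a [])) =
      (unif e.p).mean fun x => (unifList e.p (n - 1)).mean fun xs => (unif (2 ^ e.k)).mean fun s =>
        (initTapes e qS M).mean fun τ => φ (τ.trial e x xs s) := by
  simp only [outerLaw, initTapes, tapesLaw, fill_replicate, PMF.mean_bind, PMF.mean_pure,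
    PMF.mean_map]
  refine PMF.mean_congr fun x _ => ?_
  rw [PMF.mean_comm]
  refine PMF.mean_congr fun xs _ => ?_
  rw [PMF.mean_comm]
  rfl

/-- The bounds on the resources of the forger hold for all keys. -/
def BoundedAll (F : Code ForgerOracle) (T : Polynomial ℕ) (n qS : ℕ) (e : Env 𝒢) (H : ℕ) : Prop :=
  ∀ x ∈ (unif e.p).support, ∀ xs ∈ (unifList e.p (n - 1)).support,
    ∀ s ∈ (unif (2 ^ e.k)).support, Bounded F T qS e H x xs s

theorem run_bounded_of_mem (hb : BoundedAll F T n qS e H) {t : Trial 𝒢}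
    (ht : t ∈ (outerLaw e n qS (T.eval e.k)).support) {a : List ℕ}
    (ha : a ∈ (unifList (2 ^ e.k) (T.eval e.k)).support) :
    t.env = e ∧ t.nonces.length = qS ∧ (t.run F T a).1.2 ≤ T.eval e.k ∧
      (t.run F T a).2.hashQueries ≤ H := by
  simp only [outerLaw, PMF.mem_support_bind_iff, PMF.mem_support_pure_iff] at ht
  obtain ⟨x, hx, no, hno, xs, hxs, s, hs, fr, hfr, f, hf, u, hu, rfl⟩ := ht
  have := run_bounded (hb x hx xs hxs s hs) (τ := ⟨no, fr, f, u, a⟩)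
    (mem_support_initTapes.2 ⟨hno, hfr, hf, hu, ha⟩)
  exact ⟨rfl, (List.length_map _).trans (unifList_length hno), this⟩

theorem proper_withTapes (hb : BoundedAll F T n qS e H) {t : Trial 𝒢}
    (ht : t ∈ (outerLaw e n qS (T.eval e.k)).support) {a b : List ℕ}
    (ha : a ∈ (unifList (2 ^ e.k) (T.eval e.k)).support)
    (hb' : b ∈ (unifList (2 ^ e.k) (T.eval e.k)).support) :
    (t.withTapes a b).Proper F T qS := by
  obtain ⟨rfl, hno, -⟩ := run_bounded_of_mem hb ht ha
  exact {
    length_nonces := hno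
    length_hashTape := unifList_length ha
    hashTape_lt := unifList_lt (by positivity) ha
    altTape_lt := unifList_lt (by positivity) hb'
    time := fun tape bk h1 h2 => by
      rw [(Trial.runBook_eq _ _ _).1]
      exact (run_bounded_of_mem hb ht (mem_support_unifList h1 h2)).2.2.1 }

theorem proper_of_mem (hb : BoundedAll F T n qS e H) {t : Trial 𝒢}
    (ht : t ∈ (trialLaw e n qS (T.eval e.k)).support) : t.Proper F T qS := by
  simp only [trialLaw, PMF.mem_support_bind_iff, PMF.mem_support_pure_iff] at ht
  obtain ⟨x, hx, no, hno, xs, hxs, s, hs, fr, hfr, f, hf, u, hu, a, ha, b, hb', rfl⟩ := ht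
  refine proper_withTapes (t := .ofDraws e x no xs s fr f u [] []) hb ?_ ha hb'
  simp only [outerLaw, PMF.mem_support_bind_iff, PMF.mem_support_pure_iff]
  exact ⟨x, hx, no, hno, xs, hxs, s, hs, fr, hfr, f, hf, u, hu, rfl⟩

/-- The numerator of the error of the reduction. -/
def errorBound (M qS : ℕ) : ℕ := 2 * (M * (M + qS) + qS * qS) + 3 + 2 * M

variable (F T n qS) in
/-- The probability that the forger wins for a given instance. -/
noncomputable def forgeryProb (e : Env 𝒢) : ℝ≥0∞ :=
  (unif e.p).mean fun x => (unifList e.p (n - 1)).mean fun xs => (unif (2 ^ e.k)).mean fun s =>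
    (realLaw F T qS e x xs s).mean fun r => (isForgery 𝒢 e.k e.i
      ((x :: xs).map fun c => c • 𝒢.base e.i).sum r.1.1 r.2).mean tv

variable (F T n qS) in
/-- The probability of a good run for a given instance. -/
noncomputable def goodProb (e : Env 𝒢) : ℝ≥0∞ :=
  (outerLaw e n qS (T.eval e.k)).mean fun t =>
    (unifList (2 ^ e.k) (T.eval e.k)).mean fun a => ind (t.IsGood F T a)

/-- The numerator `errorBound` collects twice the birthday bound for the tape and the fresh values,
three guesses in the verification, at most `M` biased coins and at most `M` probed keys. -/
theorem forgeryProb_le (hb : BoundedAll F T n qS e H) :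
    forgeryProb F T n qS e ≤ goodProb F T n qS e +
      (errorBound (T.eval e.k) qS : ℝ≥0∞) * ((2 ^ e.k : ℕ) : ℝ≥0∞)⁻¹ := by
  set δ := ((2 ^ e.k : ℕ) : ℝ≥0∞)⁻¹ with hδ
  set M := T.eval e.k with hM
  have hgood : goodProb F T n qS e =
      (unif e.p).mean fun x => (unifList e.p (n - 1)).mean fun xs => (unif (2 ^ e.k)).mean fun s =>
        (initTapes e qS M).mean fun τ => ind ((τ.trial e x xs s).IsGood F T τ.hash) :=
    mean_outerLaw e n qS M fun t => ind (t.IsGood F T t.hashTape)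
  have hterm : ∀ x ∈ (unif e.p).support, ∀ xs ∈ (unifList e.p (n - 1)).support,
      ((unif (2 ^ e.k)).mean fun s => (realLaw F T qS e x xs s).mean fun r =>
        (isForgery 𝒢 e.k e.i ((x :: xs).map fun c => c • 𝒢.base e.i).sum r.1.1 r.2).mean tv) ≤
      ((unif (2 ^ e.k)).mean fun s => (initTapes e qS M).mean fun τ =>
        ind ((τ.trial e x xs s).IsGood F T τ.hash)) + (errorBound M qS : ℝ≥0∞) * δ := by
    intro x hx xs hxs
    refine (PMF.mean_mono fun s hs => mean_realLaw_le (hb x hx xs hxs s hs)).trans ?_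
    rw [PMF.mean_add, PMF.mean_const]
    simp only [PMF.mean_add]
    rw [add_assoc]
    refine add_le_add le_rfl ((add_le_add (mean_hit_le e x xs) le_rfl).trans_eq ?_)
    rw [errorBound, ← hδ, ← hM]
    push_cast
    ring
  rw [hgood]
  refine (PMF.mean_mono fun x hx => (PMF.mean_mono (hterm x hx)).trans_eq
    (by rw [PMF.mean_add, PMF.mean_const])).trans_eq ?_
  rw [PMF.mean_add, PMF.mean_const]

/-- Jensen's inequality over everything but the two tapes of hash values reduces this to
`Trial.sq_mean_good_le`, where all other random values are fixed. -/
theorem sq_goodProb_le (hb : BoundedAll F T n qS e H) :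
    goodProb F T n qS e ^ 2 ≤ (H : ℝ≥0∞) ^ (qS + 1) *
      (((trialLaw e n qS (T.eval e.k)).mean fun t => ind (t.Wins F T qS)) +
        2 * ((2 ^ e.k : ℕ) : ℝ≥0∞)⁻¹) := by
  refine (PMF.sq_mean_le _ _).trans ?_
  rw [mean_trialLaw]
  calc _ ≤ (outerLaw e n qS (T.eval e.k)).mean fun t => (H : ℝ≥0∞) ^ (qS + 1) *
        (((unifList (2 ^ e.k) (T.eval e.k)).mean fun a => (unifList (2 ^ e.k) (T.eval e.k)).mean
          fun b => ind ((t.withTapes a b).Wins F T qS)) + 2 * ((2 ^ e.k : ℕ) : ℝ≥0∞)⁻¹) := by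
        refine PMF.mean_mono fun t ht => ?_
        obtain ⟨a₀, ha₀⟩ := (unifList (2 ^ e.k) (T.eval e.k)).support_nonempty
        obtain ⟨rfl, -⟩ := run_bounded_of_mem hb ht ha₀
        exact t.sq_mean_good_le H (fun a ha b hb' => proper_withTapes hb ht ha hb')
          fun a ha => (run_bounded_of_mem hb ht ha).2.2.2
    _ = _ := by
        rw [PMF.mean_const_mul, PMF.mean_add, PMF.mean_const]

end tapes

/-! ## The theorem -/

section games

variable {𝒢 : GroupGen} {F : Code ForgerOracle} {T : Polynomial ℕ} {n qS : ℕ}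

/-- The bounds hold on the whole support of the game, hence for each instance and all keys of
positive probability; the outcome of the verification plays no role, only that there is one. -/
theorem boundedAll_of_forgeryGame {H : ℕ} (e : Env 𝒢)
    (h : ∀ o ∈ (forgeryGame 𝒢 n qS F (T.eval e.k) e.k).support,
      o.time ≤ T.eval e.k ∧ o.hashQueries ≤ H) : BoundedAll F T n qS e H := by
  intro x hx xs hxs s hs r hr
  obtain ⟨b, hb⟩ := (isForgery 𝒢 e.k e.i ((x :: xs).map fun c => c • 𝒢.base e.i).sum
    r.1.1 r.2).support_nonempty
  refine h ⟨b, r.1.2, r.2.hashQueries⟩ ?_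
  simp only [forgeryGame, PMF.mem_support_bind_iff, PMF.mem_support_pure_iff]
  exact ⟨e.i, e.mem, x, hx, xs, hxs, s, hs, r, hr, b, hb, rfl⟩

theorem forgeryGame_win (n qS k : ℕ) : ((forgeryGame 𝒢 n qS F (T.eval k) k).map Outcome.win) true =
    (𝒢.gen k).mean fun i => (unif (𝒢.order i)).mean fun x =>
      (unifList (𝒢.order i) (n - 1)).mean fun xs => (unif (2 ^ k)).mean fun s =>
        ((F.run (T.eval k) (forgerInput 𝒢 k i x xs)).exec (forgerOracle 𝒢 k i qS x s) .init).mean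
          fun r => (isForgery 𝒢 k i ((x :: xs).map fun c => c • 𝒢.base i).sum r.1.1 r.2).mean
            tv := by
  rw [PMF.apply_eq_mean]
  simp only [forgeryGame, PMF.mean_map, PMF.mean_bind, PMF.mean_pure]
  rfl

theorem dlGame_win (A : Code DLOracle) (N B k : ℕ) : ((dlGame 𝒢 N A B k).map Prod.fst) true =
    (𝒢.gen k).mean fun i => ((A.run B (𝒢.inst k i)).exec (dlOracle 𝒢 i) ⟨[], 0⟩).mean fun r =>
      ind (r.2.challenges.length = N ∧ r.2.dlogQueries < N ∧
        SolvesDL 𝒢 i r.2.challenges r.1.1) := by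
  rw [PMF.apply_eq_mean]
  simp only [dlGame, PMF.mean_map, PMF.mean_bind, PMF.mean_pure]
  refine PMF.mean_congr fun i _ => PMF.mean_congr fun r _ => ?_
  by_cases h : r.2.challenges.length = N ∧ r.2.dlogQueries < N ∧
    SolvesDL 𝒢 i r.2.challenges r.1.1
  · rw [ind_of h]
    exact if_pos (by simpa using h)
  · rw [ind_of_not h]
    exact if_neg (by simpa using h)

theorem Draws.mean_wins {e : Env 𝒢} {m : Comp DLOracle (Val × ℕ)} {B M : ℕ}
    (h : Draws e m ⟨[], 0⟩ ((trialLaw e n qS M).map fun t =>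
      (ofList ((t.output F T qS).map .num), ⟨t.challenges, t.queries F T qS⟩)) B) :
    ((trialLaw e n qS M).mean fun t => ind (t.Wins F T qS)) =
      (m.exec (dlOracle 𝒢 e.i) ⟨[], 0⟩).mean fun r => ind (r.2.challenges.length = qS + 1 ∧
        r.2.dlogQueries < qS + 1 ∧ SolvesDL 𝒢 e.i r.2.challenges r.1.1) := by
  have := congrArg (fun p => p.mean fun z => ind (z.2.challenges.length = qS + 1 ∧
    z.2.dlogQueries < qS + 1 ∧ SolvesDL 𝒢 e.i z.2.challenges z.1)) h.map_eq
  simp only [PMF.mean_map] at this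
  rw [this]
  refine PMF.mean_congr fun t ht => ?_
  have henv : t.env = e := by
    simp only [trialLaw, PMF.mem_support_bind_iff, PMF.mem_support_pure_iff] at ht
    obtain ⟨x, hx, no, hno, xs, hxs, s, hs, fr, hfr, f, hf, u, hu, a, ha, b, hb', rfl⟩ := ht
    rfl
  subst henv
  rfl

end games

/-- The error of the reduction. -/
noncomputable def reductionError (T : Polynomial ℕ) (qS k : ℕ) : ℝ :=
  (2 * errorBound (T.eval k) qS + 2 : ℕ) / 2 ^ k

theorem negligible_eval_div (P : Polynomial ℕ) :
    Negligible fun k => (P.eval k : ℕ) / (2 : ℝ) ^ k := by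
  have h : Asymptotics.SuperpolynomialDecay Filter.atTop (fun k : ℕ => (k : ℝ))
      fun k => (1 / 2 : ℝ) ^ k := fun z => by
    exact tendsto_pow_const_mul_const_pow_of_abs_lt_one z
      (by rw [abs_of_pos] <;> norm_num)
  refine (h.polynomial_mul (P.map (Nat.castRingHom ℝ))).congr fun k => ?_
  rw [Polynomial.eval_natCast_map, one_div, inv_pow, div_eq_mul_inv]
  rfl

theorem negligible_reductionError (T : Polynomial ℕ) (qS : ℕ) :
    Negligible (reductionError T qS) := by
  convert negligible_eval_div (2 * (2 * (T * (T + .C qS) + .C (qS * qS)) + 3 + 2 * T) + 2)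
    using 2 with k
  simp [reductionError, errorBound]

/-- If `g ≤ w ≤ 1`, then `w ^ 2 - g ^ 2 = (w - g) * (w + g) ≤ 2 * d`. Division by a power of `H ≥ 1`
cannot enlarge the error terms. For `H = 0` the quotient is `0` by convention and the bound is
trivial. -/
theorem sq_div_sub_le {ε w g v d δ H : ℝ} {q : ℕ} (hε : 0 ≤ ε) (hεw : ε ≤ w) (hw : w ≤ 1)
    (hg : 0 ≤ g) (hv : 0 ≤ v) (hd : 0 ≤ d) (hδ : 0 ≤ δ) (hH : H = 0 ∨ 1 ≤ H) (hwg : w ≤ g + d)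
    (hgv : g ^ 2 ≤ H ^ (q + 1) * (v + 2 * δ)) :
    ε ^ 2 / H ^ (q + 1) - (2 * d + 2 * δ) ≤ v := by
  rcases hH with rfl | hH
  · rw [zero_pow (Nat.succ_ne_zero q), div_zero]
    linarith
  · have hpow : 1 ≤ H ^ (q + 1) := one_le_pow₀ hH
    have h1 : ε ^ 2 ≤ g ^ 2 + 2 * d := by
      rcases le_total w g with h | h <;> nlinarith
    rw [sub_le_iff_le_add, div_le_iff₀ (by linarith)]
    nlinarith

theorem theorem1 (𝒢 : GroupGen) (n : ℕ) (hn : 1 ≤ n) (qS : ℕ) (qH : ℕ → ℕ) (ε : ℕ → ℝ)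
    (hε : ∀ k, 0 ≤ ε k) (F : Code ForgerOracle) (hF : Breaks 𝒢 n F qS qH ε) :
    ∃ (A : Code DLOracle) (ν : ℕ → ℝ), Negligible ν ∧
      SolvesOneMoreDL 𝒢 (qS + 1) A (fun k => ε k ^ 2 / (qH k : ℝ) ^ (qS + 1) - ν k) := by
  obtain ⟨T, hT⟩ := hF
  have hb : ∀ e : Env 𝒢, BoundedAll F T n qS e (qH e.k) := fun e =>
    boundedAll_of_forgeryGame e (hT e.k e.two_le).1
  obtain ⟨A, P, hA⟩ := exists_adversary 𝒢 F T n qS fun e t ht => proper_of_mem (hb e) ht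
  refine ⟨A, reductionError T qS, negligible_reductionError T qS, P, fun k hk => ⟨?_, ?_⟩⟩
  · intro o ho
    simp only [dlGame, PMF.mem_support_bind_iff, PMF.mem_support_pure_iff] at ho
    obtain ⟨i, hi, r, hr, rfl⟩ := ho
    exact (hA ⟨k, i, hk, hi⟩).time_le r hr
  have hwin := (hT k hk).2
  set w := ((forgeryGame 𝒢 n qS F (T.eval k) k).map Outcome.win) true with hw
  set v := ((dlGame 𝒢 (qS + 1) A (P.eval k) k).map Prod.fst) true with hv
  set δ := ((2 ^ k : ℕ) : ℝ≥0∞)⁻¹ with hδ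
  set d := (errorBound (T.eval k) qS : ℝ≥0∞) * δ with hd
  have hδt : δ ≠ ∞ := by simp [hδ]
  have hdt : d ≠ ∞ := ENNReal.mul_ne_top (by simp) hδt
  have hvt : v ≠ ∞ := PMF.apply_ne_top _ _
  set p : 𝒢.Inst → ℝ≥0∞ := fun i => (unif (𝒢.order i)).mean fun x =>
      (unifList (𝒢.order i) (n - 1)).mean fun xs => (unif (2 ^ k)).mean fun s =>
        ((F.run (T.eval k) (forgerInput 𝒢 k i x xs)).exec (forgerOracle 𝒢 k i qS x s) .init).mean
          fun r => (isForgery 𝒢 k i ((x :: xs).map fun c => c • 𝒢.base i).sum r.1.1 r.2).mean tv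
    with hp
  -- The probability of a good run makes sense only for instances in the support of the generator.
  -- The truncated difference `p i - d` is defined for all `i`, lies below it there, and can be
  -- averaged before Jensen's inequality is applied.
  set g := (𝒢.gen k).mean fun i => p i - d with hg
  have hwg : w ≤ g + d := by
    rw [hw, forgeryGame_win, hg, ← PMF.mean_const (𝒢.gen k) d, ← PMF.mean_add, PMF.mean_const]
    exact PMF.mean_mono fun i _ => le_tsub_add
  have hgv : g ^ 2 ≤ (qH k : ℝ≥0∞) ^ (qS + 1) * (v + 2 * δ) := by
    refine (PMF.sq_mean_le _ _).trans ?_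
    rw [hv, dlGame_win, ← PMF.mean_const (𝒢.gen k) (2 * δ), ← PMF.mean_add, ← PMF.mean_const_mul]
    refine PMF.mean_mono fun i hi => ?_
    have h1 : p i - d ≤ goodProb F T n qS ⟨k, i, hk, hi⟩ :=
      tsub_le_iff_right.2 (forgeryProb_le (hb ⟨k, i, hk, hi⟩))
    have h2 := sq_goodProb_le (hb ⟨k, i, hk, hi⟩)
    rw [(hA ⟨k, i, hk, hi⟩).mean_wins] at h2
    exact (pow_le_pow_left₀ zero_le h1 2).trans h2
  have hgt : g ≠ ∞ := by
    intro h
    rw [h] at hgv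
    have : (qH k : ℝ≥0∞) ^ (qS + 1) * (v + 2 * δ) ≠ ∞ :=
      ENNReal.mul_ne_top (by simp) (ENNReal.add_ne_top.2 ⟨hvt, ENNReal.mul_ne_top (by simp) hδt⟩)
    exact this (top_le_iff.1 (by simpa using hgv))
  have hδr : δ.toReal = 1 / 2 ^ k := by simp [hδ]
  have hdr : d.toReal = errorBound (T.eval k) qS / 2 ^ k := by
    rw [hd, ENNReal.toReal_mul, hδr, ENNReal.toReal_natCast]
    ring
  have herr : reductionError T qS k = 2 * d.toReal + 2 * δ.toReal := by
    rw [hδr, hdr, reductionError]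
    push_cast
    ring
  beta_reduce
  rw [herr]
  refine sq_div_sub_le (g := g.toReal) (hε k) hwin ?_ ENNReal.toReal_nonneg ENNReal.toReal_nonneg
    ENNReal.toReal_nonneg ENNReal.toReal_nonneg ?_ ?_ ?_
  · exact ENNReal.toReal_le_of_le_ofReal zero_le_one (by simpa using PMF.coe_le_one _ _)
  · rcases Nat.eq_zero_or_pos (qH k) with h | h
    · exact Or.inl (by rw [h, Nat.cast_zero])
    · exact Or.inr (by exact_mod_cast h)
  · rw [← ENNReal.toReal_add hgt hdt]
    exact ENNReal.toReal_mono (ENNReal.add_ne_top.2 ⟨hgt, hdt⟩) hwg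
  · have h2δ : 2 * δ ≠ ∞ := ENNReal.mul_ne_top (by simp) hδt
    have h := ENNReal.toReal_mono
      (ENNReal.mul_ne_top (by simp) (ENNReal.add_ne_top.2 ⟨hvt, h2δ⟩)) hgv
    rw [ENNReal.toReal_mul, ENNReal.toReal_pow, ENNReal.toReal_pow, ENNReal.toReal_natCast,
      ENNReal.toReal_add hvt h2δ, ENNReal.toReal_mul, ENNReal.toReal_ofNat] at h
    exact h
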